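/- **Theorem.** Let $\rho_0,v_0:\mathbb R\to\mathbb R$ and $R_*>0$, and put $m(R)=4\pi\int_0^R\rho_0(s)s^2\,ds$, $E(R)=\tfrac12 v_0(R)^2-m(R)/R$, $c(R)=2m(R)/R^3$, $q(R)=\sqrt{1-(v_0(R)/R)^2/c(R)}$ (quotients at $R=0$ are understood as limits). Assume: (i) $\rho_0$ is even, $v_0$ is odd, both are $C^\infty$; (ii) $\rho_0>0$ on $[0,R_*)$ and $\rho_0=0$ on $[R_*,\infty)$; (iii) $c'(R)\le0$ for $R>0$; (iv) $2m(R)/R<1$ for $R>0$; (v) $v_0(R)/R<0$ for $R\ge0$; (vi) $(v_0(R)/R)^2<c(R)$ for $R\ge0$; (vii) $q'(R)\ge0$ for $R>0$; (viii) for every $R\ge0$ with $c'(R)/R=0$ one has $q'(R)/R>0$. Let $r(\tau,R)$ be the collapsing solution ($\dot r<0$) of $\tfrac12\dot r^2=E(R)+m(R)/r$, $r(0,R)=R$, which exists for $0\le\tau<\tau_s(R)$, where $\tau_s(R)$ is the time at which $r$ reaches $0$. Here and below a dot is $\partial_\tau$ and a prime is $\partial_R$. Let $\gamma=\sqrt{1+2E}/r'$.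 Let $M=\{R\ge0,\ 0\le\tau<\tau_s(R)\}\times S^2$ (with the spheres at $R=0$ collapsed to points) carry the Tolman-Bondi metric $$\mathbf g=-d\tau^2+\frac{dR^2}{\gamma^2}+r^2(d\vartheta^2+\sin^2\vartheta\,d\varphi^2),$$ and put $\mathbf u=\partial_\tau$, $\mathbf w=\gamma\partial_R$, $\mathbf k=\mathbf u+\mathbf w$, $\mathbf l=\mathbf u-\mathbf w$. Assume that the central singularity is globally naked: some outgoing radial light ray emanating from the first singular point $(\tau,R)=(\tau_s(0),0)$ reaches the surface $R=R_*$ of the cloud at an event with $r>2m(R_*)$. Let $D\subset M$ be the maximal future development of the initial surface $\tau=0$, i.e. the set of points of $M$ from which every past-inextendible causal curve meets $\tau=0$. Let $U,V$ be the functions of $(\tau,R)$ on $D$ determined by $\dot U=-\gamma U'$, $\dot V=\gamma V'$, $-U(0,R)=V(0,R)=R$ for $R\ge0$, and $U(\tau,0)=V(\tau,0)$ for $0\le\tau<\tau_s(0)$. Denote by $\Sigma_\tau,\Sigma_U,\Sigma_V$ the hypersurfaces in $D$ of constant $\tau$, $U$, $V$, and write $\langle F\rangle_{S^2}=\int_{S^2}F\sin\vartheta\,d\vartheta\,d\varphi$.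 Then there is a constant $\kappa>0$, depending only on the spacetime, such that the following holds for every $C^1$ symmetric tensor field $T_{\mu\nu}$ on $D$ that is divergence-free ($\nabla^\mu T_{\mu\nu}=0$) and satisfies the dominant energy condition (for every future-directed timelike $X$, the vector $-T^\mu{}_\nu X^\nu$ is zero or future-directed timelike or null). Let $$\mathcal E_0=\int_{\Sigma_0}\langle r^2\mathbf T(\mathbf u,\mathbf u)\rangle_{S^2}\frac{dR}{\gamma}\in[0,\infty].$$ For every $\tau>0$ and all values of $U$ and of $V$, each of $$\int_{\Sigma_\tau}\langle r^2\mathbf T(\mathbf u,\mathbf u)\rangle_{S^2}\frac{dR}{\gamma},\qquad \int_{\Sigma_U}\langle r^2\mathbf T(\mathbf u,\mathbf k)\rangle_{S^2}\frac{dV}{\dot V},\qquad \int_{\Sigma_V}\langle r^2\mathbf T(\mathbf u,\mathbf l)\rangle_{S^2}\frac{dU}{\dot U}$$ is at most $\kappa\,\mathcal E_0$. In particular, if $\mathcal E_0<\infty$, there is a constant $C>0$ that bounds all of these integrals. -/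

import Mathlib

open Set Filter Topology MeasureTheory
open scoped ContDiff ENNReal

noncomputable section

/-- Initial data of a Tolman-Bondi dust cloud: initial density `ρ₀` and radial velocity `v₀`
(already extended to the real axis), and the initial radius `Rstar` of the cloud. -/
structure TBData where
  ρ₀ : ℝ → ℝ
  v₀ : ℝ → ℝ
  Rstar : ℝ

namespace TBData

variable (d : TBData)

/-- The mass `m(R) = 4π ∫₀ᴿ ρ₀(s) s² ds` inside the shell `R`. -/
def m (R : ℝ) : ℝ := 4 * Real.pi * ∫ s in (0 : ℝ)..R, d.ρ₀ s * s ^ 2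

/-- The energy `E(R) = v₀(R)²/2 - m(R)/R` of the shell `R` (with value `0` at `R = 0`). -/
def E (R : ℝ) : ℝ := d.v₀ R ^ 2 / 2 - d.m R / R

/-- `v₀(R)/R`, extended to `R = 0` by its limit `v₀'(0)`. -/
def vOverR (R : ℝ) : ℝ := if R = 0 then deriv d.v₀ 0 else d.v₀ R / R

/-- `c(R) = 2m(R)/R³`, extended to `R = 0` by its limit `8πρ₀(0)/3`. -/
def c (R : ℝ) : ℝ := if R = 0 then 8 * Real.pi / 3 * d.ρ₀ 0 else 2 * d.m R / R ^ 3

/-- `q(R) = √(1 - R v₀(R)²/(2m(R))) = √(1 - (v₀(R)/R)²/c(R))`. -/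
def q (R : ℝ) : ℝ := Real.sqrt (1 - d.vOverR R ^ 2 / d.c R)

/-- `φ'(R)/R`, extended to `R = 0` by its limit `φ''(0)` (for even smooth `φ`). -/
def derivOverR (φ : ℝ → ℝ) (R : ℝ) : ℝ :=
  if R = 0 then deriv (deriv φ) 0 else deriv φ R / R

/-- The assumptions (i)-(viii) on the initial data. -/
structure Admissible : Prop where
  Rstar_pos : 0 < d.Rstar
  smooth_ρ₀ : ContDiff ℝ ∞ d.ρ₀
  smooth_v₀ : ContDiff ℝ ∞ d.v₀
  even_ρ₀ : ∀ R, d.ρ₀ (-R) = d.ρ₀ R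
  odd_v₀ : ∀ R, d.v₀ (-R) = -d.v₀ R
  density_pos : ∀ R, 0 ≤ R → R < d.Rstar → 0 < d.ρ₀ R
  density_zero : ∀ R, d.Rstar ≤ R → d.ρ₀ R = 0
  mean_density_antitone : ∀ R, 0 < R → deriv d.c R ≤ 0
  no_trapped : ∀ R, 0 < R → 2 * d.m R / R < 1
  collapsing : ∀ R, 0 ≤ R → d.vOverR R < 0
  bounded_collapse : ∀ R, 0 ≤ R → d.vOverR R ^ 2 < d.c R
  no_shell_crossing : ∀ R, 0 < R → 0 ≤ deriv d.q R
  nondegenerate : ∀ R, 0 ≤ R → derivOverR d.c R = 0 → 0 < derivOverR d.q R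

/-! ### The Tolman-Bondi metric -/

/-- `f(x) = x √(1-x²) + arccos x`. -/
def f (x : ℝ) : ℝ := x * Real.sqrt (1 - x ^ 2) + Real.arccos x

/-- Proper time `τ(y,R) = (f(q y) - f(q)) / (q³ √c)` at which the shell `R` has areal radius
`r = R y²`; this is the collapsing solution of `ṙ²/2 = E(R) + m(R)/r`, `r(0,R) = R`. -/
def tau (y R : ℝ) : ℝ := (f (d.q R * y) - f (d.q R)) / d.q R ^ 3 / Real.sqrt (d.c R)

/-- Collapse time of the shell `R`; `d.tauS 0` is the time of the first singular point. -/
def tauS (R : ℝ) : ℝ := d.tau 0 R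

/-- `y(τ,R) = √(r/R)`: the solution `y ∈ [0,1]` of `τ(y,R) = τ`. -/
def y (τ R : ℝ) : ℝ := Function.invFunOn (fun s => d.tau s R) (Icc 0 1) τ

/-- The areal radius. -/
def r (τ R : ℝ) : ℝ := R * d.y τ R ^ 2

/-- `γ = √(1+2E)/r'`. -/
def γ (τ R : ℝ) : ℝ := Real.sqrt (1 + 2 * d.E R) / deriv (fun s => d.r τ s) R

/-- The comoving radius of the point with coordinates `x = (τ, x¹, x², x³)`. -/
def rad (x : Fin 4 → ℝ) : ℝ := Real.sqrt (x 1 ^ 2 + x 2 ^ 2 + x 3 ^ 2)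

/-- The spacetime manifold `M : R ≥ 0, 0 ≤ τ < τ_s(R)`, in the global chart `(τ, x¹, x², x³)`
where `(x¹, x², x³)` are the Cartesian coordinates belonging to `(R, ϑ, φ)`. -/
def M : Set (Fin 4 → ℝ) := {x | 0 ≤ x 0 ∧ x 0 < d.tauS (rad x)}

/-- Components of the vector `∂_R` (and of the covector `dR`) in the Cartesian chart. -/
def radial (x : Fin 4 → ℝ) (μ : Fin 4) : ℝ := if μ = 0 then 0 else x μ / rad x

/-- The metric `-dτ² + dR²/γ² + r²(dϑ² + sin²ϑ dφ²)` in the Cartesian chart: its spatial part is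
`(r/R)² (δ_ij dxⁱ dxʲ - dR²) + dR²/γ²`. At `R = 0`, where `1/γ² = (r/R)² = y⁴`, it is
`y⁴ δ_ij`. -/
def g (x : Fin 4 → ℝ) : Matrix (Fin 4) (Fin 4) ℝ := Matrix.of fun μ ν =>
  if μ = 0 ∨ ν = 0 then (if μ = ν then -1 else 0)
  else (if μ = ν then d.y (x 0) (rad x) ^ 4 else 0)
    + (1 / d.γ (x 0) (rad x) ^ 2 - d.y (x 0) (rad x) ^ 4) * radial x μ * radial x ν

/-- Evaluation of a twice covariant tensor on two vectors. -/
def ev (A : Matrix (Fin 4) (Fin 4) ℝ) (X Y : Fin 4 → ℝ) : ℝ := ∑ μ, ∑ ν, A μ ν * X μ * Y ν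

/-- Four-velocity `u = ∂_τ` of the dust. -/
def u : Fin 4 → ℝ := Pi.single 0 1

/-- Unit outward radial vector `w = γ ∂_R`. -/
def w (x : Fin 4 → ℝ) : Fin 4 → ℝ := d.γ (x 0) (rad x) • radial x

/-- Outgoing null vector `k = u + w`. -/
def k (x : Fin 4 → ℝ) : Fin 4 → ℝ := u + d.w x

/-- Incoming null vector `l = u - w`. -/
def l (x : Fin 4 → ℝ) : Fin 4 → ℝ := u - d.w x

/-! ### Maximal development and global nakedness -/

/-- `σ` on `(t₀, x⁰]` is a past-directed causal curve in `M` starting at `x`. As the tangent of a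
causal curve has nonvanishing `τ`-component, `τ` itself serves as the parameter. -/
def IsPastCausalCurve (x : Fin 4 → ℝ) (t₀ : ℝ) (σ : ℝ → Fin 4 → ℝ) : Prop :=
  σ (x 0) = x ∧ ContinuousOn σ (Ioc t₀ (x 0)) ∧
  (∀ t ∈ Ioc t₀ (x 0), σ t ∈ d.M ∧ σ t 0 = t) ∧
  ∀ t ∈ Ioo t₀ (x 0), ∃ X, HasDerivAt σ X t ∧ ev (d.g (σ t)) X X ≤ 0

/-- The maximal future development (future domain of dependence) `D` of the initial surface
`τ = 0`: the points of `M` from which every past-inextendible causal curve meets `τ = 0`, that is,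
every past-directed causal curve on `(t₀, x⁰]` with `t₀ ≥ 0` has an endpoint in `M` at `t₀`. -/
def D : Set (Fin 4 → ℝ) := {x | x ∈ d.M ∧ ∀ t₀ σ, 0 ≤ t₀ → t₀ < x 0 →
  d.IsPastCausalCurve x t₀ σ → ∃ p ∈ d.M, Tendsto σ (𝓝[>] t₀) (𝓝 p)}

/-- The point with spherical coordinates `(τ, R, ϑ, φ)`. -/
def sph (τ R θ φ : ℝ) : Fin 4 → ℝ :=
  ![τ, R * (Real.sin θ * Real.cos φ), R * (Real.sin θ * Real.sin φ), R * Real.cos θ]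

/-- The image of the (rotationally symmetric) set `D` in the `(τ,R)` half plane. -/
def Drad : Set (ℝ × ℝ) := {p | 0 ≤ p.2 ∧ ∀ θ φ, sph p.1 p.2 θ φ ∈ d.D}

/-- The central singularity is globally naked: a radial light ray `R = ϱ(τ)` emanating from the
first singular point `(τ_s(0), 0)` arrives at the surface of the cloud (at time `τ₁`) before the
apparent horizon `r = 2m` does. Such a ray exists iff the first one, the Cauchy horizon, is such. -/
def GloballyNaked : Prop :=
  ∃ (τ₁ : ℝ) (ϱ : ℝ → ℝ), d.tauS 0 < τ₁ ∧
    (∀ t ∈ Ioc (d.tauS 0) τ₁, 0 < ϱ t ∧ t < d.tauS (ϱ t)) ∧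
    ContinuousOn ϱ (Ioc (d.tauS 0) τ₁) ∧
    (∀ t ∈ Ioo (d.tauS 0) τ₁, HasDerivAt ϱ (d.γ t (ϱ t)) t) ∧
    Tendsto ϱ (𝓝[>] (d.tauS 0)) (𝓝 0) ∧
    ϱ τ₁ = d.Rstar ∧ 2 * d.m d.Rstar < d.r τ₁ d.Rstar

/-- `U` and `V` are the retarded and advanced time on `D`: `U̇ = -γ U'`, `V̇ = γ V'`,
`-U = V = R` on the initial surface, `U = V` at the centre. -/
structure IsNullCoordinates (U V : ℝ → ℝ → ℝ) : Prop where
  smooth_U : ContDiffOn ℝ ∞ (Function.uncurry U) d.Drad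
  smooth_V : ContDiffOn ℝ ∞ (Function.uncurry V) d.Drad
  eq_U : ∀ τ R, (τ, R) ∈ d.Drad → 0 < τ → 0 < R →
    deriv (fun t => U t R) τ = -d.γ τ R * deriv (fun s => U τ s) R
  eq_V : ∀ τ R, (τ, R) ∈ d.Drad → 0 < τ → 0 < R →
    deriv (fun t => V t R) τ = d.γ τ R * deriv (fun s => V τ s) R
  init_U : ∀ R, 0 ≤ R → U 0 R = -R
  init_V : ∀ R, 0 ≤ R → V 0 R = R
  centre : ∀ τ, 0 ≤ τ → τ < d.tauS 0 → U τ 0 = V τ 0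

/-! ### Stress-energy tensors -/

/-- Partial derivative `∂_μ φ`. -/
def pd (μ : Fin 4) (φ : (Fin 4 → ℝ) → ℝ) (x : Fin 4 → ℝ) : ℝ := fderiv ℝ φ x (Pi.single μ 1)

/-- Christoffel symbols `Γ^κ_{μν}` of the metric. -/
def christoffel (x : Fin 4 → ℝ) (κ μ ν : Fin 4) : ℝ :=
  1 / 2 * ∑ s, (d.g x)⁻¹ κ s * (pd μ (fun z => d.g z s ν) x + pd ν (fun z => d.g z s μ) x
    - pd s (fun z => d.g z μ ν) x)

/-- Covariant derivative `∇_κ T_{μν}`. -/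
def covDeriv (T : (Fin 4 → ℝ) → Matrix (Fin 4) (Fin 4) ℝ) (x : Fin 4 → ℝ) (κ μ ν : Fin 4) : ℝ :=
  pd κ (fun z => T z μ ν) x - ∑ s, d.christoffel x s κ μ * T x s ν
    - ∑ s, d.christoffel x s κ ν * T x μ s

/-- Divergence `∇^μ T_{μν}`. -/
def divergence (T : (Fin 4 → ℝ) → Matrix (Fin 4) (Fin 4) ℝ) (x : Fin 4 → ℝ) (ν : Fin 4) : ℝ :=
  ∑ κ, ∑ μ, (d.g x)⁻¹ κ μ * d.covDeriv T x κ μ ν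

/-- The current `J^μ = -T^μ_ν X^ν`. -/
def current (T : (Fin 4 → ℝ) → Matrix (Fin 4) (Fin 4) ℝ) (x X : Fin 4 → ℝ) (μ : Fin 4) : ℝ :=
  -∑ s, ∑ ν, (d.g x)⁻¹ μ s * T x s ν * X ν

/-- The dominant energy condition at `x`: for `X` future-directed timelike, `J_X` is
future-directed timelike or null (or zero). -/
def DominantEnergy (T : (Fin 4 → ℝ) → Matrix (Fin 4) (Fin 4) ℝ) (x : Fin 4 → ℝ) : Prop :=
  ∀ X : Fin 4 → ℝ, ev (d.g x) X X < 0 → 0 < X 0 →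
    ev (d.g x) (d.current T x X) (d.current T x X) ≤ 0 ∧ 0 ≤ d.current T x X 0

/-- Symmetric, continuously differentiable, divergence-free tensor fields on `D` (up to and
including the initial surface) that satisfy the dominant energy condition. -/
structure IsStressEnergy (T : (Fin 4 → ℝ) → Matrix (Fin 4) (Fin 4) ℝ) : Prop where
  symm : ∀ x ∈ d.D, (T x).IsSymm
  smooth : ∀ μ ν, ContDiffOn ℝ 1 (fun x => T x μ ν) d.D
  div_free : ∀ x ∈ d.D, 0 < x 0 → ∀ ν, d.divergence T x ν = 0
  dominant : ∀ x ∈ d.D, d.DominantEnergy T x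

/-! ### Energies and fluxes -/

/-- `⟨F⟩_{S²} = ∫ F sin ϑ dϑ dφ` over the sphere of constant `(τ,R)`, for `F ≥ 0`. -/
def sphereInt (F : (Fin 4 → ℝ) → ℝ) (τ R : ℝ) : ℝ≥0∞ :=
  ∫⁻ θ in Icc 0 Real.pi, ∫⁻ φ in Icc 0 (2 * Real.pi),
    ENNReal.ofReal (F (sph τ R θ φ) * Real.sin θ)

/-- The co-moving energy `∫ ⟨r² T(u,u)⟩ dR/γ` on the slice `Σ_τ` of `D`. -/
def sliceEnergy (T : (Fin 4 → ℝ) → Matrix (Fin 4) (Fin 4) ℝ) (τ : ℝ) : ℝ≥0∞ :=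
  ∫⁻ R in {R | (τ, R) ∈ d.Drad},
    sphereInt (fun x => d.r τ R ^ 2 * ev (T x) u u / d.γ τ R) τ R

/-- The outgoing flux `∫ ⟨r² T(u,k)⟩ dV/V̇` through the null surface `Σ_U` (`U = U₀`) in `D`. The
supremum evaluates the integrand at the point of `D` with double null coordinates `(U₀, v)`, and is
`0` if there is no such point. -/
def fluxU (U V : ℝ → ℝ → ℝ) (T : (Fin 4 → ℝ) → Matrix (Fin 4) (Fin 4) ℝ) (U₀ : ℝ) : ℝ≥0∞ :=
  ∫⁻ v, ⨆ p ∈ {p : ℝ × ℝ | p ∈ d.Drad ∧ U p.1 p.2 = U₀ ∧ V p.1 p.2 = v},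
    sphereInt (fun x => d.r p.1 p.2 ^ 2 * ev (T x) u (d.k x) / deriv (fun t => V t p.2) p.1)
      p.1 p.2

/-- The incoming flux `∫ ⟨r² T(u,l)⟩ dU/U̇` through the null surface `Σ_V` (`V = V₀`) in `D`. -/
def fluxV (U V : ℝ → ℝ → ℝ) (T : (Fin 4 → ℝ) → Matrix (Fin 4) (Fin 4) ℝ) (V₀ : ℝ) : ℝ≥0∞ :=
  ∫⁻ s, ⨆ p ∈ {p : ℝ × ℝ | p ∈ d.Drad ∧ U p.1 p.2 = s ∧ V p.1 p.2 = V₀},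
    sphereInt (fun x => d.r p.1 p.2 ^ 2 * ev (T x) u (d.l x) / deriv (fun t => U t p.2) p.1)
      p.1 p.2

/-- `C` bounds the energy on all slices `τ > 0` and the fluxes through all null surfaces of
constant `U` and of constant `V`, where `(U, V)` is the double null coordinate system of `D`. -/
def UniformBound (T : (Fin 4 → ℝ) → Matrix (Fin 4) (Fin 4) ℝ) (C : ℝ≥0∞) : Prop :=
  (∀ τ, 0 < τ → d.sliceEnergy T τ ≤ C) ∧
  ∀ U V : ℝ → ℝ → ℝ, d.IsNullCoordinates U V →
    (∀ U₀, d.fluxU U V T U₀ ≤ C) ∧ ∀ V₀, d.fluxV U V T V₀ ≤ C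

end TBData

end

noncomputable section

/-! ### Smoothness of parametric integrals -/

/-! The field `u` is not Killing, so the energy measured by the dust is not conserved. A spherically
symmetric spacetime does carry the Kodama vector K = W u - ṙ w, with W = √(1+2E) and w = γ∂_R. After
averaging over spheres, the current T(K,·) satisfies a balance law (`balance`): the τ-derivative of
its density `flA` equals the R-derivative of its flux `flB` plus a source r m'/r' times the average
of T(u,∂_R). The tangential stresses disappear by Stokes' theorem on the sphere
(`tangential_average`). The equation r̈ = -m/r² and the R-derivative of the energy equation cancel
everything else except a term proportional to the dust density.

Two facts turn the balance law into an estimate. First, K is uniformly timelike on D: W² - ṙ² = 1 -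
2m/r, and 2m ≤ (1-δ) r on D (`GloballyNaked.exists_untrapped`). By the dominant energy condition the
energies and null fluxes of K therefore control those of u (`flux_bounds`). Second, the source is at
most (2/δ) n(τ) `flA`, where n bounds m'/(r r') on each slice and has a bounded primitive
(`GloballyNaked.exists_source_bound`). Gronwall's argument then gives `energy_inequality`.

Both facts rest on global nakedness. Write r = R y². Inside the cloud y³ is comparable to τ_s(R) -
τ, the nondegeneracy of the data gives τ_s(R) ≥ τ_s(0) + kR², and close to the singular point D
stays below the timelike curve τ - τ_s(0) = kR²/2 (`exists_barrier`, `barrier_G`). Hence y³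
dominates both R² and |τ - τ_s(0)|. So 2m/r = cR²/y² is small near the singular point, and m'/(r r')
is at most a multiple of R/y⁴, hence of |τ - τ_s(0)|^(-5/6), which is integrable. Farther out in the
cloud D lies outside the naked ray, which is untrapped and can there be restricted to a compact arc.
Outside the cloud there is no source, and r along outgoing rays cannot descend to 2m.

To treat both families of rays and the centre at once, all functions are extended to R < 0 by
parity. An incoming ray is then the reflection of an outgoing one, and D consists of the points
joined to τ = 0 by an outgoing ray of the extended spacetime (`mem_D_iff`). The energy inequality
for the region between an outgoing and an incoming ray bounds the slices through its final energy
and the null fluxes through its boundary terms. The change of variables from a null coordinate to τ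
along the ray (`flux_le`) translates the latter into the required integrals. -/

theorem hasFDerivAt_intervalIntegral_of_contDiff {E F : Type*} [NormedAddCommGroup E]
    [NormedSpace ℝ E] [NormedAddCommGroup F] [NormedSpace ℝ F] [CompleteSpace F]
    [FiniteDimensional ℝ E] {φ : E → ℝ → F} (hφ : ContDiff ℝ 1 (Function.uncurry φ)) (a b : ℝ)
    (x : E) :
    HasFDerivAt (fun x => ∫ s in a..b, φ x s)
      (∫ s in a..b, (fderiv ℝ (Function.uncurry φ) (x, s)).comp (ContinuousLinearMap.inl ℝ E ℝ))
      x := by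
  have hder : Continuous fun p : E × ℝ =>
      (fderiv ℝ (Function.uncurry φ) p).comp (ContinuousLinearMap.inl ℝ E ℝ) :=
    ((hφ.continuous_fderiv one_ne_zero)).clm_comp continuous_const
  have hcomp : IsCompact (Metric.closedBall x 1 ×ˢ uIcc a b) :=
    (isCompact_closedBall x 1).prod isCompact_uIcc
  obtain ⟨C, hC⟩ := hcomp.exists_bound_of_continuousOn hder.continuousOn
  have hc : ∀ z, Continuous fun s => φ z s := fun z =>
    hφ.continuous.comp (continuous_const.prodMk continuous_id)
  refine (intervalIntegral.hasFDerivAt_integral_of_dominated_of_fderiv_le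
    (F' := fun z s => (fderiv ℝ (Function.uncurry φ) (z, s)).comp (ContinuousLinearMap.inl ℝ E ℝ))
    (bound := fun _ => C) (Metric.ball_mem_nhds x one_pos) ?_ ?_ ?_ ?_ ?_ ?_)
  · exact Eventually.of_forall fun z => (hc z).aestronglyMeasurable
  · exact (hc x).intervalIntegrable _ _
  · exact (hder.comp (continuous_const.prodMk continuous_id)).aestronglyMeasurable
  · refine Eventually.of_forall fun s hs z hz => hC (z, s) ⟨Metric.ball_subset_closedBall hz, ?_⟩
    exact uIoc_subset_uIcc hs
  · exact intervalIntegrable_const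
  · refine Eventually.of_forall fun s hs z hz => ?_
    have h1 : HasFDerivAt (Function.uncurry φ) (fderiv ℝ (Function.uncurry φ) (z, s)) (z, s) :=
      (hφ.differentiable one_ne_zero _).hasFDerivAt
    exact HasFDerivAt.comp (f := fun e : E => (e, s)) z h1 (hasFDerivAt_prodMk_left z s)

/-- The derivative is again a parametric integral, with values in the continuous linear maps from
`E` to `F`. For this reason the target is quantified inside the induction. -/
theorem contDiff_intervalIntegral {E : Type} [NormedAddCommGroup E] [NormedSpace ℝ E]
    [FiniteDimensional ℝ E] (n : ℕ) : ∀ {F : Type} [NormedAddCommGroup F] [NormedSpace ℝ F]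
    [CompleteSpace F] {φ : E → ℝ → F} (_ : ContDiff ℝ n (Function.uncurry φ)) (a b : ℝ),
    ContDiff ℝ n (fun x => ∫ s in a..b, φ x s) := by
  induction n with
  | zero =>
    intro F _ _ _ φ hφ a b
    refine contDiff_zero.2 ?_
    exact intervalIntegral.continuous_parametric_intervalIntegral_of_continuous'
      (contDiff_zero.1 hφ) a b
  | succ n ih =>
    intro F _ _ _ φ hφ a b
    have h1 : ContDiff ℝ 1 (Function.uncurry φ) := hφ.of_le (by norm_cast; omega)
    push_cast
    refine contDiff_succ_iff_hasFDerivAt.2 ⟨_, ?_,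
      hasFDerivAt_intervalIntegral_of_contDiff h1 a b⟩
    apply ih
    have : ContDiff ℝ n (fderiv ℝ (Function.uncurry φ)) :=
      hφ.fderiv_right (by norm_cast)
    exact this.clm_comp contDiff_const

namespace TBData

variable {d : TBData}

/-! ### Regularity and signs of the initial data -/

namespace Admissible

/-- Rescaling the integration variable by R extracts the factor R³. The quotient c = 2m/R³ thereby
becomes a parametric integral that is smooth through R = 0. -/
theorem m_eq_integral (R : ℝ) :
    d.m R = 4 * Real.pi * (R ^ 3 * ∫ s in (0 : ℝ)..1, d.ρ₀ (R * s) * s ^ 2) := by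
  unfold m
  congr 1
  have h := intervalIntegral.mul_integral_comp_mul_left (a := 0) (b := 1)
    (f := fun s => d.ρ₀ s * s ^ 2) (c := R)
  simp only [mul_zero, mul_one] at h
  rw [← h]
  have : ∀ s, d.ρ₀ (R * s) * (R * s) ^ 2 = R ^ 2 * (d.ρ₀ (R * s) * s ^ 2) := fun s => by ring
  simp_rw [this]
  rw [intervalIntegral.integral_const_mul]
  ring

theorem c_eq (_hd : d.Admissible) (R : ℝ) :
    d.c R = 8 * Real.pi * ∫ s in (0 : ℝ)..1, d.ρ₀ (R * s) * s ^ 2 := by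
  unfold c
  split_ifs with h
  · subst h
    simp only [zero_mul]
    rw [intervalIntegral.integral_const_mul]
    simp [integral_pow]
    ring
  · rw [m_eq_integral]
    field_simp
    ring

theorem m_eq_c (hd : d.Admissible) (R : ℝ) : d.m R = d.c R * R ^ 3 / 2 := by
  rw [hd.c_eq, m_eq_integral]; ring

theorem contDiff_c (hd : d.Admissible) : ContDiff ℝ ∞ d.c := by
  have h : d.c = fun R => 8 * Real.pi * ∫ s in (0 : ℝ)..1, d.ρ₀ (R * s) * s ^ 2 := by
    ext R; exact hd.c_eq R
  rw [h, contDiff_infty]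
  intro n
  refine contDiff_const.mul (contDiff_intervalIntegral n ?_ 0 1)
  have h0 : ContDiff ℝ n d.ρ₀ := hd.smooth_ρ₀.of_le (by exact_mod_cast le_top)
  have : (Function.uncurry fun R s => d.ρ₀ (R * s) * s ^ 2)
      = fun p : ℝ × ℝ => d.ρ₀ (p.1 * p.2) * p.2 ^ 2 := rfl
  rw [this]
  exact (h0.comp (contDiff_fst.mul contDiff_snd)).mul (contDiff_snd.pow 2)

theorem v₀_zero (hd : d.Admissible) : d.v₀ 0 = 0 := by
  have := hd.odd_v₀ 0
  simp at this; linarith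

theorem v₀_eq (hd : d.Admissible) (R : ℝ) : d.v₀ R = R * d.vOverR R := by
  unfold vOverR
  split_ifs with h
  · rw [h, hd.v₀_zero]; simp
  · field_simp

/-- Hadamard's lemma: dividing an odd function by its argument costs no regularity at the centre. -/
theorem vOverR_eq (hd : d.Admissible) (R : ℝ) :
    d.vOverR R = ∫ s in (0 : ℝ)..1, deriv d.v₀ (R * s) := by
  unfold vOverR
  split_ifs with h
  · subst h
    simp
  · have h1 := intervalIntegral.mul_integral_comp_mul_left (a := 0) (b := 1)
      (f := fun s => deriv d.v₀ s) (c := R)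
    simp only [mul_zero, mul_one] at h1
    have hs : ContDiff ℝ 1 d.v₀ := hd.smooth_v₀.of_le (by exact_mod_cast le_top)
    rw [intervalIntegral.integral_deriv_eq_sub
      (fun x _ => hs.differentiable one_ne_zero x)
      ((hs.continuous_deriv le_rfl).intervalIntegrable _ _), hd.v₀_zero] at h1
    field_simp
    linarith

theorem contDiff_vOverR (hd : d.Admissible) : ContDiff ℝ ∞ d.vOverR := by
  have h : d.vOverR = fun R => ∫ s in (0 : ℝ)..1, deriv d.v₀ (R * s) := by
    ext R; exact hd.vOverR_eq R
  rw [h, contDiff_infty]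
  intro n
  refine contDiff_intervalIntegral n ?_ 0 1
  have h0 : ContDiff ℝ n (deriv d.v₀) := by
    have : ContDiff ℝ ((n : ℕ) + 1 : ℕ) d.v₀ := hd.smooth_v₀.of_le (by exact_mod_cast le_top)
    push_cast at this
    exact (contDiff_succ_iff_deriv.1 this).2.2
  exact h0.comp (contDiff_fst.mul contDiff_snd)

theorem c_neg (hd : d.Admissible) (R : ℝ) : d.c (-R) = d.c R := by
  simp only [hd.c_eq, neg_mul, hd.even_ρ₀]

theorem vOverR_neg (hd : d.Admissible) (R : ℝ) : d.vOverR (-R) = d.vOverR R := by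
  unfold vOverR
  simp [hd.odd_v₀]

theorem q_neg (hd : d.Admissible) (R : ℝ) : d.q (-R) = d.q R := by
  simp only [q, hd.c_neg, hd.vOverR_neg]

theorem c_abs (hd : d.Admissible) (R : ℝ) : d.c |R| = d.c R := by
  rcases abs_choice R with h | h <;> rw [h]
  exact hd.c_neg R

theorem vOverR_abs (hd : d.Admissible) (R : ℝ) : d.vOverR |R| = d.vOverR R := by
  rcases abs_choice R with h | h <;> rw [h]
  exact hd.vOverR_neg R

theorem sq_vOverR_lt (hd : d.Admissible) (R : ℝ) : d.vOverR R ^ 2 < d.c R := by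
  rw [← hd.c_abs, ← hd.vOverR_abs]; exact hd.bounded_collapse _ (abs_nonneg R)

theorem c_pos (hd : d.Admissible) (R : ℝ) : 0 < d.c R :=
  (sq_nonneg _).trans_lt (hd.sq_vOverR_lt R)

theorem vOverR_lt (hd : d.Admissible) (R : ℝ) : d.vOverR R < 0 := by
  rw [← hd.vOverR_abs]; exact hd.collapsing _ (abs_nonneg R)

theorem q_arg_pos (hd : d.Admissible) (R : ℝ) : 0 < 1 - d.vOverR R ^ 2 / d.c R := by
  rw [sub_pos, div_lt_one (hd.c_pos R)]; exact hd.sq_vOverR_lt R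

theorem q_pos (hd : d.Admissible) (R : ℝ) : 0 < d.q R := Real.sqrt_pos.2 (hd.q_arg_pos R)

theorem q_sq (hd : d.Admissible) (R : ℝ) : d.q R ^ 2 = 1 - d.vOverR R ^ 2 / d.c R :=
  Real.sq_sqrt (hd.q_arg_pos R).le

theorem q_lt_one (hd : d.Admissible) (R : ℝ) : d.q R < 1 := by
  have h1 : 0 < d.vOverR R ^ 2 / d.c R :=
    div_pos (sq_pos_of_neg (hd.vOverR_lt R)) (hd.c_pos R)
  have := hd.q_sq R
  nlinarith [hd.q_pos R]

theorem contDiff_q (hd : d.Admissible) : ContDiff ℝ ∞ d.q := by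
  refine ContDiff.sqrt ?_ fun R => (hd.q_arg_pos R).ne'
  exact contDiff_const.sub ((hd.contDiff_vOverR.pow 2).div hd.contDiff_c fun R => (hd.c_pos R).ne')

/-- In the variables c and q the energy is manifestly regular at the centre and nonpositive, so
every shell is bound. -/
theorem E_eq (hd : d.Admissible) (R : ℝ) : 2 * d.E R = -(d.c R * d.q R ^ 2 * R ^ 2) := by
  have hc := (hd.c_pos R).ne'
  rw [hd.q_sq, E, hd.m_eq_c, hd.v₀_eq]
  by_cases h : R = 0
  · subst h; simp
  · field_simp
    ring

theorem contDiff_E (hd : d.Admissible) : ContDiff ℝ ∞ d.E := by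
  have : d.E = fun R => -(d.c R * d.q R ^ 2 * R ^ 2) / 2 := by
    ext R; rw [← hd.E_eq]; ring
  rw [this]
  exact ((hd.contDiff_c.mul (hd.contDiff_q.pow 2)).mul (contDiff_id.pow 2)).neg.div_const 2

theorem contDiff_m (hd : d.Admissible) : ContDiff ℝ ∞ d.m := by
  have : d.m = fun R => d.c R * R ^ 3 / 2 := by ext R; exact hd.m_eq_c R
  rw [this]
  exact (hd.contDiff_c.mul (contDiff_id.pow 3)).div_const 2

theorem hasDerivAt_m (hd : d.Admissible) (R : ℝ) :
    HasDerivAt d.m (4 * Real.pi * (d.ρ₀ R * R ^ 2)) R := by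
  have hc : Continuous fun s => d.ρ₀ s * s ^ 2 := hd.smooth_ρ₀.continuous.mul (continuous_pow 2)
  exact (intervalIntegral.integral_hasDerivAt_right (hc.intervalIntegrable _ _)
    (hc.stronglyMeasurableAtFilter _ _) hc.continuousAt).const_mul _

theorem E_le (hd : d.Admissible) (R : ℝ) : 1 + 2 * d.E R ≤ 1 := by
  rw [hd.E_eq]
  have := hd.c_pos R
  have : 0 ≤ d.c R * d.q R ^ 2 * R ^ 2 := by positivity
  linarith

theorem E_neg (hd : d.Admissible) (R : ℝ) : d.E (-R) = d.E R := by
  have h1 := hd.E_eq R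
  have h2 := hd.E_eq (-R)
  rw [hd.c_neg, hd.q_neg] at h2
  nlinarith

/-- Since 1 + 2E = 1 - 2m/R + v₀², this is the absence of trapped surfaces in the data. It makes W =
√(1+2E), and with it γ, nonzero. -/
theorem E_pos (hd : d.Admissible) (R : ℝ) : 0 < 1 + 2 * d.E R := by
  have key : ∀ R, 0 < R → 0 < 1 + 2 * d.E R := by
    intro R hR
    have := hd.no_trapped R hR
    have h2 : 2 * d.E R = d.v₀ R ^ 2 - 2 * d.m R / R := by unfold E; ring
    rw [h2]; nlinarith [sq_nonneg (d.v₀ R)]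
  rcases lt_trichotomy R 0 with h | h | h
  · rw [← hd.E_neg]; exact key _ (by linarith)
  · subst h; rw [hd.E_eq]; simp
  · exact key R h

theorem m_pos (hd : d.Admissible) {R : ℝ} (hR : 0 < R) : 0 < d.m R := by
  rw [hd.m_eq_c]; have := hd.c_pos R; positivity

theorem c_antitone (hd : d.Admissible) : AntitoneOn d.c (Ici 0) := by
  refine antitoneOn_of_deriv_nonpos (convex_Ici 0) hd.contDiff_c.continuous.continuousOn
    (hd.contDiff_c.differentiable (by simp)).differentiableOn fun R hR => ?_
  rw [interior_Ici] at hR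
  exact hd.mean_density_antitone R hR

theorem q_monotone (hd : d.Admissible) : MonotoneOn d.q (Ici 0) := by
  refine monotoneOn_of_deriv_nonneg (convex_Ici 0) hd.contDiff_q.continuous.continuousOn
    (hd.contDiff_q.differentiable (by simp)).differentiableOn fun R hR => ?_
  rw [interior_Ici] at hR
  exact hd.no_shell_crossing R hR

end Admissible

/-- The derivative of an even function vanishes at the origin. -/
theorem deriv_zero_of_even {φ : ℝ → ℝ} (h : ∀ x, φ (-x) = φ x) : deriv φ 0 = 0 := by
  have h1 : deriv (fun x => φ (-x)) 0 = -deriv φ (-0) := deriv_comp_neg φ 0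
  have h2 : (fun x => φ (-x)) = φ := funext h
  rw [h2, neg_zero] at h1
  linarith

/-- Evenness gives φ'(0) = 0, so the quotient is the completed difference quotient of φ' at the
origin. -/
theorem continuous_derivOverR {φ : ℝ → ℝ} (hφ : ContDiff ℝ ∞ φ) (h : ∀ x, φ (-x) = φ x) :
    Continuous (derivOverR φ) := by
  have h0 := deriv_zero_of_even h
  have h1 : derivOverR φ = dslope (deriv φ) 0 := by
    ext R
    by_cases hR : R = 0
    · subst hR; simp [derivOverR]
    · rw [dslope_of_ne _ hR, slope_def_field, h0]; simp [derivOverR, hR]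
  have h2 : ContDiff ℝ 2 φ := contDiff_infty.1 hφ 2
  have h3 : ContDiff ℝ 1 (deriv φ) := by
    have : ContDiff ℝ (1 + 1) φ := by convert h2 using 1; norm_num
    exact (contDiff_succ_iff_deriv.1 this).2.2
  rw [h1, ← continuousOn_univ]
  exact (continuousOn_dslope univ_mem).2
    ⟨h3.continuous.continuousOn, h3.differentiable one_ne_zero _⟩

/-- Quantitative form of the nondegeneracy of the data inside the cloud. -/
theorem Admissible.exists_nondegenerate (hd : d.Admissible) : ∃ k > 0, ∀ R, 0 ≤ R → R ≤ d.Rstar →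
    k * R ^ 2 ≤ (d.q R - d.q 0) + (d.c 0 - d.c R) := by
  -- Both summands q'/R and -c'/R are nonnegative, and assumption (viii) says that they never vanish
  -- together. Hence F has a positive minimum on the compact cloud.
  set F : ℝ → ℝ := fun R => derivOverR d.q R - derivOverR d.c R with hF
  have hFc : Continuous F := (continuous_derivOverR hd.contDiff_q hd.q_neg).sub
    (continuous_derivOverR hd.contDiff_c hd.c_neg)
  have hqn : ∀ R, 0 ≤ R → 0 ≤ derivOverR d.q R := by
    have : ∀ R ∈ Ioi (0 : ℝ), 0 ≤ derivOverR d.q R := fun R hR => by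
      have hR' : (0 : ℝ) < R := hR
      simp only [derivOverR, hR'.ne', if_false]
      exact div_nonneg (hd.no_shell_crossing R hR) hR'.le
    have hcl : IsClosed {R | 0 ≤ derivOverR d.q R} :=
      isClosed_le continuous_const (continuous_derivOverR hd.contDiff_q hd.q_neg)
    have := hcl.closure_subset_iff.2 this
    rw [closure_Ioi] at this
    exact fun R hR => this hR
  have hcn : ∀ R, 0 ≤ R → derivOverR d.c R ≤ 0 := by
    have : ∀ R ∈ Ioi (0 : ℝ), derivOverR d.c R ≤ 0 := fun R hR => by
      have hR' : (0 : ℝ) < R := hR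
      simp only [derivOverR, hR'.ne', if_false]
      exact div_nonpos_of_nonpos_of_nonneg (hd.mean_density_antitone R hR) hR'.le
    have hcl : IsClosed {R | derivOverR d.c R ≤ 0} :=
      isClosed_le (continuous_derivOverR hd.contDiff_c hd.c_neg) continuous_const
    have := hcl.closure_subset_iff.2 this
    rw [closure_Ioi] at this
    exact fun R hR => this hR
  obtain ⟨R₁, hR₁, hmin⟩ := (isCompact_Icc (a := (0 : ℝ)) (b := d.Rstar)).exists_isMinOn
    ⟨0, le_rfl, hd.Rstar_pos.le⟩ hFc.continuousOn
  have hpos : 0 < F R₁ := by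
    rcases (hcn R₁ hR₁.1).lt_or_eq with h | h
    · have := hqn R₁ hR₁.1; simp only [hF]; linarith
    · have := hd.nondegenerate R₁ hR₁.1 h; simp only [hF]; linarith
  refine ⟨F R₁ / 2, by positivity, fun R h0 h1 => ?_⟩
  -- The derivative of ψ is R (F(R) - F(R₁)), which is nonnegative because R₁ minimises F.
  set ψ : ℝ → ℝ := fun R => d.q R - d.c R - F R₁ / 2 * R ^ 2
  have hdq : ∀ R, HasDerivAt d.q (deriv d.q R) R := fun R =>
    (hd.contDiff_q.differentiable (by simp) R).hasDerivAt
  have hdc : ∀ R, HasDerivAt d.c (deriv d.c R) R := fun R =>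
    (hd.contDiff_c.differentiable (by simp) R).hasDerivAt
  have hψ : ∀ R, HasDerivAt ψ (deriv d.q R - deriv d.c R - F R₁ / 2 * (2 * R)) R := fun R => by
    have := ((hdq R).sub (hdc R)).sub ((hasDerivAt_pow 2 R).const_mul (F R₁ / 2))
    simp only [Nat.cast_ofNat, Nat.add_one_sub_one, pow_one] at this
    exact this
  have hmono : MonotoneOn ψ (Icc 0 d.Rstar) := by
    refine monotoneOn_of_deriv_nonneg (convex_Icc _ _)
      (fun x _ => (hψ x).continuousAt.continuousWithinAt)
      (fun x _ => (hψ x).differentiableAt.differentiableWithinAt) fun x hx => ?_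
    rw [interior_Icc] at hx
    rw [(hψ x).deriv]
    have hm : F R₁ ≤ F x := hmin ⟨hx.1.le, hx.2.le⟩
    have : F x * x = deriv d.q x - deriv d.c x := by
      simp only [hF, derivOverR, hx.1.ne', if_false]
      field_simp [hx.1.ne']
    nlinarith [mul_le_mul_of_nonneg_right hm hx.1.le]
  have := hmono ⟨le_rfl, hd.Rstar_pos.le⟩ ⟨h0, h1⟩ h0
  simp only [ψ] at this
  nlinarith

end TBData
end

noncomputable section
namespace TBData
variable {d : TBData}

/-! ### The profile function `f` -/

theorem hasDerivAt_f {x : ℝ} (h1 : -1 < x) (h2 : x < 1) :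
    HasDerivAt f (-(2 * x ^ 2 / Real.sqrt (1 - x ^ 2))) x := by
  have hp : 0 < 1 - x ^ 2 := by nlinarith
  have hs : HasDerivAt (fun x : ℝ => Real.sqrt (1 - x ^ 2)) (-(2 * x) / (2 * Real.sqrt (1 - x ^ 2))) x := by
    have h := ((hasDerivAt_pow 2 x).const_sub 1).sqrt hp.ne'
    simpa using h
  have ha := Real.hasDerivAt_arccos h1.ne' h2.ne
  have h := ((hasDerivAt_id x).mul hs).add ha
  have hsq := Real.mul_self_sqrt hp.le
  have hne := (Real.sqrt_pos.2 hp).ne'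
  refine h.congr_deriv ?_
  simp only [id]
  field_simp
  nlinarith

theorem contDiffAt_f {x : ℝ} (h1 : -1 < x) (h2 : x < 1) : ContDiffAt ℝ ∞ f x := by
  have hp : 0 < 1 - x ^ 2 := by nlinarith
  exact (contDiffAt_id.mul ((contDiffAt_const.sub (contDiffAt_id.pow 2)).sqrt hp.ne')).add
    (Real.contDiffAt_arccos h1.ne' h2.ne)

theorem continuous_f : Continuous f := by
  unfold f
  exact (continuous_id.mul (Real.continuous_sqrt.comp (by fun_prop))).add Real.continuous_arccos

theorem f_strictAnti : StrictAntiOn f (Icc 0 1) := by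
  refine strictAntiOn_of_deriv_neg (convex_Icc 0 1) continuous_f.continuousOn fun x hx => ?_
  rw [interior_Icc] at hx
  rw [(hasDerivAt_f (by linarith [hx.1]) hx.2).deriv]
  have hp : 0 < 1 - x ^ 2 := by nlinarith [hx.1, hx.2]
  have := Real.sqrt_pos.2 hp
  have := hx.1
  simp only [neg_lt_zero]
  positivity

/-- `Hf q y = ∫_y^1 2 s² / √(1 - q² s²) ds`. -/
def Hf (q y : ℝ) : ℝ := (f (q * y) - f q) / q ^ 3

theorem hasDerivAt_Hf {q y : ℝ} (hq : 0 < q) (hy : 0 ≤ y) (h : q * y < 1) :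
    HasDerivAt (Hf q) (-(2 * y ^ 2 / Real.sqrt (1 - (q * y) ^ 2))) y := by
  have h0 : 0 ≤ q * y := by positivity
  have h1 := (hasDerivAt_f (x := q * y) (by linarith) h).comp y ((hasDerivAt_id y).const_mul q)
  have h2 := (h1.sub_const (f q)).div_const (q ^ 3)
  refine h2.congr_deriv ?_
  simp only [mul_one]
  field_simp

theorem Hf_one (q : ℝ) : Hf q 1 = 0 := by simp [Hf]

/-- Comparison of increments of `Hf` on `[0,1]`. -/
theorem Hf_sub_mono_aux {q : ℝ} (hq : 0 < q) (hq1 : q < 1) {φ φ' : ℝ → ℝ}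
    (hφ : ∀ y, HasDerivAt φ (φ' y) y)
    (h : ∀ y ∈ Ioo (0 : ℝ) 1, 0 ≤ -(2 * y ^ 2 / Real.sqrt (1 - (q * y) ^ 2)) + φ' y) :
    MonotoneOn (fun y => Hf q y + φ y) (Icc 0 1) := by
  have hlt : ∀ y ∈ Icc (0 : ℝ) 1, q * y < 1 := fun y hy => by nlinarith [hy.1, hy.2]
  have hD : ∀ y ∈ Icc (0 : ℝ) 1, HasDerivAt (fun y => Hf q y + φ y)
      (-(2 * y ^ 2 / Real.sqrt (1 - (q * y) ^ 2)) + φ' y) y := fun y hy =>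
    (hasDerivAt_Hf hq hy.1 (hlt y hy)).add (hφ y)
  refine monotoneOn_of_deriv_nonneg (convex_Icc 0 1)
    (fun y hy => (hD y hy).continuousAt.continuousWithinAt)
    (fun y hy => (hD y (interior_subset hy)).differentiableAt.differentiableWithinAt)
    fun y hy => ?_
  rw [interior_Icc] at hy
  rw [(hD y ⟨hy.1.le, hy.2.le⟩).deriv]
  exact h y hy

theorem hasDerivAt_cube (k y : ℝ) : HasDerivAt (fun y : ℝ => k * (2 / 3 * y ^ 3)) (k * (2 * y ^ 2)) y := by
  have := ((hasDerivAt_pow 3 y).const_mul (2 / 3)).const_mul k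
  refine this.congr_deriv ?_
  push_cast; ring

/-- The weight 1/√(1 - q²s²) in the integrand lies between 1 and its value at s = 1. The upper bound
gives this estimate, the lower one `le_Hf_sub`. -/
theorem Hf_sub_le {q y₁ y₂ : ℝ} (hq : 0 < q) (hq1 : q < 1) (h0 : 0 ≤ y₁) (h : y₁ ≤ y₂)
    (h1 : y₂ ≤ 1) : Hf q y₁ - Hf q y₂ ≤ 2 / 3 * (y₂ ^ 3 - y₁ ^ 3) / Real.sqrt (1 - q ^ 2) := by
  have hp : 0 < 1 - q ^ 2 := by nlinarith
  have hs := Real.sqrt_pos.2 hp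
  have := Hf_sub_mono_aux hq hq1 (hasDerivAt_cube (1 / Real.sqrt (1 - q ^ 2))) (fun y hy => by
    have hle : 1 - q ^ 2 ≤ 1 - (q * y) ^ 2 := by
      have : (q * y) ^ 2 ≤ q ^ 2 := by
        rw [mul_pow]; nlinarith [hy.1, hy.2, sq_nonneg q, mul_nonneg (sq_nonneg q) hy.1.le]
      linarith
    have h2 := Real.sqrt_le_sqrt hle
    have h3 : 2 * y ^ 2 / Real.sqrt (1 - (q * y) ^ 2) ≤ 2 * y ^ 2 / Real.sqrt (1 - q ^ 2) := by
      gcongr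
    have : 1 / Real.sqrt (1 - q ^ 2) * (2 * y ^ 2) = 2 * y ^ 2 / Real.sqrt (1 - q ^ 2) := by ring
    linarith) ⟨h0, h.trans h1⟩ ⟨h0.trans h, h1⟩ h
  simp only at this
  have e : 2 / 3 * (y₂ ^ 3 - y₁ ^ 3) / Real.sqrt (1 - q ^ 2) = 1 / Real.sqrt (1 - q ^ 2) * (2 / 3 * y₂ ^ 3)
    - 1 / Real.sqrt (1 - q ^ 2) * (2 / 3 * y₁ ^ 3) := by ring
  linarith

theorem le_Hf_sub {q y₁ y₂ : ℝ} (hq : 0 < q) (hq1 : q < 1) (h0 : 0 ≤ y₁) (h : y₁ ≤ y₂)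
    (h1 : y₂ ≤ 1) : 2 / 3 * (y₂ ^ 3 - y₁ ^ 3) ≤ Hf q y₁ - Hf q y₂ := by
  have hlt : ∀ y ∈ Icc (0 : ℝ) 1, q * y < 1 := fun y hy => by nlinarith [hy.1, hy.2]
  have hD : ∀ y ∈ Icc (0 : ℝ) 1, HasDerivAt (fun y => Hf q y + 1 * (2 / 3 * y ^ 3))
      (-(2 * y ^ 2 / Real.sqrt (1 - (q * y) ^ 2)) + 1 * (2 * y ^ 2)) y := fun y hy =>
    (hasDerivAt_Hf hq hy.1 (hlt y hy)).add (hasDerivAt_cube 1 y)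
  have hanti : AntitoneOn (fun y => Hf q y + 1 * (2 / 3 * y ^ 3)) (Icc 0 1) := by
    refine antitoneOn_of_deriv_nonpos (convex_Icc 0 1)
      (fun y hy => (hD y hy).continuousAt.continuousWithinAt)
      (fun y hy => (hD y (interior_subset hy)).differentiableAt.differentiableWithinAt)
      fun y hy => ?_
    rw [interior_Icc] at hy
    rw [(hD y ⟨hy.1.le, hy.2.le⟩).deriv]
    have hl := hlt y ⟨hy.1.le, hy.2.le⟩
    have h0 : 0 < q * y := mul_pos hq hy.1
    have hp : 0 < 1 - (q * y) ^ 2 := by nlinarith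
    have hs := Real.sqrt_pos.2 hp
    have hs1 : Real.sqrt (1 - (q * y) ^ 2) ≤ 1 := Real.sqrt_le_one.2 (by nlinarith)
    have : 2 * y ^ 2 ≤ 2 * y ^ 2 / Real.sqrt (1 - (q * y) ^ 2) := by
      rw [le_div_iff₀ hs]
      have : 0 ≤ 2 * y ^ 2 := by positivity
      nlinarith
    linarith
  have := hanti ⟨h0, h.trans h1⟩ ⟨h0.trans h, h1⟩ h
  simp only at this
  linarith

/-- The function (1-x)^(-1/2) has slope at least 1/2 on [0,1). With a and b the two roots, the
difference is (a - b)/(ab), and (a + b)ab ≤ 2. -/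
theorem inv_sqrt_sub_ge {x₁ x₂ : ℝ} (h0 : 0 ≤ x₁) (h : x₁ ≤ x₂) (h1 : x₂ < 1) :
    (x₂ - x₁) / 2 ≤ 1 / Real.sqrt (1 - x₂) - 1 / Real.sqrt (1 - x₁) := by
  have hb := Real.sqrt_pos.2 (show 0 < 1 - x₂ by linarith)
  have ha := Real.sqrt_pos.2 (show 0 < 1 - x₁ by linarith)
  have hb2 := Real.sq_sqrt (show 0 ≤ 1 - x₂ by linarith)
  have ha2 := Real.sq_sqrt (show 0 ≤ 1 - x₁ by linarith)
  have hab := Real.sqrt_le_sqrt (show 1 - x₂ ≤ 1 - x₁ by linarith)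
  have ha1 : Real.sqrt (1 - x₁) ≤ 1 := Real.sqrt_le_one.2 (by linarith)
  set a := Real.sqrt (1 - x₁)
  set b := Real.sqrt (1 - x₂)
  have e : x₂ - x₁ = (a - b) * (a + b) := by nlinarith
  have hab1 : a * b ≤ 1 := by nlinarith
  rw [div_sub_div _ _ hb.ne' ha.ne', le_div_iff₀ (by positivity), e]
  have h3 : (a + b) * (b * a) ≤ 2 := by nlinarith [mul_pos ha hb]
  nlinarith [mul_le_mul_of_nonneg_left h3 (sub_nonneg.2 hab)]

/-- By `inv_sqrt_sub_ge` the two integrands differ by at least (q₂² - q₁²) s⁴, which is integrated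
from y to 1. The gain is kept explicit because the lower bound on τ_s(R) - τ_s(0) depends on it. -/
theorem Hf_mono_q {q₁ q₂ y : ℝ} (hq : 0 < q₁) (h : q₁ ≤ q₂) (hq1 : q₂ < 1) (h0 : 0 ≤ y)
    (h1 : y ≤ 1) : (q₂ ^ 2 - q₁ ^ 2) * (1 - y ^ 5) / 5 ≤ Hf q₂ y - Hf q₁ y := by
  have hlt₁ : ∀ y ∈ Icc (0 : ℝ) 1, q₁ * y < 1 := fun y hy => by nlinarith [hy.1, hy.2]
  have hlt₂ : ∀ y ∈ Icc (0 : ℝ) 1, q₂ * y < 1 := fun y hy => by nlinarith [hy.1, hy.2]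
  have hD : ∀ y ∈ Icc (0 : ℝ) 1, HasDerivAt
      (fun y => Hf q₂ y - Hf q₁ y + (q₂ ^ 2 - q₁ ^ 2) / 5 * y ^ 5)
      (-(2 * y ^ 2 / Real.sqrt (1 - (q₂ * y) ^ 2)) - -(2 * y ^ 2 / Real.sqrt (1 - (q₁ * y) ^ 2))
        + (q₂ ^ 2 - q₁ ^ 2) / 5 * ((5 : ℕ) * y ^ (5 - 1))) y := fun y hy =>
    ((hasDerivAt_Hf (hq.trans_le h) hy.1 (hlt₂ y hy)).sub
      (hasDerivAt_Hf hq hy.1 (hlt₁ y hy))).add ((hasDerivAt_pow 5 y).const_mul _)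
  have hanti : AntitoneOn (fun y => Hf q₂ y - Hf q₁ y + (q₂ ^ 2 - q₁ ^ 2) / 5 * y ^ 5)
      (Icc 0 1) := by
    refine antitoneOn_of_deriv_nonpos (convex_Icc 0 1)
      (fun y hy => (hD y hy).continuousAt.continuousWithinAt)
      (fun y hy => (hD y (interior_subset hy)).differentiableAt.differentiableWithinAt)
      fun y hy => ?_
    rw [interior_Icc] at hy
    rw [(hD y ⟨hy.1.le, hy.2.le⟩).deriv]
    have hl := hlt₂ y ⟨hy.1.le, hy.2.le⟩
    have h0 : 0 < q₂ * y := mul_pos (hq.trans_le h) hy.1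
    have hle : (q₁ * y) ^ 2 ≤ (q₂ * y) ^ 2 := by
      have := hy.1
      gcongr
    have := inv_sqrt_sub_ge (sq_nonneg (q₁ * y)) hle (by nlinarith)
    have h5 := mul_le_mul_of_nonneg_left this (show 0 ≤ 2 * y ^ 2 by positivity)
    push_cast
    have e1 : 2 * y ^ 2 * (((q₂ * y) ^ 2 - (q₁ * y) ^ 2) / 2) = (q₂ ^ 2 - q₁ ^ 2) * y ^ 4 := by ring
    have e2 : 2 * y ^ 2 * (1 / Real.sqrt (1 - (q₂ * y) ^ 2) - 1 / Real.sqrt (1 - (q₁ * y) ^ 2))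
      = 2 * y ^ 2 / Real.sqrt (1 - (q₂ * y) ^ 2) - 2 * y ^ 2 / Real.sqrt (1 - (q₁ * y) ^ 2) := by
      ring
    rw [e1, e2] at h5
    nlinarith
  have := hanti ⟨h0, h1⟩ ⟨zero_le_one, le_rfl⟩ h1
  simp only [Hf_one] at this
  linarith

/-! ### Proper time along a shell -/

theorem tau_eq (y R : ℝ) : d.tau y R = Hf (d.q R) y / Real.sqrt (d.c R) := rfl

theorem tau_one (R : ℝ) : d.tau 1 R = 0 := by rw [tau_eq, Hf_one, zero_div]

/-- The time at which the time-reversed shell `R` reaches its maximal radius. -/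
def tMin (d : TBData) (R : ℝ) : ℝ := d.tau (1 / d.q R) R

namespace Admissible

theorem sqrt_c_pos (hd : d.Admissible) (R : ℝ) : 0 < Real.sqrt (d.c R) :=
  Real.sqrt_pos.2 (hd.c_pos R)

theorem tau_neg (hd : d.Admissible) (y R : ℝ) : d.tau y (-R) = d.tau y R := by
  simp only [tau, hd.q_neg, hd.c_neg]

theorem tauS_neg (hd : d.Admissible) (R : ℝ) : d.tauS (-R) = d.tauS R := hd.tau_neg 0 R

theorem tauS_abs (hd : d.Admissible) (R : ℝ) : d.tauS |R| = d.tauS R := by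
  rcases abs_choice R with h | h <;> rw [h]
  exact hd.tauS_neg R

theorem tMin_neg (hd : d.Admissible) (R : ℝ) : d.tMin (-R) = d.tMin R := by
  unfold tMin; rw [hd.tau_neg, hd.q_neg]

/-- The range extends beyond y = 1 up to the turning point y = 1/q. Shells are thus followed to
times before τ = 0, the initial slice becomes interior to an open domain, and two-sided derivatives
exist there. -/
theorem tau_strictAnti (hd : d.Admissible) (R : ℝ) :
    StrictAntiOn (fun y => d.tau y R) (Icc 0 (1 / d.q R)) := by
  intro y₁ h₁ y₂ h₂ h
  have hq := hd.q_pos R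
  have hm : ∀ y ∈ Icc 0 (1 / d.q R), d.q R * y ∈ Icc (0 : ℝ) 1 := fun y hy =>
    ⟨mul_nonneg hq.le hy.1, by have := (le_div_iff₀ hq).1 hy.2; linarith⟩
  have := f_strictAnti (hm _ h₁) (hm _ h₂) (mul_lt_mul_of_pos_left h hq)
  have hc := hd.sqrt_c_pos R
  simp only [tau]
  gcongr

theorem one_lt_inv_q (hd : d.Admissible) (R : ℝ) : 1 < 1 / d.q R := by
  rw [lt_div_iff₀ (hd.q_pos R), one_mul]; exact hd.q_lt_one R

theorem tMin_lt_zero (hd : d.Admissible) (R : ℝ) : d.tMin R < 0 := by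
  have h := hd.one_lt_inv_q R
  have := hd.tau_strictAnti R ⟨zero_le_one, h.le⟩ ⟨by linarith, le_rfl⟩ h
  simp only [tau_one] at this
  exact this

theorem tauS_pos (hd : d.Admissible) (R : ℝ) : 0 < d.tauS R := by
  have h := hd.one_lt_inv_q R
  have := hd.tau_strictAnti R ⟨le_rfl, by linarith⟩ ⟨zero_le_one, h.le⟩ one_pos
  simp only [tau_one] at this
  exact this

/-- As R grows, q grows and c decreases, and both delay the collapse. This monotonicity is what
excludes shell crossing. -/
theorem tau_mono_R (hd : d.Admissible) {y R₁ R₂ : ℝ} (h0 : 0 ≤ y) (h1 : y ≤ 1) (hR : 0 ≤ R₁)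
    (h : R₁ ≤ R₂) : d.tau y R₁ ≤ d.tau y R₂ := by
  have hq := hd.q_monotone hR (hR.trans h) h
  have hc := hd.c_antitone hR (hR.trans h) h
  have h2 := Hf_mono_q (hd.q_pos R₁) hq (hd.q_lt_one R₂) h0 h1
  have h3 : 0 ≤ (d.q R₂ ^ 2 - d.q R₁ ^ 2) * (1 - y ^ 5) / 5 := by
    have : d.q R₁ ^ 2 ≤ d.q R₂ ^ 2 := by
      have := (hd.q_pos R₁).le
      gcongr
    have : y ^ 5 ≤ 1 := pow_le_one₀ h0 h1
    have : 0 ≤ (d.q R₂ ^ 2 - d.q R₁ ^ 2) * (1 - y ^ 5) := mul_nonneg (by linarith) (by linarith)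
    linarith
  have h4 : 0 ≤ Hf (d.q R₂) y := by
    have := le_Hf_sub (hd.q_pos R₂) (hd.q_lt_one R₂) h0 h1 le_rfl
    rw [Hf_one] at this
    have : y ^ 3 ≤ 1 := pow_le_one₀ h0 h1
    linarith
  rw [tau_eq, tau_eq]
  have := hd.sqrt_c_pos R₁
  have := hd.sqrt_c_pos R₂
  have := Real.sqrt_le_sqrt hc
  exact div_le_div₀ h4 (by linarith) (by positivity) (by linarith)

theorem tauS_mono (hd : d.Admissible) {R₁ R₂ : ℝ} (hR : 0 ≤ R₁) (h : R₁ ≤ R₂) :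
    d.tauS R₁ ≤ d.tauS R₂ := hd.tau_mono_R le_rfl zero_le_one hR h

theorem tauS_zero_le (hd : d.Admissible) (R : ℝ) : d.tauS 0 ≤ d.tauS R := by
  rw [← hd.tauS_abs R]; exact hd.tauS_mono le_rfl (abs_nonneg R)

theorem contDiffAt_tau (hd : d.Admissible) {y R : ℝ} (h0 : 0 ≤ y) (h1 : d.q R * y < 1) :
    ContDiffAt ℝ ∞ (fun p : ℝ × ℝ => d.tau p.1 p.2) (y, R) := by
  have hq := hd.q_pos R
  have h0' : 0 ≤ d.q R * y := by positivity
  have hqs : ContDiffAt ℝ ∞ (fun p : ℝ × ℝ => d.q p.2) (y, R) :=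
    hd.contDiff_q.contDiffAt.comp _ contDiffAt_snd
  have hcs : ContDiffAt ℝ ∞ (fun p : ℝ × ℝ => d.c p.2) (y, R) :=
    hd.contDiff_c.contDiffAt.comp _ contDiffAt_snd
  have hf1 : ContDiffAt ℝ ∞ (fun p : ℝ × ℝ => f (d.q p.2 * p.1)) (y, R) :=
    ContDiffAt.comp (g := f) (y, R) (contDiffAt_f (x := d.q R * y) (by linarith) h1)
      (hqs.mul contDiffAt_fst)
  have hf2 : ContDiffAt ℝ ∞ (fun p : ℝ × ℝ => f (d.q p.2)) (y, R) :=
    ContDiffAt.comp (g := f) (y, R) (contDiffAt_f (x := d.q R) (by linarith) (hd.q_lt_one R)) hqs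
  exact ((hf1.sub hf2).div (hqs.pow 3) (by positivity)).div
    (hcs.sqrt (hd.c_pos R).ne') (hd.sqrt_c_pos R).ne'

theorem hasDerivAt_tau (hd : d.Admissible) {y R : ℝ} (h0 : 0 ≤ y) (h1 : d.q R * y < 1) :
    HasDerivAt (fun y => d.tau y R)
      (-(2 * y ^ 2 / (Real.sqrt (1 - (d.q R * y) ^ 2) * Real.sqrt (d.c R)))) y := by
  have := (hasDerivAt_Hf (hd.q_pos R) h0 h1).div_const (Real.sqrt (d.c R))
  refine this.congr_deriv ?_
  rw [neg_div, div_div]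

theorem continuous_tauS (hd : d.Admissible) : Continuous d.tauS := by
  rw [continuous_iff_continuousAt]
  intro R
  have := (hd.contDiffAt_tau (y := 0) (R := R) le_rfl (by simp)).continuousAt
  exact this.comp (f := fun R => ((0 : ℝ), R)) (by fun_prop)

theorem continuous_tMin (hd : d.Admissible) : Continuous d.tMin := by
  have : d.tMin = fun R => (f 1 - f (d.q R)) / d.q R ^ 3 / Real.sqrt (d.c R) := by
    ext R
    simp only [tMin, tau]
    rw [mul_one_div_cancel (hd.q_pos R).ne']
  rw [this]
  have hq := hd.contDiff_q.continuous
  have hc := hd.contDiff_c.continuous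
  exact ((continuous_const.sub (continuous_f.comp hq)).div (hq.pow 3)
    fun R => (pow_pos (hd.q_pos R) 3).ne').div (Real.continuous_sqrt.comp hc)
    fun R => (hd.sqrt_c_pos R).ne'

end Admissible

/-! ### The extended shell variable -/

/-- The spacetime extended evenly to negative `R` and slightly to negative `τ`. -/
def Mext (d : TBData) : Set (ℝ × ℝ) := {p | d.tMin p.2 < p.1 ∧ p.1 < d.tauS p.2}

/-- The solution `y` of `τ(y,R) = τ` on the extended spacetime. -/
def yE (d : TBData) (p : ℝ × ℝ) : ℝ :=
  Function.invFunOn (fun s => d.tau s p.2) (Icc 0 (1 / d.q p.2)) p.1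

namespace Admissible

theorem isOpen_Mext (hd : d.Admissible) : IsOpen d.Mext :=
  (isOpen_lt (hd.continuous_tMin.comp continuous_snd) continuous_fst).inter
    (isOpen_lt continuous_fst (hd.continuous_tauS.comp continuous_snd))

theorem mem_Mext (hd : d.Admissible) {t R : ℝ} (h0 : 0 ≤ t) (h1 : t < d.tauS R) :
    (t, R) ∈ d.Mext := ⟨(hd.tMin_lt_zero R).trans_le h0, h1⟩

theorem Mext_neg (hd : d.Admissible) {t R : ℝ} (h : (t, R) ∈ d.Mext) : (t, -R) ∈ d.Mext := by
  simpa only [Mext, mem_ofPred_eq, hd.tMin_neg, hd.tauS_neg] using h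

theorem q_mul_mem_iff (hd : d.Admissible) {y R : ℝ} : y ∈ Icc 0 (1 / d.q R) ↔
    0 ≤ y ∧ d.q R * y ≤ 1 := by
  rw [mem_Icc, le_div_iff₀ (hd.q_pos R), mul_comm]

theorem yE_eq (hd : d.Admissible) {y t R : ℝ} (h0 : 0 ≤ y) (h1 : d.q R * y ≤ 1)
    (h : d.tau y R = t) : d.yE (t, R) = y := by
  have hm := hd.q_mul_mem_iff.2 ⟨h0, h1⟩
  have hex : ∃ a ∈ Icc 0 (1 / d.q R), (fun s => d.tau s R) a = t := ⟨y, hm, h⟩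
  have h2 := Function.invFunOn_mem hex
  have h3 := Function.invFunOn_eq hex
  exact (hd.tau_strictAnti R).injOn h2 hm (h3.trans h.symm)

theorem yE_spec (hd : d.Admissible) {p : ℝ × ℝ} (hp : p ∈ d.Mext) :
    0 < d.yE p ∧ d.q p.2 * d.yE p < 1 ∧ d.tau (d.yE p) p.2 = p.1 := by
  have hq := hd.q_pos p.2
  have hcont : ContinuousOn (fun s => d.tau s p.2) (Icc 0 (1 / d.q p.2)) := by
    have : Continuous fun s => d.tau s p.2 := by
      unfold tau
      exact (((continuous_f.comp (continuous_const.mul continuous_id)).sub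
        continuous_const).div_const _).div_const _
    exact this.continuousOn
  have hle : (0 : ℝ) ≤ 1 / d.q p.2 := by positivity
  obtain ⟨y, hy, hyt⟩ := intermediate_value_Ioo' hle hcont (show p.1 ∈ _ from hp)
  have hy1 : d.q p.2 * y < 1 := by
    have := (lt_div_iff₀ hq).1 hy.2; linarith
  have : d.yE p = y := hd.yE_eq (t := p.1) (R := p.2) hy.1.le hy1.le hyt
  rw [this]
  exact ⟨hy.1, hy1, hyt⟩

/-- Nonnegative times are attained only for y ≤ 1, so the inverse on the longer interval agrees with
the original one. -/
theorem y_eq (hd : d.Admissible) {t R : ℝ} (h0 : 0 ≤ t) (h1 : t < d.tauS R) :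
    d.y t R = d.yE (t, R) ∧ d.yE (t, R) ≤ 1 := by
  obtain ⟨hy0, hy1, hyt⟩ := hd.yE_spec (hd.mem_Mext h0 h1)
  have hle : d.yE (t, R) ≤ 1 := by
    by_contra hc
    push Not at hc
    have := hd.tau_strictAnti R ⟨zero_le_one, (hd.one_lt_inv_q R).le⟩
      (hd.q_mul_mem_iff.2 ⟨hy0.le, hy1.le⟩) hc
    simp only [tau_one] at this
    simp only at hyt
    linarith
  refine ⟨?_, hle⟩
  have hex : ∃ a ∈ Icc (0 : ℝ) 1, (fun s => d.tau s R) a = t := ⟨_, ⟨hy0.le, hle⟩, hyt⟩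
  have h2 := Function.invFunOn_mem hex
  have h3 := Function.invFunOn_eq hex
  have hsub : Icc (0 : ℝ) 1 ⊆ Icc 0 (1 / d.q R) := Icc_subset_Icc le_rfl (hd.one_lt_inv_q R).le
  exact (hd.tau_strictAnti R).injOn (hsub h2) (hsub ⟨hy0.le, hle⟩) (h3.trans hyt.symm)

theorem yE_neg (hd : d.Admissible) (t R : ℝ) : d.yE (t, -R) = d.yE (t, R) := by
  simp only [yE, hd.tau_neg, hd.q_neg]

theorem yE_zero (hd : d.Admissible) (R : ℝ) : d.yE (0, R) = 1 :=
  hd.yE_eq zero_le_one (by linarith [hd.q_lt_one R]) (tau_one R)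

/-- `y` decreases in time. -/
theorem yE_anti_t (hd : d.Admissible) {t₁ t₂ R : ℝ} (h₁ : (t₁, R) ∈ d.Mext)
    (h₂ : (t₂, R) ∈ d.Mext) (h : t₁ ≤ t₂) : d.yE (t₂, R) ≤ d.yE (t₁, R) := by
  obtain ⟨a0, a1, a2⟩ := hd.yE_spec h₁
  obtain ⟨b0, b1, b2⟩ := hd.yE_spec h₂
  refine (hd.tau_strictAnti R).le_iff_ge (hd.q_mul_mem_iff.2 ⟨a0.le, a1.le⟩)
    (hd.q_mul_mem_iff.2 ⟨b0.le, b1.le⟩) |>.1 ?_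
  simp only at a2 b2 ⊢
  rw [a2, b2]; exact h

/-- `y` increases in `R`. -/
theorem yE_mono_R (hd : d.Admissible) {t R₁ R₂ : ℝ} (h0 : 0 ≤ t) (hR : 0 ≤ R₁) (h : R₁ ≤ R₂)
    (ht : t < d.tauS R₁) : d.yE (t, R₁) ≤ d.yE (t, R₂) := by
  have ht2 := ht.trans_le (hd.tauS_mono hR h)
  obtain ⟨a0, a1, a2⟩ := hd.yE_spec (hd.mem_Mext h0 ht)
  obtain ⟨b0, b1, b2⟩ := hd.yE_spec (hd.mem_Mext h0 ht2)
  have hle := (hd.y_eq h0 ht).2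
  by_contra hc
  push Not at hc
  have h3 := hd.tau_mono_R a0.le hle hR h
  have hi : d.yE (t, R₁) ∈ Icc 0 (1 / d.q R₂) := ⟨a0.le, hle.trans (hd.one_lt_inv_q R₂).le⟩
  have h4 := hd.tau_strictAnti R₂ (hd.q_mul_mem_iff.2 ⟨b0.le, b1.le⟩) hi hc
  simp only at a2 b2 h4
  linarith

/-- The inverse function theorem is applied to (y,R) ↦ (τ(y,R),R). Its Jacobian is ∂τ/∂y, which is
nonzero exactly because 0 < y and qy < 1. Strict monotonicity identifies the local inverse with
`yE`. -/
theorem contDiffAt_yE (hd : d.Admissible) {p : ℝ × ℝ} (hp : p ∈ d.Mext) :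
    ContDiffAt ℝ ∞ d.yE p := by
  obtain ⟨a0, a1, a2⟩ := hd.yE_spec hp
  set y := d.yE p with hy
  set Ψ : ℝ × ℝ → ℝ × ℝ := fun z => (d.tau z.1 z.2, z.2) with hΨ
  have htau := hd.contDiffAt_tau a0.le a1
  have hΨc : ContDiffAt ℝ ∞ Ψ (y, p.2) := htau.prodMk contDiffAt_snd
  have hΨp : Ψ (y, p.2) = p := by simp only [hΨ, a2]
  have hD : HasFDerivAt Ψ (fderiv ℝ Ψ (y, p.2)) (y, p.2) :=
    (hΨc.differentiableAt (by simp)).hasFDerivAt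
  have hτ : HasFDerivAt (fun z : ℝ × ℝ => d.tau z.1 z.2)
      (fderiv ℝ (fun z : ℝ × ℝ => d.tau z.1 z.2) (y, p.2)) (y, p.2) :=
    (htau.differentiableAt (by simp)).hasFDerivAt
  have hL : fderiv ℝ Ψ (y, p.2) = (fderiv ℝ (fun z : ℝ × ℝ => d.tau z.1 z.2) (y, p.2)).prod
      (ContinuousLinearMap.snd ℝ ℝ ℝ) := (hτ.prodMk hasFDerivAt_snd).fderiv
  have hτy : fderiv ℝ (fun z : ℝ × ℝ => d.tau z.1 z.2) (y, p.2) (1, 0) ≠ 0 := by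
    have h1 : HasDerivAt (fun s => d.tau s p.2)
        (fderiv ℝ (fun z : ℝ × ℝ => d.tau z.1 z.2) (y, p.2) (1, 0)) y :=
      HasFDerivAt.comp_hasDerivAt (f := fun s : ℝ => (s, p.2)) y hτ
        ((hasDerivAt_id y).prodMk (hasDerivAt_const y p.2))
    rw [h1.unique (hd.hasDerivAt_tau a0.le a1), neg_ne_zero]
    have : 0 < 1 - (d.q p.2 * y) ^ 2 := by nlinarith [mul_pos (hd.q_pos p.2) a0]
    have := Real.sqrt_pos.2 this
    have := hd.sqrt_c_pos p.2
    positivity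
  have hinj : Function.Injective (fderiv ℝ Ψ (y, p.2) : ℝ × ℝ →ₗ[ℝ] ℝ × ℝ) := by
    rw [← LinearMap.ker_eq_bot, LinearMap.ker_eq_bot']
    rintro ⟨a, b⟩ h
    rw [hL] at h
    have h1 := (Prod.ext_iff.1 h).2
    simp only [ContinuousLinearMap.coe_coe, ContinuousLinearMap.prod_apply,
      ContinuousLinearMap.coe_snd', Prod.snd_zero] at h1
    subst h1
    have h2 := (Prod.ext_iff.1 h).1
    simp only [ContinuousLinearMap.coe_coe, ContinuousLinearMap.prod_apply, Prod.fst_zero] at h2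
    have h3 : ((a, 0) : ℝ × ℝ) = a • ((1, 0) : ℝ × ℝ) := by simp
    rw [h3, map_smul, smul_eq_mul] at h2
    rcases mul_eq_zero.1 h2 with h | h
    · rw [h]; rfl
    · exact absurd h hτy
  set e : (ℝ × ℝ) ≃L[ℝ] (ℝ × ℝ) :=
    (LinearEquiv.ofInjectiveEndo _ hinj).toContinuousLinearEquiv with he
  have heD : HasFDerivAt Ψ (e : ℝ × ℝ →L[ℝ] ℝ × ℝ) (y, p.2) := by
    have : (e : ℝ × ℝ →L[ℝ] ℝ × ℝ) = fderiv ℝ Ψ (y, p.2) := by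
      ext <;> simp [he]
    rw [this]; exact hD
  have hinv := hΨc.to_localInverse heD (by simp)
  set g := hΨc.localInverse heD (by simp) with hg
  have hstrict : HasStrictFDerivAt Ψ (e : ℝ × ℝ →L[ℝ] ℝ × ℝ) (y, p.2) :=
    hΨc.hasStrictFDerivAt' heD (by simp)
  have hright : ∀ᶠ z in 𝓝 (Ψ (y, p.2)), Ψ (g z) = z := hstrict.eventually_right_inverse
  have hgp : g (Ψ (y, p.2)) = (y, p.2) := hΨc.localInverse_apply_image heD (by simp)
  have hlim : Tendsto g (𝓝 (Ψ (y, p.2))) (𝓝 (y, p.2)) := by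
    have := hinv.continuousAt.tendsto
    rwa [hgp] at this
  have hopen : ∀ᶠ z in 𝓝 (y, p.2), 0 < z.1 ∧ d.q z.2 * z.1 < 1 := by
    refine ((isOpen_lt continuous_const continuous_fst).inter (isOpen_lt
      ((hd.contDiff_q.continuous.comp continuous_snd).mul continuous_fst)
      continuous_const)).mem_nhds ⟨a0, a1⟩
  rw [hΨp] at hright hlim hinv
  have heq : d.yE =ᶠ[𝓝 p] fun z => (g z).1 := by
    filter_upwards [hright, hlim.eventually hopen] with z hz hz2
    have h1 := (Prod.ext_iff.1 hz).1
    have h2 := (Prod.ext_iff.1 hz).2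
    simp only [hΨ] at h1 h2
    rw [h2] at h1 hz2
    exact hd.yE_eq (t := z.1) (R := z.2) hz2.1.le hz2.2.le h1
  exact (contDiffAt_fst.comp p hinv).congr_of_eventuallyEq heq

end Admissible
end TBData
end

noncomputable section

/-! ### Partial derivatives of functions of `(τ, R)` -/

/-- The partial derivative `∂_τ`. -/
def pdt (φ : ℝ × ℝ → ℝ) (p : ℝ × ℝ) : ℝ := fderiv ℝ φ p (1, 0)

/-- The partial derivative `∂_R`. -/
def pdR (φ : ℝ × ℝ → ℝ) (p : ℝ × ℝ) : ℝ := fderiv ℝ φ p (0, 1)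

theorem hasDerivAt_pdt {φ : ℝ × ℝ → ℝ} {t R : ℝ} (h : DifferentiableAt ℝ φ (t, R)) :
    HasDerivAt (fun s => φ (s, R)) (pdt φ (t, R)) t :=
  HasFDerivAt.comp_hasDerivAt (f := fun s : ℝ => (s, R)) t h.hasFDerivAt
    ((hasDerivAt_id t).prodMk (hasDerivAt_const t R))

theorem hasDerivAt_pdR {φ : ℝ × ℝ → ℝ} {t R : ℝ} (h : DifferentiableAt ℝ φ (t, R)) :
    HasDerivAt (fun s => φ (t, s)) (pdR φ (t, R)) R :=
  HasFDerivAt.comp_hasDerivAt (f := fun s : ℝ => (t, s)) R h.hasFDerivAt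
    ((hasDerivAt_const R t).prodMk (hasDerivAt_id R))

theorem hasDerivAt_comp_curve {φ : ℝ × ℝ → ℝ} {α : ℝ → ℝ} {α' t : ℝ}
    (h : DifferentiableAt ℝ φ (t, α t)) (hα : HasDerivAt α α' t) :
    HasDerivAt (fun s => φ (s, α s)) (pdt φ (t, α t) + α' * pdR φ (t, α t)) t := by
  have h1 := HasFDerivAt.comp_hasDerivAt (f := fun s : ℝ => (s, α s)) t h.hasFDerivAt
    ((hasDerivAt_id t).prodMk hα)
  refine h1.congr_deriv ?_
  have : ((1, α') : ℝ × ℝ) = (1, 0) + α' • (0, 1) := by simp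
  rw [this, map_add, map_smul]; rfl

theorem ContDiffAt.pdt_infty {φ : ℝ × ℝ → ℝ} {p : ℝ × ℝ} (h : ContDiffAt ℝ ∞ φ p) :
    ContDiffAt ℝ ∞ (pdt φ) p :=
  (h.fderiv_right (m := ∞) (by simp)).clm_apply contDiffAt_const

theorem ContDiffAt.pdR_infty {φ : ℝ × ℝ → ℝ} {p : ℝ × ℝ} (h : ContDiffAt ℝ ∞ φ p) :
    ContDiffAt ℝ ∞ (pdR φ) p :=
  (h.fderiv_right (m := ∞) (by simp)).clm_apply contDiffAt_const

theorem pdt_pdR_comm {φ : ℝ × ℝ → ℝ} {p : ℝ × ℝ} (h : ContDiffAt ℝ ∞ φ p) :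
    pdt (pdR φ) p = pdR (pdt φ) p := by
  have hs : IsSymmSndFDerivAt ℝ φ p := h.isSymmSndFDerivAt (by simpa using (WithTop.coe_le_coe.2 (le_top : (2 : ℕ∞) ≤ ⊤)))
  have hd : DifferentiableAt ℝ (fderiv ℝ φ) p :=
    (h.fderiv_right (m := ∞) (by simp)).differentiableAt (by simp)
  have h1 : ∀ v w : ℝ × ℝ, fderiv ℝ (fun q => fderiv ℝ φ q v) p w = fderiv ℝ (fderiv ℝ φ) p w v := by
    intro v w
    have := (hd.hasFDerivAt.clm_apply (hasFDerivAt_const v p)).fderiv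
    rw [this]; simp
  unfold pdt pdR
  rw [h1, h1]
  exact hs _ _

namespace TBData
variable {d : TBData}

/-! ### The areal radius on the extended spacetime -/

/-- The areal radius on the extended spacetime. -/
def rE (d : TBData) (p : ℝ × ℝ) : ℝ := p.2 * d.yE p ^ 2

/-- `∂_R r`. -/
def rR (d : TBData) (p : ℝ × ℝ) : ℝ := pdR d.rE p

/-- `∂_τ r`. -/
def rT (d : TBData) (p : ℝ × ℝ) : ℝ := pdt d.rE p

/-- `γ` on the extended spacetime. -/
def gE (d : TBData) (p : ℝ × ℝ) : ℝ := Real.sqrt (1 + 2 * d.E p.2) / d.rR p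

/-- `∂_R τ(y,R)`. -/
def tauR (d : TBData) (y R : ℝ) : ℝ := pdR (fun z => d.tau z.1 z.2) (y, R)

namespace Admissible

theorem contDiffAt_rE (hd : d.Admissible) {p : ℝ × ℝ} (hp : p ∈ d.Mext) :
    ContDiffAt ℝ ∞ d.rE p := contDiffAt_snd.mul ((hd.contDiffAt_yE hp).pow 2)

theorem contDiffAt_rR (hd : d.Admissible) {p : ℝ × ℝ} (hp : p ∈ d.Mext) :
    ContDiffAt ℝ ∞ d.rR p := (hd.contDiffAt_rE hp).pdR_infty

theorem contDiffAt_rT (hd : d.Admissible) {p : ℝ × ℝ} (hp : p ∈ d.Mext) :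
    ContDiffAt ℝ ∞ d.rT p := (hd.contDiffAt_rE hp).pdt_infty

theorem one_sub_sq_pos (hd : d.Admissible) {p : ℝ × ℝ} (hp : p ∈ d.Mext) :
    0 < 1 - (d.q p.2 * d.yE p) ^ 2 := by
  obtain ⟨a0, a1, a2⟩ := hd.yE_spec hp
  nlinarith [mul_pos (hd.q_pos p.2) a0]

/-- Implicit differentiation of τ(y(t,R),R) = t in t. Differentiating the same identity in R gives
`pdR_yE`. -/
theorem pdt_yE (hd : d.Admissible) {p : ℝ × ℝ} (hp : p ∈ d.Mext) : pdt d.yE p =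
    -(Real.sqrt (1 - (d.q p.2 * d.yE p) ^ 2) * Real.sqrt (d.c p.2)) / (2 * d.yE p ^ 2) := by
  obtain ⟨t, R⟩ := p
  obtain ⟨a0, a1, a2⟩ := hd.yE_spec hp
  have h1 := hasDerivAt_pdt ((hd.contDiffAt_yE hp).differentiableAt (by simp))
  have h2 := (hd.hasDerivAt_tau a0.le a1).comp t h1
  have h3 : (fun s => d.tau (d.yE (s, R)) R) =ᶠ[𝓝 t] fun s => s := by
    have hc : Tendsto (fun s : ℝ => (s, R)) (𝓝 t) (𝓝 (t, R)) :=
      (continuous_id.prodMk continuous_const).tendsto t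
    filter_upwards [hc (hd.isOpen_Mext.mem_nhds hp)] with s hs
    exact (hd.yE_spec hs).2.2
  have h3' : HasDerivAt (fun s => d.tau (d.yE (s, R)) R) 1 t :=
    (hasDerivAt_id' t).congr_of_eventuallyEq h3
  have h2' : HasDerivAt (fun s => d.tau (d.yE (s, R)) R) _ t := h2
  have h4 := h2'.unique h3'
  have hs := Real.sqrt_pos.2 (hd.one_sub_sq_pos hp)
  have hc := hd.sqrt_c_pos R
  simp only at a0 a1 hs hc h4 ⊢
  set σ := Real.sqrt (1 - (d.q R * d.yE (t, R)) ^ 2)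
  field_simp at h4
  field_simp
  linarith

theorem pdR_yE (hd : d.Admissible) {p : ℝ × ℝ} (hp : p ∈ d.Mext) : pdR d.yE p =
    d.tauR (d.yE p) p.2 *
      (Real.sqrt (1 - (d.q p.2 * d.yE p) ^ 2) * Real.sqrt (d.c p.2)) / (2 * d.yE p ^ 2) := by
  obtain ⟨t, R⟩ := p
  obtain ⟨a0, a1, a2⟩ := hd.yE_spec hp
  have h1 := hasDerivAt_pdR ((hd.contDiffAt_yE hp).differentiableAt (by simp))
  have hτ := (hd.contDiffAt_tau a0.le a1).differentiableAt (by simp)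
  have h2 := HasFDerivAt.comp_hasDerivAt (f := fun s : ℝ => (d.yE (t, s), s)) R hτ.hasFDerivAt
    (h1.prodMk (hasDerivAt_id R))
  have h3 : (fun s => d.tau (d.yE (t, s)) s) =ᶠ[𝓝 R] fun _ => t := by
    have hc : Tendsto (fun s : ℝ => (t, s)) (𝓝 R) (𝓝 (t, R)) :=
      (continuous_const.prodMk continuous_id).tendsto R
    filter_upwards [hc (hd.isOpen_Mext.mem_nhds hp)] with s hs
    exact (hd.yE_spec hs).2.2
  have h3' : HasDerivAt (fun s => d.tau (d.yE (t, s)) s) 0 R :=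
    (hasDerivAt_const R t).congr_of_eventuallyEq h3
  have h2' : HasDerivAt (fun s => d.tau (d.yE (t, s)) s) _ R := h2
  have h4 := h2'.unique h3'
  have h5 : ((pdR d.yE (t, R), 1) : ℝ × ℝ) = pdR d.yE (t, R) • (1, 0) + (0, 1) := by simp
  rw [h5, map_add, map_smul, smul_eq_mul] at h4
  have h6 := (hasDerivAt_pdt hτ).unique (hd.hasDerivAt_tau a0.le a1)
  have h7 : pdR d.yE (t, R) * pdt (fun z : ℝ × ℝ => d.tau z.1 z.2) (d.yE (t, R), R)
    + d.tauR (d.yE (t, R)) R = 0 := h4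
  rw [h6] at h7
  have hs := Real.sqrt_pos.2 (hd.one_sub_sq_pos hp)
  have hc := hd.sqrt_c_pos R
  simp only at a0 a1 hs hc h7 ⊢
  set σ := Real.sqrt (1 - (d.q R * d.yE (t, R)) ^ 2)
  field_simp at h7
  field_simp
  linarith

theorem rT_eq (hd : d.Admissible) {p : ℝ × ℝ} (hp : p ∈ d.Mext) : d.rT p =
    -(p.2 * (Real.sqrt (1 - (d.q p.2 * d.yE p) ^ 2) * Real.sqrt (d.c p.2)) / d.yE p) := by
  obtain ⟨t, R⟩ := p
  have a0 := (hd.yE_spec hp).1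
  have h1 := hasDerivAt_pdt ((hd.contDiffAt_yE hp).differentiableAt (by simp))
  have h2 := (h1.pow 2).const_mul R
  have h3 := hasDerivAt_pdt ((hd.contDiffAt_rE hp).differentiableAt (by simp))
  rw [rT, h3.unique h2, hd.pdt_yE hp]
  simp only
  field_simp
  norm_num
  ring

theorem rR_eq (hd : d.Admissible) {p : ℝ × ℝ} (hp : p ∈ d.Mext) : d.rR p =
    d.yE p ^ 2 + 2 * p.2 * d.yE p * pdR d.yE p := by
  obtain ⟨t, R⟩ := p
  have h1 := hasDerivAt_pdR ((hd.contDiffAt_yE hp).differentiableAt (by simp))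
  have h2 := (hasDerivAt_id R).mul (h1.pow 2)
  have h3 := hasDerivAt_pdR ((hd.contDiffAt_rE hp).differentiableAt (by simp))
  rw [rR, h3.unique h2]
  simp only [id]
  norm_num
  ring

/-- This confirms that the closed formula for `tau` solves the equation of motion of the shells. The
dynamics enters the later arguments through this identity and its two partial derivatives. -/
theorem rT_sq (hd : d.Admissible) {p : ℝ × ℝ} (hp : p ∈ d.Mext) (hR : p.2 ≠ 0) :
    d.rT p ^ 2 = 2 * d.E p.2 + 2 * d.m p.2 / d.rE p := by
  have a0 := (hd.yE_spec hp).1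
  rw [hd.rT_eq hp, hd.E_eq, hd.m_eq_c, rE, neg_sq, div_pow, mul_pow, mul_pow,
    Real.sq_sqrt (hd.one_sub_sq_pos hp).le, Real.sq_sqrt (hd.c_pos _).le]
  field_simp
  ring

theorem rT_ne_zero (hd : d.Admissible) {p : ℝ × ℝ} (hp : p ∈ d.Mext) (hR : p.2 ≠ 0) :
    d.rT p ≠ 0 := by
  have a0 := (hd.yE_spec hp).1
  rw [hd.rT_eq hp, neg_ne_zero]
  have hs := Real.sqrt_pos.2 (hd.one_sub_sq_pos hp)
  have hc := hd.sqrt_c_pos p.2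
  positivity

theorem rE_neg (hd : d.Admissible) (t R : ℝ) : d.rE (t, -R) = -d.rE (t, R) := by
  simp only [rE, hd.yE_neg]; ring

theorem rR_neg (hd : d.Admissible) {t R : ℝ} (hp : (t, R) ∈ d.Mext) :
    d.rR (t, -R) = d.rR (t, R) := by
  have hp' := hd.Mext_neg hp
  have h1 := hasDerivAt_pdR ((hd.contDiffAt_rE hp').differentiableAt (by simp))
  have h2 := h1.scomp R (hasDerivAt_neg R)
  have h3 : (fun s => d.rE (t, s)) ∘ Neg.neg = fun s => -d.rE (t, s) := by
    ext s; simp [hd.rE_neg]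
  rw [h3] at h2
  have h4 := (hasDerivAt_pdR ((hd.contDiffAt_rE hp).differentiableAt (by simp))).neg
  have := h2.unique h4
  unfold rR
  simp at this
  linarith

theorem gE_neg (hd : d.Admissible) {t R : ℝ} (hp : (t, R) ∈ d.Mext) :
    d.gE (t, -R) = d.gE (t, R) := by
  simp only [gE, hd.rR_neg hp, hd.E_neg]

theorem pdR_yE_nonneg (hd : d.Admissible) {t R : ℝ} (h0 : 0 ≤ t) (h1 : t < d.tauS R)
    (hR : 0 ≤ R) : 0 ≤ pdR d.yE (t, R) := by
  have hp := hd.mem_Mext h0 h1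
  have hD := hasDerivAt_pdR ((hd.contDiffAt_yE hp).differentiableAt (by simp))
  have hm : MonotoneOn (fun s => d.yE (t, s)) (Ici R) := fun a ha b _ hab =>
    hd.yE_mono_R h0 (hR.trans ha) hab (h1.trans_le (hd.tauS_mono hR ha))
  have h2 := hD.hasDerivWithinAt (s := Ici R)
  rw [← h2.derivWithin (uniqueDiffWithinAt_Ici R)]
  exact hm.derivWithin_nonneg

/-- The product rule gives r' = y² + 2R y y', and y increases with R ≥ 0; negative R follows by
parity. The bound excludes shell crossing and yields γ ≤ 1/y², the estimate used for the speed of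
light. -/
theorem sq_yE_le_rR (hd : d.Admissible) {t R : ℝ} (h0 : 0 ≤ t) (h1 : t < d.tauS R) :
    d.yE (t, R) ^ 2 ≤ d.rR (t, R) := by
  have key : ∀ R, t < d.tauS R → 0 ≤ R → d.yE (t, R) ^ 2 ≤ d.rR (t, R) := by
    intro R h1 hR
    have hp := hd.mem_Mext h0 h1
    have a0 := (hd.yE_spec hp).1
    rw [hd.rR_eq hp]
    have := hd.pdR_yE_nonneg h0 h1 hR
    have : 0 ≤ 2 * R * d.yE (t, R) * pdR d.yE (t, R) := by positivity
    simp only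
    linarith
  rcases le_total 0 R with h | h
  · exact key R h1 h
  · have := key (-R) (by rwa [hd.tauS_neg]) (by linarith)
    rwa [hd.yE_neg, hd.rR_neg (hd.mem_Mext h0 h1)] at this

theorem yE_pos (hd : d.Admissible) {t R : ℝ} (h0 : 0 ≤ t) (h1 : t < d.tauS R) :
    0 < d.yE (t, R) := (hd.yE_spec (hd.mem_Mext h0 h1)).1

theorem rR_pos (hd : d.Admissible) {t R : ℝ} (h0 : 0 ≤ t) (h1 : t < d.tauS R) :
    0 < d.rR (t, R) := (pow_pos (hd.yE_pos h0 h1) 2).trans_le (hd.sq_yE_le_rR h0 h1)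

theorem sqrt_E_pos (hd : d.Admissible) (R : ℝ) : 0 < Real.sqrt (1 + 2 * d.E R) :=
  Real.sqrt_pos.2 (hd.E_pos R)

theorem sqrt_E_le_one (hd : d.Admissible) (R : ℝ) : Real.sqrt (1 + 2 * d.E R) ≤ 1 :=
  Real.sqrt_le_one.2 (hd.E_le R)

theorem gE_pos (hd : d.Admissible) {t R : ℝ} (h0 : 0 ≤ t) (h1 : t < d.tauS R) :
    0 < d.gE (t, R) := div_pos (hd.sqrt_E_pos R) (hd.rR_pos h0 h1)

theorem gE_le (hd : d.Admissible) {t R : ℝ} (h0 : 0 ≤ t) (h1 : t < d.tauS R) :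
    d.gE (t, R) ≤ 1 / d.yE (t, R) ^ 2 :=
  div_le_div₀ zero_le_one (hd.sqrt_E_le_one R) (pow_pos (hd.yE_pos h0 h1) 2)
    (hd.sq_yE_le_rR h0 h1)

theorem r_eq (hd : d.Admissible) {t R : ℝ} (h0 : 0 ≤ t) (h1 : t < d.tauS R) :
    d.r t R = d.rE (t, R) := by rw [r, rE, (hd.y_eq h0 h1).1]

theorem γ_eq (hd : d.Admissible) {t R : ℝ} (h0 : 0 ≤ t) (h1 : t < d.tauS R) :
    d.γ t R = d.gE (t, R) := by
  have heq : (fun s => d.r t s) =ᶠ[𝓝 R] fun s => d.rE (t, s) := by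
    filter_upwards [(isOpen_lt continuous_const hd.continuous_tauS).mem_nhds h1] with s hs
    exact hd.r_eq h0 hs
  rw [γ, gE, heq.deriv_eq]
  congr 1
  exact (hasDerivAt_pdR ((hd.contDiffAt_rE (hd.mem_Mext h0 h1)).differentiableAt (by simp))).deriv

theorem contDiffAt_gE (hd : d.Admissible) {p : ℝ × ℝ} (hp : p ∈ d.Mext) (h : 0 < d.rR p) :
    ContDiffAt ℝ ∞ d.gE p := by
  have hE : ContDiffAt ℝ ∞ (fun p : ℝ × ℝ => 1 + 2 * d.E p.2) p :=
    contDiffAt_const.add (contDiffAt_const.mul (hd.contDiff_E.contDiffAt.comp p contDiffAt_snd))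
  exact (hE.sqrt (hd.E_pos p.2).ne').div (hd.contDiffAt_rR hp) h.ne'

/-- Centre value of `γ`. -/
theorem gE_centre (hd : d.Admissible) {t : ℝ} (h0 : 0 ≤ t) (h1 : t < d.tauS 0) :
    d.gE (t, 0) = 1 / d.yE (t, 0) ^ 2 := by
  have hE : d.E 0 = 0 := by have := hd.E_eq 0; simp at this; exact this
  rw [gE, hd.rR_eq (hd.mem_Mext h0 h1)]
  simp [hE]

/-- The dust geodesic equation `r̈ = -m/r²`. -/
theorem pdt_rT (hd : d.Admissible) {p : ℝ × ℝ} (hp : p ∈ d.Mext) (hR : p.2 ≠ 0) :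
    pdt d.rT p = -(d.m p.2 / d.rE p ^ 2) := by
  obtain ⟨t, R⟩ := p
  have a0 := (hd.yE_spec hp).1
  have hr : d.rE (t, R) ≠ 0 := by simp only [rE]; positivity
  have h1 := hasDerivAt_pdt ((hd.contDiffAt_rT hp).differentiableAt (by simp))
  have h2 := hasDerivAt_pdt ((hd.contDiffAt_rE hp).differentiableAt (by simp))
  have h3 := ((h2.inv hr).const_mul (2 * d.m R)).const_add (2 * d.E R)
  have heq : (fun s => d.rT (s, R) ^ 2) =ᶠ[𝓝 t] fun s => 2 * d.E R + 2 * d.m R * (d.rE (s, R))⁻¹ := by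
    have hc : Tendsto (fun s : ℝ => (s, R)) (𝓝 t) (𝓝 (t, R)) :=
      (continuous_id.prodMk continuous_const).tendsto t
    filter_upwards [hc (hd.isOpen_Mext.mem_nhds hp)] with s hs
    rw [hd.rT_sq hs hR]; rfl
  have h3' : HasDerivAt (fun s => d.rT (s, R) ^ 2) _ t := h3.congr_of_eventuallyEq heq
  have h1' : HasDerivAt (fun s => d.rT (s, R) ^ 2) _ t := h1.pow 2
  have h4 := h1'.unique h3'
  have h5 := hd.rT_ne_zero hp hR
  have h6 : pdt d.rE (t, R) = d.rT (t, R) := rfl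
  rw [h6] at h4
  norm_num at h4
  apply mul_left_cancel₀ (mul_ne_zero two_ne_zero h5)
  rw [h4]; field_simp

/-- The spatial derivative of the energy equation. -/
theorem rT_mul_pdR_rT (hd : d.Admissible) {p : ℝ × ℝ} (hp : p ∈ d.Mext) (hR : p.2 ≠ 0) :
    d.rT p * pdR d.rT p = deriv d.E p.2 + 4 * Real.pi * (d.ρ₀ p.2 * p.2 ^ 2) / d.rE p
      - d.m p.2 * d.rR p / d.rE p ^ 2 := by
  obtain ⟨t, R⟩ := p
  have a0 := (hd.yE_spec hp).1
  have hr : d.rE (t, R) ≠ 0 := by simp only [rE]; positivity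
  have h1 := hasDerivAt_pdR ((hd.contDiffAt_rT hp).differentiableAt (by simp))
  have h2 := hasDerivAt_pdR ((hd.contDiffAt_rE hp).differentiableAt (by simp))
  have hE := (hd.contDiff_E.differentiable (by simp) R).hasDerivAt.const_mul 2
  have h3 := hE.add (((hd.hasDerivAt_m R).const_mul 2).mul (h2.inv hr))
  have heq : (fun s => d.rT (t, s) ^ 2) =ᶠ[𝓝 R] fun s => 2 * d.E s + 2 * d.m s * (d.rE (t, s))⁻¹ := by
    have hc : Tendsto (fun s : ℝ => (t, s)) (𝓝 R) (𝓝 (t, R)) :=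
      (continuous_const.prodMk continuous_id).tendsto R
    filter_upwards [hc (hd.isOpen_Mext.mem_nhds hp),
      isOpen_ne.mem_nhds (show R ≠ 0 from hR)] with s hs hs0
    rw [hd.rT_sq hs hs0]; rfl
  have h3' : HasDerivAt (fun s => d.rT (t, s) ^ 2) _ R := h3.congr_of_eventuallyEq heq
  have h1' : HasDerivAt (fun s => d.rT (t, s) ^ 2) _ R := h1.pow 2
  have h4 := h1'.unique h3'
  have h6 : pdR d.rE (t, R) = d.rR (t, R) := rfl
  rw [h6] at h4
  simp only [Pi.inv_apply] at h4
  norm_num at h4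
  have e : d.rT (t, R) * pdR d.rT (t, R) = (2 * d.rT (t, R) * pdR d.rT (t, R)) / 2 := by ring
  simp only
  rw [e, h4]; field_simp; ring

theorem pdt_rR (hd : d.Admissible) {p : ℝ × ℝ} (hp : p ∈ d.Mext) : pdt d.rR p = pdR d.rT p :=
  pdt_pdR_comm (hd.contDiffAt_rE hp)

end Admissible
end TBData
end

noncomputable section

/-! ### Scalar ordinary differential equations with a globally Lipschitz right-hand side -/

theorem LipschitzWith.slice {F : ℝ × ℝ → ℝ} {L : NNReal} (hL : LipschitzWith L F) (t : ℝ) :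
    LipschitzWith L fun x => F (t, x) := by
  intro x y
  have := hL (t, x) (t, y)
  simpa [Prod.edist_eq] using this

/-- A bounded right-hand side moves a solution by at most B times the elapsed time. The
Picard-Lindelöf ball can therefore be chosen for the whole interval, and no blow-up has to be ruled
out. -/
theorem exists_solution_of_lipschitz {F : ℝ × ℝ → ℝ} {L : NNReal} (hL : LipschitzWith L F)
    {B : ℝ} (hB : ∀ p, |F p| ≤ B) {a b t₀ : ℝ} (ht : t₀ ∈ Ioo a b) (R₀ : ℝ) :
    ∃ α : ℝ → ℝ, α t₀ = R₀ ∧ ∀ t ∈ Ioo a b, HasDerivAt α (F (t, α t)) t := by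
  have hB0 : 0 ≤ B := (abs_nonneg _).trans (hB (0, 0))
  have hm : 0 ≤ max (b - t₀) (t₀ - a) := le_max_of_le_left (by linarith [ht.2])
  have hP : IsPicardLindelof (fun t x => F (t, x)) (tmin := a) (tmax := b)
      ⟨t₀, ⟨ht.1.le, ht.2.le⟩⟩ R₀ ⟨B * max (b - t₀) (t₀ - a), mul_nonneg hB0 hm⟩ 0 ⟨B, hB0⟩ L :=
    { lipschitzOnWith := fun t _ => (hL.slice t).lipschitzOnWith
      continuousOn := fun x _ =>
        (hL.continuous.comp (continuous_id.prodMk continuous_const)).continuousOn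
      norm_le := fun t _ x _ => hB (t, x)
      mul_max_le := by rw [NNReal.coe_zero, sub_zero]; exact le_rfl }
  obtain ⟨α, h0, h1⟩ := hP.exists_eq_forall_mem_Icc_hasDerivWithinAt₀
  exact ⟨α, h0, fun t ht => (h1 t ⟨ht.1.le, ht.2.le⟩).hasDerivAt (Icc_mem_nhds ht.1 ht.2)⟩

theorem solution_unique_of_lipschitz {F : ℝ × ℝ → ℝ} {L : NNReal} (hL : LipschitzWith L F)
    {α β : ℝ → ℝ} {a b t₀ : ℝ} (hα : ∀ t ∈ Icc a b, HasDerivAt α (F (t, α t)) t)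
    (hβ : ∀ t ∈ Icc a b, HasDerivAt β (F (t, β t)) t) (ht : t₀ ∈ Icc a b) (h : α t₀ = β t₀) :
    EqOn α β (Icc a b) := by
  have hs : ∀ t, LipschitzOnWith L ((fun t x => F (t, x)) t) univ := fun t =>
    (hL.slice t).lipschitzOnWith
  have e1 : EqOn α β (Icc a t₀) := by
    have hsub : Icc a t₀ ⊆ Icc a b := Icc_subset_Icc le_rfl ht.2
    exact ODE_solution_unique_of_mem_Icc_left (v := fun t x => F (t, x)) (s := fun _ => univ)
      (fun t _ => hs t) (fun t ht' => (hα t (hsub ht')).continuousAt.continuousWithinAt)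
      (fun t ht' => (hα t (hsub (Ioc_subset_Icc_self ht'))).hasDerivWithinAt) (fun _ _ => mem_univ _)
      (fun t ht' => (hβ t (hsub ht')).continuousAt.continuousWithinAt)
      (fun t ht' => (hβ t (hsub (Ioc_subset_Icc_self ht'))).hasDerivWithinAt) (fun _ _ => mem_univ _) h
  have e2 : EqOn α β (Icc t₀ b) := by
    have hsub : Icc t₀ b ⊆ Icc a b := Icc_subset_Icc ht.1 le_rfl
    exact ODE_solution_unique_of_mem_Icc_right (v := fun t x => F (t, x)) (s := fun _ => univ)
      (fun t _ => hs t) (fun t ht' => (hα t (hsub ht')).continuousAt.continuousWithinAt)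
      (fun t ht' => (hα t (hsub (Ico_subset_Icc_self ht'))).hasDerivWithinAt) (fun _ _ => mem_univ _)
      (fun t ht' => (hβ t (hsub ht')).continuousAt.continuousWithinAt)
      (fun t ht' => (hβ t (hsub (Ico_subset_Icc_self ht'))).hasDerivWithinAt) (fun _ _ => mem_univ _) h
  intro t ht'
  rcases le_total t t₀ with h' | h'
  · exact e1 ⟨ht'.1, h'⟩
  · exact e2 ⟨h', ht'.2⟩

/-- Backward Gronwall estimate. -/
theorem abs_sub_le_of_lipschitz {F : ℝ × ℝ → ℝ} {L : NNReal} (hL : LipschitzWith L F)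
    {α β : ℝ → ℝ} {a b : ℝ} (hα : ∀ t ∈ Icc a b, HasDerivAt α (F (t, α t)) t)
    (hβ : ∀ t ∈ Icc a b, HasDerivAt β (F (t, β t)) t) {t : ℝ} (ht : t ∈ Icc a b) :
    |α t - β t| ≤ |α b - β b| * Real.exp (L * (b - t)) := by
  have hrev : ∀ {α : ℝ → ℝ}, (∀ t ∈ Icc a b, HasDerivAt α (F (t, α t)) t) → ∀ s ∈ Icc 0 (b - a),
      HasDerivAt (fun s => α (b - s)) (-F (b - s, α (b - s))) s := by
    intro α hα s hs
    have h1 := hα (b - s) ⟨by linarith [hs.2], by linarith [hs.1]⟩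
    have h2 := h1.scomp s ((hasDerivAt_id s).const_sub b)
    simp only [neg_smul, one_smul] at h2
    exact h2
  have := dist_le_of_trajectories_ODE (v := fun s x => -F (b - s, x)) (K := L)
    (f := fun s => α (b - s)) (g := fun s => β (b - s)) (a := 0) (b := b - a)
    (δ := |α b - β b|) (fun s => (hL.slice (b - s)).neg)
    (fun s hs => (hrev hα s hs).continuousAt.continuousWithinAt)
    (fun s hs => (hrev hα s (Ico_subset_Icc_self hs)).hasDerivWithinAt)
    (fun s hs => (hrev hβ s hs).continuousAt.continuousWithinAt)
    (fun s hs => (hrev hβ s (Ico_subset_Icc_self hs)).hasDerivWithinAt)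
    (by simp [Real.dist_eq]) (b - t) ⟨by linarith [ht.2], by linarith [ht.1]⟩
  simpa [Real.dist_eq] using this

theorem monotoneOn_of_hasDerivAt_nonneg {α α' : ℝ → ℝ} {a b : ℝ}
    (h : ∀ t ∈ Icc a b, HasDerivAt α (α' t) t) (h0 : ∀ t ∈ Icc a b, 0 ≤ α' t) :
    MonotoneOn α (Icc a b) :=
  monotoneOn_of_deriv_nonneg (convex_Icc a b)
    (fun t ht => (h t ht).continuousAt.continuousWithinAt)
    (fun t ht => (h t (interior_subset ht)).differentiableAt.differentiableWithinAt)
    fun t ht => by rw [(h t (interior_subset ht)).deriv]; exact h0 t (interior_subset ht)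

/-! ### Radial light rays and the region that they reach -/

namespace TBData
variable {d : TBData}

/-- The part of the extended spacetime on which `r' > 0`. -/
def Mpos (d : TBData) : Set (ℝ × ℝ) := {p | p ∈ d.Mext ∧ 0 < d.rR p}

/-- `F` is a Lipschitz continuous cutoff of `γ` that agrees with `γ` on the open set `O`. -/
structure IsCutoff (d : TBData) (F : ℝ × ℝ → ℝ) (L : NNReal) (B : ℝ) (O : Set (ℝ × ℝ)) : Prop where
  lip : LipschitzWith L F
  bound : ∀ p, |F p| ≤ B
  nonneg : ∀ p, 0 ≤ F p
  le : ∀ p ∈ d.Mpos, F p ≤ d.gE p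
  isOpen : IsOpen O
  subset : O ⊆ d.Mpos
  eq : ∀ p ∈ O, F p = d.gE p

/-- `α` solves the equation of outgoing radial light rays on `[a,b]`. -/
def IsRayOn (d : TBData) (α : ℝ → ℝ) (a b : ℝ) : Prop :=
  ∀ t ∈ Icc a b, 0 ≤ t ∧ t < d.tauS (α t) ∧ HasDerivAt α (d.gE (t, α t)) t

/-- The points that are connected to `τ = 0` by an outgoing light ray of the spacetime extended
to negative `R`. -/
def G (d : TBData) : Set (ℝ × ℝ) := {p | 0 ≤ p.1 ∧ ∃ α, d.IsRayOn α 0 p.1 ∧ α p.1 = p.2}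

theorem IsRayOn.mono {α : ℝ → ℝ} {a b a' b' : ℝ} (h : d.IsRayOn α a b) (ha : a ≤ a')
    (hb : b' ≤ b) : d.IsRayOn α a' b' := fun t ht => h t ⟨ha.trans ht.1, ht.2.trans hb⟩

theorem IsRayOn.continuousOn {α : ℝ → ℝ} {a b : ℝ} (h : d.IsRayOn α a b) :
    ContinuousOn α (Icc a b) := fun t ht => (h t ht).2.2.continuousAt.continuousWithinAt

theorem IsRayOn.isCompact_graph {α : ℝ → ℝ} {a b : ℝ} (h : d.IsRayOn α a b) :
    IsCompact ((fun t => (t, α t)) '' Icc a b) :=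
  isCompact_Icc.image_of_continuousOn (continuousOn_id.prodMk h.continuousOn)

namespace Admissible

theorem isOpen_Mpos (hd : d.Admissible) : IsOpen d.Mpos := by
  have : ContinuousOn d.rR d.Mext := fun p hp => (hd.contDiffAt_rR hp).continuousAt.continuousWithinAt
  exact this.isOpen_inter_preimage hd.isOpen_Mext isOpen_Ioi

theorem mem_Mpos (hd : d.Admissible) {t R : ℝ} (h0 : 0 ≤ t) (h1 : t < d.tauS R) :
    (t, R) ∈ d.Mpos := ⟨hd.mem_Mext h0 h1, hd.rR_pos h0 h1⟩

theorem gE_nonneg (_hd : d.Admissible) {p : ℝ × ℝ} (hp : p ∈ d.Mpos) : 0 ≤ d.gE p :=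
  div_nonneg (Real.sqrt_nonneg _) hp.2.le

/-- Since γ is smooth only where r' > 0, it is multiplied by a bump function that equals 1 near K
and is supported in that region. The product is compactly supported, hence globally Lipschitz and
bounded. -/
theorem exists_cutoff (hd : d.Admissible) {K : Set (ℝ × ℝ)} (hK : IsCompact K)
    (hKM : K ⊆ d.Mpos) : ∃ F L B O, d.IsCutoff F L B O ∧ K ⊆ O := by
  obtain ⟨K', hK', hKK', hK'M⟩ := exists_compact_between hK hd.isOpen_Mpos hKM
  obtain ⟨χ, h1, h2, h3⟩ := exists_contMDiffMap_one_nhds_of_subset_interior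
    (modelWithCornersSelf ℝ (ℝ × ℝ)) (n := 1) hK.isClosed hKK'
  have hχ : ContDiff ℝ 1 χ := χ.contMDiff.contDiff
  set F : ℝ × ℝ → ℝ := fun p => χ p * d.gE p with hF
  have hFc : ContDiff ℝ 1 F := by
    rw [contDiff_iff_contDiffAt]
    intro p
    by_cases hp : p ∈ d.Mpos
    · exact hχ.contDiffAt.mul ((hd.contDiffAt_gE hp.1 hp.2).of_le (by exact_mod_cast le_top))
    · have hp' : p ∈ K'ᶜ := fun h => hp (hK'M h)
      have : F =ᶠ[𝓝 p] fun _ => 0 := by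
        filter_upwards [hK'.isClosed.isOpen_compl.mem_nhds hp'] with z hz
        simp [hF, h2 z hz]
      exact contDiffAt_const.congr_of_eventuallyEq this
  have hsupp : HasCompactSupport F := by
    refine HasCompactSupport.intro hK' fun p hp => ?_
    simp [hF, h2 p hp]
  obtain ⟨L, hL⟩ := ContDiff.lipschitzWith_of_hasCompactSupport hsupp hFc one_ne_zero
  obtain ⟨B, hB⟩ := hsupp.exists_bound_of_continuous hFc.continuous
  obtain ⟨O, hO, hKO, hO1⟩ := mem_nhdsSet_iff_exists.1 h1
  refine ⟨F, L, B, O ∩ d.Mpos, ⟨hL, hB, fun p => ?_, fun p hp => ?_, hO.inter hd.isOpen_Mpos,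
    inter_subset_right, fun p hp => ?_⟩, subset_inter hKO hKM⟩
  · by_cases hp : p ∈ d.Mpos
    · exact mul_nonneg (h3 p).1 (hd.gE_nonneg hp)
    · have : p ∉ K' := fun h => hp (hK'M h)
      simp [hF, h2 p this]
  · exact mul_le_of_le_one_left (hd.gE_nonneg hp) (h3 p).2
  · have : χ p = 1 := hO1 hp.1
    simp [hF, this]

theorem IsRayOn_graph_subset (hd : d.Admissible) {α : ℝ → ℝ} {a b : ℝ} (h : d.IsRayOn α a b) :
    (fun t => (t, α t)) '' Icc a b ⊆ d.Mpos := by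
  rintro _ ⟨t, ht, rfl⟩
  exact hd.mem_Mpos (h t ht).1 (h t ht).2.1

/-- One cutoff around both graphs makes the two rays solutions of the same globally Lipschitz
equation. -/
theorem ray_unique (hd : d.Admissible) {α β : ℝ → ℝ} {a b t₀ : ℝ} (hα : d.IsRayOn α a b)
    (hβ : d.IsRayOn β a b) (ht : t₀ ∈ Icc a b) (h : α t₀ = β t₀) : EqOn α β (Icc a b) := by
  obtain ⟨F, L, B, O, hF, hKO⟩ := hd.exists_cutoff (hα.isCompact_graph.union hβ.isCompact_graph)
    (union_subset (hd.IsRayOn_graph_subset hα) (hd.IsRayOn_graph_subset hβ))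
  refine solution_unique_of_lipschitz hF.lip (fun t ht => ?_) (fun t ht => ?_) ht h
  · rw [hF.eq _ (hKO (Or.inl ⟨t, ht, rfl⟩))]; exact (hα t ht).2.2
  · rw [hF.eq _ (hKO (Or.inr ⟨t, ht, rfl⟩))]; exact (hβ t ht).2.2

theorem ray_lt (hd : d.Admissible) {α β : ℝ → ℝ} {a b t₀ : ℝ} (hα : d.IsRayOn α a b)
    (hβ : d.IsRayOn β a b) (ht : t₀ ∈ Icc a b) (h : α t₀ < β t₀) : ∀ t ∈ Icc a b, α t < β t := by
  intro t ht'
  by_contra hc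
  push Not at hc
  have hcont : ContinuousOn (fun t => β t - α t) (uIcc t t₀) :=
    (hβ.continuousOn.sub hα.continuousOn).mono (uIcc_subset_Icc ht' ht)
  have h0 : (0 : ℝ) ∈ (fun t => β t - α t) '' uIcc t t₀ :=
    intermediate_value_uIcc hcont (by
      rw [mem_uIcc]; left; exact ⟨by linarith, by linarith⟩)
  obtain ⟨s, hs, hs0⟩ := h0
  have := hd.ray_unique hα hβ (uIcc_subset_Icc ht' ht hs) (by simp only at hs0; linarith) ht
  linarith

theorem ray_strictMono (hd : d.Admissible) {α : ℝ → ℝ} {a b : ℝ} (hα : d.IsRayOn α a b) :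
    StrictMonoOn α (Icc a b) :=
  strictMonoOn_of_deriv_pos (convex_Icc a b) hα.continuousOn fun t ht => by
    have h := hα t (interior_subset ht)
    rw [h.2.2.deriv]; exact hd.gE_pos h.1 h.2.1

/-- A solution of the cut off equation is a ray as long as it stays in the region of agreement. -/
theorem isRayOn_of_cutoff {F : ℝ × ℝ → ℝ} {L : NNReal} {B : ℝ} {O : Set (ℝ × ℝ)}
    (hF : d.IsCutoff F L B O) {α : ℝ → ℝ} {a b : ℝ} (h0 : 0 ≤ a)
    (hα : ∀ t ∈ Icc a b, HasDerivAt α (F (t, α t)) t) (hO : ∀ t ∈ Icc a b, (t, α t) ∈ O) :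
    d.IsRayOn α a b := fun t ht => ⟨h0.trans ht.1, (hF.subset (hO t ht)).1.2, by
      rw [← hF.eq _ (hO t ht)]; exact hα t ht⟩

/-- The interval is a single point, but the condition there still fixes the derivative. This is the
germ from which `exists_extension` produces a ray on a genuine interval. -/
theorem exists_local_ray (hd : d.Admissible) {t R : ℝ} (h0 : 0 ≤ t) (h1 : t < d.tauS R) :
    ∃ α, d.IsRayOn α t t ∧ α t = R := by
  obtain ⟨F, L, B, O, hF, hKO⟩ := hd.exists_cutoff (isCompact_singleton (x := (t, R)))
    (singleton_subset_iff.2 (hd.mem_Mpos h0 h1))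
  obtain ⟨α, hα0, hα⟩ := exists_solution_of_lipschitz hF.lip hF.bound
    (show t ∈ Ioo (t - 1) (t + 1) from ⟨by linarith, by linarith⟩) R
  refine ⟨α, isRayOn_of_cutoff hF h0 (fun s hs => hα s ⟨by linarith [hs.1], by linarith [hs.2]⟩)
    fun s hs => ?_, hα0⟩
  have : s = t := le_antisymm hs.2 hs.1
  rw [this, hα0]; exact hKO rfl

/-- Rays extend a little into the past and the future, as a solution of a cut off equation. -/
theorem exists_extension (hd : d.Admissible) {α : ℝ → ℝ} {a b : ℝ} (hab : a ≤ b)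
    (hα : d.IsRayOn α a b) : ∃ β, ∃ δ > 0, EqOn β α (Icc a b) ∧
      ∀ a', 0 ≤ a' → a - δ < a' → ∀ b', b' < b + δ → d.IsRayOn β a' b' := by
  obtain ⟨F, L, B, O, hF, hKO⟩ := hd.exists_cutoff hα.isCompact_graph (hd.IsRayOn_graph_subset hα)
  obtain ⟨β, hβ0, hβ⟩ := exists_solution_of_lipschitz hF.lip hF.bound
    (show b ∈ Ioo (a - 1) (b + 1) from ⟨by linarith, by linarith⟩) (α b)
  have heq : EqOn β α (Icc a b) := solution_unique_of_lipschitz hF.lip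
    (fun t ht => hβ t ⟨by linarith [ht.1], by linarith [ht.2]⟩)
    (fun t ht => by rw [hF.eq _ (hKO ⟨t, ht, rfl⟩)]; exact (hα t ht).2.2)
    (right_mem_Icc.2 hab) hβ0
  have hcont : ∀ t ∈ Ioo (a - 1) (b + 1), ContinuousAt (fun t => (t, β t)) t := fun t ht =>
    continuousAt_id.prodMk (hβ t ht).continuousAt
  have hnear : ∀ t ∈ Icc a b, ∀ᶠ s in 𝓝 t, (s, β s) ∈ O := fun t ht =>
    (hcont t ⟨by linarith [ht.1], by linarith [ht.2]⟩) (hF.isOpen.mem_nhds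
      (hKO ⟨t, ht, by simp only [heq ht]⟩))
  obtain ⟨δ₁, hδ₁, h₁⟩ := Metric.eventually_nhds_iff.1 (hnear a (left_mem_Icc.2 hab))
  obtain ⟨δ₂, hδ₂, h₂⟩ := Metric.eventually_nhds_iff.1 (hnear b (right_mem_Icc.2 hab))
  -- The bound 1 keeps the extension inside `Ioo (a - 1) (b + 1)`, where β is known to solve the cut
  -- off equation.
  refine ⟨β, min (min δ₁ δ₂) 1, by positivity, heq, fun a' ha0 ha' b' hb' =>
    isRayOn_of_cutoff hF ha0 (fun t ht => ?_) fun t ht => ?_⟩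
  · have := min_le_right (min δ₁ δ₂) 1
    exact hβ t ⟨by linarith [ht.1], by linarith [ht.2]⟩
  · have hm1 := (min_le_left (min δ₁ δ₂) 1).trans (min_le_left _ _)
    have hm2 := (min_le_left (min δ₁ δ₂) 1).trans (min_le_right _ _)
    rcases lt_or_ge t a with h | h
    · exact h₁ (by rw [Real.dist_eq, abs_lt]; constructor <;> linarith [ht.1])
    · rcases le_or_gt t b with h' | h'
      · exact hKO ⟨t, ⟨h, h'⟩, by simp only [heq ⟨h, h'⟩]⟩
      · exact h₂ (by rw [Real.dist_eq, abs_lt]; constructor <;> linarith [ht.2])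

theorem mem_G_of_ray (_hd : d.Admissible) {α : ℝ → ℝ} {T t : ℝ} (hα : d.IsRayOn α 0 T) (h0 : 0 ≤ t)
    (h1 : t ≤ T) : (t, α t) ∈ d.G := ⟨h0, α, hα.mono le_rfl h1, rfl⟩

/-- `G` is closed under increasing `R`. -/
theorem G_upward (hd : d.Admissible) {α : ℝ → ℝ} {T R : ℝ} (hT : 0 ≤ T) (hα : d.IsRayOn α 0 T)
    (hR0 : ∀ t ∈ Icc 0 T, ∀ ρ, α t ≤ ρ → t < d.tauS ρ) (hR : α T ≤ R) : (T, R) ∈ d.G := by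
  rcases hR.eq_or_lt with h | hlt
  · exact ⟨hT, α, hα, h⟩
  -- The solution through (T,R), followed backwards, decreases from R and cannot cross α by
  -- uniqueness. It is therefore confined to this compact region, where the cutoff agrees with γ.
  set K : Set (ℝ × ℝ) := {p | p.1 ∈ Icc 0 T ∧ α p.1 ≤ p.2 ∧ p.2 ≤ R} with hKdef
  have hmono := (hd.ray_strictMono hα).monotoneOn
  have hKc : IsCompact K := by
    have hcl : IsClosed K := by
      have e : K = (Icc 0 T ×ˢ Iic R) ∩ {p : ℝ × ℝ | p ∈ Icc 0 T ×ˢ univ ∧ α p.1 ≤ p.2} := by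
        ext p; simp only [hKdef, mem_ofPred_eq, mem_inter_iff, mem_prod, mem_univ, mem_Iic]; tauto
      rw [e]
      refine (isClosed_Icc.prod isClosed_Iic).inter ?_
      have hc : ContinuousOn (fun p : ℝ × ℝ => α p.1) (Icc 0 T ×ˢ univ) :=
        hα.continuousOn.comp continuousOn_fst fun p hp => hp.1
      exact (isClosed_Icc.prod isClosed_univ).isClosed_le hc continuousOn_snd
    refine ((isCompact_Icc (a := (0 : ℝ)) (b := T)).prod
      (isCompact_Icc (a := α 0) (b := R))).of_isClosed_subset hcl fun p hp => ⟨hp.1, ?_, hp.2.2⟩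
    exact (hmono (left_mem_Icc.2 hT) hp.1 hp.1.1).trans hp.2.1
  have hKM : K ⊆ d.Mpos := fun p hp => hd.mem_Mpos hp.1.1 (hR0 p.1 hp.1 p.2 hp.2.1)
  obtain ⟨F, L, B, O, hF, hKO⟩ := hd.exists_cutoff hKc hKM
  obtain ⟨β, hβ0, hβ⟩ := exists_solution_of_lipschitz hF.lip hF.bound
    (show T ∈ Ioo (-1) (T + 1) from ⟨by linarith, by linarith⟩) R
  have hβ' : ∀ t ∈ Icc 0 T, HasDerivAt β (F (t, β t)) t := fun t ht =>
    hβ t ⟨by linarith [ht.1], by linarith [ht.2]⟩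
  have hβmono := monotoneOn_of_hasDerivAt_nonneg hβ' fun t _ => hF.nonneg _
  have hα' : ∀ t ∈ Icc 0 T, HasDerivAt α (F (t, α t)) t := fun t ht => by
    rw [hF.eq _ (hKO ⟨ht, le_rfl, (hmono ht (right_mem_Icc.2 hT) ht.2).trans hR⟩)]
    exact (hα t ht).2.2
  have hge : ∀ t ∈ Icc 0 T, α t ≤ β t := by
    intro t ht
    by_contra hc
    push Not at hc
    have hcont : ContinuousOn (fun t => β t - α t) (Icc t T) := fun s hs =>
      ((hβ' s ⟨ht.1.trans hs.1, hs.2⟩).continuousAt.sub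
        (hα' s ⟨ht.1.trans hs.1, hs.2⟩).continuousAt).continuousWithinAt
    obtain ⟨s, hs, hs0⟩ := intermediate_value_Icc ht.2 hcont
      (show (0 : ℝ) ∈ _ from ⟨by linarith, by rw [hβ0]; linarith⟩)
    have := solution_unique_of_lipschitz hF.lip hβ' hα' (t₀ := s) ⟨ht.1.trans hs.1, hs.2⟩
      (by simp only at hs0; linarith) (right_mem_Icc.2 hT)
    rw [hβ0] at this
    linarith
  refine ⟨hT, β, isRayOn_of_cutoff hF le_rfl hβ' fun t ht => hKO ⟨ht, hge t ht, ?_⟩, hβ0⟩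
  rw [← hβ0]
  exact hβmono ht (right_mem_Icc.2 hT) ht.2

/-- Ingoing rays: every point with `R ≤ 0` belongs to `G`. -/
theorem mem_G_of_nonpos (hd : d.Admissible) {T R : ℝ} (hT : 0 ≤ T) (hR : R ≤ 0)
    (h : T < d.tauS R) : (T, R) ∈ d.G := by
  have hm : ∀ t ∈ Icc 0 T, ∀ ρ ≤ R, t < d.tauS ρ := by
    intro t ht ρ hρ
    have h1 : d.tauS R ≤ d.tauS ρ := by
      rw [← hd.tauS_neg R, ← hd.tauS_neg ρ]; exact hd.tauS_mono (by linarith) (by linarith)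
    linarith [ht.2]
  -- Among earlier times and radii ρ ≤ R ≤ 0, y is smallest at (T,R), so Γ bounds γ there. The
  -- backward ray thus stays in the box [R - ΓT, R].
  set Γ := 1 / d.yE (T, R) ^ 2
  have hΓ : ∀ t ∈ Icc 0 T, ∀ ρ ≤ R, d.gE (t, ρ) ≤ Γ := by
    intro t ht ρ hρ
    have h1 := hd.gE_le ht.1 (hm t ht ρ hρ)
    have hy := hd.yE_pos hT h
    have h2 : d.yE (T, R) ≤ d.yE (t, ρ) := by
      have h3 := hd.yE_anti_t (hd.mem_Mext ht.1 (hm t ht R le_rfl)) (hd.mem_Mext hT h) ht.2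
      have h4 := hd.yE_mono_R ht.1 (show 0 ≤ -R by linarith) (show -R ≤ -ρ by linarith)
        (by rw [hd.tauS_neg]; exact hm t ht R le_rfl)
      rw [hd.yE_neg, hd.yE_neg] at h4
      linarith
    exact h1.trans (one_div_le_one_div_of_le (pow_pos hy 2) (pow_le_pow_left₀ hy.le h2 2))
  have hΓ0 : 0 ≤ Γ := by positivity
  set K : Set (ℝ × ℝ) := Icc 0 T ×ˢ Icc (R - Γ * T) R
  have hKM : K ⊆ d.Mpos := fun p hp => hd.mem_Mpos hp.1.1 (hm p.1 hp.1 p.2 hp.2.2)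
  obtain ⟨F, L, B, O, hF, hKO⟩ := hd.exists_cutoff (isCompact_Icc.prod isCompact_Icc) hKM
  obtain ⟨β, hβ0, hβ⟩ := exists_solution_of_lipschitz hF.lip hF.bound
    (show T ∈ Ioo (-1) (T + 1) from ⟨by linarith, by linarith⟩) R
  have hβ' : ∀ t ∈ Icc 0 T, HasDerivAt β (F (t, β t)) t := fun t ht =>
    hβ t ⟨by linarith [ht.1], by linarith [ht.2]⟩
  have hle : ∀ t ∈ Icc 0 T, β t ≤ R := fun t ht => by
    rw [← hβ0]
    exact monotoneOn_of_hasDerivAt_nonneg hβ' (fun t _ => hF.nonneg _) ht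
      (right_mem_Icc.2 hT) ht.2
  have hmono2 : MonotoneOn (fun t => Γ * t - β t) (Icc 0 T) := by
    refine monotoneOn_of_hasDerivAt_nonneg (α' := fun t => Γ * 1 - F (t, β t))
      (fun t ht => ((hasDerivAt_id t).const_mul Γ).sub (hβ' t ht)) fun t ht => ?_
    have := hF.le _ (hd.mem_Mpos ht.1 (hm t ht _ (hle t ht)))
    have := hΓ t ht _ (hle t ht)
    linarith
  refine ⟨hT, β, isRayOn_of_cutoff hF le_rfl hβ' fun t ht => hKO ⟨ht, ?_, hle t ht⟩, hβ0⟩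
  have := hmono2 ht (right_mem_Icc.2 hT) ht.2
  simp only [hβ0] at this
  have := mul_nonneg hΓ0 ht.1
  simp only
  linarith

/-- Along a ray that ends at `R ≥ 0`, the spacetime contains all larger radii. -/
theorem ray_lt_tauS (hd : d.Admissible) {α : ℝ → ℝ} {T : ℝ} (hα : d.IsRayOn α 0 T)
    (hR : 0 ≤ α T) : ∀ t ∈ Icc 0 T, ∀ ρ, α t ≤ ρ → t < d.tauS ρ := by
  intro t ht ρ hρ
  have hT := ht.1.trans ht.2
  rcases le_or_gt 0 (α t) with h | h
  · exact (hα t ht).2.1.trans_le (hd.tauS_mono h hρ)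
  -- The ray crosses the centre at a time s < τ_s(0). The time t is no later, and all shells still
  -- exist then.
  · obtain ⟨s, hs, hs0⟩ := intermediate_value_Icc ht.2
      (hα.continuousOn.mono (Icc_subset_Icc ht.1 le_rfl)) (show (0 : ℝ) ∈ _ from ⟨h.le, hR⟩)
    have h1 := (hα s ⟨ht.1.trans hs.1, hs.2⟩).2.1
    rw [hs0] at h1
    exact (hs.1.trans_lt h1).trans_le (hd.tauS_zero_le ρ)

theorem mem_G_of_lt (hd : d.Admissible) {T R₁ R₂ : ℝ} (h1 : (T, R₁) ∈ d.G) (h0 : 0 ≤ R₁)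
    (h : R₁ ≤ R₂) : (T, R₂) ∈ d.G := by
  obtain ⟨hT, α, hα, e⟩ := h1
  simp only at hT hα e
  exact hd.G_upward hT hα (hd.ray_lt_tauS hα (by rw [e]; exact h0)) (by rw [e]; exact h)

/-- Nothing is lost before the first singularity: incoming rays cover R ≤ 0, and the remaining
points lie outside the centre. -/
theorem mem_G_of_lt_tauS_zero (hd : d.Admissible) {T R : ℝ} (hT : 0 ≤ T) (h : T < d.tauS 0) :
    (T, R) ∈ d.G := by
  rcases le_total R 0 with hR | hR
  · exact hd.mem_G_of_nonpos hT hR (h.trans_le (hd.tauS_zero_le R))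
  · exact hd.mem_G_of_lt (hd.mem_G_of_nonpos hT le_rfl h) le_rfl hR

theorem G_lt_tauS (_hd : d.Admissible) {t R : ℝ} (h : (t, R) ∈ d.G) : t < d.tauS R := by
  obtain ⟨hT, α, hα, e⟩ := h
  simp only at hT hα e
  rw [← e]; exact (hα t (right_mem_Icc.2 hT)).2.1

/-- `G` is open in the half plane `τ ≥ 0`. -/
theorem G_open (hd : d.Admissible) {p : ℝ × ℝ} (hp : p ∈ d.G) :
    ∀ᶠ z in 𝓝 p, 0 ≤ z.1 → z ∈ d.G := by
  obtain ⟨T, R⟩ := p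
  obtain ⟨hT, α₀, hα₀, e₀⟩ := hp
  simp only at hT hα₀ e₀
  obtain ⟨α, δ, hδ, heq, hext⟩ := hd.exists_extension hT hα₀
  have hαT : α T = R := by rw [heq (right_mem_Icc.2 hT), e₀]
  have hα := hext 0 le_rfl (by linarith) (T + δ / 2) (by linarith)
  -- The ray is prolonged beyond T so that it can also be compared with rays ending at slightly
  -- later times.
  set T' := T + δ / 2 with hT'
  obtain ⟨F, L, B, O, hF, hKO⟩ := hd.exists_cutoff hα.isCompact_graph (hd.IsRayOn_graph_subset hα)
  obtain ⟨ε, hε, htube⟩ := hα.isCompact_graph.exists_thickening_subset_open hF.isOpen hKO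
  have hcont : ContinuousAt (fun z : ℝ × ℝ => |z.2 - α z.1| * Real.exp (L * T')) (T, R) := by
    have h1 : ContinuousAt (fun z : ℝ × ℝ => α z.1) (T, R) :=
      ContinuousAt.comp (g := α) (f := Prod.fst) (x := ((T, R) : ℝ × ℝ))
        (hα T ⟨hT, by linarith⟩).2.2.continuousAt continuousAt_fst
    exact ((continuousAt_snd.sub h1).abs).mul continuousAt_const
  -- By the backward Gronwall estimate, a solution that ends this close to α stays in the ε-tube
  -- around it down to time 0.
  have hev : ∀ᶠ z : ℝ × ℝ in 𝓝 (T, R), |z.2 - α z.1| * Real.exp (L * T') < ε := by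
    refine hcont.eventually_lt continuousAt_const ?_
    simp [hαT, hε]
  have hev2 : ∀ᶠ z : ℝ × ℝ in 𝓝 (T, R), z.1 < T' :=
    continuousAt_fst.eventually_lt continuousAt_const (by simp only [hT']; linarith)
  filter_upwards [hev, hev2] with z h1 h2 h0
  obtain ⟨β, hβ0, hβ⟩ := exists_solution_of_lipschitz hF.lip hF.bound
    (show z.1 ∈ Ioo (-1) (T' + 1) from ⟨by linarith, by linarith⟩) z.2
  have hβ' : ∀ t ∈ Icc 0 z.1, HasDerivAt β (F (t, β t)) t := fun t ht =>
    hβ t ⟨by linarith [ht.1], by linarith [ht.2]⟩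
  have hα' : ∀ t ∈ Icc 0 z.1, HasDerivAt α (F (t, α t)) t := fun t ht => by
    have ht' : t ∈ Icc 0 T' := ⟨ht.1, ht.2.trans h2.le⟩
    rw [hF.eq _ (hKO ⟨t, ht', rfl⟩)]; exact (hα t ht').2.2
  refine ⟨h0, β, isRayOn_of_cutoff hF le_rfl hβ' fun t ht => htube ?_, hβ0⟩
  rw [Metric.mem_thickening_iff]
  refine ⟨(t, α t), ⟨t, ⟨ht.1, ht.2.trans h2.le⟩, rfl⟩, ?_⟩
  have h3 := abs_sub_le_of_lipschitz hF.lip hβ' hα' ht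
  rw [Prod.dist_eq, dist_self, max_eq_right dist_nonneg, Real.dist_eq]
  refine lt_of_le_of_lt (h3.trans ?_) h1
  rw [hβ0]
  have : (L : ℝ) * (z.1 - t) ≤ L * T' :=
    mul_le_mul_of_nonneg_left (by linarith [ht.1]) L.coe_nonneg
  gcongr

end Admissible
end TBData
end

noncomputable section
namespace TBData
variable {d : TBData}

/-! ### The maximal development -/

theorem rad_nonneg (x : Fin 4 → ℝ) : 0 ≤ rad x := Real.sqrt_nonneg _

theorem rad_sq (x : Fin 4 → ℝ) : rad x ^ 2 = x 1 ^ 2 + x 2 ^ 2 + x 3 ^ 2 :=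
  Real.sq_sqrt (by positivity)

theorem rad_smul (a : ℝ) (x : Fin 4 → ℝ) : rad (a • x) = |a| * rad x := by
  unfold rad
  rw [← Real.sqrt_sq_eq_abs, ← Real.sqrt_mul (sq_nonneg a)]
  congr 1
  simp only [Pi.smul_apply, smul_eq_mul]; ring

theorem continuous_rad : Continuous rad := by
  unfold rad
  exact Real.continuous_sqrt.comp (by fun_prop)

theorem abs_apply_le_rad (x : Fin 4 → ℝ) {i : Fin 4} (hi : i ≠ 0) : |x i| ≤ rad x := by
  refine abs_le_of_sq_le_sq ?_ (rad_nonneg x)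
  rw [rad_sq]
  fin_cases i
  · exact absurd rfl hi
  all_goals simp only [Fin.mk_one, Fin.reduceFinMk]; nlinarith [sq_nonneg (x 1), sq_nonneg (x 2), sq_nonneg (x 3)]

/-- The Euclidean product of the radial direction with a vector. -/
def rdot (x X : Fin 4 → ℝ) : ℝ := radial x 1 * X 1 + radial x 2 * X 2 + radial x 3 * X 3

theorem ev_g (x X Y : Fin 4 → ℝ) : ev (d.g x) X Y = -(X 0 * Y 0)
    + d.y (x 0) (rad x) ^ 4 * (X 1 * Y 1 + X 2 * Y 2 + X 3 * Y 3)
    + (1 / d.γ (x 0) (rad x) ^ 2 - d.y (x 0) (rad x) ^ 4) * (rdot x X * rdot x Y) := by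
  simp only [ev, g, Matrix.of_apply, Fin.sum_univ_four, rdot]
  simp
  ring

theorem rdot_sq_le (x X : Fin 4 → ℝ) : rdot x X ^ 2 ≤ rad X ^ 2 := by
  by_cases h : rad x = 0
  · simp only [rdot, radial, h]
    simp
    positivity
  · have h1 : rdot x X = (x 1 * X 1 + x 2 * X 2 + x 3 * X 3) / rad x := by
      simp [rdot, radial]; ring
    have hp : 0 < rad x := lt_of_le_of_ne (rad_nonneg x) (Ne.symm h)
    rw [h1, div_pow, div_le_iff₀ (by positivity), rad_sq, rad_sq]
    nlinarith [sq_nonneg (x 1 * X 2 - x 2 * X 1), sq_nonneg (x 1 * X 3 - x 3 * X 1),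
      sq_nonneg (x 2 * X 3 - x 3 * X 2)]

theorem hasDerivAt_rad {σ : ℝ → Fin 4 → ℝ} {X : Fin 4 → ℝ} {t : ℝ} (h : HasDerivAt σ X t)
    (h0 : 0 < rad (σ t)) : HasDerivAt (fun s => rad (σ s)) (rdot (σ t) X) t := by
  have hi := hasDerivAt_pi.1 h
  have h1 := (((hi 1).pow 2).add ((hi 2).pow 2)).add ((hi 3).pow 2)
  have hne : σ t 1 ^ 2 + σ t 2 ^ 2 + σ t 3 ^ 2 ≠ 0 := by rw [← rad_sq]; positivity
  have h2 := h1.sqrt hne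
  refine h2.congr_deriv ?_
  have e : Real.sqrt (((fun x => σ x 1) ^ 2 + (fun x => σ x 2) ^ 2 + (fun x => σ x 3) ^ 2) t)
    = rad (σ t) := rfl
  rw [e]
  simp [rdot, radial]
  field_simp

theorem rad_line {n : Fin 4 → ℝ} (hn : rad n = 1) (hn0 : n 0 = 0) (t ρ : ℝ) :
    rad (t • u + ρ • n) = |ρ| ∧ (t • u + ρ • n) 0 = t := by
  constructor
  · have : rad (t • u + ρ • n) = rad (ρ • n) := by simp [rad, u]
    rw [this, rad_smul, hn, mul_one]
  · simp [u, hn0]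

theorem rdot_line {n : Fin 4 → ℝ} (hn : rad n = 1) (hn0 : n 0 = 0) (t : ℝ) {ρ : ℝ} (hρ : ρ ≠ 0)
    (a : ℝ) : rdot (t • u + ρ • n) (u + a • n) ^ 2 = a ^ 2 := by
  have h1 := (rad_line hn hn0 t ρ).1
  have h2 : rdot (t • u + ρ • n) (u + a • n) = ρ / |ρ| * a * (n 1 ^ 2 + n 2 ^ 2 + n 3 ^ 2) := by
    simp only [rdot, radial, h1]
    simp [u]
    ring
  rw [h2, ← rad_sq, hn, mul_pow, mul_pow, div_pow, sq_abs, div_self (pow_ne_zero 2 hρ)]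
  ring

namespace Admissible

/-- Outgoing rays, continued through the centre, are causal curves. -/
theorem ray_causal (hd : d.Admissible) {n : Fin 4 → ℝ} (hn : rad n = 1) (hn0 : n 0 = 0)
    {t ρ : ℝ} (h0 : 0 ≤ t) (h1 : t < d.tauS ρ) :
    ev (d.g (t • u + ρ • n)) (u + d.gE (t, ρ) • n) (u + d.gE (t, ρ) • n) ≤ 0 := by
  obtain ⟨e1, e2⟩ := rad_line hn hn0 t ρ
  have habs : t < d.tauS |ρ| := by rwa [hd.tauS_abs]
  have hg : d.gE (t, |ρ|) = d.gE (t, ρ) := by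
    rcases abs_choice ρ with h | h <;> rw [h]
    exact hd.gE_neg (hd.mem_Mext h0 h1)
  have hpos := hd.gE_pos h0 h1
  have hX : (u + d.gE (t, ρ) • n) 0 = 1 := by simp [u, hn0]
  have hXX : (u + d.gE (t, ρ) • n) 1 * (u + d.gE (t, ρ) • n) 1
      + (u + d.gE (t, ρ) • n) 2 * (u + d.gE (t, ρ) • n) 2
      + (u + d.gE (t, ρ) • n) 3 * (u + d.gE (t, ρ) • n) 3 = d.gE (t, ρ) ^ 2 := by
    have : d.gE (t, ρ) ^ 2 = d.gE (t, ρ) ^ 2 * rad n ^ 2 := by rw [hn]; ring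
    rw [this, rad_sq]
    simp [u]
    ring
  rw [ev_g, e1, e2, hX, hXX, hd.γ_eq h0 habs, (hd.y_eq h0 habs).1, hg]
  by_cases hρ : ρ = 0
  · subst hρ
    have : rdot (t • u + (0 : ℝ) • n) (u + d.gE (t, 0) • n) = 0 := by
      simp [rdot, radial, u]
    rw [this, abs_zero, hd.gE_centre h0 h1]
    have := hd.yE_pos h0 h1
    field_simp
    norm_num
  · have h2 := rdot_line hn hn0 t hρ (d.gE (t, ρ))
    rw [sq] at h2
    rw [h2]
    refine le_of_eq ?_
    field_simp
    ring

theorem exists_unit (x : Fin 4 → ℝ) : ∃ n : Fin 4 → ℝ, rad n = 1 ∧ n 0 = 0 ∧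
    x = x 0 • u + rad x • n := by
  by_cases h : rad x = 0
  · refine ⟨Pi.single 1 1, by simp [rad], by simp, ?_⟩
    have hx : ∀ i : Fin 4, i ≠ 0 → x i = 0 := fun i hi => by
      have := abs_apply_le_rad x hi
      rw [h] at this
      exact abs_nonpos_iff.1 this
    ext i
    by_cases hi : i = 0
    · subst hi; simp [u]
    · rw [hx i hi, h]; simp [u, hi]
  · refine ⟨radial x, ?_, by simp [radial], ?_⟩
    · have h1 : radial x = (1 / rad x) • (x - x 0 • u) := by
        ext i
        by_cases hi : i = 0
        · subst hi; simp [radial, u]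
        · simp [radial, u, hi]; ring
      have h2 : rad (x - x 0 • u) = rad x := by simp [rad, u]
      rw [h1, rad_smul, h2, abs_of_nonneg (by have := rad_nonneg x; positivity)]
      field_simp
    · ext i
      by_cases hi : i = 0
      · subst hi; simp [u, radial]
      · simp [u, radial, hi]; field_simp

theorem mem_M_iff (hd : d.Admissible) {n : Fin 4 → ℝ} (hn : rad n = 1) (hn0 : n 0 = 0) {t ρ : ℝ} :
    t • u + ρ • n ∈ d.M ↔ 0 ≤ t ∧ t < d.tauS ρ := by
  obtain ⟨e1, e2⟩ := rad_line hn hn0 t ρ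
  simp only [M, mem_ofPred_eq, e1, e2, hd.tauS_abs]

theorem continuous_line (n : Fin 4 → ℝ) :
    Continuous fun p : ℝ × ℝ => p.1 • (u : Fin 4 → ℝ) + p.2 • n := by fun_prop

/-- The outgoing ray through the point is followed into the past on its maximal interval, passing
through the centre to the antipodal side. It is a causal curve, so the definition of D supplies an
endpoint in M. There the ray could be continued, so by maximality it has already reached τ = 0. -/
theorem mem_G_of_mem_D (hd : d.Admissible) {x : Fin 4 → ℝ} (hx : x ∈ d.D) :
    (x 0, rad x) ∈ d.G := by
  obtain ⟨hxM, hxD⟩ := hx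
  obtain ⟨n, hn, hn0, hxn⟩ := exists_unit x
  set T := x 0
  set R := rad x
  have hT : 0 ≤ T := hxM.1
  have hTR : T < d.tauS R := hxM.2
  set S : Set ℝ := {s | s ∈ Icc 0 T ∧ ∃ α, d.IsRayOn α s T ∧ α T = R} with hS
  have hTS : T ∈ S := ⟨⟨hT, le_rfl⟩, hd.exists_local_ray hT hTR⟩
  have hbdd : BddBelow S := ⟨0, fun s hs => hs.1.1⟩
  set t₀ := sInf S with ht₀
  have ht₀0 : 0 ≤ t₀ := le_csInf ⟨T, hTS⟩ fun s hs => hs.1.1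
  have ht₀T : t₀ ≤ T := csInf_le hbdd hTS
  -- rays do not stop at a positive time
  have hmin : ∀ s ∈ S, s = t₀ → t₀ = 0 := by
    intro s hs hst
    by_contra hne
    have hpos : 0 < t₀ := lt_of_le_of_ne ht₀0 (Ne.symm hne)
    obtain ⟨hsI, α, hα, hαT⟩ := hs
    rw [hst] at hα
    obtain ⟨β, δ, hδ, heq, hext⟩ := hd.exists_extension ht₀T hα
    have h1 := hext (max 0 (t₀ - δ / 2)) (le_max_left _ _)
      (lt_of_lt_of_le (by linarith) (le_max_right _ _)) T (by linarith)
    have h2 : max 0 (t₀ - δ / 2) ∈ S := ⟨⟨le_max_left _ _, max_le hT (by linarith)⟩, β, h1, by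
      rw [heq (right_mem_Icc.2 ht₀T), hαT]⟩
    have h3 := csInf_le hbdd h2
    have h4 : max 0 (t₀ - δ / 2) < t₀ := max_lt hpos (by linarith)
    linarith
  rcases ht₀T.eq_or_lt with hEq | hlt
  · have h0 := hmin T hTS hEq.symm
    obtain ⟨α, hα, hαT⟩ := hTS.2
    have hT0 : T = 0 := by rw [← hEq, h0]
    refine ⟨hT, α, ?_, hαT⟩
    simp only
    rw [hT0] at hα ⊢
    exact hα
  -- the maximal past ray
  have hmem : ∀ s, t₀ < s → s ≤ T → ∃ α, d.IsRayOn α s T ∧ α T = R := by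
    intro s hs hsT
    obtain ⟨s', hs', hs's⟩ := exists_lt_of_csInf_lt ⟨T, hTS⟩ hs
    obtain ⟨α, hα, hαT⟩ := hs'.2
    exact ⟨α, hα.mono hs's.le le_rfl, hαT⟩
  choose! A hA hAT using hmem
  set α : ℝ → ℝ := fun s => A s s with hα
  have hagree : ∀ s, t₀ < s → s ≤ T → EqOn α (A s) (Icc s T) := by
    intro s hs hsT t ht
    have h1 := hA t (hs.trans_le ht.1) ht.2
    have h2 := (hA s hs hsT).mono ht.1 le_rfl
    exact hd.ray_unique h1 h2 (right_mem_Icc.2 ht.2)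
      (by rw [hAT t (hs.trans_le ht.1) ht.2, hAT s hs hsT]) (left_mem_Icc.2 ht.2)
  have hαT : α T = R := hAT T hlt le_rfl
  have hderiv : ∀ t ∈ Ioo t₀ T, HasDerivAt α (d.gE (t, α t)) t := by
    intro t ht
    obtain ⟨s, hs1, hs2⟩ := exists_between ht.1
    have h1 := (hA s hs1 (hs2.le.trans ht.2.le) t ⟨hs2.le, ht.2.le⟩).2.2
    have h2 : α =ᶠ[𝓝 t] A s := by
      filter_upwards [Icc_mem_nhds hs2 ht.2] with z hz
      exact hagree s hs1 (hs2.le.trans ht.2.le) hz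
    rw [h2.eq_of_nhds]
    exact h1.congr_of_eventuallyEq h2
  have hlt' : ∀ t ∈ Ioc t₀ T, 0 ≤ t ∧ t < d.tauS (α t) := by
    intro t ht
    have := hA t ht.1 ht.2 t (left_mem_Icc.2 ht.2)
    exact ⟨this.1, this.2.1⟩
  have hcontα : ContinuousOn α (Ioc t₀ T) := by
    intro t ht
    obtain ⟨s, hs1, hs2⟩ := exists_between ht.1
    have hsT := hs2.le.trans ht.2
    have h1 : ContinuousWithinAt (A s) (Icc s T) t :=
      (hA s hs1 hsT).continuousOn t ⟨hs2.le, ht.2⟩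
    have h2 : ContinuousWithinAt α (Icc s T) t :=
      h1.congr (fun z hz => hagree s hs1 hsT hz) (hagree s hs1 hsT ⟨hs2.le, ht.2⟩)
    refine h2.mono_of_mem_nhdsWithin ?_
    filter_upwards [self_mem_nhdsWithin, mem_nhdsWithin_of_mem_nhds (Ici_mem_nhds hs2)] with z hz hz2
    exact ⟨hz2, hz.2⟩
  set σ : ℝ → Fin 4 → ℝ := fun t => t • u + α t • n with hσ
  have hcurve : d.IsPastCausalCurve x t₀ σ := by
    refine ⟨?_, ?_, ?_, ?_⟩
    · show T • (u : Fin 4 → ℝ) + α T • n = x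
      rw [hαT]; exact hxn.symm
    · exact (continuous_line n).comp_continuousOn (continuousOn_id.prodMk hcontα)
    · intro t ht
      exact ⟨(hd.mem_M_iff hn hn0).2 (hlt' t ht), (rad_line hn hn0 t (α t)).2⟩
    · intro t ht
      obtain ⟨h0, h1⟩ := hlt' t ⟨ht.1, ht.2.le⟩
      refine ⟨u + d.gE (t, α t) • n, ?_, hd.ray_causal hn hn0 h0 h1⟩
      have := ((hasDerivAt_id t).smul_const (u : Fin 4 → ℝ)).add ((hderiv t ht).smul_const n)
      simp only [one_smul] at this
      exact this
  obtain ⟨p, hpM, hplim⟩ := hxD t₀ σ ht₀0 hlt hcurve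
  -- the limit of the radius
  set ρ := n 1 * p 1 + n 2 * p 2 + n 3 * p 3 with hρ
  have hαlim : Tendsto α (𝓝[>] t₀) (𝓝 ρ) := by
    have h1 : Continuous fun z : Fin 4 → ℝ => n 1 * z 1 + n 2 * z 2 + n 3 * z 3 := by fun_prop
    have h2 := (h1.tendsto p).comp hplim
    refine h2.congr fun t => ?_
    have : n 1 ^ 2 + n 2 ^ 2 + n 3 ^ 2 = 1 := by rw [← rad_sq, hn]; norm_num
    simp only [hσ, Function.comp, u, Pi.add_apply, Pi.smul_apply, smul_eq_mul]
    simp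
    linear_combination (α t) * this
  have hp : p = t₀ • u + ρ • n := by
    have h3 : Tendsto (fun t : ℝ => t) (𝓝[>] t₀) (𝓝 t₀) := tendsto_id.mono_left nhdsWithin_le_nhds
    have h2 := ((continuous_line n).tendsto (t₀, ρ)).comp (h3.prodMk_nhds hαlim)
    exact tendsto_nhds_unique hplim h2
  have hρM : t₀ < d.tauS ρ := by
    rw [hp] at hpM
    exact ((hd.mem_M_iff hn hn0).1 hpM).2
  -- continue beyond the limit point
  set αb : ℝ → ℝ := fun t => if t ≤ t₀ then ρ else α t with hαb
  have hαbc : ContinuousOn αb (Icc t₀ T) := by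
    intro t ht
    rcases ht.1.eq_or_lt with h | h
    · rw [← h]
      have e0 : αb t₀ = ρ := by simp [hαb]
      rw [ContinuousWithinAt, e0, ← Ioc_insert_left ht₀T, nhdsWithin_insert, tendsto_sup]
      refine ⟨by rw [tendsto_pure_left]; intro s hs; rw [e0]; exact mem_of_mem_nhds hs, ?_⟩
      refine (hαlim.mono_left (nhdsWithin_mono _ Ioc_subset_Ioi_self)).congr' ?_
      filter_upwards [self_mem_nhdsWithin] with s hs
      simp [hαb, not_le.2 hs.1]
    · have h1 := hcontα t ⟨h, ht.2⟩
      have h2 : ContinuousWithinAt αb (Ioc t₀ T) t :=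
        h1.congr (fun z hz => by simp [hαb, not_le.2 hz.1]) (by simp [hαb, not_le.2 h])
      refine h2.mono_of_mem_nhdsWithin ?_
      filter_upwards [self_mem_nhdsWithin, mem_nhdsWithin_of_mem_nhds (Ioi_mem_nhds h)] with z hz hz2
      exact ⟨hz2, hz.2⟩
  have hK : IsCompact ((fun t => (t, αb t)) '' Icc t₀ T) :=
    isCompact_Icc.image_of_continuousOn (continuousOn_id.prodMk hαbc)
  have hKM : (fun t => (t, αb t)) '' Icc t₀ T ⊆ d.Mpos := by
    rintro _ ⟨t, ht, rfl⟩
    by_cases h : t ≤ t₀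
    · have : t = t₀ := le_antisymm h ht.1
      simp only [hαb, this, le_refl, if_true]
      exact hd.mem_Mpos ht₀0 hρM
    · have h' := hlt' t ⟨not_le.1 h, ht.2⟩
      simp only [hαb, h, if_false]
      exact hd.mem_Mpos h'.1 h'.2
  -- The graph closed up by the limit point is compact in the region where γ is smooth. The cut off
  -- equation thus has a solution on all of [t₀,T] that agrees with α. It shows that the infimum t₀
  -- is attained, and `hmin` then gives t₀ = 0.
  obtain ⟨F, L, B, O, hF, hKO⟩ := hd.exists_cutoff hK hKM
  obtain ⟨β, hβ0, hβ⟩ := exists_solution_of_lipschitz hF.lip hF.bound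
    (show T ∈ Ioo (t₀ - 1) (T + 1) from ⟨by linarith, by linarith⟩) R
  have hβ' : ∀ t ∈ Icc t₀ T, HasDerivAt β (F (t, β t)) t := fun t ht =>
    hβ t ⟨by linarith [ht.1], by linarith [ht.2]⟩
  have heq : ∀ t ∈ Ioc t₀ T, β t = α t := by
    intro t ht
    have h1 : ∀ s ∈ Icc t T, HasDerivAt (A t) (F (s, A t s)) s := by
      intro s hs
      have hs' := hagree t ht.1 ht.2 hs
      have hst : ¬ s ≤ t₀ := not_le.2 (ht.1.trans_le hs.1)
      have : (s, A t s) ∈ O := hKO ⟨s, ⟨ht.1.le.trans hs.1, hs.2⟩, by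
        simp only [hαb, hst, if_false, hs']⟩
      rw [hF.eq _ this]
      exact (hA t ht.1 ht.2 s hs).2.2
    exact solution_unique_of_lipschitz hF.lip (fun s hs => hβ' s ⟨ht.1.le.trans hs.1, hs.2⟩) h1
      (right_mem_Icc.2 ht.2) (by rw [hβ0, hAT t ht.1 ht.2]) (left_mem_Icc.2 ht.2)
  have hβt₀ : β t₀ = ρ := by
    have h1 : Tendsto β (𝓝[>] t₀) (𝓝 (β t₀)) :=
      (hβ' t₀ (left_mem_Icc.2 ht₀T)).continuousAt.tendsto.mono_left nhdsWithin_le_nhds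
    refine tendsto_nhds_unique h1 (hαlim.congr' ?_)
    filter_upwards [Ioc_mem_nhdsGT hlt] with t ht
    exact (heq t ht).symm
  have hray : d.IsRayOn β t₀ T := by
    refine isRayOn_of_cutoff hF ht₀0 hβ' fun t ht => hKO ⟨t, ht, ?_⟩
    by_cases h : t ≤ t₀
    · have : t = t₀ := le_antisymm h ht.1
      simp [hαb, this, hβt₀]
    · simp only [hαb, h, if_false]
      rw [heq t ⟨not_le.1 h, ht.2⟩]
  have h0 := hmin t₀ ⟨⟨ht₀0, ht₀T⟩, β, hray, hβ0⟩ rfl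
  rw [h0] at hray
  exact ⟨hT, β, hray, hβ0⟩

/-- Speed bounds for causal curves. -/
theorem causal_bounds (hd : d.Admissible) {x X : Fin 4 → ℝ} (hx : x ∈ d.M) (hX0 : X 0 = 1)
    (h : ev (d.g x) X X ≤ 0) : rad X ≤ 1 / d.yE (x 0, rad x) ^ 2 ∧
      (0 < rad x → rdot x X ≤ d.gE (x 0, rad x)) := by
  obtain ⟨h0, h1⟩ := hx
  rw [ev_g, hX0, hd.γ_eq h0 h1, (hd.y_eq h0 h1).1] at h
  have hy := hd.yE_pos h0 h1
  have hg := hd.gE_pos h0 h1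
  have hgle := hd.gE_le h0 h1
  set y := d.yE (x 0, rad x)
  set γ := d.gE (x 0, rad x)
  have e1 : X 1 * X 1 + X 2 * X 2 + X 3 * X 3 = rad X ^ 2 := by rw [rad_sq]; ring
  rw [e1] at h
  -- The radial coefficient of the metric dominates the angular one, so the spatial metric is at
  -- least y⁴ times the Euclidean metric.
  have hle : y ^ 4 ≤ 1 / γ ^ 2 := by
    have h3 : γ * y ^ 2 ≤ 1 := by rwa [le_div_iff₀ (by positivity)] at hgle
    rw [le_div_iff₀ (by positivity)]
    have : 0 ≤ γ * y ^ 2 := by positivity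
    nlinarith
  have hdot := rdot_sq_le x X
  constructor
  · have h4 : y ^ 4 * rad X ^ 2 ≤ 1 := by
      nlinarith [mul_nonneg (sub_nonneg.2 hle) (mul_self_nonneg (rdot x X))]
    rw [le_div_iff₀ (by positivity)]
    have : 0 ≤ rad X * y ^ 2 := mul_nonneg (rad_nonneg X) (by positivity)
    nlinarith
  · intro _
    have h5 : rdot x X ^ 2 / γ ^ 2 ≤ 1 := by
      have : rdot x X ^ 2 / γ ^ 2 = 1 / γ ^ 2 * (rdot x X * rdot x X) := by ring
      rw [this]
      nlinarith [mul_le_mul_of_nonneg_left hdot (show 0 ≤ y ^ 4 by positivity)]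
    rw [div_le_one (by positivity)] at h5
    exact le_of_sq_le_sq h5 hg.le

/-- The radius is not differentiable at the centre, and the comparison with rays needs only a
right-hand slope. At the centre that slope is |X|, which is bounded by 1/y² = γ. -/
theorem slope_rad_tendsto (hd : d.Admissible) {σ : ℝ → Fin 4 → ℝ} {X : Fin 4 → ℝ} {t : ℝ}
    (hM : σ t ∈ d.M) (hσ0 : σ t 0 = t) (hX : HasDerivAt σ X t) (hX0 : X 0 = 1)
    (hc : ev (d.g (σ t)) X X ≤ 0) : ∃ v ≤ d.gE (t, rad (σ t)),
      Tendsto (slope (fun s => rad (σ s)) t) (𝓝[>] t) (𝓝 v) := by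
  obtain ⟨b1, b2⟩ := hd.causal_bounds hM hX0 hc
  rw [hσ0] at b1 b2
  rcases (rad_nonneg (σ t)).eq_or_lt with h | h
  · refine ⟨rad X, ?_, ?_⟩
    · have h1 := hM.1
      have h2 := hM.2
      rw [hσ0] at h1 h2
      rw [← h] at b1 h2 ⊢
      rw [hd.gE_centre h1 h2]; exact b1
    · have h1 : Tendsto (slope σ t) (𝓝[>] t) (𝓝 X) :=
        (hasDerivAt_iff_tendsto_slope.1 hX).mono_left (nhdsWithin_mono _ fun s hs => ne_of_gt hs)
      have h2 := (continuous_rad.tendsto X).comp h1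
      refine h2.congr' ?_
      filter_upwards [self_mem_nhdsWithin] with s hs
      have hs' : 0 < s - t := sub_pos.2 hs
      have h0 : ∀ i : Fin 4, i ≠ 0 → σ t i = 0 := fun i hi => by
        have := abs_apply_le_rad (σ t) hi
        rw [← h] at this
        exact abs_nonpos_iff.1 this
      have h3 : rad (σ s - σ t) = rad (σ s) := by
        simp [rad, h0]
      simp only [Function.comp, slope_def_module, smul_eq_mul]
      rw [rad_smul, h3, ← h, abs_of_pos (by positivity), sub_zero]
  · refine ⟨_, b2 h, ?_⟩
    exact (hasDerivAt_iff_tendsto_slope.1 (hasDerivAt_rad hX h)).mono_left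
      (nhdsWithin_mono _ fun s hs => ne_of_gt hs)

/-- A past causal curve stays outside the past outgoing ray. -/
theorem ray_le_rad (hd : d.Admissible) {x : Fin 4 → ℝ} {t₀ : ℝ} {σ : ℝ → Fin 4 → ℝ}
    (h0 : 0 ≤ t₀) (hσ : d.IsPastCausalCurve x t₀ σ) {α : ℝ → ℝ} (hα : d.IsRayOn α 0 (x 0))
    (hαx : α (x 0) = rad x) : ∀ s ∈ Ioc t₀ (x 0), α s ≤ rad (σ s) := by
  obtain ⟨hσx, hσc, hσM, hσd⟩ := hσ
  intro s₀ hs₀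
  by_contra hlt
  push Not at hlt
  set T := x 0
  have hαc : ContinuousOn α (Ioc t₀ T) := hα.continuousOn.mono fun s hs => ⟨h0.trans hs.1.le, hs.2⟩
  have hRc : ContinuousOn (fun s => rad (σ s)) (Ioc t₀ T) := continuous_rad.comp_continuousOn hσc
  -- first time at which the curve meets the ray
  set Z : Set ℝ := {s | s ∈ Icc s₀ T ∧ α s ≤ rad (σ s)} with hZ
  have hsub : Icc s₀ T ⊆ Ioc t₀ T := fun s hs => ⟨hs₀.1.trans_le hs.1, hs.2⟩
  have hZcl : IsClosed Z := isClosed_Icc.isClosed_le (hαc.mono hsub) (hRc.mono hsub)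
  have hTZ : T ∈ Z := ⟨right_mem_Icc.2 hs₀.2, by rw [hαx, hσx]⟩
  have hZb : BddBelow Z := ⟨s₀, fun s hs => hs.1.1⟩
  set s₁ := sInf Z
  have hs₁Z : s₁ ∈ Z := hZcl.csInf_mem ⟨T, hTZ⟩ hZb
  have hless : ∀ s ∈ Ico s₀ s₁, rad (σ s) < α s := by
    intro s hs
    by_contra hc
    push Not at hc
    have : s₁ ≤ s := csInf_le hZb ⟨⟨hs.1, hs.2.le.trans hs₁Z.1.2⟩, hc⟩
    linarith [hs.2]
  have hI : Icc s₀ s₁ ⊆ Ioc t₀ T := fun s hs => ⟨hs₀.1.trans_le hs.1, hs.2.trans hs₁Z.1.2⟩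
  have hs₀₁ : s₀ < s₁ := by
    rcases hs₁Z.1.1.eq_or_lt with h | h
    · have := hs₁Z.2; rw [← h] at this; linarith
    · exact h
  have heq1 : rad (σ s₁) = α s₁ := by
    refine le_antisymm ?_ hs₁Z.2
    have h1 : ContinuousWithinAt (fun s => α s - rad (σ s)) (Ico s₀ s₁) s₁ :=
      ((hαc.sub hRc).mono hI s₁ (right_mem_Icc.2 hs₀₁.le)).mono Ico_subset_Icc_self
    have h2 : s₁ ∈ closure (Ico s₀ s₁) := by
      rw [closure_Ico hs₀₁.ne]; exact right_mem_Icc.2 hs₀₁.le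
    have := ContinuousWithinAt.closure_le h2 (f := fun _ => (0 : ℝ)) continuousWithinAt_const h1
      (fun s hs => by have := hless s hs; linarith)
    linarith
  have hle : ∀ s ∈ Icc s₀ s₁, rad (σ s) ≤ α s := fun s hs => by
    rcases hs.2.eq_or_lt with h | h
    · rw [h, heq1]
    · exact (hless s ⟨hs.1, h⟩).le
  -- the compact region between the curve and the ray
  set K : Set (ℝ × ℝ) := {p | p.1 ∈ Icc s₀ s₁ ∧ rad (σ p.1) ≤ p.2 ∧ p.2 ≤ α p.1} with hKdef
  have hKc : IsCompact K := by
    obtain ⟨C, hC⟩ := (isCompact_Icc (a := s₀) (b := s₁)).exists_bound_of_continuousOn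
      (hαc.mono hI)
    have hcl : IsClosed K := by
      have hP : IsClosed (Icc s₀ s₁ ×ˢ (univ : Set ℝ)) := isClosed_Icc.prod isClosed_univ
      have c1 : ContinuousOn (fun p : ℝ × ℝ => rad (σ p.1)) (Icc s₀ s₁ ×ˢ univ) :=
        (hRc.mono hI).comp continuousOn_fst fun p hp => hp.1
      have c2 : ContinuousOn (fun p : ℝ × ℝ => α p.1) (Icc s₀ s₁ ×ˢ univ) :=
        (hαc.mono hI).comp continuousOn_fst fun p hp => hp.1
      have e : K = {p : ℝ × ℝ | p ∈ Icc s₀ s₁ ×ˢ univ ∧ rad (σ p.1) ≤ p.2} ∩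
          {p : ℝ × ℝ | p ∈ Icc s₀ s₁ ×ˢ univ ∧ p.2 ≤ α p.1} := by
        ext p; simp only [hKdef, mem_ofPred_eq, mem_inter_iff, mem_prod, mem_univ]; tauto
      rw [e]
      exact (hP.isClosed_le c1 continuousOn_snd).inter (hP.isClosed_le continuousOn_snd c2)
    refine ((isCompact_Icc (a := s₀) (b := s₁)).prod
      (isCompact_Icc (a := 0) (b := C))).of_isClosed_subset hcl fun p hp =>
        ⟨hp.1, (rad_nonneg _).trans hp.2.1, hp.2.2.trans ((le_abs_self _).trans (hC _ hp.1))⟩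
  have hKM : K ⊆ d.Mpos := fun p hp => by
    have h1 := hσM p.1 (hI hp.1)
    have h2 := h1.1.2
    rw [h1.2] at h2
    exact hd.mem_Mpos (h0.trans (hI hp.1).1.le)
      (h2.trans_le (hd.tauS_mono (rad_nonneg _) hp.2.1))
  obtain ⟨F, L, B, O, hF, hKO⟩ := hd.exists_cutoff hKc hKM
  -- The comparison function α - η exp(-L'(s - s₀)) starts at the radius of the curve. As L' exceeds
  -- the Lipschitz constant, its slope at any contact is larger than γ at the radius of the curve,
  -- which bounds the slope of that radius. The curve cannot overtake it, yet at s₁ it would meet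
  -- the larger value α.
  set L' : ℝ := L + 1
  set η := α s₀ - rad (σ s₀)
  have hη : 0 < η := sub_pos.2 hlt
  have hfin := image_le_of_liminf_slope_right_lt_deriv_boundary' (f := fun s => rad (σ s))
    (f' := fun s => d.gE (s, rad (σ s))) (a := s₀) (b := s₁) (hRc.mono hI) ?_
    (B := fun s => α s - η * Real.exp (-L' * (s - s₀)))
    (B' := fun s => d.gE (s, α s) - η * (Real.exp (-L' * (s - s₀)) * (-L' * 1)))
    (by simp [η]) ?_ ?_ ?_ (right_mem_Icc.2 hs₀₁.le)
  · have : 0 < η * Real.exp (-L' * (s₁ - s₀)) := by positivity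
    simp only [heq1] at hfin
    linarith
  · intro s hs r hr
    have hsI := hI ⟨hs.1, hs.2.le⟩
    have hs' : s ∈ Ioo t₀ T := ⟨hsI.1, hs.2.trans_le hs₁Z.1.2⟩
    obtain ⟨X, hX, hXc⟩ := hσd s hs'
    have hX0 : X 0 = 1 := by
      have h1 := hasDerivAt_pi.1 hX 0
      have h2 : (fun s => σ s 0) =ᶠ[𝓝 s] fun s => s := by
        filter_upwards [Ioo_mem_nhds hs'.1 hs'.2] with z hz
        exact (hσM z ⟨hz.1, hz.2.le⟩).2
      exact h1.unique ((hasDerivAt_id' s).congr_of_eventuallyEq h2)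
    obtain ⟨v, hv, hvt⟩ := hd.slope_rad_tendsto (hσM s hsI).1 (hσM s hsI).2 hX hX0 hXc
    exact (hvt.eventually (gt_mem_nhds (hv.trans_lt hr))).frequently
  · exact (hαc.mono hI).sub (Continuous.continuousOn (by fun_prop))
  · intro s hs
    have hsI := hI ⟨hs.1, hs.2.le⟩
    have h1 := (hα s ⟨h0.trans hsI.1.le, hsI.2⟩).2.2
    have h2 := ((((hasDerivAt_id s).sub_const s₀).const_mul (-L')).exp).const_mul η
    exact (h1.sub h2).hasDerivWithinAt
  · intro s hs hfs
    have hsI : s ∈ Icc s₀ s₁ := ⟨hs.1, hs.2.le⟩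
    have h1 : d.gE (s, rad (σ s)) = F (s, rad (σ s)) :=
      (hF.eq _ (hKO ⟨hsI, le_rfl, hle s hsI⟩)).symm
    have h2 : d.gE (s, α s) = F (s, α s) := (hF.eq _ (hKO ⟨hsI, hle s hsI, le_rfl⟩)).symm
    have h3 := (hF.lip.slice s).dist_le_mul (rad (σ s)) (α s)
    rw [Real.dist_eq, Real.dist_eq] at h3
    have h4 := le_abs_self (F (s, rad (σ s)) - F (s, α s))
    have hp : 0 < η * Real.exp (-L' * (s - s₀)) := by positivity
    have h5 : |rad (σ s) - α s| = η * Real.exp (-L' * (s - s₀)) := by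
      rw [hfs, abs_sub_comm, abs_of_nonneg (by linarith)]; ring
    rw [h5] at h3
    rw [h1, h2]
    have h6 : (L : ℝ) * (η * Real.exp (-L' * (s - s₀))) <
        L' * (η * Real.exp (-L' * (s - s₀))) := by
      have : (L : ℝ) < L' := by simp [L']
      gcongr
    linarith

/-- By `ray_le_rad` a past causal curve stays outside the past outgoing ray, whose negative radii
are replaced by the centre. On that side y is bounded below by compactness, which bounds the speed
and makes the curve Lipschitz. It thus has a limit, which again lies outside the ray and hence in M.
-/
theorem mem_D_of_mem_G (hd : d.Admissible) {x : Fin 4 → ℝ} (hx : (x 0, rad x) ∈ d.G) :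
    x ∈ d.D := by
  obtain ⟨hT, α, hα, hαx⟩ := hx
  simp only at hT hα hαx
  have hpast := hd.ray_lt_tauS hα (by rw [hαx]; exact rad_nonneg x)
  refine ⟨⟨hT, by rw [← hαx]; exact (hα _ (right_mem_Icc.2 hT)).2.1⟩, fun t₀ σ h0 h1 hσ => ?_⟩
  have hle := hd.ray_le_rad h0 hσ hα hαx
  obtain ⟨hσx, hσc, hσM, hσd⟩ := hσ
  set T := x 0
  -- lower bound for `y`
  have hmc : ContinuousOn (fun s => d.yE (s, max (α s) 0)) (Icc 0 T) := by
    intro s hs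
    have h2 := (hd.contDiffAt_yE (hd.mem_Mext hs.1 (hpast s hs (max (α s) 0)
      (le_max_left _ _)))).continuousAt
    have h3 : ContinuousWithinAt (fun s => (s, max (α s) 0)) (Icc 0 T) s :=
      continuousWithinAt_id.prodMk ((hα.continuousOn s hs).max continuousWithinAt_const)
    exact ContinuousAt.comp_continuousWithinAt (f := fun s => (s, max (α s) 0)) h2 h3
  obtain ⟨sm, hsm, hmin⟩ := (isCompact_Icc (a := (0 : ℝ)) (b := T)).exists_isMinOn
    ⟨0, left_mem_Icc.2 hT⟩ hmc
  set y₀ := d.yE (sm, max (α sm) 0)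
  have hy₀ : 0 < y₀ := hd.yE_pos hsm.1 (hpast sm hsm _ (le_max_left _ _))
  have hbound : ∀ s ∈ Ioo t₀ T, ∃ X, HasDerivAt σ X s ∧ ‖X‖ ≤ max 1 (1 / y₀ ^ 2) := by
    intro s hs
    have hsI : s ∈ Ioc t₀ T := ⟨hs.1, hs.2.le⟩
    have hs0 : s ∈ Icc 0 T := ⟨h0.trans hs.1.le, hs.2.le⟩
    obtain ⟨X, hX, hXc⟩ := hσd s hs
    have hX0 : X 0 = 1 := by
      have h1 := hasDerivAt_pi.1 hX 0
      have h2 : (fun s => σ s 0) =ᶠ[𝓝 s] fun s => s := by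
        filter_upwards [Ioo_mem_nhds hs.1 hs.2] with z hz
        exact (hσM z ⟨hz.1, hz.2.le⟩).2
      exact h1.unique ((hasDerivAt_id' s).congr_of_eventuallyEq h2)
    refine ⟨X, hX, ?_⟩
    have h3 := (hd.causal_bounds (hσM s hsI).1 hX0 hXc).1
    rw [(hσM s hsI).2] at h3
    have h4 : y₀ ≤ d.yE (s, rad (σ s)) :=
      (hmin hs0).trans (hd.yE_mono_R hs0.1 (le_max_right _ _)
        (max_le (hle s hsI) (rad_nonneg _)) (hpast s hs0 _ (le_max_left _ _)))
    have h5 : rad X ≤ 1 / y₀ ^ 2 :=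
      h3.trans (one_div_le_one_div_of_le (pow_pos hy₀ 2) (pow_le_pow_left₀ hy₀.le h4 2))
    rw [pi_norm_le_iff_of_nonneg (by positivity)]
    intro i
    by_cases hi : i = 0
    · subst hi; rw [hX0]; simp
    · exact (abs_apply_le_rad X hi).trans (h5.trans (le_max_right _ _))
  choose! X hX hXn using hbound
  set C : NNReal := ⟨max 1 (1 / y₀ ^ 2), by positivity⟩
  have hlip : LipschitzOnWith C σ (Ioo t₀ T) := LipschitzOnWith.of_dist_le_mul fun a ha b hb => by
    rw [dist_eq_norm, dist_eq_norm]
    exact Convex.norm_image_sub_le_of_norm_hasDerivWithin_le (f' := X)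
      (fun s hs => (hX s hs).hasDerivWithinAt) hXn (convex_Ioo _ _) hb ha
  -- The value at t₀ of a Lipschitz extension is the limit of the curve.
  obtain ⟨σ', hσ', hσeq⟩ := hlip.extend_pi
  have hlim : Tendsto σ (𝓝[>] t₀) (𝓝 (σ' t₀)) := by
    refine (hσ'.continuous.tendsto t₀ |>.mono_left nhdsWithin_le_nhds).congr' ?_
    filter_upwards [Ioo_mem_nhdsGT h1] with s hs
    exact (hσeq hs).symm
  have ht₀ : σ' t₀ 0 = t₀ := by
    have h2 : Tendsto (fun s => σ s 0) (𝓝[>] t₀) (𝓝 (σ' t₀ 0)) :=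
      ((continuous_apply 0).tendsto _).comp hlim
    refine tendsto_nhds_unique h2 ((tendsto_id.mono_left nhdsWithin_le_nhds).congr' ?_)
    filter_upwards [Ioo_mem_nhdsGT h1] with s hs
    exact ((hσM s ⟨hs.1, hs.2.le⟩).2).symm
  have hrad : α t₀ ≤ rad (σ' t₀) := by
    have h2 := (continuous_rad.tendsto _).comp hlim
    have h3 : Tendsto α (𝓝[>] t₀) (𝓝 (α t₀)) :=
      (hα t₀ ⟨h0, h1.le⟩).2.2.continuousAt.tendsto.mono_left nhdsWithin_le_nhds
    refine le_of_tendsto_of_tendsto h3 h2 ?_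
    filter_upwards [Ioo_mem_nhdsGT h1] with s hs
    exact hle s ⟨hs.1, hs.2.le⟩
  refine ⟨σ' t₀, ⟨by rw [ht₀]; exact h0, ?_⟩, hlim⟩
  rw [ht₀]
  exact hpast t₀ ⟨h0, h1.le⟩ _ hrad

theorem mem_D_iff (hd : d.Admissible) {x : Fin 4 → ℝ} : x ∈ d.D ↔ (x 0, rad x) ∈ d.G :=
  ⟨hd.mem_G_of_mem_D, hd.mem_D_of_mem_G⟩

end Admissible

theorem rad_sph (t R θ φ : ℝ) : rad (sph t R θ φ) = |R| := by
  rw [rad, ← Real.sqrt_sq_eq_abs]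
  congr 1
  simp [sph]
  linear_combination R ^ 2 * (Real.sin θ ^ 2) * Real.sin_sq_add_cos_sq φ
    + R ^ 2 * Real.sin_sq_add_cos_sq θ

theorem sph_zero (t R θ φ : ℝ) : sph t R θ φ 0 = t := by simp [sph]

theorem Admissible.mem_Drad_iff (hd : d.Admissible) {t R : ℝ} :
    (t, R) ∈ d.Drad ↔ 0 ≤ R ∧ (t, R) ∈ d.G := by
  constructor
  · rintro ⟨h0, h⟩
    have := hd.mem_D_iff.1 (h 0 0)
    rw [rad_sph, sph_zero, abs_of_nonneg h0] at this
    exact ⟨h0, this⟩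
  · rintro ⟨h0, h⟩
    refine ⟨h0, fun θ φ => hd.mem_D_iff.2 ?_⟩
    rw [rad_sph, sph_zero, abs_of_nonneg h0]
    exact h

end TBData
end

noncomputable section

/-- A function with positive derivative at its zeros does not become negative. -/
theorem nonneg_of_deriv_pos_at_zeros {φ φ' : ℝ → ℝ} {a b : ℝ} (hab : a ≤ b)
    (hc : ContinuousOn φ (Icc a b)) (hφ : ∀ s ∈ Ico a b, HasDerivAt φ (φ' s) s)
    (h0 : ∀ s ∈ Ico a b, φ s = 0 → 0 < φ' s) (ha : 0 ≤ φ a) : 0 ≤ φ b := by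
  have := image_le_of_deriv_right_lt_deriv_boundary' (f := fun s => -φ s) (f' := fun s => -φ' s)
    (B := fun _ => 0) (B' := fun _ => 0) (a := a) (b := b) hc.neg
    (fun s hs => (hφ s hs).neg.hasDerivWithinAt) (by simpa using ha) continuousOn_const
    (fun s _ => hasDerivWithinAt_const _ _ _) (fun s hs h => by
      have := h0 s hs (by simpa using h); simpa using this) (right_mem_Icc.2 hab)
  simpa using this

namespace TBData
variable {d : TBData}

/-! ### Estimates near the singularity -/

namespace Admissible

/-- The collapse time is H(q)/√c with H the integral over [0,1]. The growth of q enters through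
`Hf_mono_q`, the decay of c through 1/√c. Each contributes at least linearly, and
`exists_nondegenerate` converts the sum into R². -/
theorem exists_tauS_ge (hd : d.Admissible) : ∃ k > 0, ∀ R, 0 ≤ R → R ≤ d.Rstar →
    d.tauS 0 + k * R ^ 2 ≤ d.tauS R := by
  obtain ⟨k₀, hk₀, hk⟩ := hd.exists_nondegenerate
  have hs0 := hd.sqrt_c_pos 0
  have hc0 := hd.c_pos 0
  have hq0 := hd.q_pos 0
  -- The two entries are lower bounds for the gain in collapse time per unit decrease of c and per
  -- unit increase of q. They come from H ≥ 2/3 and the factor 1/5 in `Hf_mono_q`.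
  set k₁ := min (1 / (3 * (d.c 0 * Real.sqrt (d.c 0)))) (d.q 0 / (5 * Real.sqrt (d.c 0))) with hk₁
  have hk₁p : 0 < k₁ := lt_min (by positivity) (by positivity)
  refine ⟨k₁ * k₀, by positivity, fun R h0 h1 => ?_⟩
  have hR := hk R h0 h1
  have hq := hd.q_monotone (mem_Ici.2 le_rfl) h0 h0
  have hc := hd.c_antitone (mem_Ici.2 le_rfl) h0 h0
  have hsR := hd.sqrt_c_pos R
  have hss := Real.sqrt_le_sqrt hc
  have e0 := Real.sq_sqrt hc0.le
  have eR := Real.sq_sqrt (hd.c_pos R).le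
  have hH := Hf_mono_q hq0 hq (hd.q_lt_one R) (le_refl (0 : ℝ)) zero_le_one
  have hH0 : 2 / 3 ≤ Hf (d.q 0) 0 := by
    have := le_Hf_sub hq0 (hd.q_lt_one 0) (le_refl (0 : ℝ)) zero_le_one le_rfl
    rw [Hf_one] at this
    linarith
  have hq2 : d.q 0 * (d.q R - d.q 0) ≤ d.q R ^ 2 - d.q 0 ^ 2 := by nlinarith
  set a := Real.sqrt (d.c 0)
  set b := Real.sqrt (d.c R)
  have hinv : (d.c 0 - d.c R) / (2 * (d.c 0 * a)) ≤ 1 / b - 1 / a := by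
    rw [div_sub_div _ _ hsR.ne' hs0.ne', div_le_div_iff₀ (by positivity) (by positivity), ← e0, ← eR]
    have h3 : (a + b) * (b * a) ≤ 2 * (a ^ 2 * a) := by
      have : b * a ≤ a * a := by gcongr
      nlinarith [mul_pos hs0 hs0, mul_pos hsR hs0]
    have h4 := mul_le_mul_of_nonneg_left h3 (sub_nonneg.2 hss)
    nlinarith
  have hab : 1 / a ≤ 1 / b := one_div_le_one_div_of_le hsR hss
  have hΔ : 0 ≤ d.q 0 * (d.q R - d.q 0) / 5 := by
    have := mul_nonneg hq0.le (sub_nonneg.2 hq); linarith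
  have hmain : Hf (d.q 0) 0 * (1 / a) + 2 / 3 * ((d.c 0 - d.c R) / (2 * (d.c 0 * a)))
      + d.q 0 * (d.q R - d.q 0) / 5 * (1 / a) ≤ Hf (d.q R) 0 * (1 / b) := by
    have h5 : (Hf (d.q 0) 0 + d.q 0 * (d.q R - d.q 0) / 5) * (1 / b) ≤ Hf (d.q R) 0 * (1 / b) := by
      gcongr
      simp at hH
      linarith
    have h6 : Hf (d.q 0) 0 * (1 / a) + Hf (d.q 0) 0 * (1 / b - 1 / a) = Hf (d.q 0) 0 * (1 / b) := by
      ring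
    have h7 : 2 / 3 * ((d.c 0 - d.c R) / (2 * (d.c 0 * a))) ≤ Hf (d.q 0) 0 * (1 / b - 1 / a) := by
      have : 0 ≤ (d.c 0 - d.c R) / (2 * (d.c 0 * a)) := div_nonneg (by linarith) (by positivity)
      exact mul_le_mul hH0 hinv this (by linarith)
    have h8 := mul_le_mul_of_nonneg_left hab hΔ
    nlinarith
  have e1 : d.tauS 0 = Hf (d.q 0) 0 * (1 / a) := by simp only [tauS, tau_eq]; ring
  have e2 : d.tauS R = Hf (d.q R) 0 * (1 / b) := by simp only [tauS, tau_eq]; ring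
  rw [e1, e2]
  have h9 : k₁ * (d.c 0 - d.c R) ≤ 2 / 3 * ((d.c 0 - d.c R) / (2 * (d.c 0 * a))) := by
    have : 2 / 3 * ((d.c 0 - d.c R) / (2 * (d.c 0 * a)))
      = 1 / (3 * (d.c 0 * a)) * (d.c 0 - d.c R) := by field_simp
    rw [this]
    exact mul_le_mul_of_nonneg_right (min_le_left _ _) (by linarith)
  have h10 : k₁ * (d.q R - d.q 0) ≤ d.q 0 * (d.q R - d.q 0) / 5 * (1 / a) := by
    have : d.q 0 * (d.q R - d.q 0) / 5 * (1 / a) = d.q 0 / (5 * a) * (d.q R - d.q 0) := by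
      field_simp
    rw [this]
    exact mul_le_mul_of_nonneg_right (min_le_right _ _) (by linarith)
  have h11 := mul_le_mul_of_nonneg_left hR hk₁p.le
  nlinarith

/-- The remaining time τ_s(R) - t is an integral of about 2s² over [0,y], divided by √c. Evaluating
q and c at the surface makes the constant uniform in the cloud. The converse estimate is `cube_le`.
-/
theorem exists_cube_ge (hd : d.Admissible) : ∃ k > 0, ∀ t R, 0 ≤ R → R ≤ d.Rstar → 0 ≤ t →
    t < d.tauS R → k * (d.tauS R - t) ≤ d.yE (t, R) ^ 3 := by
  have hq1 := hd.q_lt_one d.Rstar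
  have hqp := hd.q_pos d.Rstar
  have hp : 0 < 1 - d.q d.Rstar ^ 2 := by nlinarith
  have hs := Real.sqrt_pos.2 hp
  have hc := hd.sqrt_c_pos d.Rstar
  refine ⟨3 / 2 * (Real.sqrt (1 - d.q d.Rstar ^ 2) * Real.sqrt (d.c d.Rstar)), by positivity,
    fun t R h0 h1 ht0 ht => ?_⟩
  obtain ⟨a0, a1, a2⟩ := hd.yE_spec (hd.mem_Mext ht0 ht)
  have hle := (hd.y_eq ht0 ht).2
  set y := d.yE (t, R)
  have h2 := Hf_sub_le (hd.q_pos R) (hd.q_lt_one R) (le_refl (0 : ℝ)) a0.le hle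
  have h3 : d.tauS R - t = (Hf (d.q R) 0 - Hf (d.q R) y) / Real.sqrt (d.c R) := by
    simp only at a2
    rw [← a2, tauS, tau_eq, tau_eq]; ring
  have hqR := hd.q_monotone h0 hd.Rstar_pos.le h1
  have hcR := hd.c_antitone h0 hd.Rstar_pos.le h1
  have hs' : Real.sqrt (1 - d.q d.Rstar ^ 2) ≤ Real.sqrt (1 - d.q R ^ 2) :=
    Real.sqrt_le_sqrt (by nlinarith [hd.q_pos R])
  have hc' := Real.sqrt_le_sqrt hcR
  have h4 : d.tauS R - t ≤ 2 / 3 * y ^ 3 /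
      (Real.sqrt (1 - d.q d.Rstar ^ 2) * Real.sqrt (d.c d.Rstar)) := by
    have hsR : 0 < Real.sqrt (1 - d.q R ^ 2) := hs.trans_le hs'
    rw [h3]
    calc (Hf (d.q R) 0 - Hf (d.q R) y) / Real.sqrt (d.c R)
        ≤ (2 / 3 * (y ^ 3 - 0 ^ 3) / Real.sqrt (1 - d.q R ^ 2)) / Real.sqrt (d.c R) := by
          have := hd.sqrt_c_pos R
          gcongr
      _ = 2 / 3 * y ^ 3 / (Real.sqrt (1 - d.q R ^ 2) * Real.sqrt (d.c R)) := by
          rw [div_div]; norm_num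
      _ ≤ _ := by gcongr
  rw [le_div_iff₀ (by positivity)] at h4
  nlinarith

theorem cube_le (hd : d.Admissible) {t R : ℝ} (h0 : 0 ≤ R) (ht0 : 0 ≤ t) (ht : t < d.tauS R) :
    d.yE (t, R) ^ 3 ≤ 3 / 2 * Real.sqrt (d.c 0) * (d.tauS R - t) := by
  obtain ⟨a0, a1, a2⟩ := hd.yE_spec (hd.mem_Mext ht0 ht)
  have hle := (hd.y_eq ht0 ht).2
  set y := d.yE (t, R)
  have h2 := le_Hf_sub (hd.q_pos R) (hd.q_lt_one R) (le_refl (0 : ℝ)) a0.le hle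
  have hcR := hd.sqrt_c_pos R
  have h3 : d.tauS R - t = (Hf (d.q R) 0 - Hf (d.q R) y) / Real.sqrt (d.c R) := by
    simp only at a2
    rw [← a2, tauS, tau_eq, tau_eq]; ring
  have h4 : Real.sqrt (d.c R) * (d.tauS R - t) = Hf (d.q R) 0 - Hf (d.q R) y := by
    rw [h3]; field_simp
  have h5 := Real.sqrt_le_sqrt (hd.c_antitone (mem_Ici.2 le_rfl) h0 h0)
  have h6 := mul_le_mul_of_nonneg_right h5 (sub_nonneg.2 ht.le)
  nlinarith

theorem tauR_zero (hd : d.Admissible) {y : ℝ} (h0 : 0 ≤ y) (h1 : y ≤ 1) : d.tauR y 0 = 0 := by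
  have hlt : d.q 0 * y < 1 := by nlinarith [hd.q_pos 0, hd.q_lt_one 0]
  have h2 := hasDerivAt_pdR ((hd.contDiffAt_tau h0 hlt).differentiableAt (by simp))
  rw [tauR, ← h2.deriv]
  exact deriv_zero_of_even fun x => hd.tau_neg y x

/-- At fixed y the function τ(y,·) is even, so its R-derivative vanishes at 0. The second derivative
is bounded on the compact set of (y,R). -/
theorem exists_tauR_le (hd : d.Admissible) : ∃ C > 0, (∀ y R, 0 ≤ y → y ≤ 1 → 0 ≤ R →
    R ≤ d.Rstar → |d.tauR y R| ≤ C * R) ∧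
    ∀ R, 0 ≤ R → R ≤ d.Rstar → d.tauS R ≤ d.tauS 0 + C * R ^ 2 := by
  have hlt : ∀ y R, 0 ≤ y → y ≤ 1 → d.q R * y < 1 := fun y R h0 h1 => by
    nlinarith [hd.q_pos R, hd.q_lt_one R]
  have hsm : ∀ p ∈ Icc (0 : ℝ) 1 ×ˢ Icc 0 d.Rstar,
      ContDiffAt ℝ ∞ (pdR fun z : ℝ × ℝ => d.tau z.1 z.2) p := fun p hp =>
    (hd.contDiffAt_tau hp.1.1 (hlt p.1 p.2 hp.1.1 hp.1.2)).pdR_infty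
  obtain ⟨C, hC⟩ := ((isCompact_Icc (a := (0 : ℝ)) (b := 1)).prod
    (isCompact_Icc (a := 0) (b := d.Rstar))).exists_bound_of_continuousOn
    (f := pdR (pdR fun z : ℝ × ℝ => d.tau z.1 z.2))
    fun p hp => (hsm p hp).pdR_infty.continuousAt.continuousWithinAt
  have hC' : 0 < max C 1 := by positivity
  have key : ∀ y R, 0 ≤ y → y ≤ 1 → 0 ≤ R → R ≤ d.Rstar → |d.tauR y R| ≤ max C 1 * R := by
    intro y R hy0 hy1 hR0 hR1
    have := Convex.norm_image_sub_le_of_norm_hasDerivWithin_le (f := fun R => d.tauR y R)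
      (f' := fun R => pdR (pdR fun z : ℝ × ℝ => d.tau z.1 z.2) (y, R)) (s := Icc 0 d.Rstar)
      (C := max C 1) (x := 0) (y := R)
      (fun x hx => (hasDerivAt_pdR ((hsm (y, x) ⟨⟨hy0, hy1⟩, hx⟩).differentiableAt
        (by simp))).hasDerivWithinAt)
      (fun x hx => (hC (y, x) ⟨⟨hy0, hy1⟩, hx⟩).trans (le_max_left _ _)) (convex_Icc _ _)
      ⟨le_rfl, hd.Rstar_pos.le⟩ ⟨hR0, hR1⟩
    simp only [hd.tauR_zero hy0 hy1, sub_zero, Real.norm_eq_abs, abs_of_nonneg hR0] at this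
    exact this
  refine ⟨max C 1, hC', key, fun R hR0 hR1 => ?_⟩
  have := Convex.norm_image_sub_le_of_norm_hasDerivWithin_le (f := fun R => d.tauS R)
    (f' := fun R => d.tauR 0 R) (s := Icc 0 R) (C := max C 1 * R) (x := 0) (y := R)
    (fun x hx => (hasDerivAt_pdR ((hd.contDiffAt_tau le_rfl (by simp)).differentiableAt
      (by simp))).hasDerivWithinAt)
    (fun x hx => (key 0 x le_rfl zero_le_one hx.1 (hx.2.trans hR1)).trans
      (mul_le_mul_of_nonneg_left hx.2 hC'.le)) (convex_Icc _ _)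
    ⟨le_rfl, hR0⟩ ⟨hR0, le_rfl⟩
  simp only [sub_zero, Real.norm_eq_abs, abs_of_nonneg hR0] at this
  have := (le_abs_self _).trans this
  nlinarith

set_option maxHeartbeats 600000 in
/-- Near the singular point the curves `τ - τ_s(0) = ε R²` are timelike. -/
theorem exists_barrier (hd : d.Admissible) {k : ℝ} (hk : 0 < k)
    (hτ : ∀ R, 0 ≤ R → R ≤ d.Rstar → d.tauS 0 + k * R ^ 2 ≤ d.tauS R) :
    ∃ η > 0, ∀ t R, 0 < R → t - d.tauS 0 = k / 2 * R ^ 2 → t - d.tauS 0 ≤ η →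
      t < d.tauS R → 1 < k * R * d.gE (t, R) := by
  obtain ⟨k₁, hk₁, hcube⟩ := hd.exists_cube_ge
  obtain ⟨C, hC, hτR, hτS⟩ := hd.exists_tauR_le
  have hc0 := hd.sqrt_c_pos 0
  -- lower bound of `√(1+2E)`
  obtain ⟨Rm, hRm, hmin⟩ := (isCompact_Icc (a := 0) (b := d.Rstar)).exists_isMinOn
    ⟨0, left_mem_Icc.2 hd.Rstar_pos.le⟩ (f := fun R => Real.sqrt (1 + 2 * d.E R))
    (Real.continuous_sqrt.comp (continuous_const.add
      (continuous_const.mul hd.contDiff_E.continuous))).continuousOn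
  set W₀ := Real.sqrt (1 + 2 * d.E Rm)
  have hW₀ : 0 < W₀ := hd.sqrt_E_pos Rm
  -- On the curve the remaining time lies between (k/2)R² and CR². This gives y³ ≤ C₃R² and r' ≤
  -- C₄y². Hence r' is of order R^(4/3), smaller than R near the centre, and γ exceeds the slope
  -- 1/(kR) of the curve.
  set C₃ := 3 / 2 * Real.sqrt (d.c 0) * C with hC₃
  set C₄ := 1 + C * Real.sqrt (d.c 0) / (k₁ * (k / 2)) with hC₄
  have hC₃p : 0 < C₃ := by positivity
  have hC₄p : 0 < C₄ := by positivity
  set μ := k * W₀ / C₄ with hμ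
  have hμp : 0 < μ := by positivity
  set R₂ := min d.Rstar (μ ^ 3 / C₃ ^ 2) / 2 with hR₂
  have hm1 : 0 < min d.Rstar (μ ^ 3 / C₃ ^ 2) := lt_min hd.Rstar_pos (by positivity)
  have hR₂p : 0 < R₂ := by positivity
  refine ⟨k / 2 * R₂ ^ 2, by positivity, fun t R hR hz hη ht => ?_⟩
  have hRR₂ : R ≤ R₂ := by
    rw [hz] at hη
    have : R ^ 2 ≤ R₂ ^ 2 := le_of_mul_le_mul_left hη (by positivity)
    exact le_of_sq_le_sq this hR₂p.le
  have hRs : R ≤ d.Rstar := hRR₂.trans (by rw [hR₂]; linarith [min_le_left d.Rstar (μ ^ 3 / C₃ ^ 2)])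
  have hRμ : R < μ ^ 3 / C₃ ^ 2 := by
    have := min_le_right d.Rstar (μ ^ 3 / C₃ ^ 2)
    have h2 : R₂ < min d.Rstar (μ ^ 3 / C₃ ^ 2) := by rw [hR₂]; linarith
    linarith
  have ht0 : 0 ≤ t := by
    have := hd.tauS_pos 0
    have : 0 ≤ k / 2 * R ^ 2 := by positivity
    linarith
  have hp := hd.mem_Mext ht0 ht
  have hy := hd.yE_pos ht0 ht
  have hy1 := (hd.y_eq ht0 ht).2
  have h3 := hcube t R hR.le hRs ht0 ht
  have h4 := hd.cube_le hR.le ht0 ht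
  have h5 := hτ R hR.le hRs
  have h6 := hτS R hR.le hRs
  have hτRb := hτR (d.yE (t, R)) R hy.le hy1 hR.le hRs
  have hyR := hd.pdR_yE hp
  have hrR := hd.rR_eq hp
  have hs1 : Real.sqrt (1 - (d.q R * d.yE (t, R)) ^ 2) ≤ 1 :=
    Real.sqrt_le_one.2 (by nlinarith [sq_nonneg (d.q R * d.yE (t, R))])
  have hs0 := Real.sqrt_nonneg (1 - (d.q R * d.yE (t, R)) ^ 2)
  have hcc := Real.sqrt_le_sqrt (hd.c_antitone (mem_Ici.2 le_rfl) hR.le hR.le)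
  have hcR := hd.sqrt_c_pos R
  have hWR : W₀ ≤ Real.sqrt (1 + 2 * d.E R) := hmin ⟨hR.le, hRs⟩
  have hrRp := hd.rR_pos ht0 ht
  set y := d.yE (t, R)
  simp only at hyR hrR
  set σ := Real.sqrt (1 - (d.q R * y) ^ 2)
  have hlow : k₁ * (k / 2) * R ^ 2 ≤ y ^ 3 := by
    have : k / 2 * R ^ 2 ≤ d.tauS R - t := by linarith
    have := mul_le_mul_of_nonneg_left this hk₁.le
    linarith
  have hup : y ^ 3 ≤ C₃ * R ^ 2 := by
    have h7 : d.tauS R - t ≤ C * R ^ 2 := by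
      have : 0 ≤ k / 2 * R ^ 2 := by positivity
      linarith
    have := mul_le_mul_of_nonneg_left h7 (show 0 ≤ 3 / 2 * Real.sqrt (d.c 0) by positivity)
    rw [hC₃]; linarith
  have hrle : d.rR (t, R) ≤ C₄ * y ^ 2 := by
    have h8 : d.tauR y R * (σ * Real.sqrt (d.c R)) ≤ C * R * Real.sqrt (d.c 0) := by
      have h9 : σ * Real.sqrt (d.c R) ≤ 1 * Real.sqrt (d.c 0) := mul_le_mul hs1 hcc hcR.le zero_le_one
      rw [one_mul] at h9
      exact mul_le_mul ((le_abs_self _).trans hτRb) h9 (by positivity) (by positivity)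
    have h10 : 2 * R * y * pdR d.yE (t, R) ≤ C * Real.sqrt (d.c 0) * R ^ 2 / y := by
      rw [hyR]
      have e : 2 * R * y * (d.tauR y R * (σ * Real.sqrt (d.c R)) / (2 * y ^ 2))
        = R * (d.tauR y R * (σ * Real.sqrt (d.c R))) / y := by field_simp
      rw [e]
      have : R * (d.tauR y R * (σ * Real.sqrt (d.c R))) ≤ C * Real.sqrt (d.c 0) * R ^ 2 := by
        calc _ ≤ R * (C * R * Real.sqrt (d.c 0)) := mul_le_mul_of_nonneg_left h8 hR.le
          _ = _ := by ring
      exact div_le_div_of_nonneg_right this hy.le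
    have h11 : C * Real.sqrt (d.c 0) * R ^ 2 / y ≤ C * Real.sqrt (d.c 0) / (k₁ * (k / 2)) * y ^ 2 := by
      rw [div_le_iff₀ hy, div_mul_eq_mul_div, div_mul_eq_mul_div, le_div_iff₀ (by positivity)]
      calc _ = C * Real.sqrt (d.c 0) * (k₁ * (k / 2) * R ^ 2) := by ring
        _ ≤ C * Real.sqrt (d.c 0) * y ^ 3 := mul_le_mul_of_nonneg_left hlow (by positivity)
        _ = _ := by ring
    rw [hrR, hC₄]
    linarith
  have hyμ : y ^ 2 < μ * R := by
    by_contra hcon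
    push Not at hcon
    have h12 : (μ * R) ^ 3 ≤ (y ^ 2) ^ 3 := pow_le_pow_left₀ (by positivity) hcon 3
    have h13 : (y ^ 3) ^ 2 ≤ (C₃ * R ^ 2) ^ 2 := pow_le_pow_left₀ (by positivity) hup 2
    have h14 : μ ^ 3 * R ^ 3 ≤ C₃ ^ 2 * R * R ^ 3 := by
      calc _ = (μ * R) ^ 3 := by ring
        _ ≤ (y ^ 2) ^ 3 := h12
        _ = (y ^ 3) ^ 2 := by ring
        _ ≤ _ := h13
        _ = _ := by ring
    have h15 : μ ^ 3 ≤ C₃ ^ 2 * R := le_of_mul_le_mul_right h14 (by positivity)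
    rw [lt_div_iff₀ (by positivity)] at hRμ
    linarith
  have hfin : d.rR (t, R) < k * R * W₀ := by
    have : C₄ * y ^ 2 < C₄ * (μ * R) := by gcongr
    have e : C₄ * (μ * R) = k * R * W₀ := by rw [hμ]; field_simp
    linarith
  have hg : W₀ / d.rR (t, R) ≤ d.gE (t, R) := by
    rw [gE]
    exact div_le_div_of_nonneg_right hWR hrRp.le
  have h16 : 1 < k * R * (W₀ / d.rR (t, R)) := by
    rw [← mul_div_assoc, lt_div_iff₀ hrRp, one_mul]; exact hfin
  have := mul_le_mul_of_nonneg_left hg (show 0 ≤ k * R by positivity)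
  linarith

/-- A ray from the initial surface to a point `R ≥ 0` later than the first singular point
passes at positive radius at the time of the first singular point. -/
theorem ray_pos (hd : d.Admissible) {α : ℝ → ℝ} {T : ℝ} (hα : d.IsRayOn α 0 T) (hR : 0 ≤ α T)
    (hT : d.tauS 0 ≤ T) : 0 < α (d.tauS 0) := by
  have h0 := (hd.tauS_pos 0).le
  by_contra hc
  push Not at hc
  obtain ⟨s, hs, hs0⟩ := intermediate_value_Icc hT
    (hα.continuousOn.mono (Icc_subset_Icc h0 le_rfl)) (show (0 : ℝ) ∈ _ from ⟨hc, hR⟩)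
  have := (hα s ⟨h0.trans hs.1, hs.2⟩).2.1
  rw [hs0] at this
  linarith [hs.1]

/-- A ray of the development has positive radius at time τ_s(0) and so starts below the curve. At a
contact, (k/2)R² - (t - τ_s(0)) has derivative kRγ - 1 > 0 along the ray, which forbids crossing. -/
theorem barrier_G (hd : d.Admissible) {k η : ℝ} (hk : 0 < k) (hη : ∀ t R, 0 < R →
      t - d.tauS 0 = k / 2 * R ^ 2 → t - d.tauS 0 ≤ η → t < d.tauS R → 1 < k * R * d.gE (t, R))
    {t R : ℝ} (h : (t, R) ∈ d.G) (hR : 0 ≤ R) (h1 : d.tauS 0 ≤ t) (h2 : t - d.tauS 0 ≤ η) :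
    t - d.tauS 0 ≤ k / 2 * R ^ 2 := by
  obtain ⟨hT, α, hα, e⟩ := h
  simp only at hT hα e
  have h0 := (hd.tauS_pos 0).le
  have hpos := hd.ray_pos hα (by rw [e]; exact hR) h1
  have hmono := (hd.ray_strictMono hα).monotoneOn
  have hsub : ∀ s ∈ Icc (d.tauS 0) t, s ∈ Icc 0 t := fun s hs => ⟨h0.trans hs.1, hs.2⟩
  have hαp : ∀ s ∈ Icc (d.tauS 0) t, 0 < α s := fun s hs =>
    hpos.trans_le (hmono ⟨h0, h1⟩ (hsub s hs) hs.1)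
  have hD : ∀ s ∈ Icc (d.tauS 0) t, HasDerivAt (fun s => k / 2 * α s ^ 2 - (s - d.tauS 0))
      (k / 2 * (2 * α s * d.gE (s, α s)) - 1) s := fun s hs => by
    have h3 := (((hα s (hsub s hs)).2.2.pow 2).const_mul (k / 2)).sub
      ((hasDerivAt_id s).sub_const (d.tauS 0))
    refine h3.congr_deriv ?_
    norm_num
  have := nonneg_of_deriv_pos_at_zeros h1
    (fun s hs => (hD s hs).continuousAt.continuousWithinAt)
    (fun s hs => hD s ⟨hs.1, hs.2.le⟩) (fun s hs hs0 => ?_) (by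
      have := hpos; simp only [sub_self, sub_zero]; positivity)
  · simp only [e] at this
    linarith
  · have hs' : s ∈ Icc (d.tauS 0) t := ⟨hs.1, hs.2.le⟩
    have := hη s (α s) (hαp s hs') (by linarith) (by linarith [hs.2]) (hα s (hsub s hs')).2.1
    linarith

end Admissible
end TBData
end

noncomputable section
namespace TBData
variable {d : TBData}

/-! ### Consequences of global nakedness -/

/-- A light ray from the singularity to the surface of the cloud. -/
structure IsNakedRay (d : TBData) (τ₁ : ℝ) (ϱ : ℝ → ℝ) : Prop where
  lt : d.tauS 0 < τ₁
  pos : ∀ t ∈ Ioc (d.tauS 0) τ₁, 0 < ϱ t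
  lt_tauS : ∀ t ∈ Ioc (d.tauS 0) τ₁, t < d.tauS (ϱ t)
  cont : ContinuousOn ϱ (Ioc (d.tauS 0) τ₁)
  deriv : ∀ t ∈ Ioo (d.tauS 0) τ₁, HasDerivAt ϱ (d.gE (t, ϱ t)) t
  lim : Tendsto ϱ (𝓝[>] (d.tauS 0)) (𝓝 0)
  surface : ϱ τ₁ = d.Rstar
  untrapped : 2 * d.m d.Rstar < d.rE (τ₁, d.Rstar)

theorem GloballyNaked.exists_nakedRay (hd : d.Admissible) (hn : d.GloballyNaked) :
    ∃ τ₁ ϱ, d.IsNakedRay τ₁ ϱ := by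
  obtain ⟨τ₁, ϱ, h1, h2, h3, h4, h5, h6, h7⟩ := hn
  have h0 := (hd.tauS_pos 0).le
  refine ⟨τ₁, ϱ, h1, fun t ht => (h2 t ht).1, fun t ht => (h2 t ht).2, h3, fun t ht => ?_, h5, h6, ?_⟩
  · rw [← hd.γ_eq (h0.trans ht.1.le) (h2 t ⟨ht.1, ht.2.le⟩).2]; exact h4 t ht
  · have := (h2 τ₁ ⟨h1, le_rfl⟩).2
    rw [h6] at this
    rwa [← hd.r_eq (h0.trans h1.le) this]

namespace IsNakedRay

variable {τ₁ : ℝ} {ϱ : ℝ → ℝ}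

theorem isRayOn (hϱ : d.IsNakedRay τ₁ ϱ) (hd : d.Admissible) {a b : ℝ} (ha : d.tauS 0 < a)
    (hb : b < τ₁) : d.IsRayOn ϱ a b := fun t ht =>
  ⟨(hd.tauS_pos 0).le.trans (ha.le.trans ht.1),
    hϱ.lt_tauS t ⟨ha.trans_le ht.1, ht.2.trans hb.le⟩, hϱ.deriv t ⟨ha.trans_le ht.1, ht.2.trans_lt hb⟩⟩

theorem strictMono (hϱ : d.IsNakedRay τ₁ ϱ) (hd : d.Admissible) :
    StrictMonoOn ϱ (Ioc (d.tauS 0) τ₁) :=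
  strictMonoOn_of_deriv_pos (convex_Ioc _ _) hϱ.cont fun t ht => by
    rw [interior_Ioc] at ht
    rw [(hϱ.deriv t ht).deriv]
    exact hd.gE_pos ((hd.tauS_pos 0).le.trans ht.1.le) (hϱ.lt_tauS t ⟨ht.1, ht.2.le⟩)

/-- A ray of the development that is inside the naked ray at one time would remain inside back to
τ_s(0). There the naked ray shrinks to the centre, while the other has positive radius by `ray_pos`.
-/
theorem le_of_mem_G (hϱ : d.IsNakedRay τ₁ ϱ) (hd : d.Admissible) {t R : ℝ} (h : (t, R) ∈ d.G)
    (hR : 0 ≤ R) (h1 : d.tauS 0 < t) (h2 : t ≤ τ₁) : ϱ t ≤ R := by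
  have key : ∀ t R, (t, R) ∈ d.G → 0 ≤ R → d.tauS 0 < t → t < τ₁ → ϱ t ≤ R := by
    intro t R h hR h1 h2
    obtain ⟨hT, α, hα, e⟩ := h
    simp only at hT hα e
    have hpos := hd.ray_pos hα (by rw [e]; exact hR) h1.le
    by_contra hc
    push Not at hc
    have hlt : ∀ s ∈ Ioc (d.tauS 0) t, α s < ϱ s := by
      intro s hs
      have h0 := (hd.tauS_pos 0).le
      exact hd.ray_lt (hα.mono (h0.trans hs.1.le) le_rfl) (hϱ.isRayOn hd hs.1 h2)
        (right_mem_Icc.2 hs.2) (by rw [e]; exact hc) s (left_mem_Icc.2 hs.2)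
    have h3 : Tendsto α (𝓝[>] (d.tauS 0)) (𝓝 (α (d.tauS 0))) :=
      (hα _ ⟨(hd.tauS_pos 0).le, h1.le⟩).2.2.continuousAt.tendsto.mono_left nhdsWithin_le_nhds
    have := le_of_tendsto_of_tendsto h3 hϱ.lim (by
      filter_upwards [Ioc_mem_nhdsGT h1] with s hs using (hlt s hs).le)
    linarith
  -- At τ₁ the naked ray is only known to be continuous, so the endpoint is reached as a limit of
  -- earlier times.
  rcases h2.eq_or_lt with he | hlt
  · subst he
    obtain ⟨hT, α, hα, e⟩ := h
    simp only at hT hα e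
    have h0 := (hd.tauS_pos 0).le
    have hpos := hd.ray_pos hα (by rw [e]; exact hR) h1.le
    have hmono := (hd.ray_strictMono hα).monotoneOn
    have hcl : t ∈ closure (Ioo (d.tauS 0) t) := by
      rw [closure_Ioo h1.ne]; exact right_mem_Icc.2 h1.le
    rw [← e]
    refine ContinuousWithinAt.closure_le hcl
      ((hϱ.cont t ⟨h1, le_rfl⟩).mono Ioo_subset_Ioc_self)
      (hα t (right_mem_Icc.2 hT)).2.2.continuousAt.continuousWithinAt fun s hs => ?_
    refine key s (α s) (hd.mem_G_of_ray hα (h0.trans hs.1.le) hs.2.le) ?_ hs.1 hs.2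
    exact hpos.le.trans (hmono ⟨h0, h1.le⟩ ⟨h0.trans hs.1.le, hs.2.le⟩ hs.1.le)
  · exact key t R h hR h1 hlt

/-- The past ray from such a point is at or beyond the surface at time τ₁ and moves strictly
outwards afterwards. -/
theorem Rstar_lt_of_mem_G (hϱ : d.IsNakedRay τ₁ ϱ) (hd : d.Admissible) {t R : ℝ}
    (h : (t, R) ∈ d.G) (hR : 0 ≤ R) (h1 : τ₁ < t) : d.Rstar < R := by
  obtain ⟨hT, α, hα, e⟩ := h
  simp only at hT hα e
  have h0 := (hd.tauS_pos 0).le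
  have hτ₁ : 0 ≤ τ₁ := h0.trans hϱ.lt.le
  have hpos := hd.ray_pos hα (by rw [e]; exact hR) (hϱ.lt.le.trans h1.le)
  have hmono := hd.ray_strictMono hα
  have h2 := hϱ.le_of_mem_G hd (hd.mem_G_of_ray hα hτ₁ h1.le)
    (hpos.le.trans (hmono.monotoneOn ⟨h0, hϱ.lt.le.trans h1.le⟩ ⟨hτ₁, h1.le⟩ hϱ.lt.le)) hϱ.lt le_rfl
  rw [hϱ.surface] at h2
  rw [← e]
  exact h2.trans_lt (hmono ⟨hτ₁, h1.le⟩ (right_mem_Icc.2 hT) h1)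

end IsNakedRay

namespace Admissible

theorem rE_pos (hd : d.Admissible) {t R : ℝ} (h0 : 0 ≤ t) (h1 : t < d.tauS R) (hR : 0 < R) :
    0 < d.rE (t, R) := mul_pos hR (pow_pos (hd.yE_pos h0 h1) 2)

theorem rE_anti (hd : d.Admissible) {t₁ t₂ R : ℝ} (h0 : 0 ≤ t₁) (h : t₁ ≤ t₂)
    (h1 : t₂ < d.tauS R) (hR : 0 ≤ R) : d.rE (t₂, R) ≤ d.rE (t₁, R) := by
  have h2 := hd.yE_anti_t (hd.mem_Mext h0 (h.trans_lt h1)) (hd.mem_Mext (h0.trans h) h1) h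
  have h3 := (hd.yE_pos (h0.trans h) h1).le
  unfold rE
  simp only
  gcongr

theorem rT_neg (hd : d.Admissible) {t R : ℝ} (h : (t, R) ∈ d.Mext) (hR : 0 < R) :
    d.rT (t, R) < 0 := by
  rw [hd.rT_eq h, neg_lt_zero]
  have := (hd.yE_spec h).1
  have := Real.sqrt_pos.2 (hd.one_sub_sq_pos h)
  have := hd.sqrt_c_pos R
  simp only at *
  positivity

/-- The rate of change of `r` along outgoing rays is positive iff the point is untrapped. -/
theorem rT_add_sqrt (hd : d.Admissible) {t R : ℝ} (h : (t, R) ∈ d.Mext) (hR : 0 < R) :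
    (2 * d.m R < d.rE (t, R) → 0 < d.rT (t, R) + Real.sqrt (1 + 2 * d.E R)) ∧
    (d.rE (t, R) ≤ 2 * d.m R → d.rT (t, R) + Real.sqrt (1 + 2 * d.E R) ≤ 0) := by
  have hsq := hd.rT_sq h (show (t, R).2 ≠ 0 from hR.ne')
  have hneg := hd.rT_neg h hR
  have hW := hd.sqrt_E_pos R
  have hW2 := Real.sq_sqrt (hd.E_pos R).le
  have hr : 0 < d.rE (t, R) := mul_pos hR (pow_pos (hd.yE_spec h).1 2)
  simp only at hsq
  constructor
  · intro h1
    have : 2 * d.m R / d.rE (t, R) < 1 := by rwa [div_lt_one hr]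
    nlinarith
  · intro h1
    have : 1 ≤ 2 * d.m R / d.rE (t, R) := by rwa [one_le_div hr]
    nlinarith

/-- Derivative of `r` along an outgoing ray. -/
theorem hasDerivAt_rE_ray (hd : d.Admissible) {α : ℝ → ℝ} {t : ℝ} (h0 : 0 ≤ t)
    (h1 : t < d.tauS (α t)) (hα : HasDerivAt α (d.gE (t, α t)) t) :
    HasDerivAt (fun s => d.rE (s, α s))
      (d.rT (t, α t) + Real.sqrt (1 + 2 * d.E (α t))) t := by
  have h2 := hasDerivAt_comp_curve
    ((hd.contDiffAt_rE (hd.mem_Mext h0 h1)).differentiableAt (by simp)) hα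
  refine h2.congr_deriv ?_
  have h3 := (hd.rR_pos h0 h1).ne'
  have e : d.gE (t, α t) * pdR d.rE (t, α t) = Real.sqrt (1 + 2 * d.E (α t)) := by
    rw [gE]; exact div_mul_cancel₀ _ h3
  rw [e]; rfl

end Admissible

namespace IsNakedRay

variable {τ₁ : ℝ} {ϱ : ℝ → ℝ}

/-- The naked ray is untrapped. -/
theorem two_m_lt (hϱ : d.IsNakedRay τ₁ ϱ) (hd : d.Admissible) {t : ℝ}
    (ht : t ∈ Ioc (d.tauS 0) τ₁) : 2 * d.m (ϱ t) < d.rE (t, ϱ t) := by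
  by_contra hc
  push Not at hc
  have h0 := (hd.tauS_pos 0).le
  have hsub : ∀ s ∈ Icc t τ₁, s ∈ Ioc (d.tauS 0) τ₁ := fun s hs => ⟨ht.1.trans_le hs.1, hs.2⟩
  have hcont : ContinuousOn (fun s => 2 * d.m (ϱ s) - d.rE (s, ϱ s)) (Icc t τ₁) := by
    have hc1 : ContinuousOn ϱ (Icc t τ₁) := hϱ.cont.mono hsub
    refine (continuousOn_const.mul (hd.contDiff_m.continuous.comp_continuousOn hc1)).sub ?_
    intro s hs
    have h2 := (hd.contDiffAt_rE (hd.mem_Mext (h0.trans (hsub s hs).1.le)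
      (hϱ.lt_tauS s (hsub s hs)))).continuousAt
    exact ContinuousAt.comp_continuousWithinAt (f := fun s => (s, ϱ s)) h2
      (continuousWithinAt_id.prodMk (hc1 s hs))
  -- Once the ray is trapped it stays so up to the surface. At a zero of 2m - r the radius r does
  -- not increase along the ray, while m strictly increases inside the cloud. This contradicts the
  -- untrapped endpoint.
  have := nonneg_of_deriv_pos_at_zeros (φ' := fun s =>
      2 * (4 * Real.pi * (d.ρ₀ (ϱ s) * ϱ s ^ 2) * d.gE (s, ϱ s))
        - (d.rT (s, ϱ s) + Real.sqrt (1 + 2 * d.E (ϱ s)))) ht.2 hcont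
    (fun s hs => ?_) (fun s hs hs0 => ?_) (by linarith)
  · simp only [hϱ.surface] at this
    linarith [hϱ.untrapped]
  · have hs' : s ∈ Ioo (d.tauS 0) τ₁ := ⟨ht.1.trans_le hs.1, hs.2⟩
    have hD := hϱ.deriv s hs'
    have hlt := hϱ.lt_tauS s ⟨hs'.1, hs'.2.le⟩
    have h1 := ((hd.hasDerivAt_m (ϱ s)).comp s hD).const_mul 2
    exact h1.sub (hd.hasDerivAt_rE_ray (h0.trans hs'.1.le) hlt hD)
  · have hs' : s ∈ Ioc (d.tauS 0) τ₁ := ⟨ht.1.trans_le hs.1, hs.2.le⟩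
    have hlt := hϱ.lt_tauS s hs'
    have hp := hϱ.pos s hs'
    have h0s := h0.trans hs'.1.le
    have h1 := (hd.rT_add_sqrt (hd.mem_Mext h0s hlt) hp).2 (by linarith)
    have h2 : ϱ s < d.Rstar := by
      rw [← hϱ.surface]
      exact hϱ.strictMono hd hs' ⟨hϱ.lt, le_rfl⟩ hs.2
    have h3 := hd.density_pos _ hp.le h2
    have h4 := hd.gE_pos h0s hlt
    have : 0 < 2 * (4 * Real.pi * (d.ρ₀ (ϱ s) * ϱ s ^ 2) * d.gE (s, ϱ s)) := by positivity
    linarith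

/-- Exterior points of the development stay away from the horizon. -/
theorem rE_ge_of_exterior (hϱ : d.IsNakedRay τ₁ ϱ) (hd : d.Admissible) {t R : ℝ}
    (h : (t, R) ∈ d.G) (hR : d.Rstar ≤ R) : d.rE (τ₁, d.Rstar) ≤ d.rE (t, R) := by
  obtain ⟨hT, α, hα, e⟩ := h
  simp only at hT hα e
  have hRs := hd.Rstar_pos
  have h0 := (hd.tauS_pos 0).le
  have hτ₁ : 0 ≤ τ₁ := h0.trans hϱ.lt.le
  have hlt₁ : τ₁ < d.tauS d.Rstar := by
    have := hϱ.lt_tauS τ₁ ⟨hϱ.lt, le_rfl⟩; rwa [hϱ.surface] at this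
  have hmono := (hd.ray_strictMono hα).monotoneOn
  -- the ray enters the exterior with large areal radius
  obtain ⟨s₀, hs₀, hαs, hrs⟩ : ∃ s₀ ∈ Icc 0 t, d.Rstar ≤ α s₀ ∧
      d.rE (τ₁, d.Rstar) ≤ d.rE (s₀, α s₀) := by
    rcases le_total d.Rstar (α 0) with hc | hc
    · refine ⟨0, left_mem_Icc.2 hT, hc, ?_⟩
      have h1 := hd.rE_anti le_rfl hτ₁ hlt₁ hRs.le
      simp only [rE, hd.yE_zero] at h1 ⊢
      linarith
    · obtain ⟨s, hs, hse⟩ := intermediate_value_Icc hT hα.continuousOn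
        (show d.Rstar ∈ _ from ⟨hc, by rw [e]; exact hR⟩)
      refine ⟨s, hs, hse.ge, ?_⟩
      have hsτ : s ≤ τ₁ := by
        by_contra hcon
        push Not at hcon
        have := hϱ.Rstar_lt_of_mem_G hd (hd.mem_G_of_ray hα hs.1 hs.2) (by rw [hse]; exact hRs.le) hcon
        linarith
      rw [hse]
      exact hd.rE_anti hs.1 hsτ hlt₁ hRs.le
  have hm : ∀ R, d.Rstar ≤ R → d.m R = d.m d.Rstar := by
    intro R hR
    have hDm : ∀ s ∈ Icc d.Rstar R, HasDerivWithinAt d.m 0 (Icc d.Rstar R) s := fun s hs => by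
      have := hd.hasDerivAt_m s
      rw [hd.density_zero s hs.1] at this
      simpa using this.hasDerivWithinAt
    have := constant_of_derivWithin_zero (f := d.m) (a := d.Rstar) (b := R)
      (fun s hs => (hDm s hs).differentiableWithinAt)
      (fun s hs => (hDm s ⟨hs.1, hs.2.le⟩).derivWithin
        (uniqueDiffOn_Icc (hs.1.trans_lt hs.2) s ⟨hs.1, hs.2.le⟩)) R (right_mem_Icc.2 hR)
    exact this
  by_contra hc
  push Not at hc
  -- The level ℓ lies above 2m and below the entrance value of r. In the exterior m is constant, so
  -- r increases along the ray whenever r = ℓ and cannot fall below ℓ.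
  obtain ⟨ℓ, hℓ1, hℓ2⟩ := exists_between (max_lt hc hϱ.untrapped)
  have hsub : ∀ s ∈ Icc s₀ t, s ∈ Icc 0 t := fun s hs => ⟨hs₀.1.trans hs.1, hs.2⟩
  have hD : ∀ s ∈ Icc s₀ t, HasDerivAt (fun s => d.rE (s, α s) - ℓ)
      (d.rT (s, α s) + Real.sqrt (1 + 2 * d.E (α s))) s := fun s hs => by
    have h1 := hα s (hsub s hs)
    exact (hd.hasDerivAt_rE_ray h1.1 h1.2.1 h1.2.2).sub_const ℓ
  have := nonneg_of_deriv_pos_at_zeros hs₀.2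
    (fun s hs => (hD s hs).continuousAt.continuousWithinAt)
    (fun s hs => hD s ⟨hs.1, hs.2.le⟩) (fun s hs hs0 => ?_) (by linarith)
  · simp only [e] at this
    have := (le_max_left _ _).trans_lt hℓ1
    linarith
  · have hs' : s ∈ Icc s₀ t := ⟨hs.1, hs.2.le⟩
    have h1 := hα s (hsub s hs')
    have h2 : d.Rstar ≤ α s := hαs.trans (hmono hs₀ (hsub s hs') hs.1)
    refine (hd.rT_add_sqrt (hd.mem_Mext h1.1 h1.2.1) (hRs.trans_le h2)).1 ?_
    rw [hm _ h2]
    have := (le_max_right _ _).trans_lt hℓ1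
    linarith

set_option maxHeartbeats 400000 in
/-- Uniform estimates on the part of the development inside the cloud: it stays away from the
apparent horizon, and `y³` dominates both `R²` and `|τ - τ_s(0)|` near the singular point. -/
theorem exists_interior_bounds (hϱ : d.IsNakedRay τ₁ ϱ) (hd : d.Admissible) :
    ∃ δ > 0, ∃ K > 0, ∀ t R, (t, R) ∈ d.G → 0 < R → R ≤ d.Rstar →
      2 * d.m R ≤ (1 - δ) * d.rE (t, R) ∧
      ((K * |t - d.tauS 0| ≤ d.yE (t, R) ^ 3 ∧ K * R ^ 2 ≤ d.yE (t, R) ^ 3) ∨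
        K ≤ d.yE (t, R)) := by
  obtain ⟨k, hk, hτ⟩ := hd.exists_tauS_ge
  obtain ⟨η₀, hη₀, hbar⟩ := hd.exists_barrier hk hτ
  obtain ⟨k₁, hk₁, hcube⟩ := hd.exists_cube_ge
  have hRs := hd.Rstar_pos
  have h00 := hd.tauS_pos 0
  have hc0 := hd.c_pos 0
  -- The first entry is the range of the barrier; the second keeps τ_s(0) + η strictly before τ₁,
  -- where the naked ray has positive radius.
  set η := min η₀ ((τ₁ - d.tauS 0) / 2) with hη
  have hηp : 0 < η := lt_min hη₀ (by linarith [hϱ.lt])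
  have hηle : η ≤ (τ₁ - d.tauS 0) / 2 := min_le_right _ _
  have hηI : d.tauS 0 + η ∈ Ioc (d.tauS 0) τ₁ := ⟨by linarith, by linarith [hϱ.lt]⟩
  set κ := k₁ * min 1 (k / 2) with hκ
  have hκp : 0 < κ := mul_pos hk₁ (lt_min one_pos (by positivity))
  -- near the singular point
  have hnear : ∀ t R, (t, R) ∈ d.G → 0 < R → R ≤ d.Rstar → t - d.tauS 0 ≤ η →
      κ * |t - d.tauS 0| ≤ d.yE (t, R) ^ 3 ∧ κ * R ^ 2 ≤ d.yE (t, R) ^ 3 := by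
    intro t R hG hR hR1 ht
    have ht0 : 0 ≤ t := hG.1
    have h1 := hcube t R hR.le hR1 ht0 (hd.G_lt_tauS hG)
    have h2 := hτ R hR.le hR1
    have hkR : 0 ≤ k / 2 * R ^ 2 := by positivity
    have hmul : ∀ z, 0 ≤ z → κ * z ≤ k₁ * z ∧ κ * z ≤ k₁ * (k / 2 * z) := fun z hz => by
      constructor
      · exact mul_le_mul_of_nonneg_right (by
          rw [hκ]; exact mul_le_of_le_one_right hk₁.le (min_le_left _ _)) hz
      · rw [← mul_assoc]
        exact mul_le_mul_of_nonneg_right (by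
          rw [hκ]; exact mul_le_mul_of_nonneg_left (min_le_right _ _) hk₁.le) hz
    have hmain : |t - d.tauS 0| ≤ d.tauS R - t ∧ k / 2 * R ^ 2 ≤ d.tauS R - t := by
      rcases le_total t (d.tauS 0) with h | h
      · rw [abs_of_nonpos (by linarith)]
        constructor <;> linarith
      · have := hd.barrier_G hk hbar hG hR.le h (ht.trans (min_le_left _ _))
        rw [abs_of_nonneg (by linarith)]
        constructor <;> linarith
    have h3 := mul_le_mul_of_nonneg_left hmain.1 hk₁.le
    have h4 := mul_le_mul_of_nonneg_left hmain.2 hk₁.le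
    have h5 := (hmul _ (abs_nonneg (t - d.tauS 0))).1
    have h6 := (hmul _ (sq_nonneg R)).2
    constructor <;> linarith
  -- For R < R₃ the bound κR² ≤ y³ forces 2c(0)R² ≤ y². Hence 2m/r = cR²/y² is at most 1/2.
  set R₃ := κ / Real.sqrt (8 * d.c 0 ^ 3) with hR₃
  have hR₃p : 0 < R₃ := by positivity
  set R₄ := min R₃ (ϱ (d.tauS 0 + η)) with hR₄
  have hR₄p : 0 < R₄ := lt_min hR₃p (hϱ.pos _ hηI)
  -- a starting point of the far part of the naked ray
  obtain ⟨s₄, hs₄, hϱs₄⟩ : ∃ s ∈ Ioc (d.tauS 0) τ₁, ϱ s ≤ R₄ := by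
    have h1 : ∀ᶠ s in 𝓝[>] (d.tauS 0), ϱ s < R₄ := hϱ.lim.eventually (gt_mem_nhds hR₄p)
    have h2 : ∀ᶠ s in 𝓝[>] (d.tauS 0), s ∈ Ioc (d.tauS 0) τ₁ := Ioc_mem_nhdsGT hϱ.lt
    obtain ⟨s, hs1, hs2⟩ := (h1.and h2).exists
    exact ⟨s, hs2, hs1.le⟩
  have hsub : ∀ s ∈ Icc s₄ τ₁, s ∈ Ioc (d.tauS 0) τ₁ := fun s hs => ⟨hs₄.1.trans_le hs.1, hs.2⟩
  have hcϱ : ContinuousOn ϱ (Icc s₄ τ₁) := hϱ.cont.mono hsub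
  have hrp : ∀ s ∈ Icc s₄ τ₁, 0 < d.rE (s, ϱ s) := fun s hs =>
    hd.rE_pos (h00.le.trans (hsub s hs).1.le) (hϱ.lt_tauS s (hsub s hs)) (hϱ.pos s (hsub s hs))
  have hcq : ContinuousOn (fun s => 1 - 2 * d.m (ϱ s) / d.rE (s, ϱ s)) (Icc s₄ τ₁) := by
    refine continuousOn_const.sub (ContinuousOn.div
      (continuousOn_const.mul (hd.contDiff_m.continuous.comp_continuousOn hcϱ)) ?_
      fun s hs => (hrp s hs).ne')
    intro s hs
    have h2 := (hd.contDiffAt_rE (hd.mem_Mext (h00.le.trans (hsub s hs).1.le)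
      (hϱ.lt_tauS s (hsub s hs)))).continuousAt
    exact ContinuousAt.comp_continuousWithinAt (f := fun s => (s, ϱ s)) h2
      (continuousWithinAt_id.prodMk (hcϱ s hs))
  -- Away from the singular point the naked ray is a compact untrapped arc, on which 1 - 2m/r has a
  -- positive minimum.
  obtain ⟨sm, hsm, hmin⟩ := (isCompact_Icc (a := s₄) (b := τ₁)).exists_isMinOn
    ⟨s₄, left_mem_Icc.2 hs₄.2⟩ hcq
  set δ₀ := 1 - 2 * d.m (ϱ sm) / d.rE (sm, ϱ sm) with hδ₀
  have hδ₀p : 0 < δ₀ := by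
    have := hϱ.two_m_lt hd (hsub sm hsm)
    rw [hδ₀, sub_pos, div_lt_one (hrp sm hsm)]; exact this
  have hfar : ∀ t R, (t, R) ∈ d.G → R₄ ≤ R → R ≤ d.Rstar →
      2 * d.m R ≤ (1 - δ₀) * d.rE (t, R) := by
    intro t R hG h1 h2
    have hR : 0 < R := hR₄p.trans_le h1
    obtain ⟨s, hs, hsR⟩ := intermediate_value_Icc hs₄.2 hcϱ
      (show R ∈ _ from ⟨hϱs₄.trans h1, by rw [hϱ.surface]; exact h2⟩)
    -- On a given shell, points of the development are no later than the naked ray. As r decreases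
    -- in time, 2m/r is largest on the ray.
    have hts : t ≤ s := by
      by_contra hcon
      push Not at hcon
      have ht1 : t ≤ τ₁ := by
        by_contra hcon2
        push Not at hcon2
        linarith [hϱ.Rstar_lt_of_mem_G hd hG hR.le hcon2]
      have h3 := hϱ.le_of_mem_G hd hG hR.le ((hsub s hs).1.trans hcon) ht1
      have h4 := hϱ.strictMono hd (hsub s hs) ⟨(hsub s hs).1.trans hcon, ht1⟩ hcon
      rw [hsR] at h4
      linarith
    have h5 : δ₀ ≤ 1 - 2 * d.m (ϱ s) / d.rE (s, ϱ s) := hmin hs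
    have hls := hϱ.lt_tauS s (hsub s hs)
    have hrs := hrp s hs
    rw [hsR] at h5 hls hrs
    have h6 := hd.rE_anti hG.1 hts hls hR.le
    have h7 : 2 * d.m R ≤ (1 - δ₀) * d.rE (s, R) := by
      have : 2 * d.m R / d.rE (s, R) ≤ 1 - δ₀ := by linarith
      rwa [div_le_iff₀ hrs] at this
    have h8 : 0 ≤ 1 - δ₀ := by
      have := hd.m_pos hR
      have : 0 ≤ 2 * d.m R / d.rE (s, R) := by positivity
      linarith
    exact h7.trans (mul_le_mul_of_nonneg_left h6 h8)
  set y₄ := Real.sqrt (d.c d.Rstar) * R₄ with hy₄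
  have hy₄p : 0 < y₄ := mul_pos (hd.sqrt_c_pos _) hR₄p
  have hyfar : ∀ t R, (t, R) ∈ d.G → R₄ ≤ R → R ≤ d.Rstar → y₄ ≤ d.yE (t, R) := by
    intro t R hG h1 h2
    have hR : 0 < R := hR₄p.trans_le h1
    have h3 := hfar t R hG h1 h2
    have hy := hd.yE_pos hG.1 (hd.G_lt_tauS hG)
    have hr := hd.rE_pos hG.1 (hd.G_lt_tauS hG) hR
    have h4 : 2 * d.m R ≤ d.rE (t, R) := by nlinarith
    rw [hd.m_eq_c, rE] at h4
    simp only at h4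
    have h5 : d.c R * R ^ 2 ≤ d.yE (t, R) ^ 2 := by
      have : R * (d.c R * R ^ 2) ≤ R * d.yE (t, R) ^ 2 := by linarith
      exact le_of_mul_le_mul_left this hR
    refine le_of_sq_le_sq ?_ hy.le
    rw [hy₄, mul_pow, Real.sq_sqrt (hd.c_pos _).le]
    refine le_trans ?_ h5
    have h6 := hd.c_antitone hR.le hRs.le h2
    have h7 : R₄ ^ 2 ≤ R ^ 2 := pow_le_pow_left₀ hR₄p.le h1 2
    exact mul_le_mul h6 h7 (by positivity) (hd.c_pos R).le
  refine ⟨min (1 / 2) δ₀, lt_min (by norm_num) hδ₀p, min κ y₄, lt_min hκp hy₄p,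
    fun t R hG hR hR1 => ?_⟩
  have hr := hd.rE_pos hG.1 (hd.G_lt_tauS hG) hR
  have hy := hd.yE_pos hG.1 (hd.G_lt_tauS hG)
  -- Later points lie outside the naked ray, whose radius by then exceeds its value at τ_s(0) + η.
  have hR₄' : η < t - d.tauS 0 → R₄ ≤ R := by
    intro ht
    have ht1 : t ≤ τ₁ := by
      by_contra hcon2
      push Not at hcon2
      linarith [hϱ.Rstar_lt_of_mem_G hd hG hR.le hcon2]
    have h3 := hϱ.le_of_mem_G hd hG hR.le (by linarith) ht1
    have h4 := (hϱ.strictMono hd).monotoneOn hηI ⟨by linarith, ht1⟩ (by linarith)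
    exact (min_le_right _ _).trans (h4.trans h3)
  constructor
  · rcases le_or_gt R₄ R with hf | hf
    · have := hfar t R hG hf hR1
      have h2 := mul_le_mul_of_nonneg_right (min_le_right (1 / 2) δ₀) hr.le
      linarith
    · have ht : t - d.tauS 0 ≤ η := by
        by_contra hcon
        push Not at hcon
        linarith [hR₄' hcon]
      have h2 := (hnear t R hG hR hR1 ht).2
      have hRR₃ : R < R₃ := hf.trans_le (min_le_left _ _)
      have hcR := hd.c_antitone (mem_Ici.2 le_rfl) hR.le hR.le
      have h3 : 2 * (d.c 0 * R ^ 2) ≤ d.yE (t, R) ^ 2 := by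
        by_contra hcon
        push Not at hcon
        have h4 : (d.yE (t, R) ^ 2) ^ 3 < (2 * (d.c 0 * R ^ 2)) ^ 3 :=
          pow_lt_pow_left₀ hcon (by positivity) (by norm_num)
        have h5 : (κ * R ^ 2) ^ 2 ≤ (d.yE (t, R) ^ 3) ^ 2 := pow_le_pow_left₀ (by positivity) h2 2
        have h6 : κ ^ 2 * R ^ 4 < 8 * d.c 0 ^ 3 * R ^ 2 * R ^ 4 := by
          calc _ = (κ * R ^ 2) ^ 2 := by ring
            _ ≤ (d.yE (t, R) ^ 3) ^ 2 := h5
            _ = (d.yE (t, R) ^ 2) ^ 3 := by ring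
            _ < _ := h4
            _ = _ := by ring
        have h7 : κ ^ 2 < 8 * d.c 0 ^ 3 * R ^ 2 := lt_of_mul_lt_mul_right h6 (by positivity)
        have h8 : R ^ 2 < R₃ ^ 2 := pow_lt_pow_left₀ hRR₃ hR.le (by norm_num)
        rw [hR₃, div_pow, Real.sq_sqrt (by positivity), lt_div_iff₀ (by positivity)] at h8
        linarith
      have h9 : 2 * d.m R ≤ 1 / 2 * d.rE (t, R) := by
        rw [hd.m_eq_c, rE]
        simp only
        have h10 : d.c R * R ^ 2 ≤ d.c 0 * R ^ 2 := mul_le_mul_of_nonneg_right hcR (sq_nonneg R)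
        have h11 := mul_le_mul_of_nonneg_left (show 2 * (d.c R * R ^ 2) ≤ d.yE (t, R) ^ 2 by linarith) hR.le
        linarith
      have h12 := mul_le_mul_of_nonneg_right (min_le_left (1 / 2) δ₀) hr.le
      linarith
  · rcases le_or_gt (t - d.tauS 0) η with ht | ht
    · left
      obtain ⟨h1, h2⟩ := hnear t R hG hR hR1 ht
      have hm := min_le_left κ y₄
      exact ⟨(mul_le_mul_of_nonneg_right hm (abs_nonneg _)).trans h1,
        (mul_le_mul_of_nonneg_right hm (sq_nonneg _)).trans h2⟩
    · right
      exact (min_le_right _ _).trans (hyfar t R hG (hR₄' ht) hR1)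

end IsNakedRay

/-- The development is uniformly untrapped. -/
theorem GloballyNaked.exists_untrapped (hd : d.Admissible) (hn : d.GloballyNaked) :
    ∃ δ > 0, ∀ t R, (t, R) ∈ d.G → 0 < R → 2 * d.m R ≤ (1 - δ) * d.rE (t, R) := by
  obtain ⟨τ₁, ϱ, hϱ⟩ := hn.exists_nakedRay hd
  obtain ⟨δ, hδ, K, hK, hb⟩ := hϱ.exists_interior_bounds hd
  have h00 := hd.tauS_pos 0
  have hlt₁ : τ₁ < d.tauS d.Rstar := by
    have := hϱ.lt_tauS τ₁ ⟨hϱ.lt, le_rfl⟩; rwa [hϱ.surface] at this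
  have hr₁ := hd.rE_pos (h00.le.trans hϱ.lt.le) hlt₁ hd.Rstar_pos
  set r₁ := d.rE (τ₁, d.Rstar)
  set δ₁ := 1 - 2 * d.m d.Rstar / r₁ with hδ₁
  have hδ₁p : 0 < δ₁ := by
    rw [hδ₁, sub_pos, div_lt_one hr₁]; exact hϱ.untrapped
  refine ⟨min δ δ₁, lt_min hδ hδ₁p, fun t R hG hR => ?_⟩
  have hr := hd.rE_pos hG.1 (hd.G_lt_tauS hG) hR
  rcases le_total R d.Rstar with h | h
  · have := (hb t R hG hR h).1
    have h2 := mul_le_mul_of_nonneg_right (min_le_left δ δ₁) hr.le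
    linarith
  · have h1 := hϱ.rE_ge_of_exterior hd hG h
    have hm : d.m R = d.m d.Rstar := by
      unfold m
      congr 1
      rw [← sub_eq_zero, intervalIntegral.integral_interval_sub_left]
      · refine intervalIntegral.integral_zero_ae (Eventually.of_forall fun s hs => ?_)
        rw [uIoc_of_le h] at hs
        rw [hd.density_zero s hs.1.le, zero_mul]
      · exact (hd.smooth_ρ₀.continuous.mul (continuous_pow 2)).intervalIntegrable _ _
      · exact (hd.smooth_ρ₀.continuous.mul (continuous_pow 2)).intervalIntegrable _ _
    have h3 : 2 * d.m R = (1 - δ₁) * r₁ := by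
      rw [hm, hδ₁]; field_simp; ring
    have h4 : 0 ≤ 1 - δ₁ := by
      have := hd.m_pos hd.Rstar_pos
      rw [hδ₁]
      have : 0 ≤ 2 * d.m d.Rstar / r₁ := by positivity
      linarith
    have h5 := mul_le_mul_of_nonneg_left h1 h4
    have h2 := mul_le_mul_of_nonneg_right (min_le_right δ δ₁) hr.le
    linarith

end TBData
end

noncomputable section

/-! ### An integrable majorant of the source term -/

/-- The odd primitive of `|z|^(-5/6)`. -/
def sixthRoot (z : ℝ) : ℝ :=
  6 * (max z 0) ^ (1 / 6 : ℝ) - 6 * (max (-z) 0) ^ (1 / 6 : ℝ)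

theorem continuous_sixthRoot : Continuous sixthRoot := by
  unfold sixthRoot
  exact (continuous_const.mul ((continuous_id.max continuous_const).rpow_const
    fun _ => Or.inr (by norm_num))).sub (continuous_const.mul
    ((continuous_neg.max continuous_const).rpow_const fun _ => Or.inr (by norm_num)))

theorem hasDerivAt_sixthRoot {z : ℝ} (hz : z ≠ 0) :
    HasDerivAt sixthRoot (|z| ^ (-5 / 6 : ℝ)) z := by
  have key : ∀ z : ℝ, 0 < z → HasDerivAt (fun z => 6 * z ^ (1 / 6 : ℝ)) (z ^ (-5 / 6 : ℝ)) z := by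
    intro z hz
    refine ((Real.hasDerivAt_rpow_const (p := 1 / 6) (Or.inl hz.ne')).const_mul 6).congr_deriv ?_
    norm_num
    ring
  rcases hz.lt_or_gt with h | h
  · have h1 := ((key (-z) (by linarith)).comp z (hasDerivAt_neg z)).neg
    rw [abs_of_neg h]
    refine (h1.congr_of_eventuallyEq ?_).congr_deriv (by ring)
    filter_upwards [Iio_mem_nhds h] with x hx
    have hx' : x < 0 := hx
    simp [sixthRoot, max_eq_right hx'.le, max_eq_left (neg_nonneg.2 hx'.le), Real.zero_rpow]
  · rw [abs_of_pos h]
    refine (key z h).congr_of_eventuallyEq ?_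
    filter_upwards [Ioi_mem_nhds h] with x hx
    have hx' : 0 < x := hx
    simp [sixthRoot, max_eq_left hx'.le, max_eq_right (neg_nonpos.2 hx'.le), Real.zero_rpow]

theorem abs_sixthRoot_le {z Z : ℝ} (h : |z| ≤ Z) : |sixthRoot z| ≤ 6 * Z ^ (1 / 6 : ℝ) := by
  have hb := abs_le.1 h
  have hZ : 0 ≤ Z := (abs_nonneg z).trans h
  have h1 : (max z 0) ^ (1 / 6 : ℝ) ≤ Z ^ (1 / 6 : ℝ) :=
    Real.rpow_le_rpow (le_max_right _ _) (max_le hb.2 hZ) (by norm_num)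
  have h2 : (max (-z) 0) ^ (1 / 6 : ℝ) ≤ Z ^ (1 / 6 : ℝ) :=
    Real.rpow_le_rpow (le_max_right _ _) (max_le (by linarith) hZ) (by norm_num)
  have h3 : 0 ≤ (max z 0) ^ (1 / 6 : ℝ) := Real.rpow_nonneg (le_max_right _ _) _
  have h4 : 0 ≤ (max (-z) 0) ^ (1 / 6 : ℝ) := Real.rpow_nonneg (le_max_right _ _) _
  unfold sixthRoot
  rw [abs_le]
  constructor <;> linarith

namespace TBData
variable {d : TBData}

/-- With σ⁶ = |τ - τ_s(0)|, the hypotheses make R of order y^(3/2) and σ⁵ of order y^(5/2), and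
these exponents add up to 4. Working with sixth powers avoids roots, and the constant is
deliberately crude. -/
theorem sixth_power_estimate {K y R σ : ℝ} (hK : 0 < K) (hy : 0 < y) (_hR : 0 ≤ R) (_hσ : 0 ≤ σ)
    (h1 : K * σ ^ 6 ≤ y ^ 3) (h2 : K * R ^ 2 ≤ y ^ 3) : R * σ ^ 5 ≤ (1 + 1 / K) ^ 2 * y ^ 4 := by
  have e1 : σ ^ 6 ≤ y ^ 3 * (1 / K) := by rw [mul_one_div, le_div_iff₀ hK]; linarith
  have e2 : R ^ 2 ≤ y ^ 3 * (1 / K) := by rw [mul_one_div, le_div_iff₀ hK]; linarith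
  have hL : 0 < 1 / K := by positivity
  generalize 1 / K = L at *
  refine le_of_pow_le_pow_left₀ (n := 6) (by norm_num) (by positivity) ?_
  calc (R * σ ^ 5) ^ 6 = (R ^ 2) ^ 3 * (σ ^ 6) ^ 5 := by ring
    _ ≤ (y ^ 3 * L) ^ 3 * (y ^ 3 * L) ^ 5 := by gcongr
    _ = L ^ 8 * y ^ 24 := by ring
    _ ≤ (1 + L) ^ 12 * y ^ 24 := by
        gcongr
        calc L ^ 8 ≤ (1 + L) ^ 8 := by gcongr; linarith
          _ ≤ (1 + L) ^ 12 := pow_le_pow_right₀ (by linarith) (by norm_num)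
    _ = _ := by ring

/-- The source coefficient is dominated by an integrable function of time. -/
theorem GloballyNaked.exists_source_bound (hd : d.Admissible) (hn : d.GloballyNaked) :
    ∃ (N n : ℝ → ℝ) (Nmax τ₁ : ℝ), Continuous N ∧ (∀ t, 0 ≤ t → |N t| ≤ Nmax) ∧ (∀ t, 0 ≤ n t) ∧
      (∀ t, t ≠ d.tauS 0 → t ≠ τ₁ → HasDerivAt N (n t) t) ∧
      ∀ t R, (t, R) ∈ d.G → 0 < R → t ≠ d.tauS 0 → t ≠ τ₁ →
        4 * Real.pi * (d.ρ₀ R * R ^ 2) / (d.rE (t, R) * d.rR (t, R)) ≤ n t := by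
  obtain ⟨τ₁, ϱ, hϱ⟩ := hn.exists_nakedRay hd
  obtain ⟨δ, -, K, hK, hb⟩ := hϱ.exists_interior_bounds hd
  obtain ⟨ρm, hρm⟩ := (isCompact_Icc (a := (0 : ℝ)) (b := d.Rstar)).exists_bound_of_continuousOn
    hd.smooth_ρ₀.continuous.continuousOn
  have hρ0 : 0 ≤ ρm := (norm_nonneg _).trans (hρm 0 ⟨le_rfl, hd.Rstar_pos.le⟩)
  have hs0 := hd.tauS_pos 0
  have hτ := hϱ.lt
  have hRs := hd.Rstar_pos
  -- The two summands serve the two alternatives of `exists_interior_bounds`: the interpolation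
  -- estimate near the singular point, and y ≥ K elsewhere, where |τ - τ_s(0)| ≤ τ₁ suffices.
  set C₁ := (1 + 1 / K) ^ 2 + d.Rstar * (1 + τ₁) / K ^ 4 with hC₁
  have hτ₁ : 0 < τ₁ := hs0.trans hτ
  have hC₁0 : 0 ≤ C₁ := by positivity
  set C := 4 * Real.pi * ρm * C₁ with hC
  have hC0 : 0 ≤ C := by positivity
  -- After τ₁ the development lies outside the cloud and the source vanishes. The primitive is
  -- frozen there, which keeps it bounded for all times.
  refine ⟨fun t => C * sixthRoot (min t τ₁ - d.tauS 0),
    fun t => if t < τ₁ then C * |t - d.tauS 0| ^ (-5 / 6 : ℝ) else 0, C * (6 * τ₁ ^ (1 / 6 : ℝ)), τ₁,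
    continuous_const.mul (continuous_sixthRoot.comp
      ((continuous_id.min continuous_const).sub continuous_const)), ?_, ?_, ?_, ?_⟩
  · intro t ht
    rw [abs_mul, abs_of_nonneg hC0]
    refine mul_le_mul_of_nonneg_left (abs_sixthRoot_le ?_) hC0
    rw [abs_le]
    constructor
    · have : 0 ≤ min t τ₁ := le_min ht hτ₁.le
      linarith
    · linarith [min_le_right t τ₁]
  · intro t
    dsimp only
    split_ifs
    · positivity
    · exact le_rfl
  · intro t h1 h2
    dsimp only
    rcases h2.lt_or_gt with h | h
    · rw [if_pos h]
      have := ((hasDerivAt_sixthRoot (sub_ne_zero.2 h1)).comp t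
        ((hasDerivAt_id t).sub_const (d.tauS 0))).const_mul C
      refine (this.congr_of_eventuallyEq ?_).congr_deriv (by simp)
      filter_upwards [Iio_mem_nhds h] with x hx
      have hx' : x < τ₁ := hx
      simp [min_eq_left hx'.le]
    · rw [if_neg h.not_gt]
      refine (hasDerivAt_const t (C * sixthRoot (τ₁ - d.tauS 0))).congr_of_eventuallyEq ?_
      filter_upwards [Ioi_mem_nhds h] with x hx
      have hx' : τ₁ < x := hx
      simp [min_eq_right hx'.le]
  · intro t R hG hR h1 h2
    dsimp only
    have ht0 : 0 ≤ t := hG.1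
    have hz : 0 < |t - d.tauS 0| := abs_pos.2 (sub_ne_zero.2 h1)
    by_cases hRs' : d.Rstar ≤ R
    · rw [hd.density_zero R hRs']
      simp only [zero_mul, mul_zero, zero_div]
      split_ifs
      · positivity
      · exact le_rfl
    push Not at hRs'
    have hlt : t < τ₁ := by
      by_contra hc
      exact (hϱ.Rstar_lt_of_mem_G hd hG hR.le (lt_of_le_of_ne (not_lt.1 hc) h2.symm)).not_gt hRs'
    rw [if_pos hlt]
    have hy := hd.yE_pos ht0 (hd.G_lt_tauS hG)
    have hρ := hρm R ⟨hR.le, hRs'.le⟩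
    have hρp := hd.density_pos R hR.le hRs'
    rw [Real.norm_eq_abs, abs_of_pos hρp] at hρ
    set Y := d.yE (t, R) with hY
    set σ := |t - d.tauS 0| ^ (1 / 6 : ℝ) with hσ
    have hσ0 : 0 < σ := by positivity
    have hσ6 : σ ^ 6 = |t - d.tauS 0| := by
      rw [hσ, ← Real.rpow_natCast, ← Real.rpow_mul hz.le]; norm_num
    have hσ5 : |t - d.tauS 0| ^ (-5 / 6 : ℝ) = 1 / σ ^ 5 := by
      rw [hσ, ← Real.rpow_natCast, ← Real.rpow_mul hz.le, one_div, ← Real.rpow_neg hz.le]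
      norm_num
    have hest : R * σ ^ 5 ≤ C₁ * Y ^ 4 := by
      rcases (hb t R hG hR hRs'.le).2 with ⟨e1, e2⟩ | e
      · rw [← hσ6] at e1
        have := sixth_power_estimate hK hy hR.le hσ0.le e1 e2
        have h4 : 0 ≤ d.Rstar * (1 + τ₁) / K ^ 4 * Y ^ 4 := by positivity
        rw [hC₁, add_mul]; linarith
      · have h5 : σ ^ 5 ≤ 1 + τ₁ := by
          have h6 : σ ^ 6 ≤ τ₁ := by
            rw [hσ6, abs_le]; constructor <;> linarith
          rcases le_total σ 1 with h | h
          · have := pow_le_one₀ (n := 5) hσ0.le h; linarith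
          · have := pow_le_pow_right₀ h (show 5 ≤ 6 by norm_num); linarith
        have h7 : K ^ 4 ≤ Y ^ 4 := by gcongr
        have h8 : d.Rstar * (1 + τ₁) ≤ d.Rstar * (1 + τ₁) / K ^ 4 * Y ^ 4 := by
          rw [div_mul_eq_mul_div, le_div_iff₀ (by positivity)]; gcongr
        have h9 : R * σ ^ 5 ≤ d.Rstar * (1 + τ₁) := by gcongr
        have h10 : 0 ≤ (1 + 1 / K) ^ 2 * Y ^ 4 := by positivity
        rw [hC₁, add_mul]; linarith
    have hrR := hd.sq_yE_le_rR ht0 (hd.G_lt_tauS hG)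
    rw [hσ5, mul_one_div]
    have hrE : d.rE (t, R) = R * Y ^ 2 := rfl
    rw [hrE]
    calc 4 * Real.pi * (d.ρ₀ R * R ^ 2) / (R * Y ^ 2 * d.rR (t, R))
        ≤ 4 * Real.pi * (ρm * R ^ 2) / (R * Y ^ 2 * Y ^ 2) := by gcongr
      _ = 4 * Real.pi * ρm * R / Y ^ 4 := by field_simp
      _ ≤ C / σ ^ 5 := by
        rw [div_le_div_iff₀ (by positivity) (by positivity), hC]
        calc 4 * Real.pi * ρm * R * σ ^ 5 = 4 * Real.pi * ρm * (R * σ ^ 5) := by ring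
          _ ≤ 4 * Real.pi * ρm * (C₁ * Y ^ 4) := by gcongr
          _ = _ := by ring

end TBData
end

noncomputable section
namespace TBData
variable {d : TBData}

/-! ### Algebra of spherically symmetric metrics -/

/-- The projection onto the orthogonal complement of `u` and `n`. -/
def proj (n : Fin 4 → ℝ) (μ ν : Fin 4) : ℝ := (if μ = ν then 1 else 0) - u μ * u ν - n μ * n ν

/-- The inverse of the metric `-u u + s P + h n n`. -/
def ginvS (n : Fin 4 → ℝ) (s h : ℝ) (κ μ : Fin 4) : ℝ :=
  -(u κ * u μ) + proj n κ μ / s + n κ * n μ / h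

/-- The metric `-u u + s P + h n n`. -/
def metricS (n : Fin 4 → ℝ) (s h : ℝ) (κ μ : Fin 4) : ℝ :=
  -(u κ * u μ) + s * proj n κ μ + h * (n κ * n μ)

/-- Spatial unit vectors. -/
structure IsUnitRadial (n : Fin 4 → ℝ) : Prop where
  zero : n 0 = 0
  sq : ∑ μ, n μ * n μ = 1

theorem sum_u (f : Fin 4 → ℝ) : ∑ σ, u σ * f σ = f 0 := by
  simp [u, Pi.single_apply]

theorem u_zero : u 0 = 1 := by simp [u]

theorem proj_symm (n : Fin 4 → ℝ) (μ ν : Fin 4) : proj n μ ν = proj n ν μ := by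
  simp only [proj, eq_comm (a := μ)]; ring

theorem sum_proj (n : Fin 4 → ℝ) (κ : Fin 4) (f : Fin 4 → ℝ) :
    ∑ σ, proj n κ σ * f σ = f κ - u κ * f 0 - n κ * ∑ σ, n σ * f σ := by
  have : ∀ σ, proj n κ σ * f σ = (if κ = σ then f σ else 0) - u κ * (u σ * f σ)
      - n κ * (n σ * f σ) := fun σ => by simp only [proj]; split_ifs <;> ring
  simp_rw [this, Finset.sum_sub_distrib, ← Finset.mul_sum, sum_u, Finset.sum_ite_eq,
    Finset.mem_univ, if_true]

theorem sum_ginvS (n : Fin 4 → ℝ) (s h : ℝ) (κ : Fin 4) (f : Fin 4 → ℝ) :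
    ∑ σ, ginvS n s h κ σ * f σ = -u κ * f 0 + (f κ - u κ * f 0 - n κ * ∑ σ, n σ * f σ) / s
      + n κ / h * ∑ σ, n σ * f σ := by
  have : ∀ σ, ginvS n s h κ σ * f σ = -u κ * (u σ * f σ) + (proj n κ σ * f σ) / s
      + n κ / h * (n σ * f σ) := fun σ => by simp only [ginvS]; ring
  simp_rw [this, Finset.sum_add_distrib, ← Finset.sum_div, ← Finset.mul_sum, sum_u, sum_proj]

/-- The tangential trace is the full trace minus the time and radial components. Contractions of the
divergence can thus be computed from three scalars, without expanding all components. -/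
theorem contract_ginvS (n : Fin 4 → ℝ) (s h : ℝ) (X : Fin 4 → Fin 4 → ℝ) :
    ∑ κ, ∑ μ, ginvS n s h κ μ * X κ μ = -X 0 0
      + (∑ κ, X κ κ - X 0 0 - ∑ κ, n κ * ∑ μ, n μ * X κ μ) / s
      + (∑ κ, n κ * ∑ μ, n μ * X κ μ) / h := by
  simp_rw [sum_ginvS, Finset.sum_add_distrib, ← Finset.sum_div, Finset.sum_sub_distrib,
    neg_mul, Finset.sum_neg_distrib, sum_u, div_mul_eq_mul_div, ← Finset.sum_div]

namespace IsUnitRadial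
variable {n : Fin 4 → ℝ}

theorem sum_n_proj (hn : IsUnitRadial n) (μ : Fin 4) : ∑ σ, n σ * proj n σ μ = 0 := by
  have : ∀ σ, n σ * proj n σ μ = proj n μ σ * n σ := fun σ => by rw [proj_symm]; ring
  simp_rw [this, sum_proj, hn.sq, hn.zero]; ring

theorem proj_zero (hn : IsUnitRadial n) (μ : Fin 4) : proj n 0 μ = 0 := by
  simp only [proj, hn.zero, u_zero]
  fin_cases μ <;> simp [u]

theorem proj_zero' (hn : IsUnitRadial n) (μ : Fin 4) : proj n μ 0 = 0 := by
  rw [proj_symm, hn.proj_zero]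

theorem trace_proj (hn : IsUnitRadial n) : ∑ μ, proj n μ μ = 2 := by
  simp only [proj, Finset.sum_sub_distrib, hn.sq, if_true]
  simp [u, Fin.sum_univ_four]
  norm_num

theorem sum_n_u (hn : IsUnitRadial n) : ∑ σ, n σ * u σ = 0 := by
  simp_rw [mul_comm (n _)]; rw [sum_u, hn.zero]

theorem sum_ginvS_comb (hn : IsUnitRadial n) (s h c₁ c₂ c₃ c₄ : ℝ) (κ μ ν : Fin 4) :
    ∑ σ, ginvS n s h κ σ * (c₁ * u σ + c₂ * n σ + c₃ * proj n σ μ + c₄ * proj n σ ν) =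
      -c₁ * u κ + c₂ / h * n κ + c₃ / s * proj n κ μ + c₄ / s * proj n κ ν := by
  have e : ∑ σ, n σ * (c₁ * u σ + c₂ * n σ + c₃ * proj n σ μ + c₄ * proj n σ ν) = c₂ := by
    have : ∀ σ, n σ * (c₁ * u σ + c₂ * n σ + c₃ * proj n σ μ + c₄ * proj n σ ν) =
        c₁ * (n σ * u σ) + c₂ * (n σ * n σ) + c₃ * (n σ * proj n σ μ)
          + c₄ * (n σ * proj n σ ν) := fun σ => by ring
    simp_rw [this, Finset.sum_add_distrib, ← Finset.mul_sum, hn.sum_n_proj, hn.sq, hn.sum_n_u]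
    ring
  rw [sum_ginvS, e, hn.proj_zero, hn.proj_zero, hn.zero, u_zero]
  ring

theorem metricS_inv (hn : IsUnitRadial n) {s h : ℝ} (hs : s ≠ 0) (hh : h ≠ 0) :
    (Matrix.of (metricS n s h))⁻¹ = Matrix.of (ginvS n s h) := by
  refine Matrix.inv_eq_left_inv ?_
  ext κ μ
  rw [Matrix.mul_apply]
  have : ∀ σ, (Matrix.of (ginvS n s h)) κ σ * (Matrix.of (metricS n s h)) σ μ =
      ginvS n s h κ σ * (-u μ * u σ + h * n μ * n σ + s * proj n σ μ + 0 * proj n σ μ) :=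
    fun σ => by simp only [Matrix.of_apply, metricS]; ring
  rw [Finset.sum_congr rfl fun σ _ => this σ, hn.sum_ginvS_comb, Matrix.one_apply]
  have e : (if κ = μ then (1 : ℝ) else 0) = proj n κ μ + u κ * u μ + n κ * n μ := by
    simp only [proj]; ring
  rw [e]; field_simp; ring

end IsUnitRadial

/-- The partial derivatives `∂_κ g_μν` of a spherically symmetric metric. -/
def dmetricS (n : Fin 4 → ℝ) (s h st s' ht h' R : ℝ) (κ μ ν : Fin 4) : ℝ :=
  (st * u κ + s' * n κ) * proj n μ ν + (ht * u κ + h' * n κ) * (n μ * n ν)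
    + (h - s) / R * (proj n κ μ * n ν + n μ * proj n κ ν)

/-- The Christoffel symbols `Γ^σ_κμ` of a spherically symmetric metric. -/
def christoffelS (n : Fin 4 → ℝ) (s h st s' ht h' R : ℝ) (σ κ μ : Fin 4) : ℝ :=
  1 / 2 * ((st * proj n κ μ + ht * (n κ * n μ)) * u σ
    + (-(s' / h) * proj n κ μ + ht / h * (u κ * n μ + u μ * n κ) + h' / h * (n κ * n μ)
      + 2 * (h - s) / (h * R) * proj n κ μ) * n σ
    + (st / s * u μ + s' / s * n μ) * proj n σ κ + (st / s * u κ + s' / s * n κ) * proj n σ μ)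

/-- The coefficients and their derivatives are independent parameters here, so the connection is a
matter of pure algebra in `u`, n and the projection. -/
theorem christoffelS_eq {n : Fin 4 → ℝ} (hn : IsUnitRadial n) (s h st s' ht h' R : ℝ)
    (κ μ ν : Fin 4) :
    1 / 2 * ∑ σ, ginvS n s h κ σ * (dmetricS n s h st s' ht h' R μ σ ν
      + dmetricS n s h st s' ht h' R ν σ μ - dmetricS n s h st s' ht h' R σ μ ν) =
      christoffelS n s h st s' ht h' R κ μ ν := by
  have : ∀ σ, dmetricS n s h st s' ht h' R μ σ ν
      + dmetricS n s h st s' ht h' R ν σ μ - dmetricS n s h st s' ht h' R σ μ ν =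
      -(st * proj n μ ν + ht * (n μ * n ν)) * u σ
      + (-s' * proj n μ ν + ht * (u μ * n ν + u ν * n μ) + h' * (n μ * n ν)
        + 2 * (h - s) / R * proj n μ ν) * n σ
      + (st * u ν + s' * n ν) * proj n σ μ + (st * u μ + s' * n μ) * proj n σ ν := by
    intro σ
    simp only [dmetricS]
    rw [proj_symm n μ σ, proj_symm n ν σ, proj_symm n ν μ]
    ring
  simp_rw [this]
  rw [hn.sum_ginvS_comb]
  simp only [christoffelS, div_eq_mul_inv, mul_inv]
  ring

theorem christoffelS_zero_zero {n : Fin 4 → ℝ} (hn : IsUnitRadial n) (s h st s' ht h' R : ℝ)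
    (σ : Fin 4) : christoffelS n s h st s' ht h' R σ 0 0 = 0 := by
  simp only [christoffelS, hn.proj_zero', hn.zero]; ring

theorem christoffelS_zero {n : Fin 4 → ℝ} (hn : IsUnitRadial n) (s h st s' ht h' R : ℝ)
    (σ κ : Fin 4) : christoffelS n s h st s' ht h' R σ κ 0 =
    1 / 2 * (st / s * proj n σ κ + ht / h * (n σ * n κ)) := by
  simp only [christoffelS, hn.proj_zero', hn.zero, u_zero]; ring

theorem christoffelS_n {n : Fin 4 → ℝ} (hn : IsUnitRadial n) (s h st s' ht h' R : ℝ)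
    (σ κ : Fin 4) :
    ∑ μ, n μ * christoffelS n s h st s' ht h' R σ κ μ =
    1 / 2 * (s' / s * proj n σ κ + ht / h * (n σ * u κ) + ht * (u σ * n κ)
      + h' / h * (n σ * n κ)) := by
  have : ∀ μ, n μ * christoffelS n s h st s' ht h' R σ κ μ =
      1 / 2 * ((st * u σ + (-(s' / h) + 2 * (h - s) / (h * R)) * n σ) * (n μ * proj n μ κ)
        + (ht * u σ * n κ + (ht / h * u κ + h' / h * n κ) * n σ + s' / s * proj n σ κ) * (n μ * n μ)
        + (ht / h * n κ * n σ + st / s * proj n σ κ) * (n μ * u μ)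
        + (st / s * u κ + s' / s * n κ) * (n μ * proj n μ σ)) := by
    intro μ; simp only [christoffelS]; rw [proj_symm n κ μ, proj_symm n σ μ]; ring
  simp_rw [this]
  rw [← Finset.mul_sum]
  simp_rw [Finset.sum_add_distrib, ← Finset.mul_sum, hn.sum_n_proj, hn.sq, hn.sum_n_u]
  ring

theorem christoffelS_nn {n : Fin 4 → ℝ} (hn : IsUnitRadial n) (s h st s' ht h' R : ℝ)
    (σ : Fin 4) :
    ∑ κ, n κ * ∑ μ, n μ * christoffelS n s h st s' ht h' R σ κ μ =
    1 / 2 * (ht * u σ + h' / h * n σ) := by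
  simp_rw [christoffelS_n hn]
  have : ∀ κ, n κ * (1 / 2 * (s' / s * proj n σ κ + ht / h * (n σ * u κ) + ht * (u σ * n κ)
      + h' / h * (n σ * n κ))) = 1 / 2 * (s' / s * (n κ * proj n κ σ) + ht / h * n σ * (n κ * u κ)
      + (ht * u σ + h' / h * n σ) * (n κ * n κ)) := by
    intro κ; rw [proj_symm n σ κ]; ring
  simp_rw [this]
  rw [← Finset.mul_sum]
  simp_rw [Finset.sum_add_distrib, ← Finset.mul_sum, hn.sum_n_proj, hn.sq, hn.sum_n_u]
  ring

theorem christoffelS_trace {n : Fin 4 → ℝ} (hn : IsUnitRadial n) (s h st s' ht h' R : ℝ)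
    (σ : Fin 4) :
    ∑ κ, christoffelS n s h st s' ht h' R σ κ κ =
    1 / 2 * ((2 * st + ht) * u σ
      + (-(2 * s' / h) + h' / h + 4 * (h - s) / (h * R)) * n σ) := by
  have : ∀ κ, christoffelS n s h st s' ht h' R σ κ κ =
      1 / 2 * ((st * u σ + (-(s' / h) + 2 * (h - s) / (h * R)) * n σ) * proj n κ κ
        + (ht * u σ + h' / h * n σ) * (n κ * n κ) + 2 * ht / h * n σ * (n κ * u κ)
        + 2 * (st / s) * (u κ * proj n κ σ) + 2 * (s' / s) * (n κ * proj n κ σ)) := by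
    intro κ; simp only [christoffelS]; rw [proj_symm n σ κ]; ring
  simp_rw [this]
  rw [← Finset.mul_sum]
  simp_rw [Finset.sum_add_distrib, ← Finset.mul_sum, hn.sum_n_proj, hn.sq, hn.sum_n_u,
    hn.trace_proj, sum_u, hn.proj_zero]
  ring

/-- The divergence of a symmetric tensor, with abstract derivatives `DT`. -/
def divS (n : Fin 4 → ℝ) (s h st s' ht h' R : ℝ) (T : Fin 4 → Fin 4 → ℝ)
    (DT : Fin 4 → Fin 4 → Fin 4 → ℝ) (ν : Fin 4) : ℝ :=
  ∑ κ, ∑ μ, ginvS n s h κ μ * (DT κ μ ν - ∑ σ, christoffelS n s h st s' ht h' R σ κ μ * T σ ν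
    - ∑ σ, christoffelS n s h st s' ht h' R σ κ ν * T μ σ)

theorem sum_sum_mul_sub (A X Y Z : Fin 4 → Fin 4 → ℝ) :
    ∑ κ, ∑ μ, A κ μ * (X κ μ - Y κ μ - Z κ μ) =
      ∑ κ, ∑ μ, A κ μ * X κ μ - ∑ κ, ∑ μ, A κ μ * Y κ μ - ∑ κ, ∑ μ, A κ μ * Z κ μ := by
  simp_rw [mul_sub, Finset.sum_sub_distrib]

theorem sum_n_mul_comb (n w : Fin 4 → ℝ) (c₁ c₂ : ℝ) :
    ∑ σ, 1 / 2 * (c₁ * u σ + c₂ * n σ) * w σ = 1 / 2 * (c₁ * w 0 + c₂ * ∑ σ, n σ * w σ) := by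
  have : ∀ σ, 1 / 2 * (c₁ * u σ + c₂ * n σ) * w σ = 1 / 2 * (c₁ * (u σ * w σ) + c₂ * (n σ * w σ)) :=
    fun σ => by ring
  simp_rw [this]
  rw [← Finset.mul_sum]
  simp_rw [Finset.sum_add_distrib, ← Finset.mul_sum, sum_u]

theorem contract_christoffelS {n : Fin 4 → ℝ} (hn : IsUnitRadial n) (s h st s' ht h' R : ℝ)
    (w : Fin 4 → ℝ) :
    ∑ κ, ∑ μ, ginvS n s h κ μ * ∑ σ, christoffelS n s h st s' ht h' R σ κ μ * w σ =
      1 / 2 * ((2 * st / s + ht / h) * w 0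
        + (-(2 * s' / h / s) + h' / h / h + 4 * (h - s) / (h * R) / s) * ∑ σ, n σ * w σ) := by
  rw [contract_ginvS]
  have e1 : ∑ κ, ∑ σ, christoffelS n s h st s' ht h' R σ κ κ * w σ = 1 / 2 * ((2 * st + ht) * w 0
      + (-(2 * s' / h) + h' / h + 4 * (h - s) / (h * R)) * ∑ σ, n σ * w σ) := by
    rw [Finset.sum_comm]
    simp_rw [← Finset.sum_mul, christoffelS_trace hn]
    rw [sum_n_mul_comb]
  have e2 : ∑ κ, n κ * ∑ μ, n μ * ∑ σ, christoffelS n s h st s' ht h' R σ κ μ * w σ =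
      1 / 2 * (ht * w 0 + h' / h * ∑ σ, n σ * w σ) := by
    have : ∀ κ, n κ * ∑ μ, n μ * ∑ σ, christoffelS n s h st s' ht h' R σ κ μ * w σ =
        ∑ σ, (n κ * ∑ μ, n μ * christoffelS n s h st s' ht h' R σ κ μ) * w σ := by
      intro κ
      simp_rw [Finset.mul_sum, Finset.sum_mul]
      rw [Finset.sum_comm]
      exact Finset.sum_congr rfl fun _ _ => Finset.sum_congr rfl fun _ _ => by ring
    simp_rw [this]
    rw [Finset.sum_comm]
    simp_rw [← Finset.sum_mul, christoffelS_nn hn]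
    rw [sum_n_mul_comb]
  rw [e1, e2]
  simp_rw [christoffelS_zero_zero hn, zero_mul, Finset.sum_const_zero]
  simp only [div_eq_mul_inv, mul_inv]
  ring

theorem divS_zero {n : Fin 4 → ℝ} (hn : IsUnitRadial n) (s h st s' ht h' R : ℝ)
    (T : Fin 4 → Fin 4 → ℝ) (DT : Fin 4 → Fin 4 → Fin 4 → ℝ) :
    divS n s h st s' ht h' R T DT 0 = ∑ κ, ∑ μ, ginvS n s h κ μ * DT κ μ 0
      - 1 / 2 * ((2 * st / s + ht / h) * T 0 0
        + (-(2 * s' / h / s) + h' / h / h + 4 * (h - s) / (h * R) / s) * ∑ σ, n σ * T σ 0)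
      - 1 / 2 * (st / s / s * (∑ κ, T κ κ - T 0 0 - ∑ κ, n κ * ∑ μ, n μ * T κ μ)
        + ht / h / h * ∑ κ, n κ * ∑ μ, n μ * T κ μ) := by
  unfold divS
  rw [sum_sum_mul_sub]
  rw [contract_christoffelS hn s h st s' ht h' R fun σ => T σ 0]
  congr 1
  have e : ∀ κ μ, ∑ σ, christoffelS n s h st s' ht h' R σ κ 0 * T μ σ =
      1 / 2 * (st / s * (T μ κ - u κ * T μ 0 - n κ * ∑ σ, n σ * T μ σ)
        + ht / h * (n κ * ∑ σ, n σ * T μ σ)) := by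
    intro κ μ
    rw [← sum_proj n κ fun σ => T μ σ]
    have : ∀ σ, christoffelS n s h st s' ht h' R σ κ 0 * T μ σ =
        1 / 2 * (st / s * (proj n κ σ * T μ σ) + ht / h * n κ * (n σ * T μ σ)) := by
      intro σ; rw [christoffelS_zero hn, proj_symm]; ring
    simp_rw [this]
    rw [← Finset.mul_sum]
    simp_rw [Finset.sum_add_distrib, ← Finset.mul_sum, mul_assoc]
  simp_rw [e]
  rw [contract_ginvS]
  have e1 : ∑ κ, 1 / 2 * (st / s * (T κ κ - u κ * T κ 0 - n κ * ∑ σ, n σ * T κ σ)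
        + ht / h * (n κ * ∑ σ, n σ * T κ σ)) = 1 / 2 * (st / s * (∑ κ, T κ κ - T 0 0
        - ∑ κ, n κ * ∑ μ, n μ * T κ μ) + ht / h * ∑ κ, n κ * ∑ μ, n μ * T κ μ) := by
    rw [← Finset.mul_sum]
    simp_rw [Finset.sum_add_distrib, ← Finset.mul_sum, Finset.sum_sub_distrib,
      sum_u (fun κ => T κ 0)]
  have e2 : ∑ κ, n κ * ∑ μ, n μ * (1 / 2 * (st / s * (T μ κ - u κ * T μ 0 - n κ * ∑ σ, n σ * T μ σ)
        + ht / h * (n κ * ∑ σ, n σ * T μ σ))) = 1 / 2 * (ht / h * ∑ κ, n κ * ∑ μ, n μ * T κ μ) := by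
    have hin : ∀ μ, ∑ κ, n κ * (1 / 2 * (st / s * (T μ κ - u κ * T μ 0 - n κ * ∑ σ, n σ * T μ σ)
        + ht / h * (n κ * ∑ σ, n σ * T μ σ))) = 1 / 2 * (ht / h * ∑ σ, n σ * T μ σ) := by
      intro μ
      have : ∀ κ, n κ * (1 / 2 * (st / s * (T μ κ - u κ * T μ 0 - n κ * ∑ σ, n σ * T μ σ)
        + ht / h * (n κ * ∑ σ, n σ * T μ σ))) = 1 / 2 * (st / s * (n κ * T μ κ)
        - st / s * T μ 0 * (n κ * u κ) + (ht / h - st / s) * (∑ σ, n σ * T μ σ) * (n κ * n κ)) :=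
        fun κ => by ring
      simp_rw [this]
      rw [← Finset.mul_sum]
      simp_rw [Finset.sum_add_distrib, Finset.sum_sub_distrib, ← Finset.mul_sum, hn.sum_n_u, hn.sq]
      ring
    have hsw : ∑ κ, n κ * ∑ μ, n μ * (1 / 2 * (st / s * (T μ κ - u κ * T μ 0
        - n κ * ∑ σ, n σ * T μ σ) + ht / h * (n κ * ∑ σ, n σ * T μ σ))) =
        ∑ μ, n μ * ∑ κ, n κ * (1 / 2 * (st / s * (T μ κ - u κ * T μ 0
        - n κ * ∑ σ, n σ * T μ σ) + ht / h * (n κ * ∑ σ, n σ * T μ σ))) := by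
      simp_rw [Finset.mul_sum]
      rw [Finset.sum_comm]
      refine Finset.sum_congr rfl fun _ _ => Finset.sum_congr rfl fun _ _ => ?_
      simp only [← Finset.mul_sum]
      ring
    rw [hsw]
    simp_rw [hin]
    rw [Finset.mul_sum, Finset.mul_sum]
    exact Finset.sum_congr rfl fun _ _ => by ring
  rw [e1, e2, hn.zero, u_zero]
  simp only [div_eq_mul_inv]
  ring

/-- The radial counterpart of `divS_zero`. In contrast to the time component it requires the
symmetry of T, which identifies T(n,u) with T(u,n). -/
theorem divS_n {n : Fin 4 → ℝ} (hn : IsUnitRadial n) (s h st s' ht h' R : ℝ)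
    {T : Fin 4 → Fin 4 → ℝ} (hT : ∀ μ ν, T μ ν = T ν μ) (DT : Fin 4 → Fin 4 → Fin 4 → ℝ) :
    ∑ ν, n ν * divS n s h st s' ht h' R T DT ν = ∑ κ, ∑ μ, ginvS n s h κ μ * ∑ ν, n ν * DT κ μ ν
      - 1 / 2 * ((2 * st / s + ht / h) * ∑ σ, n σ * T σ 0
        + (-(2 * s' / h / s) + h' / h / h + 4 * (h - s) / (h * R) / s)
          * ∑ κ, n κ * ∑ μ, n μ * T κ μ)
      - 1 / 2 * (s' / s / s * (∑ κ, T κ κ - T 0 0 - ∑ κ, n κ * ∑ μ, n μ * T κ μ)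
        + h' / h / h * ∑ κ, n κ * ∑ μ, n μ * T κ μ) := by
  have e0 : ∑ ν, n ν * divS n s h st s' ht h' R T DT ν = ∑ κ, ∑ μ, ginvS n s h κ μ *
      (∑ ν, n ν * DT κ μ ν - ∑ σ, christoffelS n s h st s' ht h' R σ κ μ * (∑ ν, n ν * T σ ν)
        - ∑ σ, (∑ ν, n ν * christoffelS n s h st s' ht h' R σ κ ν) * T μ σ) := by
    unfold divS
    simp_rw [Finset.mul_sum]
    rw [Finset.sum_comm]
    refine Finset.sum_congr rfl fun κ _ => ?_
    rw [Finset.sum_comm]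
    refine Finset.sum_congr rfl fun μ _ => ?_
    have : ∀ ν, n ν * (ginvS n s h κ μ * (DT κ μ ν
        - ∑ σ, christoffelS n s h st s' ht h' R σ κ μ * T σ ν
        - ∑ σ, christoffelS n s h st s' ht h' R σ κ ν * T μ σ)) = ginvS n s h κ μ * (n ν * DT κ μ ν
        - ∑ σ, christoffelS n s h st s' ht h' R σ κ μ * (n ν * T σ ν)
        - ∑ σ, n ν * christoffelS n s h st s' ht h' R σ κ ν * T μ σ) := by
      intro ν
      have a1 : ∑ σ, christoffelS n s h st s' ht h' R σ κ μ * (n ν * T σ ν) =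
          n ν * ∑ σ, christoffelS n s h st s' ht h' R σ κ μ * T σ ν := by
        rw [Finset.mul_sum]; exact Finset.sum_congr rfl fun _ _ => by ring
      have a2 : ∑ σ, n ν * christoffelS n s h st s' ht h' R σ κ ν * T μ σ =
          n ν * ∑ σ, christoffelS n s h st s' ht h' R σ κ ν * T μ σ := by
        rw [Finset.mul_sum]; exact Finset.sum_congr rfl fun _ _ => by ring
      rw [a1, a2]; ring
    simp_rw [this]
    rw [← Finset.mul_sum, Finset.sum_sub_distrib, Finset.sum_sub_distrib]
    rw [Finset.sum_comm (f := fun ν σ => christoffelS n s h st s' ht h' R σ κ μ * (n ν * T σ ν)),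
      Finset.sum_comm (f := fun ν σ => n ν * christoffelS n s h st s' ht h' R σ κ ν * T μ σ)]
    simp_rw [← Finset.mul_sum, ← Finset.sum_mul]
  rw [e0]
  rw [sum_sum_mul_sub]
  rw [contract_christoffelS hn s h st s' ht h' R fun σ => ∑ ν, n ν * T σ ν]
  have hT0 : ∑ σ, n σ * T σ 0 = ∑ σ, n σ * T 0 σ := by simp_rw [hT 0]
  rw [hT0]
  congr 1
  have e : ∀ κ μ, ∑ σ, (∑ ν, n ν * christoffelS n s h st s' ht h' R σ κ ν) * T μ σ =
      1 / 2 * (s' / s * T μ κ + (ht * n κ - s' / s * u κ) * T μ 0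
        + (ht / h * u κ + (h' / h - s' / s) * n κ) * ∑ σ, n σ * T μ σ) := by
    intro κ μ
    have : ∀ σ, (∑ ν, n ν * christoffelS n s h st s' ht h' R σ κ ν) * T μ σ =
        1 / 2 * (s' / s * (proj n κ σ * T μ σ) + ht * n κ * (u σ * T μ σ)
          + (ht / h * u κ + h' / h * n κ) * (n σ * T μ σ)) := by
      intro σ; rw [christoffelS_n hn, proj_symm]; ring
    simp_rw [this]
    rw [← Finset.mul_sum]
    simp_rw [Finset.sum_add_distrib, ← Finset.mul_sum, sum_u, sum_proj]
    ring
  simp_rw [e]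
  rw [contract_ginvS]
  have e1 : ∑ κ, 1 / 2 * (s' / s * T κ κ + (ht * n κ - s' / s * u κ) * T κ 0
        + (ht / h * u κ + (h' / h - s' / s) * n κ) * ∑ σ, n σ * T κ σ) = 1 / 2 * (s' / s *
        (∑ κ, T κ κ - T 0 0 - ∑ κ, n κ * ∑ μ, n μ * T κ μ) + ht / h * ∑ σ, n σ * T 0 σ
        + ht * ∑ σ, n σ * T 0 σ + h' / h * ∑ κ, n κ * ∑ μ, n μ * T κ μ) := by
    have : ∀ κ, (s' / s * T κ κ + (ht * n κ - s' / s * u κ) * T κ 0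
        + (ht / h * u κ + (h' / h - s' / s) * n κ) * ∑ σ, n σ * T κ σ) = s' / s * T κ κ
        + ht * (n κ * T κ 0) - s' / s * (u κ * T κ 0) + ht / h * (u κ * ∑ σ, n σ * T κ σ)
        + (h' / h - s' / s) * (n κ * ∑ σ, n σ * T κ σ) := fun κ => by ring
    simp_rw [this]
    rw [← Finset.mul_sum]
    simp_rw [Finset.sum_add_distrib, Finset.sum_sub_distrib, Finset.sum_add_distrib,
      ← Finset.mul_sum]
    rw [sum_u fun κ => T κ 0, sum_u fun κ => ∑ σ, n σ * T κ σ, hT0]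
    ring
  have e2 : ∑ κ, n κ * ∑ μ, n μ * (1 / 2 * (s' / s * T μ κ + (ht * n κ - s' / s * u κ) * T μ 0
        + (ht / h * u κ + (h' / h - s' / s) * n κ) * ∑ σ, n σ * T μ σ)) =
        1 / 2 * (ht * ∑ σ, n σ * T 0 σ + h' / h * ∑ κ, n κ * ∑ μ, n μ * T κ μ) := by
    have hin : ∀ κ, ∑ μ, n μ * (1 / 2 * (s' / s * T μ κ + (ht * n κ - s' / s * u κ) * T μ 0
        + (ht / h * u κ + (h' / h - s' / s) * n κ) * ∑ σ, n σ * T μ σ)) =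
        1 / 2 * (s' / s * (∑ μ, n μ * T κ μ) + (ht * n κ - s' / s * u κ) * (∑ σ, n σ * T 0 σ)
        + (ht / h * u κ + (h' / h - s' / s) * n κ) * ∑ κ, n κ * ∑ μ, n μ * T κ μ) := by
      intro κ
      have : ∀ μ, n μ * (1 / 2 * (s' / s * T μ κ + (ht * n κ - s' / s * u κ) * T μ 0
        + (ht / h * u κ + (h' / h - s' / s) * n κ) * ∑ σ, n σ * T μ σ)) = 1 / 2 * (s' / s * (n μ *
        T κ μ) + (ht * n κ - s' / s * u κ) * (n μ * T 0 μ)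
        + (ht / h * u κ + (h' / h - s' / s) * n κ) * (n μ * ∑ σ, n σ * T μ σ)) :=
        fun μ => by rw [hT κ μ, hT 0 μ]; ring
      simp_rw [this]
      rw [← Finset.mul_sum]
      simp_rw [Finset.sum_add_distrib, ← Finset.mul_sum]
    simp_rw [hin]
    generalize hq : ∑ κ, n κ * ∑ μ, n μ * T κ μ = q₁
    have : ∀ κ, n κ * (1 / 2 * (s' / s * (∑ μ, n μ * T κ μ) + (ht * n κ - s' / s * u κ)
        * (∑ σ, n σ * T 0 σ) + (ht / h * u κ + (h' / h - s' / s) * n κ) * q₁)) =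
        1 / 2 * (s' / s * (n κ * ∑ μ, n μ * T κ μ)
        + (ht * (∑ σ, n σ * T 0 σ) + (h' / h - s' / s) * q₁) * (n κ * n κ)
        + (ht / h * q₁ - s' / s * (∑ σ, n σ * T 0 σ)) * (n κ * u κ)) := fun κ => by ring
    simp_rw [this]
    rw [← Finset.mul_sum]
    simp_rw [Finset.sum_add_distrib, ← Finset.mul_sum, hn.sum_n_u, hn.sq]
    rw [hq]; ring
  rw [e1, e2, hn.zero, u_zero]
  simp only [div_eq_mul_inv]
  ring

end TBData
end

noncomputable section
namespace TBData
variable {d : TBData}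

/-! ### The Tolman-Bondi connection -/

theorem pd_mul {φ ψ : (Fin 4 → ℝ) → ℝ} {x : Fin 4 → ℝ} (hφ : DifferentiableAt ℝ φ x)
    (hψ : DifferentiableAt ℝ ψ x) (κ : Fin 4) :
    pd κ (fun z => φ z * ψ z) x = pd κ φ x * ψ x + φ x * pd κ ψ x := by
  unfold pd
  rw [fderiv_fun_mul hφ hψ]
  simp
  ring

theorem pd_add {φ ψ : (Fin 4 → ℝ) → ℝ} {x : Fin 4 → ℝ} (hφ : DifferentiableAt ℝ φ x)
    (hψ : DifferentiableAt ℝ ψ x) (κ : Fin 4) :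
    pd κ (fun z => φ z + ψ z) x = pd κ φ x + pd κ ψ x := by
  unfold pd
  rw [fderiv_fun_add hφ hψ]
  simp

theorem pd_const (c : ℝ) (x : Fin 4 → ℝ) (κ : Fin 4) : pd κ (fun _ => c) x = 0 := by
  unfold pd; simp

theorem pd_congr {φ ψ : (Fin 4 → ℝ) → ℝ} {x : Fin 4 → ℝ} (h : φ =ᶠ[𝓝 x] ψ) (κ : Fin 4) :
    pd κ φ x = pd κ ψ x := by
  unfold pd; rw [h.fderiv_eq]

theorem pd_apply (μ κ : Fin 4) (x : Fin 4 → ℝ) :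
    pd κ (fun z => z μ) x = if κ = μ then 1 else 0 := by
  unfold pd
  have : HasFDerivAt (fun z : Fin 4 → ℝ => z μ) (ContinuousLinearMap.proj (R := ℝ) μ) x :=
    (ContinuousLinearMap.proj (R := ℝ) (φ := fun _ : Fin 4 => ℝ) μ).hasFDerivAt
  rw [this.fderiv]
  simp [Pi.single_apply, eq_comm]

theorem differentiableAt_rad {x : Fin 4 → ℝ} (h : 0 < rad x) : DifferentiableAt ℝ rad x := by
  have hne : x 1 ^ 2 + x 2 ^ 2 + x 3 ^ 2 ≠ 0 := by rw [← rad_sq]; positivity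
  unfold rad
  exact DifferentiableAt.sqrt (by fun_prop) hne

theorem pd_rad {x : Fin 4 → ℝ} (h : 0 < rad x) (κ : Fin 4) : pd κ rad x = radial x κ := by
  have h1 := pd_mul (differentiableAt_rad h) (differentiableAt_rad h) κ
  have h2 : (fun z => rad z * rad z) = fun z : Fin 4 → ℝ => z 1 * z 1 + z 2 * z 2 + z 3 * z 3 := by
    ext z; have := rad_sq z; nlinarith
  rw [h2, pd_add (by fun_prop) (by fun_prop), pd_add (by fun_prop) (by fun_prop),
    pd_mul (by fun_prop) (by fun_prop), pd_mul (by fun_prop) (by fun_prop),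
    pd_mul (by fun_prop) (by fun_prop)] at h1
  simp only [pd_apply] at h1
  rw [radial]
  fin_cases κ <;> simp at h1 ⊢
  · have : rad x * pd 0 rad x = 0 := by linarith
    exact (mul_eq_zero.1 this).resolve_left h.ne'
  all_goals
    rw [eq_div_iff h.ne']; linarith

theorem differentiableAt_radial {x : Fin 4 → ℝ} (h : 0 < rad x) (μ : Fin 4) :
    DifferentiableAt ℝ (fun z => radial z μ) x := by
  unfold radial
  split_ifs
  · exact differentiableAt_const _
  · have h1 : DifferentiableAt ℝ (fun z : Fin 4 → ℝ => z μ) x := by fun_prop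
    simp only [div_eq_mul_inv]
    exact h1.fun_mul ((differentiableAt_inv h.ne').comp x (differentiableAt_rad h))

theorem pd_radial {x : Fin 4 → ℝ} (h : 0 < rad x) (κ μ : Fin 4) :
    pd κ (fun z => radial z μ) x = proj (radial x) κ μ / rad x := by
  rw [eq_div_iff h.ne']
  have h1 := pd_mul (differentiableAt_radial h μ) (differentiableAt_rad h) κ
  have h2 : (fun z => radial z μ * rad z) =ᶠ[𝓝 x] fun z => if μ = 0 then 0 else z μ := by
    filter_upwards [continuous_rad.continuousAt.eventually (lt_mem_nhds h)] with z hz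
    unfold radial
    split_ifs
    · simp
    · field_simp
  rw [pd_congr h2, pd_rad h] at h1
  unfold proj
  by_cases hμ : μ = 0
  · subst hμ
    simp only [if_true, pd_const] at h1
    have h0 : radial x 0 = 0 := by simp [radial]
    rw [h0] at h1 ⊢
    rw [u_zero]
    have : (if κ = 0 then (1 : ℝ) else 0) = u κ := by simp [u, Pi.single_apply]
    rw [this]
    linarith
  · simp only [hμ, if_false, pd_apply] at h1
    have : u μ = 0 := by simp [u, hμ]
    rw [this]
    linarith

theorem pd_comp_rad {φ : ℝ × ℝ → ℝ} {x : Fin 4 → ℝ} (h : 0 < rad x)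
    (hφ : DifferentiableAt ℝ φ (x 0, rad x)) (κ : Fin 4) :
    DifferentiableAt ℝ (fun z : Fin 4 → ℝ => φ (z 0, rad z)) x ∧
    pd κ (fun z => φ (z 0, rad z)) x =
      pdt φ (x 0, rad x) * u κ + pdR φ (x 0, rad x) * radial x κ := by
  have h0 : HasFDerivAt (fun z : Fin 4 → ℝ => z 0) (ContinuousLinearMap.proj (R := ℝ) 0) x :=
    (ContinuousLinearMap.proj (R := ℝ) (φ := fun _ : Fin 4 => ℝ) 0).hasFDerivAt
  have h1 := h0.prodMk (differentiableAt_rad h).hasFDerivAt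
  have h2 := HasFDerivAt.comp (f := fun z : Fin 4 → ℝ => (z 0, rad z)) x hφ.hasFDerivAt h1
  refine ⟨h2.differentiableAt, ?_⟩
  have h3 : pd κ (fun z => φ (z 0, rad z)) x = fderiv ℝ φ (x 0, rad x) (u κ, radial x κ) := by
    unfold pd
    have e : fderiv ℝ (fun z : Fin 4 → ℝ => φ (z 0, rad z)) x = _ := h2.fderiv
    rw [e, ← pd_rad h κ]
    simp only [ContinuousLinearMap.comp_apply, ContinuousLinearMap.prod_apply]
    congr 2
    simp [u, Pi.single_apply, eq_comm]
  rw [h3]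
  have : ((u κ, radial x κ) : ℝ × ℝ) = u κ • (1, 0) + radial x κ • (0, 1) := by simp
  rw [this, map_add, map_smul, map_smul]
  simp only [pdt, pdR, smul_eq_mul]
  ring

theorem isUnitRadial_radial {x : Fin 4 → ℝ} (h : 0 < rad x) : IsUnitRadial (radial x) := by
  refine ⟨by simp [radial], ?_⟩
  have := rad_sq x
  simp only [radial, Fin.sum_univ_four]
  simp
  field_simp
  linarith

/-- The angular coefficient `(r/R)²` of the metric. -/
def sE (d : TBData) (p : ℝ × ℝ) : ℝ := d.yE p ^ 4

/-- The radial coefficient `1/γ²` of the metric. -/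
def hE (d : TBData) (p : ℝ × ℝ) : ℝ := 1 / d.gE p ^ 2

namespace Admissible

theorem g_eq (hd : d.Admissible) {x : Fin 4 → ℝ} (h0 : 0 ≤ x 0) (h1 : x 0 < d.tauS (rad x)) :
    d.g x = Matrix.of (metricS (radial x) (d.sE (x 0, rad x)) (d.hE (x 0, rad x))) := by
  ext μ ν
  simp only [g, metricS, Matrix.of_apply, (hd.y_eq h0 h1).1, hd.γ_eq h0 h1, sE, hE, proj]
  by_cases hμ : μ = 0
  · subst hμ
    have h0 : radial x 0 = 0 := by simp [radial]
    rw [h0]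
    by_cases hν : ν = 0
    · subst hν; simp [u]
    · have : u ν = 0 := by simp [u, hν]
      simp [this, Ne.symm hν]
  · have hu : u μ = 0 := by simp [u, hμ]
    by_cases hν : ν = 0
    · subst hν
      have h0 : radial x 0 = 0 := by simp [radial]
      rw [h0, hu]; simp [hμ]
    · simp only [hμ, hν, or_self, if_false, hu]
      by_cases h : μ = ν <;> simp [h] <;> ring

theorem contDiffAt_sE (hd : d.Admissible) {p : ℝ × ℝ} (hp : p ∈ d.Mext) :
    ContDiffAt ℝ ∞ d.sE p := (hd.contDiffAt_yE hp).pow 4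

theorem contDiffAt_hE (hd : d.Admissible) {t R : ℝ} (h0 : 0 ≤ t) (h1 : t < d.tauS R) :
    ContDiffAt ℝ ∞ d.hE (t, R) :=
  contDiffAt_const.div ((hd.contDiffAt_gE (hd.mem_Mext h0 h1) (hd.rR_pos h0 h1)).pow 2)
    (pow_ne_zero 2 (hd.gE_pos h0 h1).ne')

theorem pd_g (hd : d.Admissible) {x : Fin 4 → ℝ} (h0 : 0 < x 0) (h1 : x 0 < d.tauS (rad x))
    (hr : 0 < rad x) (κ μ ν : Fin 4) : pd κ (fun z => d.g z μ ν) x =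
      dmetricS (radial x) (d.sE (x 0, rad x)) (d.hE (x 0, rad x)) (pdt d.sE (x 0, rad x))
        (pdR d.sE (x 0, rad x)) (pdt d.hE (x 0, rad x)) (pdR d.hE (x 0, rad x)) (rad x) κ μ ν := by
  have hs := pd_comp_rad hr ((hd.contDiffAt_sE (hd.mem_Mext h0.le h1)).differentiableAt (by simp)) κ
  have hh := pd_comp_rad hr ((hd.contDiffAt_hE h0.le h1).differentiableAt (by simp)) κ
  have heq : (fun z => d.g z μ ν) =ᶠ[𝓝 x] fun z => (-(u μ * u ν) + d.sE (z 0, rad z) *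
      ((if μ = ν then 1 else 0) - u μ * u ν))
      + (d.hE (z 0, rad z) + (-1) * d.sE (z 0, rad z)) * (radial z μ * radial z ν) := by
    have hc : Continuous fun z : Fin 4 → ℝ => d.tauS (rad z) := hd.continuous_tauS.comp continuous_rad
    filter_upwards [(isOpen_lt continuous_const (continuous_apply 0)).mem_nhds h0,
      (isOpen_lt (continuous_apply 0) hc).mem_nhds h1] with z hz0 hz1
    rw [hd.g_eq (le_of_lt hz0) hz1]
    simp only [Matrix.of_apply, metricS, proj]
    ring
  have dn := differentiableAt_radial hr
  have dc : ∀ c : ℝ, DifferentiableAt ℝ (fun _ : Fin 4 → ℝ => c) x := fun c =>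
    differentiableAt_const c
  have d1 := hs.1.fun_mul (dc ((if μ = ν then 1 else 0) - u μ * u ν))
  have d2 := (dc (-1)).fun_mul hs.1
  have d3 := hh.1.fun_add d2
  have d4 := (dn μ).fun_mul (dn ν)
  rw [pd_congr heq, pd_add ((dc _).fun_add d1) (d3.fun_mul d4), pd_add (dc _) d1, pd_const,
    pd_mul hs.1 (dc _), pd_const, pd_mul d3 d4, pd_mul (dn μ) (dn ν),
    pd_add hh.1 d2, pd_mul (dc _) hs.1, pd_const, hs.2, hh.2, pd_radial hr, pd_radial hr]
  simp only [dmetricS, proj]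
  ring

/-- This connects the divergence in the Cartesian chart with its algebraic model. Positive radius
and positive time are needed in order to differentiate the metric in a full neighbourhood. -/
theorem divergence_eq (hd : d.Admissible) {x : Fin 4 → ℝ} (h0 : 0 < x 0)
    (h1 : x 0 < d.tauS (rad x)) (hr : 0 < rad x)
    (T : (Fin 4 → ℝ) → Matrix (Fin 4) (Fin 4) ℝ) (ν : Fin 4) : d.divergence T x ν =
      divS (radial x) (d.sE (x 0, rad x)) (d.hE (x 0, rad x)) (pdt d.sE (x 0, rad x))
        (pdR d.sE (x 0, rad x)) (pdt d.hE (x 0, rad x)) (pdR d.hE (x 0, rad x)) (rad x) (T x)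
        (fun κ μ ν => pd κ (fun z => T z μ ν) x) ν := by
  have hn := isUnitRadial_radial hr
  have hs : d.sE (x 0, rad x) ≠ 0 := pow_ne_zero 4 (hd.yE_pos h0.le h1).ne'
  have hh : d.hE (x 0, rad x) ≠ 0 := one_div_ne_zero (pow_ne_zero 2 (hd.gE_pos h0.le h1).ne')
  have hinv : (d.g x)⁻¹ = Matrix.of (ginvS (radial x) (d.sE (x 0, rad x)) (d.hE (x 0, rad x))) := by
    rw [hd.g_eq h0.le h1, hn.metricS_inv hs hh]
  have hΓ : ∀ κ μ ν, d.christoffel x κ μ ν = christoffelS (radial x) (d.sE (x 0, rad x))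
      (d.hE (x 0, rad x)) (pdt d.sE (x 0, rad x)) (pdR d.sE (x 0, rad x)) (pdt d.hE (x 0, rad x))
      (pdR d.hE (x 0, rad x)) (rad x) κ μ ν := by
    intro κ μ ν
    rw [← christoffelS_eq hn]
    simp only [christoffel, hinv, Matrix.of_apply, hd.pd_g h0 h1 hr]
  simp only [divergence, covDeriv, hinv, hΓ, Matrix.of_apply, divS]

end Admissible
end TBData
end

noncomputable section

/-! ### Local versions of differentiation under the integral sign -/

/-- Functions that are smooth only near a compact set are replaced by global ones, so that the
results on parametric integrals apply. -/
theorem IsCompact.exists_contDiff_eq {E F : Type*} [NormedAddCommGroup E] [NormedSpace ℝ E]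
    [FiniteDimensional ℝ E] [NormedAddCommGroup F] [NormedSpace ℝ F] {K : Set E} (hK : IsCompact K)
    {n : ℕ} {f : E → F} (hf : ∀ x ∈ K, ContDiffAt ℝ n f x) :
    ∃ g : E → F, ContDiff ℝ n g ∧ ∀ᶠ x in 𝓝ˢ K, g x = f x := by
  set O : Set E := {x | ContDiffAt ℝ n f x} with hO
  have hOo : IsOpen O := isOpen_iff_mem_nhds.2 fun x hx => ContDiffAt.eventually hx (by simp)
  obtain ⟨K', hK', hKK', hK'O⟩ := exists_compact_between hK hOo hf
  obtain ⟨χ, h1, h2, h3⟩ := exists_contMDiffMap_one_nhds_of_subset_interior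
    (modelWithCornersSelf ℝ E) (n := n) hK.isClosed hKK'
  have hχ : ContDiff ℝ n χ := χ.contMDiff.contDiff
  refine ⟨fun x => χ x • f x, ?_, ?_⟩
  · rw [contDiff_iff_contDiffAt]
    intro p
    by_cases hp : p ∈ O
    · exact hχ.contDiffAt.smul hp
    · have hp' : p ∈ K'ᶜ := fun h => hp (hK'O h)
      have : (fun x => χ x • f x) =ᶠ[𝓝 p] fun _ => 0 := by
        filter_upwards [hK'.isClosed.isOpen_compl.mem_nhds hp'] with z hz
        simp [h2 z hz]
      exact contDiffAt_const.congr_of_eventuallyEq this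
  · filter_upwards [h1] with x hx
    simp [hx]

theorem exists_contDiff_eq_near_slice {E F : Type*} [NormedAddCommGroup E] [NormedSpace ℝ E]
    [FiniteDimensional ℝ E] [NormedAddCommGroup F] [NormedSpace ℝ F] {n : ℕ} {φ : E → ℝ → F}
    {a b : ℝ} {x : E} (h : ∀ s ∈ uIcc a b, ContDiffAt ℝ n (Function.uncurry φ) (x, s)) :
    ∃ ψ : E → ℝ → F, ContDiff ℝ n (Function.uncurry ψ) ∧
      (∀ᶠ z in 𝓝 x, ∀ s ∈ uIcc a b, ψ z s = φ z s) ∧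
      ∀ s ∈ uIcc a b, Function.uncurry ψ =ᶠ[𝓝 (x, s)] Function.uncurry φ := by
  obtain ⟨g, hg, hgf⟩ := ((isCompact_singleton (x := x)).prod (isCompact_uIcc (a := a) (b := b))
    |>.exists_contDiff_eq (f := Function.uncurry φ) (n := n) (by
      rintro ⟨x', s⟩ ⟨rfl, hs⟩; exact h s hs))
  have hloc : ∀ s ∈ uIcc a b, g =ᶠ[𝓝 (x, s)] Function.uncurry φ := fun s hs =>
    (eventually_nhdsSet_iff_forall.1 hgf) (x, s) ⟨rfl, hs⟩
  refine ⟨fun z s => g (z, s), hg, ?_, hloc⟩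
  exact isCompact_uIcc.eventually_forall_of_forall_eventually fun s hs => hloc s hs

theorem contDiffAt_intervalIntegral {E F : Type} [NormedAddCommGroup E] [NormedSpace ℝ E]
    [FiniteDimensional ℝ E] [NormedAddCommGroup F] [NormedSpace ℝ F] [CompleteSpace F] {n : ℕ}
    {φ : E → ℝ → F} {a b : ℝ} {x : E}
    (h : ∀ s ∈ uIcc a b, ContDiffAt ℝ n (Function.uncurry φ) (x, s)) :
    ContDiffAt ℝ n (fun z => ∫ s in a..b, φ z s) x := by
  obtain ⟨ψ, hψ, heq, -⟩ := exists_contDiff_eq_near_slice h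
  refine (contDiff_intervalIntegral n hψ a b).contDiffAt.congr_of_eventuallyEq ?_
  filter_upwards [heq] with z hz
  exact intervalIntegral.integral_congr fun s hs => (hz s hs).symm

theorem fderiv_intervalIntegral {E : Type} [NormedAddCommGroup E] [NormedSpace ℝ E]
    [FiniteDimensional ℝ E] {φ : E → ℝ → ℝ} {a b : ℝ} {x : E}
    (h : ∀ s ∈ uIcc a b, ContDiffAt ℝ 1 (Function.uncurry φ) (x, s)) (v : E) :
    fderiv ℝ (fun z => ∫ s in a..b, φ z s) x v = ∫ s in a..b, fderiv ℝ (fun z => φ z s) x v := by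
  obtain ⟨ψ, hψ, heq, hloc⟩ := exists_contDiff_eq_near_slice (n := 1) (φ := φ) (x := x)
    (a := a) (b := b) (by exact_mod_cast h)
  have hψ1 : ContDiff ℝ 1 (Function.uncurry ψ) := by exact_mod_cast hψ
  have h1 := hasFDerivAt_intervalIntegral_of_contDiff hψ1 a b x
  have e : (fun z => ∫ s in a..b, φ z s) =ᶠ[𝓝 x] fun z => ∫ s in a..b, ψ z s := by
    filter_upwards [heq] with z hz
    exact intervalIntegral.integral_congr fun s hs => (hz s hs).symm
  have hint : IntervalIntegrable (fun s => (fderiv ℝ (Function.uncurry ψ) (x, s)).comp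
      (ContinuousLinearMap.inl ℝ E ℝ)) volume a b := by
    have : Continuous fun s => (fderiv ℝ (Function.uncurry ψ) (x, s)).comp
        (ContinuousLinearMap.inl ℝ E ℝ) :=
      ((hψ1.continuous_fderiv one_ne_zero).comp
        (continuous_const.prodMk continuous_id)).clm_comp continuous_const
    exact this.intervalIntegrable _ _
  rw [e.fderiv_eq, h1.fderiv, ContinuousLinearMap.intervalIntegral_apply hint v]
  refine intervalIntegral.integral_congr fun s hs => ?_
  have h2 : HasFDerivAt (Function.uncurry ψ) (fderiv ℝ (Function.uncurry ψ) (x, s)) (x, s) :=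
    (hψ1.differentiable one_ne_zero _).hasFDerivAt
  have h3 := HasFDerivAt.comp (f := fun e : E => (e, s)) x h2 (hasFDerivAt_prodMk_left x s)
  have h4 : (fun z => φ z s) =ᶠ[𝓝 x] fun z => Function.uncurry ψ (z, s) := by
    have hc : Tendsto (fun z : E => (z, s)) (𝓝 x) (𝓝 (x, s)) :=
      (Continuous.prodMk_left s).tendsto x
    filter_upwards [hc.eventually (hloc s hs)] with z hz
    exact hz.symm
  have h5 : HasFDerivAt (fun z => Function.uncurry ψ (z, s)) _ x := h3
  rw [h4.fderiv_eq, h5.fderiv]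

/-- Leibniz' rule for an integral with moving end points. -/
theorem hasDerivAt_integral_of_moving_endpoints {A : ℝ × ℝ → ℝ} {α β : ℝ → ℝ} {α' β' s : ℝ}
    (hα : HasDerivAt α α' s) (hβ : HasDerivAt β β' s)
    (hA : ∀ R ∈ uIcc (α s) (β s), ContDiffAt ℝ 1 A (s, R)) :
    HasDerivAt (fun s => ∫ R in α s..β s, A (s, R))
      ((∫ R in α s..β s, pdt A (s, R)) + β' * A (s, β s) - α' * A (s, α s)) s := by
  obtain ⟨B, hB, hBA⟩ := ((isCompact_singleton (x := s)).prod
    (isCompact_uIcc (a := α s) (b := β s)) |>.exists_contDiff_eq (f := A) (n := 1) (by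
      rintro ⟨x', R⟩ ⟨rfl, hs⟩; exact_mod_cast hA R hs))
  have hB1 : ContDiff ℝ 1 B := by exact_mod_cast hB
  have hloc : ∀ R ∈ uIcc (α s) (β s), B =ᶠ[𝓝 (s, R)] A := fun R hR =>
    (eventually_nhdsSet_iff_forall.1 hBA) (s, R) ⟨rfl, hR⟩
  have hseg : ∀ s' R, R ∈ uIcc (α s') (β s') → ∃ x ∈ Icc (0 : ℝ) 1, R = α s' + x * (β s' - α s') := by
    intro s' R hR
    rw [← segment_eq_uIcc, segment_eq_image'] at hR
    obtain ⟨x, hx, rfl⟩ := hR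
    exact ⟨x, hx, by simp⟩
  have hsegm : ∀ s', ∀ x ∈ Icc (0 : ℝ) 1, α s' + x * (β s' - α s') ∈ uIcc (α s') (β s') := by
    intro s' x hx
    rw [← segment_eq_uIcc, segment_eq_image']
    exact ⟨x, hx, by simp⟩
  have hev : ∀ᶠ s' in 𝓝 s, ∀ x ∈ Icc (0 : ℝ) 1,
      B (s', α s' + x * (β s' - α s')) = A (s', α s' + x * (β s' - α s')) := by
    refine isCompact_Icc.eventually_forall_of_forall_eventually fun x hx => ?_
    have h1 := hloc _ (hsegm s x hx)
    have hα1 : ContinuousAt (fun z : ℝ × ℝ => α z.1) (s, x) :=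
      ContinuousAt.comp (g := α) hα.continuousAt continuousAt_fst
    have hβ1 : ContinuousAt (fun z : ℝ × ℝ => β z.1) (s, x) :=
      ContinuousAt.comp (g := β) hβ.continuousAt continuousAt_fst
    have h2 : ContinuousAt (fun z : ℝ × ℝ => (z.1, α z.1 + z.2 * (β z.1 - α z.1))) (s, x) :=
      continuousAt_fst.prodMk (hα1.add (continuousAt_snd.mul (hβ1.sub hα1)))
    exact h2.eventually h1
  -- The integral with moving end points is a difference of values of this primitive. The primitive
  -- is C¹ because rescaling turns it into an integral over [0,1], and the chain rule then gives the
  -- formula.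
  set G : ℝ × ℝ → ℝ := fun p => ∫ R in (0 : ℝ)..p.2, B (p.1, R) with hG
  have hBc : ∀ s', Continuous fun R => B (s', R) := fun s' =>
    hB1.continuous.comp (continuous_const.prodMk continuous_id)
  have hGC : ContDiff ℝ 1 G := by
    have e : G = fun p => p.2 * ∫ x in (0 : ℝ)..1, B (p.1, p.2 * x) := by
      ext p
      have := intervalIntegral.mul_integral_comp_mul_left (a := 0) (b := 1)
        (f := fun R => B (p.1, R)) (c := p.2)
      simp only [mul_zero, mul_one] at this
      rw [this]
    rw [e]
    refine contDiff_snd.mul ?_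
    have := contDiff_intervalIntegral (E := ℝ × ℝ) 1 (φ := fun p x => B (p.1, p.2 * x)) (by
      refine hB.comp ?_
      fun_prop) 0 1
    exact_mod_cast this
  have hGR : ∀ s' R, pdR G (s', R) = B (s', R) := by
    intro s' R
    have h1 := hasDerivAt_pdR ((hGC.differentiable one_ne_zero) (s', R))
    have h2 : HasDerivAt (fun R => G (s', R)) (B (s', R)) R :=
      intervalIntegral.integral_hasDerivAt_right ((hBc s').intervalIntegrable _ _)
        (hBc s').stronglyMeasurable.stronglyMeasurableAtFilter (hBc s').continuousAt
    exact h1.unique h2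
  have hGt : ∀ s' R, pdt G (s', R) = ∫ ρ in (0 : ℝ)..R, pdt B (s', ρ) := by
    intro s' R
    have h1 := hasDerivAt_pdt ((hGC.differentiable one_ne_zero) (s', R))
    have hsl : ContDiff ℝ 1 (Function.uncurry fun z ρ => B (z, ρ)) := hB1
    have h2 : HasFDerivAt (fun s' => G (s', R)) _ s' :=
      hasFDerivAt_intervalIntegral_of_contDiff hsl 0 R s'
    have h3 := fderiv_intervalIntegral (φ := fun z ρ => B (z, ρ)) (a := 0) (b := R) (x := s')
      (fun ρ _ => hsl.contDiffAt) 1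
    have h4 := h2.hasDerivAt.unique h1
    rw [← h4, ← h2.fderiv]
    refine h3.trans (intervalIntegral.integral_congr fun ρ _ => ?_)
    rw [fderiv_apply_one_eq_deriv]
    exact (hasDerivAt_pdt ((hB1.differentiable one_ne_zero) (s', ρ))).deriv
  have hd : HasDerivAt (fun s => G (s, β s) - G (s, α s)) _ s :=
    (hasDerivAt_comp_curve ((hGC.differentiable one_ne_zero) _) hβ).sub
      (hasDerivAt_comp_curve ((hGC.differentiable one_ne_zero) _) hα)
  have heq : (fun s => ∫ R in α s..β s, A (s, R)) =ᶠ[𝓝 s] fun s => G (s, β s) - G (s, α s) := by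
    filter_upwards [hev] with s' hs'
    simp only [hG]
    rw [intervalIntegral.integral_interval_sub_left ((hBc s').intervalIntegrable _ _)
      ((hBc s').intervalIntegrable _ _)]
    refine intervalIntegral.integral_congr fun R hR => ?_
    obtain ⟨x, hx, rfl⟩ := hseg s' R hR
    exact (hs' x hx).symm
  have hBtc : Continuous fun R => pdt B (s, R) := by
    have : Continuous fun p => pdt B p :=
      (hB1.continuous_fderiv one_ne_zero).clm_apply continuous_const
    exact this.comp (continuous_const.prodMk continuous_id)
  refine (hd.congr_of_eventuallyEq heq).congr_deriv ?_
  rw [hGR, hGR, hGt, hGt, (hloc _ right_mem_uIcc).eq_of_nhds, (hloc _ left_mem_uIcc).eq_of_nhds]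
  have e2 : ∫ R in α s..β s, pdt A (s, R) = ∫ R in α s..β s, pdt B (s, R) :=
    intervalIntegral.integral_congr fun R hR => by
      simp only [pdt]; rw [(hloc R hR).fderiv_eq]
  rw [e2, ← intervalIntegral.integral_interval_sub_left (hBtc.intervalIntegrable 0 (β s))
      (hBtc.intervalIntegrable 0 (α s))]
  ring

/-- A continuous function with nonpositive derivative off a finite set is antitone. -/
theorem le_of_hasDerivAt_nonpos_off_finite {f f' : ℝ → ℝ} (S : Finset ℝ) : ∀ {a b : ℝ}, a ≤ b →
    ContinuousOn f (Icc a b) → (∀ t ∈ Ioo a b, t ∉ S → HasDerivAt f (f' t) t ∧ f' t ≤ 0) →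
    f b ≤ f a := by
  induction S using Finset.strongInduction with
  | H S ih =>
    intro a b hab hc hd
    by_cases h : ∃ c ∈ S, c ∈ Ioo a b
    · obtain ⟨c, hcS, hc1, hc2⟩ := h
      have h1 := ih (S.erase c) (Finset.erase_ssubset hcS) hc1.le
        (hc.mono (Icc_subset_Icc_right hc2.le)) fun t ht htS => hd t ⟨ht.1, ht.2.trans hc2⟩
          fun h => htS (Finset.mem_erase.2 ⟨ht.2.ne, h⟩)
      have h2 := ih (S.erase c) (Finset.erase_ssubset hcS) hc2.le
        (hc.mono (Icc_subset_Icc_left hc1.le)) fun t ht htS => hd t ⟨hc1.trans ht.1, ht.2⟩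
          fun h => htS (Finset.mem_erase.2 ⟨ht.1.ne', h⟩)
      exact h2.trans h1
    · push Not at h
      have h1 : ∀ t ∈ Ioo a b, HasDerivAt f (f' t) t ∧ f' t ≤ 0 := fun t ht =>
        hd t ht fun hS => h t hS ht
      refine antitoneOn_of_deriv_nonpos (convex_Icc a b) hc (fun t ht => ?_) (fun t ht => ?_)
        (left_mem_Icc.2 hab) (right_mem_Icc.2 hab) hab
      · rw [interior_Icc] at ht
        exact (h1 t ht).1.differentiableAt.differentiableWithinAt
      · rw [interior_Icc] at ht
        rw [(h1 t ht).1.deriv]; exact (h1 t ht).2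

end

noncomputable section
namespace TBData
variable {d : TBData}

/-! ### The balance law for the Kodama current -/

/-- The coefficients of the balance law, in terms of the areal radius and its derivatives. -/
theorem balance_algebra {r rR rT rTR rRR m m' W Ep R a b e p a_t b_t b_R e_R tan₀ tanₙ : ℝ}
    (hr : r ≠ 0) (hrR : rR ≠ 0) (hW : W ≠ 0) (hR : R ≠ 0)
    (hE : rT * rTR = Ep + m' / r - m * rR / r ^ 2) {s h st s' ht h' : ℝ}
    (hs : s = r ^ 2 / R ^ 2) (hh : h = rR ^ 2 / W) (hst : st = 2 * r * rT / R ^ 2)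
    (hs' : s' = 2 * r * rR / R ^ 2 - 2 * r ^ 2 / R ^ 3) (hht : ht = 2 * rR * rTR / W)
    (hh' : h' = 2 * rR * rRR / W - rR ^ 2 * (2 * Ep) / W ^ 2)
    (eq₀ : -a_t + tan₀ / s + b_R / h - 1 / 2 * ((2 * st / s + ht / h) * a
      + (-(2 * s' / h / s) + h' / h / h + 4 * (h - s) / (h * R) / s) * b)
      - 1 / 2 * (st / s / s * p + ht / h / h * e) = 0)
    (eqₙ : -b_t + tanₙ / s + e_R / h - 1 / 2 * ((2 * st / s + ht / h) * b
      + (-(2 * s' / h / s) + h' / h / h + 4 * (h - s) / (h * R) / s) * e)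
      - 1 / 2 * (s' / s / s * p + h' / h / h * e) = 0) :
    (2 * r * rT * rR + r ^ 2 * rTR) * a + r ^ 2 * rR * a_t
      - ((2 * r * rT * rT + r ^ 2 * (-(m / r ^ 2))) * b + r ^ 2 * rT * b_t) =
    (2 * r * rR * rR / h + r ^ 2 * rRR / h - r ^ 2 * rR * h' / h ^ 2) * b + r ^ 2 * rR / h * b_R
      - ((2 * r * rR * rT / h + r ^ 2 * rTR / h - r ^ 2 * rT * h' / h ^ 2) * e
        + r ^ 2 * rT / h * e_R)
      + r * m' / rR * b
      + (R ^ 2 * (rR * tan₀ - rT * tanₙ) - R * rT * p - 2 * R * (rR * b - rT * e)) := by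
  -- The R-derivative of the energy equation eliminates E', and the two divergence equations
  -- eliminate the time derivatives of a and b. The remaining identity is one of rational functions.
  have hEp : Ep = rT * rTR - m' / r + m * rR / r ^ 2 := by linarith
  have ha : a_t = tan₀ / s + b_R / h - 1 / 2 * ((2 * st / s + ht / h) * a
      + (-(2 * s' / h / s) + h' / h / h + 4 * (h - s) / (h * R) / s) * b)
      - 1 / 2 * (st / s / s * p + ht / h / h * e) := by linarith
  have hb : b_t = tanₙ / s + e_R / h - 1 / 2 * ((2 * st / s + ht / h) * b
      + (-(2 * s' / h / s) + h' / h / h + 4 * (h - s) / (h * R) / s) * e)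
      - 1 / 2 * (s' / s / s * p + h' / h / h * e) := by linarith
  clear eq₀ eqₙ hE
  subst hs hh hst hs' hht hh' hEp ha hb
  field_simp
  ring

theorem Admissible.sE_eq (_hd : d.Admissible) {p : ℝ × ℝ} (hp : p.2 ≠ 0) :
    d.sE p = d.rE p ^ 2 / p.2 ^ 2 := by
  simp only [sE, rE]; field_simp

theorem Admissible.hE_eq (hd : d.Admissible) (p : ℝ × ℝ) :
    d.hE p = d.rR p ^ 2 / (1 + 2 * d.E p.2) := by
  simp only [hE, gE, div_pow, Real.sq_sqrt (hd.E_pos p.2).le, one_div_div]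

theorem Admissible.pdt_sE (hd : d.Admissible) {p : ℝ × ℝ} (hp : p ∈ d.Mext) (hR : p.2 ≠ 0) :
    pdt d.sE p = 2 * d.rE p * d.rT p / p.2 ^ 2 := by
  obtain ⟨t, R⟩ := p
  have h1 := hasDerivAt_pdt ((hd.contDiffAt_sE hp).differentiableAt (by simp))
  have h2 := ((hasDerivAt_pdt ((hd.contDiffAt_rE hp).differentiableAt (by simp))).pow 2).div_const
    (R ^ 2)
  have e : (fun s => d.sE (s, R)) = fun s => d.rE (s, R) ^ 2 / R ^ 2 := by
    ext s; exact hd.sE_eq hR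
  rw [e] at h1
  rw [h1.unique h2]
  simp [rT]

theorem Admissible.pdR_sE (hd : d.Admissible) {p : ℝ × ℝ} (hp : p ∈ d.Mext) (hR : p.2 ≠ 0) :
    pdR d.sE p = 2 * d.rE p * d.rR p / p.2 ^ 2 - 2 * d.rE p ^ 2 / p.2 ^ 3 := by
  obtain ⟨t, R⟩ := p
  have h1 := hasDerivAt_pdR ((hd.contDiffAt_sE hp).differentiableAt (by simp))
  have h2 := ((hasDerivAt_pdR ((hd.contDiffAt_rE hp).differentiableAt (by simp))).pow 2).div
    ((hasDerivAt_id R).pow 2) (pow_ne_zero 2 hR)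
  have e : (fun s => d.sE (t, s)) =ᶠ[𝓝 R] fun s => d.rE (t, s) ^ 2 / s ^ 2 := by
    filter_upwards [isOpen_ne.mem_nhds hR] with s hs
    exact hd.sE_eq hs
  have h1' := h1.congr_of_eventuallyEq e.symm
  have h2' : HasDerivAt (fun s => d.rE (t, s) ^ 2 / s ^ 2) _ R := h2
  rw [h1'.unique h2']
  simp only [id, Pi.pow_apply]
  simp only [rR]
  norm_num
  have : R ≠ 0 := hR
  field_simp

theorem Admissible.pdt_hE (hd : d.Admissible) {p : ℝ × ℝ} (h0 : 0 ≤ p.1) (h1 : p.1 < d.tauS p.2) :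
    pdt d.hE p = 2 * d.rR p * pdR d.rT p / (1 + 2 * d.E p.2) := by
  obtain ⟨t, R⟩ := p
  have hp := hd.mem_Mext h0 h1
  have h1 := hasDerivAt_pdt ((hd.contDiffAt_hE h0 h1).differentiableAt (by simp))
  have h2 := ((hasDerivAt_pdt ((hd.contDiffAt_rR hp).differentiableAt (by simp))).pow 2).div_const
    (1 + 2 * d.E R)
  have e : (fun s => d.hE (s, R)) = fun s => d.rR (s, R) ^ 2 / (1 + 2 * d.E R) := by
    ext s; exact hd.hE_eq _
  rw [e] at h1
  rw [h1.unique h2, hd.pdt_rR hp]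
  simp

theorem Admissible.pdR_hE (hd : d.Admissible) {p : ℝ × ℝ} (h0 : 0 ≤ p.1) (h1 : p.1 < d.tauS p.2) :
    pdR d.hE p = 2 * d.rR p * pdR d.rR p / (1 + 2 * d.E p.2)
      - d.rR p ^ 2 * (2 * deriv d.E p.2) / (1 + 2 * d.E p.2) ^ 2 := by
  obtain ⟨t, R⟩ := p
  have hp := hd.mem_Mext h0 h1
  have h1 := hasDerivAt_pdR ((hd.contDiffAt_hE h0 h1).differentiableAt (by simp))
  have hE := ((hd.contDiff_E.differentiable (by simp) R).hasDerivAt.const_mul 2).const_add 1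
  have hE0 := (hd.E_pos R).ne'
  have h2 := ((hasDerivAt_pdR ((hd.contDiffAt_rR hp).differentiableAt (by simp))).pow 2).div hE hE0
  have e : (fun s => d.hE (t, s)) = fun s => d.rR (t, s) ^ 2 / (1 + 2 * d.E s) := by
    ext s; exact hd.hE_eq _
  rw [e] at h1
  have h2' : HasDerivAt (fun s => d.rR (t, s) ^ 2 / (1 + 2 * d.E s)) _ R := h2
  rw [h1.unique h2']
  simp only [Pi.pow_apply]
  norm_num
  field_simp

/-! ### Spherical coordinates -/

/-- The radial unit vector. -/
def nvec (θ φ : ℝ) : Fin 4 → ℝ :=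
  ![0, Real.sin θ * Real.cos φ, Real.sin θ * Real.sin φ, Real.cos θ]

/-- The unit vector in the direction of `∂_θ`. -/
def eθ (θ φ : ℝ) : Fin 4 → ℝ :=
  ![0, Real.cos θ * Real.cos φ, Real.cos θ * Real.sin φ, -Real.sin θ]

/-- The unit vector in the direction of `∂_φ`. -/
def eφ (φ : ℝ) : Fin 4 → ℝ := ![0, -Real.sin φ, Real.cos φ, 0]

theorem delta_eq (θ φ : ℝ) (κ μ : Fin 4) : (if κ = μ then (1 : ℝ) else 0) =
    u κ * u μ + nvec θ φ κ * nvec θ φ μ + eθ θ φ κ * eθ θ φ μ + eφ φ κ * eφ φ μ := by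
  have h1 := Real.sin_sq_add_cos_sq θ
  have h2 := Real.sin_sq_add_cos_sq φ
  fin_cases κ <;> fin_cases μ <;> simp [u, nvec, eθ, eφ]
  · linear_combination -(Real.cos φ ^ 2) * h1 - h2
  · linear_combination -(Real.cos φ * Real.sin φ) * h1
  · ring
  · linear_combination -(Real.cos φ * Real.sin φ) * h1
  · linear_combination -(Real.sin φ ^ 2) * h1 - h2
  · ring
  · ring
  · ring
  · linear_combination -h1

/-- The trace over the tangent space of the spheres. -/
theorem trace_tangential (θ φ : ℝ) (X : Fin 4 → Fin 4 → ℝ) :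
    ∑ κ, X κ κ - X 0 0 - ∑ κ, nvec θ φ κ * ∑ μ, nvec θ φ μ * X κ μ =
      ∑ κ, eθ θ φ κ * ∑ μ, eθ θ φ μ * X κ μ + ∑ κ, eφ φ κ * ∑ μ, eφ φ μ * X κ μ := by
  have h0 : X 0 0 = ∑ κ, ∑ μ, u κ * u μ * X κ μ := by
    simp_rw [mul_assoc, ← Finset.mul_sum, sum_u]
  have h1 : ∑ κ, X κ κ = ∑ κ, ∑ μ, (if κ = μ then 1 else 0) * X κ μ := by simp
  rw [h1, h0]
  simp_rw [Finset.mul_sum, ← Finset.sum_sub_distrib, ← Finset.sum_add_distrib]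
  refine Finset.sum_congr rfl fun κ _ => Finset.sum_congr rfl fun μ _ => ?_
  rw [delta_eq θ φ]; ring

theorem radial_sph {R : ℝ} (hR : 0 < R) (t θ φ : ℝ) : radial (sph t R θ φ) = nvec θ φ := by
  ext μ
  rw [radial, rad_sph, abs_of_pos hR]
  fin_cases μ <;> simp [sph, nvec] <;> field_simp

theorem fderiv_eq_sum_pd (f : (Fin 4 → ℝ) → ℝ) (x v : Fin 4 → ℝ) :
    fderiv ℝ f x v = ∑ κ, v κ * pd κ f x := by
  have : v = ∑ κ, v κ • (Pi.single κ 1 : Fin 4 → ℝ) := by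
    ext i; simp [Finset.sum_apply, Pi.single_apply]
  conv_lhs => rw [this]
  rw [map_sum]
  simp [pd]

theorem hasDerivAt_comp_of_curve {f : (Fin 4 → ℝ) → ℝ} {σ : ℝ → Fin 4 → ℝ} {v : Fin 4 → ℝ} {s : ℝ}
    (hf : DifferentiableAt ℝ f (σ s)) (hσ : HasDerivAt σ v s) :
    HasDerivAt (fun s => f (σ s)) (∑ κ, v κ * pd κ f (σ s)) s := by
  rw [← fderiv_eq_sum_pd]
  exact hf.hasFDerivAt.comp_hasDerivAt s hσ

theorem hasDerivAt_sph_t (t R θ φ : ℝ) : HasDerivAt (fun s => sph s R θ φ) u t := by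
  rw [hasDerivAt_pi]
  intro i
  fin_cases i <;> simp [sph, u]
  · exact hasDerivAt_id t
  all_goals exact hasDerivAt_const _ _

theorem hasDerivAt_sph_R (t R θ φ : ℝ) : HasDerivAt (fun s => sph t s θ φ) (nvec θ φ) R := by
  rw [hasDerivAt_pi]
  intro i
  fin_cases i <;> simp [sph, nvec]
  · exact hasDerivAt_const _ _
  · simpa using (hasDerivAt_id R).mul_const (Real.sin θ * Real.cos φ)
  · simpa using (hasDerivAt_id R).mul_const (Real.sin θ * Real.sin φ)
  · simpa using (hasDerivAt_id R).mul_const (Real.cos θ)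

theorem hasDerivAt_sph_θ (t R θ φ : ℝ) :
    HasDerivAt (fun s => sph t R s φ) (R • eθ θ φ) θ := by
  rw [hasDerivAt_pi]
  intro i
  fin_cases i <;> simp [sph, eθ]
  · exact hasDerivAt_const _ _
  · exact ((Real.hasDerivAt_sin θ).mul_const _).const_mul R
  · exact ((Real.hasDerivAt_sin θ).mul_const _).const_mul R
  · simpa using (Real.hasDerivAt_cos θ).const_mul R

theorem hasDerivAt_sph_φ (t R θ φ : ℝ) :
    HasDerivAt (fun s => sph t R θ s) ((R * Real.sin θ) • eφ φ) φ := by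
  rw [hasDerivAt_pi]
  intro i
  fin_cases i <;> simp [sph, eφ]
  · exact hasDerivAt_const _ _
  · exact (((Real.hasDerivAt_cos φ).const_mul (Real.sin θ)).const_mul R).congr_deriv (by ring)
  · exact (((Real.hasDerivAt_sin φ).const_mul (Real.sin θ)).const_mul R).congr_deriv (by ring)
  · exact hasDerivAt_const _ _

theorem contDiff_sph : ContDiff ℝ ∞ fun z : ((ℝ × ℝ) × ℝ) × ℝ => sph z.1.1.1 z.1.1.2 z.1.2 z.2 := by
  rw [contDiff_pi]
  intro i
  fin_cases i <;> simp [sph] <;> fun_prop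

theorem continuous_sph : Continuous fun z : ((ℝ × ℝ) × ℝ) × ℝ => sph z.1.1.1 z.1.1.2 z.1.2 z.2 :=
  contDiff_sph.continuous

end TBData
end

noncomputable section
namespace TBData
variable {d : TBData}

/-! ### Averages over spheres -/

/-- The integral over the coordinate rectangle of the sphere. -/
def sphI (F : ℝ → ℝ → ℝ) : ℝ := ∫ θ in (0 : ℝ)..Real.pi, ∫ φ in (0 : ℝ)..2 * Real.pi, F θ φ

/-- `sphI` as a linear functional on continuous functions. -/
def sphL : C(ℝ × ℝ, ℝ) →ₗ[ℝ] ℝ where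
  toFun F := sphI fun θ φ => F (θ, φ)
  map_add' F G := by
    have hc : ∀ H : C(ℝ × ℝ, ℝ), Continuous fun θ => ∫ φ in (0 : ℝ)..2 * Real.pi, H (θ, φ) :=
      fun H => intervalIntegral.continuous_parametric_intervalIntegral_of_continuous'
        (f := fun θ φ => H (θ, φ)) H.continuous _ _
    have hs : ∀ (H : C(ℝ × ℝ, ℝ)) θ, Continuous fun φ => H (θ, φ) := fun H θ =>
      H.continuous.comp (continuous_const.prodMk continuous_id)
    unfold sphI
    rw [← intervalIntegral.integral_add ((hc F).intervalIntegrable _ _)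
      ((hc G).intervalIntegrable _ _)]
    refine intervalIntegral.integral_congr fun θ _ => ?_
    simp only [ContinuousMap.add_apply]
    exact intervalIntegral.integral_add ((hs F θ).intervalIntegrable _ _)
      ((hs G θ).intervalIntegrable _ _)
  map_smul' c F := by
    simp [sphI]

theorem sphI_nonneg {F : ℝ → ℝ → ℝ} (h : ∀ θ ∈ Icc 0 Real.pi, ∀ φ, 0 ≤ F θ φ) : 0 ≤ sphI F :=
  intervalIntegral.integral_nonneg Real.pi_pos.le fun θ hθ =>
    intervalIntegral.integral_nonneg (by positivity) fun φ _ => h θ hθ φ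

theorem contDiffAt_sphI {n : ℕ} {F : ℝ × ℝ → ℝ → ℝ → ℝ} {p : ℝ × ℝ}
    (h : ∀ θ φ, ContDiffAt ℝ n (fun z : ((ℝ × ℝ) × ℝ) × ℝ => F z.1.1 z.1.2 z.2) ((p, θ), φ)) :
    ContDiffAt ℝ n (fun p => sphI (F p)) p :=
  contDiffAt_intervalIntegral (φ := fun p θ => ∫ φ in (0 : ℝ)..2 * Real.pi, F p θ φ) fun θ _ =>
    contDiffAt_intervalIntegral (φ := fun (z : (ℝ × ℝ) × ℝ) φ => F z.1 z.2 φ) fun φ _ => h θ φ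

theorem fderiv_sphI {F : ℝ × ℝ → ℝ → ℝ → ℝ} {p : ℝ × ℝ}
    (h : ∀ θ φ, ContDiffAt ℝ 1 (fun z : ((ℝ × ℝ) × ℝ) × ℝ => F z.1.1 z.1.2 z.2) ((p, θ), φ))
    (v : ℝ × ℝ) : fderiv ℝ (fun p => sphI (F p)) p v = sphI fun θ φ => fderiv ℝ (fun p => F p θ φ) p v := by
  have h1 : ∀ θ, ContDiffAt ℝ 1 (fun z : (ℝ × ℝ) × ℝ => ∫ φ in (0 : ℝ)..2 * Real.pi, F z.1 z.2 φ)
      (p, θ) := fun θ => by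
    have := contDiffAt_intervalIntegral (n := 1) (φ := fun (z : (ℝ × ℝ) × ℝ) φ => F z.1 z.2 φ)
      (a := 0) (b := 2 * Real.pi) (x := (p, θ)) fun φ _ => by exact_mod_cast h θ φ
    exact_mod_cast this
  refine (fderiv_intervalIntegral (φ := fun p θ => ∫ φ in (0 : ℝ)..2 * Real.pi, F p θ φ)
    (fun θ _ => h1 θ) v).trans ?_
  refine intervalIntegral.integral_congr fun θ _ => ?_
  refine fderiv_intervalIntegral (φ := fun p φ => F p θ φ) (fun φ _ => ?_) v
  have hc : ContDiffAt ℝ 1 (fun z : (ℝ × ℝ) × ℝ => (((z.1, θ), z.2) : ((ℝ × ℝ) × ℝ) × ℝ)) (p, φ) := by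
    fun_prop
  exact ContDiffAt.comp (g := fun z : ((ℝ × ℝ) × ℝ) × ℝ => F z.1.1 z.1.2 z.2) (p, φ) (h θ φ) hc

/-- Stokes' theorem on the sphere, in coordinates. -/
theorem sphI_tangential_divergence {X Y Xθ Yφ : ℝ → ℝ → ℝ}
    (hX : ContDiff ℝ 1 (Function.uncurry X)) (hY : ContDiff ℝ 1 (Function.uncurry Y))
    (hXθ : ∀ θ φ, HasDerivAt (fun s => X s φ) (Xθ θ φ) θ)
    (hYφ : ∀ θ φ, HasDerivAt (fun s => Y θ s) (Yφ θ φ) φ)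
    (hX0 : ∀ φ, X 0 φ = 0) (hXπ : ∀ φ, X Real.pi φ = 0)
    (hYper : ∀ θ, Y θ (2 * Real.pi) = Y θ 0) : sphI (fun θ φ => Xθ θ φ + Yφ θ φ) = 0 := by
  have hXc : Continuous (Function.uncurry Xθ) := by
    have e : Function.uncurry Xθ = pdt (Function.uncurry X) := by
      ext ⟨θ, φ⟩
      exact (hXθ θ φ).unique (hasDerivAt_pdt ((hX.differentiable one_ne_zero) (θ, φ)))
    rw [e]
    exact (hX.continuous_fderiv one_ne_zero).clm_apply continuous_const
  have hYc : Continuous (Function.uncurry Yφ) := by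
    have e : Function.uncurry Yφ = pdR (Function.uncurry Y) := by
      ext ⟨θ, φ⟩
      exact (hYφ θ φ).unique (hasDerivAt_pdR ((hY.differentiable one_ne_zero) (θ, φ)))
    rw [e]
    exact (hY.continuous_fderiv one_ne_zero).clm_apply continuous_const
  have h1 : ∀ θ, ∫ φ in (0 : ℝ)..2 * Real.pi, (Xθ θ φ + Yφ θ φ) =
      ∫ φ in (0 : ℝ)..2 * Real.pi, Xθ θ φ := by
    intro θ
    have c1 : Continuous fun φ => Xθ θ φ := hXc.comp (continuous_const.prodMk continuous_id)
    have c2 : Continuous fun φ => Yφ θ φ := hYc.comp (continuous_const.prodMk continuous_id)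
    rw [intervalIntegral.integral_add (c1.intervalIntegrable _ _) (c2.intervalIntegrable _ _),
      intervalIntegral.integral_eq_sub_of_hasDerivAt (fun φ _ => hYφ θ φ)
        (c2.intervalIntegrable _ _), hYper]
    ring
  have h2 : ∀ θ, HasDerivAt (fun θ => ∫ φ in (0 : ℝ)..2 * Real.pi, X θ φ)
      (∫ φ in (0 : ℝ)..2 * Real.pi, Xθ θ φ) θ := by
    intro θ
    have h3 := (hasFDerivAt_intervalIntegral_of_contDiff hX 0 (2 * Real.pi) θ)
    have h4 := fderiv_intervalIntegral (φ := X) (a := 0) (b := 2 * Real.pi) (x := θ)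
      (fun ρ _ => hX.contDiffAt) 1
    refine h3.hasDerivAt.congr_deriv ?_
    rw [← h3.fderiv]
    refine h4.trans (intervalIntegral.integral_congr fun φ _ => ?_)
    rw [fderiv_apply_one_eq_deriv]
    exact (hXθ θ φ).deriv
  unfold sphI
  simp_rw [h1]
  rw [intervalIntegral.integral_eq_sub_of_hasDerivAt (fun θ _ => h2 θ)]
  · simp [hX0, hXπ]
  · exact (intervalIntegral.continuous_parametric_intervalIntegral_of_continuous'
      hXc _ _).intervalIntegrable _ _

/-! ### Averaged components of a stress-energy tensor -/

/-- The points `(τ, R)` with `(max τ 0, |R|)` in the development. -/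
def Gs (d : TBData) : Set (ℝ × ℝ) := {p | (max p.1 0, |p.2|) ∈ d.G}

/-- The component `T_μν` on the sphere `p = (τ, R)`, continued constantly to `τ < 0`. -/
def tcomp (T : (Fin 4 → ℝ) → Matrix (Fin 4) (Fin 4) ℝ) (p : ℝ × ℝ) (θ φ : ℝ) (μ ν : Fin 4) : ℝ :=
  T (sph (max p.1 0) p.2 θ φ) μ ν

/-- The spherical average of `T_00`. -/
def avA (T : (Fin 4 → ℝ) → Matrix (Fin 4) (Fin 4) ℝ) (p : ℝ × ℝ) : ℝ :=
  sphI fun θ φ => Real.sin θ * tcomp T p θ φ 0 0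

/-- The spherical average of `T_0n`. -/
def avB (T : (Fin 4 → ℝ) → Matrix (Fin 4) (Fin 4) ℝ) (p : ℝ × ℝ) : ℝ :=
  sphI fun θ φ => Real.sin θ * ∑ μ, nvec θ φ μ * tcomp T p θ φ μ 0

/-- The spherical average of `T_nn`. -/
def avE (T : (Fin 4 → ℝ) → Matrix (Fin 4) (Fin 4) ℝ) (p : ℝ × ℝ) : ℝ :=
  sphI fun θ φ => Real.sin θ * ∑ κ, nvec θ φ κ * ∑ μ, nvec θ φ μ * tcomp T p θ φ κ μ

/-- `G` is open only relative to τ ≥ 0. Truncating τ and taking |R| produces an open subset of the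
plane, so the averages can be called continuous at τ = 0 without one-sided limits. -/
theorem Admissible.isOpen_Gs (hd : d.Admissible) : IsOpen d.Gs := by
  rw [isOpen_iff_mem_nhds]
  intro p hp
  have hc : Continuous fun z : ℝ × ℝ => (max z.1 0, |z.2|) := by fun_prop
  filter_upwards [hc.continuousAt.eventually (hd.G_open hp)] with z hz
  exact hz (le_max_right _ _)

theorem Admissible.sph_mem_D (hd : d.Admissible) {p : ℝ × ℝ} (hp : p ∈ d.Gs) (θ φ : ℝ) :
    sph (max p.1 0) p.2 θ φ ∈ d.D := by
  rw [hd.mem_D_iff, sph_zero, rad_sph]; exact hp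

theorem Admissible.D_mem_nhds (hd : d.Admissible) {x : Fin 4 → ℝ} (hx : x ∈ d.D) (h0 : 0 < x 0) :
    d.D ∈ 𝓝 x := by
  have hc : Continuous fun z : Fin 4 → ℝ => (z 0, rad z) :=
    (continuous_apply 0).prodMk continuous_rad
  filter_upwards [hc.continuousAt.eventually (hd.G_open (hd.mem_G_of_mem_D hx)),
    (isOpen_lt continuous_const (continuous_apply 0)).mem_nhds h0] with z hz hz0
  exact hd.mem_D_of_mem_G (hz (le_of_lt hz0))

theorem contDiff_nvec (μ : Fin 4) {n : WithTop ℕ∞} :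
    ContDiff ℝ n fun z : ((ℝ × ℝ) × ℝ) × ℝ => nvec z.1.2 z.2 μ := by
  fin_cases μ <;> simp [nvec] <;> fun_prop

namespace IsStressEnergy
variable {T : (Fin 4 → ℝ) → Matrix (Fin 4) (Fin 4) ℝ}

/-- Continuity is available on the initial slice too. Differentiability in `contDiffAt_one_tcomp` is
restricted to τ > 0, where D is a neighbourhood of the point. -/
theorem contDiffAt_zero_tcomp (hT : d.IsStressEnergy T) (hd : d.Admissible) {p : ℝ × ℝ}
    (hp : p ∈ d.Gs) (θ φ : ℝ) (μ ν : Fin 4) :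
    ContDiffAt ℝ (0 : ℕ) (fun z : ((ℝ × ℝ) × ℝ) × ℝ => tcomp T z.1.1 z.1.2 z.2 μ ν) ((p, θ), φ) := by
  have : ContDiffAt ℝ 0 (fun z : ((ℝ × ℝ) × ℝ) × ℝ => tcomp T z.1.1 z.1.2 z.2 μ ν) ((p, θ), φ) := by
    rw [contDiffAt_zero]
    refine ⟨{z | z.1.1 ∈ d.Gs}, (hd.isOpen_Gs.preimage
      (continuous_fst.comp continuous_fst)).mem_nhds hp, ?_⟩
    have hc : Continuous fun z : ((ℝ × ℝ) × ℝ) × ℝ => sph (max z.1.1.1 0) z.1.1.2 z.1.2 z.2 :=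
      continuous_sph.comp (g := fun z : ((ℝ × ℝ) × ℝ) × ℝ => sph z.1.1.1 z.1.1.2 z.1.2 z.2)
        (f := fun z : ((ℝ × ℝ) × ℝ) × ℝ => (((max z.1.1.1 0, z.1.1.2), z.1.2), z.2)) (by fun_prop)
    exact (hT.smooth μ ν).continuousOn.comp hc.continuousOn fun z hz => hd.sph_mem_D hz _ _
  exact_mod_cast this

theorem contDiffAt_comp (hT : d.IsStressEnergy T) (hd : d.Admissible) {x : Fin 4 → ℝ}
    (hx : x ∈ d.D) (h0 : 0 < x 0) (μ ν : Fin 4) : ContDiffAt ℝ 1 (fun x => T x μ ν) x :=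
  (hT.smooth μ ν).contDiffAt (hd.D_mem_nhds hx h0)

theorem contDiffAt_one_tcomp (hT : d.IsStressEnergy T) (hd : d.Admissible) {p : ℝ × ℝ}
    (hp : p ∈ d.Gs) (h0 : 0 < p.1) (θ φ : ℝ) (μ ν : Fin 4) :
    ContDiffAt ℝ 1 (fun z : ((ℝ × ℝ) × ℝ) × ℝ => tcomp T z.1.1 z.1.2 z.2 μ ν) ((p, θ), φ) := by
  have hx := hd.sph_mem_D hp θ φ
  rw [max_eq_left h0.le] at hx
  have h1 := hT.contDiffAt_comp hd hx (by rw [sph_zero]; exact h0) μ ν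
  have h2 := ContDiffAt.comp (f := fun z : ((ℝ × ℝ) × ℝ) × ℝ => sph z.1.1.1 z.1.1.2 z.1.2 z.2)
    ((p, θ), φ) h1 (contDiff_sph.contDiffAt.of_le (by exact_mod_cast le_top))
  refine h2.congr_of_eventuallyEq ?_
  have hc : Continuous fun z : ((ℝ × ℝ) × ℝ) × ℝ => z.1.1.1 := by fun_prop
  filter_upwards [(isOpen_lt continuous_const hc).mem_nhds (show 0 < (((p, θ), φ) :
    ((ℝ × ℝ) × ℝ) × ℝ).1.1.1 from h0)] with z hz
  simp only [tcomp, Function.comp_apply]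
  rw [max_eq_left (le_of_lt hz)]

/-- Regularity of weighted averages. -/
theorem contDiffAt_weighted {n : WithTop ℕ∞} {p : ℝ × ℝ}
    (h : ∀ θ φ μ ν, ContDiffAt ℝ n (fun z : ((ℝ × ℝ) × ℝ) × ℝ => tcomp T z.1.1 z.1.2 z.2 μ ν)
      ((p, θ), φ)) (θ φ : ℝ) :
    ContDiffAt ℝ n (fun z : ((ℝ × ℝ) × ℝ) × ℝ => Real.sin z.1.2 * tcomp T z.1.1 z.1.2 z.2 0 0)
        ((p, θ), φ) ∧
    ContDiffAt ℝ n (fun z : ((ℝ × ℝ) × ℝ) × ℝ => Real.sin z.1.2 *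
        ∑ μ, nvec z.1.2 z.2 μ * tcomp T z.1.1 z.1.2 z.2 μ 0) ((p, θ), φ) ∧
    ContDiffAt ℝ n (fun z : ((ℝ × ℝ) × ℝ) × ℝ => Real.sin z.1.2 * ∑ κ, nvec z.1.2 z.2 κ *
        ∑ μ, nvec z.1.2 z.2 μ * tcomp T z.1.1 z.1.2 z.2 κ μ) ((p, θ), φ) := by
  have hs : ContDiffAt ℝ n (fun z : ((ℝ × ℝ) × ℝ) × ℝ => Real.sin z.1.2) ((p, θ), φ) := by
    have : ContDiff ℝ n (fun z : ((ℝ × ℝ) × ℝ) × ℝ => Real.sin z.1.2) := by fun_prop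
    exact this.contDiffAt
  refine ⟨hs.mul (h θ φ 0 0), hs.mul (ContDiffAt.sum fun μ _ =>
    (contDiff_nvec μ).contDiffAt.mul (h θ φ μ 0)), hs.mul (ContDiffAt.sum fun κ _ =>
    (contDiff_nvec κ).contDiffAt.mul (ContDiffAt.sum fun μ _ =>
    (contDiff_nvec μ).contDiffAt.mul (h θ φ κ μ)))⟩

theorem continuousAt_av (hT : d.IsStressEnergy T) (hd : d.Admissible) {p : ℝ × ℝ} (hp : p ∈ d.Gs) :
    ContinuousAt (avA T) p ∧ ContinuousAt (avB T) p ∧ ContinuousAt (avE T) p := by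
  have h := contDiffAt_weighted fun θ φ μ ν => hT.contDiffAt_zero_tcomp hd hp θ φ μ ν
  exact ⟨(contDiffAt_sphI (F := fun p θ φ => Real.sin θ * tcomp T p θ φ 0 0)
      fun θ φ => (h θ φ).1).continuousAt,
    (contDiffAt_sphI (F := fun p θ φ => Real.sin θ * ∑ μ, nvec θ φ μ * tcomp T p θ φ μ 0)
      fun θ φ => (h θ φ).2.1).continuousAt,
    (contDiffAt_sphI (F := fun p θ φ => Real.sin θ * ∑ κ, nvec θ φ κ *
      ∑ μ, nvec θ φ μ * tcomp T p θ φ κ μ) fun θ φ => (h θ φ).2.2).continuousAt⟩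

theorem contDiffAt_av (hT : d.IsStressEnergy T) (hd : d.Admissible) {p : ℝ × ℝ} (hp : p ∈ d.Gs)
    (h0 : 0 < p.1) :
    ContDiffAt ℝ 1 (avA T) p ∧ ContDiffAt ℝ 1 (avB T) p ∧ ContDiffAt ℝ 1 (avE T) p := by
  have h := contDiffAt_weighted (n := ((1 : ℕ) : WithTop ℕ∞)) fun θ φ μ ν => by
    exact_mod_cast hT.contDiffAt_one_tcomp hd hp h0 θ φ μ ν
  have h1 := contDiffAt_sphI (F := fun p θ φ => Real.sin θ * tcomp T p θ φ 0 0)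
      fun θ φ => (h θ φ).1
  have h2 := contDiffAt_sphI (F := fun p θ φ => Real.sin θ * ∑ μ, nvec θ φ μ * tcomp T p θ φ μ 0)
      fun θ φ => (h θ φ).2.1
  have h3 := contDiffAt_sphI (F := fun p θ φ => Real.sin θ * ∑ κ, nvec θ φ κ *
      ∑ μ, nvec θ φ μ * tcomp T p θ φ κ μ) fun θ φ => (h θ φ).2.2
  exact ⟨by exact_mod_cast h1, by exact_mod_cast h2, by exact_mod_cast h3⟩

end IsStressEnergy
end TBData
end

noncomputable section
namespace TBData
variable {d : TBData}

/-! ### The averaged balance law -/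

theorem hasDerivAt_nvec_θ (θ φ : ℝ) (μ : Fin 4) :
    HasDerivAt (fun s => nvec s φ μ) (eθ θ φ μ) θ := by
  fin_cases μ <;> simp [nvec, eθ]
  · exact hasDerivAt_const _ _
  · exact (Real.hasDerivAt_sin θ).mul_const _
  · exact (Real.hasDerivAt_sin θ).mul_const _
  · exact Real.hasDerivAt_cos θ

theorem hasDerivAt_nvec_φ (θ φ : ℝ) (μ : Fin 4) :
    HasDerivAt (fun s => nvec θ s μ) (Real.sin θ * eφ φ μ) φ := by
  fin_cases μ <;> simp [nvec, eφ]
  · exact hasDerivAt_const _ _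
  · exact ((Real.hasDerivAt_cos φ).const_mul (Real.sin θ)).congr_deriv (by ring)
  · exact (Real.hasDerivAt_sin φ).const_mul _
  · exact hasDerivAt_const _ _

theorem hasDerivAt_eθ_θ (θ φ : ℝ) (μ : Fin 4) :
    HasDerivAt (fun s => eθ s φ μ) (-nvec θ φ μ) θ := by
  fin_cases μ <;> simp [nvec, eθ]
  · exact hasDerivAt_const _ _
  · exact ((Real.hasDerivAt_cos θ).mul_const _).congr_deriv (by ring)
  · exact ((Real.hasDerivAt_cos θ).mul_const _).congr_deriv (by ring)
  · exact (Real.hasDerivAt_sin θ).neg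

theorem hasDerivAt_eφ_φ (θ φ : ℝ) (μ : Fin 4) :
    HasDerivAt (fun s => eφ s μ) (-(Real.sin θ * nvec θ φ μ + Real.cos θ * eθ θ φ μ)) φ := by
  have h := Real.sin_sq_add_cos_sq θ
  fin_cases μ <;> simp [nvec, eθ, eφ]
  · exact hasDerivAt_const _ _
  · exact (Real.hasDerivAt_sin φ).neg.congr_deriv (by linear_combination Real.cos φ * h)
  · exact (Real.hasDerivAt_cos φ).congr_deriv (by linear_combination Real.sin φ * h)
  · exact (hasDerivAt_const _ _).congr_deriv (by ring)

theorem contDiff_frame (μ : Fin 4) :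
    ContDiff ℝ 1 (fun z : ℝ × ℝ => nvec z.1 z.2 μ) ∧ ContDiff ℝ 1 (fun z : ℝ × ℝ => eθ z.1 z.2 μ) ∧
      ContDiff ℝ 1 (fun z : ℝ × ℝ => eφ z.2 μ) := by
  refine ⟨?_, ?_, ?_⟩ <;> fin_cases μ <;> simp [nvec, eθ, eφ] <;> fun_prop

theorem nvec_two_pi (θ : ℝ) : nvec θ (2 * Real.pi) = nvec θ 0 := by simp [nvec]

theorem eφ_two_pi : eφ (2 * Real.pi) = eφ 0 := by simp [eφ]

theorem sph_two_pi (t R θ : ℝ) : sph t R θ (2 * Real.pi) = sph t R θ 0 := by simp [sph]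

namespace IsStressEnergy
variable {T : (Fin 4 → ℝ) → Matrix (Fin 4) (Fin 4) ℝ}

theorem hasDerivAt_tcomp (hT : d.IsStressEnergy T) (hd : d.Admissible) {t R : ℝ}
    (hp : (t, R) ∈ d.Gs) (h0 : 0 < t) (θ φ : ℝ) (μ ν : Fin 4) :
    HasDerivAt (fun s => tcomp T (s, R) θ φ μ ν) (pd 0 (fun z => T z μ ν) (sph t R θ φ)) t ∧
    HasDerivAt (fun s => tcomp T (t, s) θ φ μ ν)
      (∑ κ, nvec θ φ κ * pd κ (fun z => T z μ ν) (sph t R θ φ)) R := by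
  have hx := hd.sph_mem_D hp θ φ
  rw [max_eq_left h0.le] at hx
  have hf := (hT.contDiffAt_comp hd hx (by rw [sph_zero]; exact h0) μ ν).differentiableAt
    one_ne_zero
  constructor
  · have h1 := hasDerivAt_comp_of_curve (σ := fun s => sph s R θ φ) hf (hasDerivAt_sph_t t R θ φ)
    rw [sum_u (fun κ => pd κ (fun z => T z μ ν) (sph t R θ φ))] at h1
    refine h1.congr_of_eventuallyEq ?_
    filter_upwards [Ioi_mem_nhds h0] with s hs
    simp only [tcomp]
    rw [max_eq_left (le_of_lt hs)]
  · have h1 := hasDerivAt_comp_of_curve (σ := fun s => sph t s θ φ) hf (hasDerivAt_sph_R t R θ φ)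
    simpa only [tcomp, max_eq_left h0.le] using h1

theorem continuous_pd (hT : d.IsStressEnergy T) (hd : d.Admissible) {t R : ℝ}
    (hp : (t, R) ∈ d.Gs) (h0 : 0 < t) (κ μ ν : Fin 4) :
    Continuous fun z : ℝ × ℝ => pd κ (fun x => T x μ ν) (sph t R z.1 z.2) := by
  rw [continuous_iff_continuousAt]
  intro z
  have hx := hd.sph_mem_D hp z.1 z.2
  rw [max_eq_left h0.le] at hx
  have hf := hT.contDiffAt_comp hd hx (by rw [sph_zero]; exact h0) μ ν
  have h1 : ContinuousAt (fderiv ℝ (fun x => T x μ ν)) (sph t R z.1 z.2) :=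
    (hf.fderiv_right (m := 0) (by simp)).continuousAt
  have h2 : ContinuousAt (pd κ fun x => T x μ ν) (sph t R z.1 z.2) := h1.clm_apply continuousAt_const
  have h3 : Continuous fun z : ℝ × ℝ => sph t R z.1 z.2 :=
    continuous_sph.comp (g := fun z : ((ℝ × ℝ) × ℝ) × ℝ => sph z.1.1.1 z.1.1.2 z.1.2 z.2)
      (f := fun z : ℝ × ℝ => (((t, R), z.1), z.2)) (by fun_prop)
  exact ContinuousAt.comp (f := fun z : ℝ × ℝ => sph t R z.1 z.2) h2 h3.continuousAt

theorem pdt_av (hT : d.IsStressEnergy T) (hd : d.Admissible) {t R : ℝ}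
    (hp : (t, R) ∈ d.Gs) (h0 : 0 < t) :
    pdt (avA T) (t, R) = sphI (fun θ φ => Real.sin θ * pd 0 (fun z => T z 0 0) (sph t R θ φ)) ∧
    pdt (avB T) (t, R) = sphI (fun θ φ => Real.sin θ *
      ∑ μ, nvec θ φ μ * pd 0 (fun z => T z μ 0) (sph t R θ φ)) := by
  have h := contDiffAt_weighted (hT.contDiffAt_one_tcomp hd hp h0)
  have hc : ∀ θ φ, ContDiffAt ℝ 1 (fun z : ℝ × ℝ => (((z, θ), φ) : ((ℝ × ℝ) × ℝ) × ℝ)) (t, R) := by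
    intro θ φ; fun_prop
  constructor
  · refine (fderiv_sphI (F := fun p θ φ => Real.sin θ * tcomp T p θ φ 0 0)
      (fun θ φ => (h θ φ).1) (1, 0)).trans ?_
    congr 1; ext θ φ
    have h1 : ContDiffAt ℝ 1 (fun p => Real.sin θ * tcomp T p θ φ 0 0) (t, R) :=
      (h θ φ).1.comp (f := fun z : ℝ × ℝ => (((z, θ), φ) : ((ℝ × ℝ) × ℝ) × ℝ)) (t, R) (hc θ φ)
    exact (hasDerivAt_pdt (h1.differentiableAt one_ne_zero)).unique
      ((hT.hasDerivAt_tcomp hd hp h0 θ φ 0 0).1.const_mul _)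
  · refine (fderiv_sphI (F := fun p θ φ => Real.sin θ * ∑ μ, nvec θ φ μ * tcomp T p θ φ μ 0)
      (fun θ φ => (h θ φ).2.1) (1, 0)).trans ?_
    congr 1; ext θ φ
    have h1 : ContDiffAt ℝ 1 (fun p => Real.sin θ * ∑ μ, nvec θ φ μ * tcomp T p θ φ μ 0) (t, R) :=
      (h θ φ).2.1.comp (f := fun z : ℝ × ℝ => (((z, θ), φ) : ((ℝ × ℝ) × ℝ) × ℝ)) (t, R) (hc θ φ)
    exact (hasDerivAt_pdt (h1.differentiableAt one_ne_zero)).unique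
      ((HasDerivAt.fun_sum fun μ _ =>
        (hT.hasDerivAt_tcomp hd hp h0 θ φ μ 0).1.const_mul (nvec θ φ μ)).const_mul _)

theorem pdR_av (hT : d.IsStressEnergy T) (hd : d.Admissible) {t R : ℝ}
    (hp : (t, R) ∈ d.Gs) (h0 : 0 < t) :
    pdR (avB T) (t, R) = sphI (fun θ φ => Real.sin θ * ∑ μ, nvec θ φ μ *
      ∑ κ, nvec θ φ κ * pd κ (fun z => T z μ 0) (sph t R θ φ)) ∧
    pdR (avE T) (t, R) = sphI (fun θ φ => Real.sin θ * ∑ μ, nvec θ φ μ * ∑ ν, nvec θ φ ν *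
      ∑ κ, nvec θ φ κ * pd κ (fun z => T z μ ν) (sph t R θ φ)) := by
  have h := contDiffAt_weighted (hT.contDiffAt_one_tcomp hd hp h0)
  have hc : ∀ θ φ, ContDiffAt ℝ 1 (fun z : ℝ × ℝ => (((z, θ), φ) : ((ℝ × ℝ) × ℝ) × ℝ)) (t, R) := by
    intro θ φ; fun_prop
  constructor
  · refine (fderiv_sphI (F := fun p θ φ => Real.sin θ * ∑ μ, nvec θ φ μ * tcomp T p θ φ μ 0)
      (fun θ φ => (h θ φ).2.1) (0, 1)).trans ?_
    congr 1; ext θ φ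
    have h1 : ContDiffAt ℝ 1 (fun p => Real.sin θ * ∑ μ, nvec θ φ μ * tcomp T p θ φ μ 0) (t, R) :=
      (h θ φ).2.1.comp (f := fun z : ℝ × ℝ => (((z, θ), φ) : ((ℝ × ℝ) × ℝ) × ℝ)) (t, R) (hc θ φ)
    exact (hasDerivAt_pdR (h1.differentiableAt one_ne_zero)).unique
      ((HasDerivAt.fun_sum fun μ _ =>
        (hT.hasDerivAt_tcomp hd hp h0 θ φ μ 0).2.const_mul (nvec θ φ μ)).const_mul _)
  · refine (fderiv_sphI (F := fun p θ φ => Real.sin θ * ∑ κ, nvec θ φ κ *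
      ∑ μ, nvec θ φ μ * tcomp T p θ φ κ μ)
      (fun θ φ => (h θ φ).2.2) (0, 1)).trans ?_
    congr 1; ext θ φ
    have h1 : ContDiffAt ℝ 1 (fun p => Real.sin θ * ∑ κ, nvec θ φ κ *
        ∑ μ, nvec θ φ μ * tcomp T p θ φ κ μ) (t, R) :=
      (h θ φ).2.2.comp (f := fun z : ℝ × ℝ => (((z, θ), φ) : ((ℝ × ℝ) × ℝ) × ℝ)) (t, R) (hc θ φ)
    exact (hasDerivAt_pdR (h1.differentiableAt one_ne_zero)).unique
      ((HasDerivAt.fun_sum fun μ _ => (HasDerivAt.fun_sum fun ν _ =>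
        (hT.hasDerivAt_tcomp hd hp h0 θ φ μ ν).2.const_mul (nvec θ φ ν)).const_mul
          (nvec θ φ μ)).const_mul _)

end IsStressEnergy
end TBData
end

/-! ### Integration by parts over the spheres -/

noncomputable section
namespace TBData
variable {d : TBData}

/-- This is the product rule for the angular divergence of J. Since ∂_θ e_θ = -n and ∂_φ e_φ = -(sin
θ n + cos θ e_θ), the cosine terms cancel and twice the radial component of J remains. -/
theorem tangential_algebra (n e f J : Fin 4 → ℝ) (t : Fin 4 → Fin 4 → ℝ)
    (D : Fin 4 → Fin 4 → Fin 4 → ℝ) (s c R c₁ c₂ : ℝ)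
    (hJ : ∀ μ, J μ = c₁ * t μ 0 - c₂ * ∑ ν, n ν * t μ ν) :
    (c * (∑ μ, e μ * J μ) + s * ∑ μ, (-n μ * J μ + e μ * (c₁ * (∑ κ, (R • e) κ * D κ μ 0)
        - c₂ * ∑ ν, (e ν * t μ ν + n ν * ∑ κ, (R • e) κ * D κ μ ν))))
      + ∑ μ, (-(s * n μ + c * e μ) * J μ + f μ * (c₁ * (∑ κ, ((R * s) • f) κ * D κ μ 0)
        - c₂ * ∑ ν, (s * f ν * t μ ν + n ν * ∑ κ, ((R * s) • f) κ * D κ μ ν))) =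
    s * (R * (c₁ * (∑ κ, e κ * ∑ μ, e μ * D κ μ 0 + ∑ κ, f κ * ∑ μ, f μ * D κ μ 0)
        - c₂ * (∑ κ, e κ * ∑ μ, e μ * (∑ ν, n ν * D κ μ ν)
          + ∑ κ, f κ * ∑ μ, f μ * (∑ ν, n ν * D κ μ ν)))
      - c₂ * (∑ κ, e κ * ∑ μ, e μ * t κ μ + ∑ κ, f κ * ∑ μ, f μ * t κ μ)
      - 2 * (c₁ * (∑ σ, n σ * t σ 0) - c₂ * ∑ κ, n κ * ∑ μ, n μ * t κ μ)) := by
  simp only [hJ, Fin.sum_univ_four, Pi.smul_apply, smul_eq_mul]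
  ring

namespace IsStressEnergy
variable {T : (Fin 4 → ℝ) → Matrix (Fin 4) (Fin 4) ℝ}

/-- The tangential part of the divergence averages out. -/
theorem tangential_average (hT : d.IsStressEnergy T) (hd : d.Admissible) {t R : ℝ}
    (hp : (t, R) ∈ d.Gs) (h0 : 0 < t) (c₁ c₂ : ℝ) :
    sphI (fun θ φ => Real.sin θ * (R * (c₁ * (∑ κ, eθ θ φ κ * ∑ μ, eθ θ φ μ *
            pd κ (fun z => T z μ 0) (sph t R θ φ)
          + ∑ κ, eφ φ κ * ∑ μ, eφ φ μ * pd κ (fun z => T z μ 0) (sph t R θ φ))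
        - c₂ * (∑ κ, eθ θ φ κ * ∑ μ, eθ θ φ μ *
            (∑ ν, nvec θ φ ν * pd κ (fun z => T z μ ν) (sph t R θ φ))
          + ∑ κ, eφ φ κ * ∑ μ, eφ φ μ * (∑ ν, nvec θ φ ν * pd κ (fun z => T z μ ν) (sph t R θ φ))))
      - c₂ * (∑ κ, eθ θ φ κ * ∑ μ, eθ θ φ μ * T (sph t R θ φ) κ μ
          + ∑ κ, eφ φ κ * ∑ μ, eφ φ μ * T (sph t R θ φ) κ μ)
      - 2 * (c₁ * (∑ σ, nvec θ φ σ * T (sph t R θ φ) σ 0)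
        - c₂ * ∑ κ, nvec θ φ κ * ∑ μ, nvec θ φ μ * T (sph t R θ φ) κ μ))) = 0 := by
  have hf : ∀ θ φ μ ν, ContDiffAt ℝ 1 (fun x => T x μ ν) (sph t R θ φ) := by
    intro θ φ μ ν
    have hx := hd.sph_mem_D hp θ φ
    rw [max_eq_left h0.le] at hx
    exact hT.contDiffAt_comp hd hx (by rw [sph_zero]; exact h0) μ ν
  have hTc : ∀ μ ν, ContDiff ℝ 1 fun z : ℝ × ℝ => T (sph t R z.1 z.2) μ ν := by
    intro μ ν
    rw [contDiff_iff_contDiffAt]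
    intro z
    have h3 : ContDiff ℝ 1 fun z : ℝ × ℝ => sph t R z.1 z.2 :=
      (contDiff_sph.of_le (by exact_mod_cast le_top)).comp
        (f := fun z : ℝ × ℝ => ((((t, R), z.1), z.2) : ((ℝ × ℝ) × ℝ) × ℝ)) (by fun_prop)
    exact ContDiffAt.comp (f := fun z : ℝ × ℝ => sph t R z.1 z.2) z (hf z.1 z.2 μ ν) h3.contDiffAt
  have hθ : ∀ θ φ μ ν, HasDerivAt (fun s => T (sph t R s φ) μ ν)
      (∑ κ, (R • eθ θ φ) κ * pd κ (fun z => T z μ ν) (sph t R θ φ)) θ := fun θ φ μ ν =>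
    hasDerivAt_comp_of_curve (σ := fun s => sph t R s φ)
      ((hf θ φ μ ν).differentiableAt one_ne_zero) (hasDerivAt_sph_θ t R θ φ)
  have hφ : ∀ θ φ μ ν, HasDerivAt (fun s => T (sph t R θ s) μ ν)
      (∑ κ, ((R * Real.sin θ) • eφ φ) κ * pd κ (fun z => T z μ ν) (sph t R θ φ)) φ :=
    fun θ φ μ ν => hasDerivAt_comp_of_curve (σ := fun s => sph t R θ s)
      ((hf θ φ μ ν).differentiableAt one_ne_zero) (hasDerivAt_sph_φ t R θ φ)
  -- With c₁ = r' and c₂ = ṙ this is, up to a factor constant on the sphere, the Kodama current. The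
  -- angular divergence theorem is applied to its tangential part.
  set J : ℝ → ℝ → Fin 4 → ℝ := fun θ φ μ =>
    c₁ * T (sph t R θ φ) μ 0 - c₂ * ∑ ν, nvec θ φ ν * T (sph t R θ φ) μ ν with hJ
  have hJc : ∀ μ, ContDiff ℝ 1 fun z : ℝ × ℝ => J z.1 z.2 μ := fun μ =>
    (contDiff_const.mul (hTc μ 0)).sub (contDiff_const.mul (ContDiff.sum fun ν _ =>
      (contDiff_frame ν).1.mul (hTc μ ν)))
  have hJθ : ∀ θ φ μ, HasDerivAt (fun s => J s φ μ)
      (c₁ * (∑ κ, (R • eθ θ φ) κ * pd κ (fun z => T z μ 0) (sph t R θ φ))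
        - c₂ * ∑ ν, (eθ θ φ ν * T (sph t R θ φ) μ ν
          + nvec θ φ ν * ∑ κ, (R • eθ θ φ) κ * pd κ (fun z => T z μ ν) (sph t R θ φ))) θ :=
    fun θ φ μ => ((hθ θ φ μ 0).const_mul c₁).sub ((HasDerivAt.fun_sum fun ν _ =>
      (hasDerivAt_nvec_θ θ φ ν).mul (hθ θ φ μ ν)).const_mul c₂)
  have hJφ : ∀ θ φ μ, HasDerivAt (fun s => J θ s μ)
      (c₁ * (∑ κ, ((R * Real.sin θ) • eφ φ) κ * pd κ (fun z => T z μ 0) (sph t R θ φ))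
        - c₂ * ∑ ν, (Real.sin θ * eφ φ ν * T (sph t R θ φ) μ ν + nvec θ φ ν *
          ∑ κ, ((R * Real.sin θ) • eφ φ) κ * pd κ (fun z => T z μ ν) (sph t R θ φ))) φ :=
    fun θ φ μ => ((hφ θ φ μ 0).const_mul c₁).sub ((HasDerivAt.fun_sum fun ν _ =>
      (hasDerivAt_nvec_φ θ φ ν).mul (hφ θ φ μ ν)).const_mul c₂)
  rw [← sphI_tangential_divergence (X := fun θ φ => Real.sin θ * ∑ μ, eθ θ φ μ * J θ φ μ)
    (Y := fun θ φ => ∑ μ, eφ φ μ * J θ φ μ)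
    (hX := (Real.contDiff_sin.comp contDiff_fst).mul (ContDiff.sum fun μ _ =>
      (contDiff_frame μ).2.1.mul (hJc μ)))
    (hY := ContDiff.sum fun μ _ => (contDiff_frame μ).2.2.mul (hJc μ))
    (hXθ := fun θ φ => (Real.hasDerivAt_sin θ).mul (HasDerivAt.fun_sum fun μ _ =>
      (hasDerivAt_eθ_θ θ φ μ).mul (hJθ θ φ μ)))
    (hYφ := fun θ φ => HasDerivAt.fun_sum fun μ _ => (hasDerivAt_eφ_φ θ φ μ).mul (hJφ θ φ μ))
    (hX0 := fun φ => by simp) (hXπ := fun φ => by simp)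
    (hYper := fun θ => by simp only [hJ, eφ_two_pi, sph_two_pi, nvec_two_pi])]
  congr 1
  ext θ φ
  exact (tangential_algebra (nvec θ φ) (eθ θ φ) (eφ φ) (J θ φ) (T (sph t R θ φ))
    (fun κ μ ν => pd κ (fun z => T z μ ν) (sph t R θ φ)) (Real.sin θ) (Real.cos θ) R c₁ c₂
    fun μ => rfl).symm

end IsStressEnergy
end TBData
end

/-! ### The averaged Kodama current and its balance law -/

noncomputable section
namespace TBData
variable {d : TBData}

/-- The averaged energy density of the Kodama current. -/
def flA (d : TBData) (T : (Fin 4 → ℝ) → Matrix (Fin 4) (Fin 4) ℝ) (p : ℝ × ℝ) : ℝ :=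
  d.rE p ^ 2 * (d.rR p * avA T p - d.rT p * avB T p)

/-- The averaged radial flux of the Kodama current. -/
def flB (d : TBData) (T : (Fin 4 → ℝ) → Matrix (Fin 4) (Fin 4) ℝ) (p : ℝ × ℝ) : ℝ :=
  d.rE p ^ 2 / d.hE p * (d.rR p * avB T p - d.rT p * avE T p)

theorem continuous_frame (μ : Fin 4) : Continuous fun z : ℝ × ℝ => nvec z.1 z.2 μ :=
  (contDiff_frame μ).1.continuous

theorem Admissible.mem_Gs (_hd : d.Admissible) {t R : ℝ} (h : (t, |R|) ∈ d.G) : (t, R) ∈ d.Gs := by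
  have h0 : 0 ≤ t := h.1
  simp only [Gs, mem_ofPred_eq, max_eq_left h0]; exact h

theorem Admissible.lt_of_mem_Gs (hd : d.Admissible) {t R : ℝ} (h0 : 0 ≤ t) (h : (t, R) ∈ d.Gs) :
    t < d.tauS R := by
  have := hd.G_lt_tauS h
  simp only [max_eq_left h0, hd.tauS_abs] at this; exact this

namespace IsStressEnergy
variable {T : (Fin 4 → ℝ) → Matrix (Fin 4) (Fin 4) ℝ}

theorem contDiffAt_fl (hT : d.IsStressEnergy T) (hd : d.Admissible) {t R : ℝ}
    (hp : (t, R) ∈ d.Gs) (h0 : 0 < t) :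
    ContDiffAt ℝ 1 (d.flA T) (t, R) ∧ ContDiffAt ℝ 1 (d.flB T) (t, R) := by
  have h1 := hd.lt_of_mem_Gs h0.le hp
  have hM := hd.mem_Mext h0.le h1
  obtain ⟨ha, hb, he⟩ := hT.contDiffAt_av hd hp h0
  have le1 : (1 : WithTop ℕ∞) ≤ ((⊤ : ℕ∞) : WithTop ℕ∞) := by exact_mod_cast le_top
  have cr := (hd.contDiffAt_rE hM).of_le le1
  have crR := (hd.contDiffAt_rR hM).of_le le1
  have crT := (hd.contDiffAt_rT hM).of_le le1
  have ch := (hd.contDiffAt_hE h0.le h1).of_le le1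
  have hh : d.hE (t, R) ≠ 0 := one_div_ne_zero (pow_ne_zero 2 (hd.gE_pos h0.le h1).ne')
  exact ⟨(cr.pow 2).mul ((crR.mul ha).sub (crT.mul hb)),
    ((cr.pow 2).div ch hh).mul ((crR.mul hb).sub (crT.mul he))⟩

/-- The pointwise form of the balance law. -/
theorem balance_pointwise (hT : d.IsStressEnergy T) (hd : d.Admissible) {t R : ℝ} (h0 : 0 < t)
    (hR : 0 < R) (hG : (t, R) ∈ d.G) (θ φ : ℝ) :
    let p := (t, R)
    let n := nvec θ φ
    let x := sph t R θ φ
    let D := fun κ μ ν => pd κ (fun z => T z μ ν) x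
    (2 * d.rE p * d.rT p * d.rR p + d.rE p ^ 2 * pdR d.rT p) * T x 0 0
      + d.rE p ^ 2 * d.rR p * D 0 0 0
      - ((2 * d.rE p * d.rT p * d.rT p + d.rE p ^ 2 * (-(d.m R / d.rE p ^ 2)))
          * (∑ σ, n σ * T x σ 0) + d.rE p ^ 2 * d.rT p * ∑ μ, n μ * D 0 μ 0) =
    (2 * d.rE p * d.rR p * d.rR p / d.hE p + d.rE p ^ 2 * pdR d.rR p / d.hE p
        - d.rE p ^ 2 * d.rR p * pdR d.hE p / d.hE p ^ 2) * (∑ σ, n σ * T x σ 0)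
      + d.rE p ^ 2 * d.rR p / d.hE p * (∑ μ, n μ * ∑ κ, n κ * D κ μ 0)
      - ((2 * d.rE p * d.rR p * d.rT p / d.hE p + d.rE p ^ 2 * pdR d.rT p / d.hE p
          - d.rE p ^ 2 * d.rT p * pdR d.hE p / d.hE p ^ 2) * (∑ κ, n κ * ∑ μ, n μ * T x κ μ)
        + d.rE p ^ 2 * d.rT p / d.hE p * ∑ μ, n μ * ∑ ν, n ν * ∑ κ, n κ * D κ μ ν)
      + d.rE p * (4 * Real.pi * (d.ρ₀ R * R ^ 2)) / d.rR p * (∑ σ, n σ * T x σ 0)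
      + (R ^ 2 * (d.rR p * (∑ κ, eθ θ φ κ * ∑ μ, eθ θ φ μ * D κ μ 0
            + ∑ κ, eφ φ κ * ∑ μ, eφ φ μ * D κ μ 0)
          - d.rT p * (∑ κ, eθ θ φ κ * ∑ μ, eθ θ φ μ * (∑ ν, n ν * D κ μ ν)
            + ∑ κ, eφ φ κ * ∑ μ, eφ φ μ * (∑ ν, n ν * D κ μ ν)))
        - R * d.rT p * (∑ κ, eθ θ φ κ * ∑ μ, eθ θ φ μ * T x κ μ
            + ∑ κ, eφ φ κ * ∑ μ, eφ φ μ * T x κ μ)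
        - 2 * R * (d.rR p * (∑ σ, n σ * T x σ 0)
          - d.rT p * ∑ κ, n κ * ∑ μ, n μ * T x κ μ)) := by
  intro p n x D
  have h1 := hd.G_lt_tauS hG
  have hM := hd.mem_Mext h0.le h1
  have hrad : rad x = R := by rw [rad_sph, abs_of_pos hR]
  have hx0 : x 0 = t := sph_zero _ _ _ _
  have hn : radial x = n := radial_sph hR t θ φ
  have hxD : x ∈ d.D := hd.mem_D_of_mem_G (by rw [hx0, hrad]; exact hG)
  have hun : IsUnitRadial n := hn ▸ isUnitRadial_radial (by rw [hrad]; exact hR)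
  have hsymm : ∀ μ ν, T x μ ν = T x ν μ := fun μ ν => (hT.symm x hxD).apply ν μ
  have hDsymm : ∀ κ μ ν, D κ μ ν = D κ ν μ := fun κ μ ν => pd_congr (by
    filter_upwards [hd.D_mem_nhds hxD (by rw [hx0]; exact h0)] with z hz
    exact (hT.symm z hz).apply ν μ) κ
  have hdiv : ∀ ν, divS n (d.sE p) (d.hE p) (pdt d.sE p) (pdR d.sE p) (pdt d.hE p) (pdR d.hE p) R
      (T x) D ν = 0 := by
    intro ν
    have e1 := hd.divergence_eq (x := x) (by rw [hx0]; exact h0) (by rw [hx0, hrad]; exact h1)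
      (by rw [hrad]; exact hR) T ν
    rw [hT.div_free x hxD (by rw [hx0]; exact h0) ν, hx0, hrad, hn] at e1
    exact e1.symm
  have e0 := (divS_zero hun (d.sE p) (d.hE p) (pdt d.sE p) (pdR d.sE p) (pdt d.hE p)
    (pdR d.hE p) R (fun μ ν => T x μ ν) D).symm.trans (hdiv 0)
  have en := (divS_n hun (d.sE p) (d.hE p) (pdt d.sE p) (pdR d.sE p) (pdt d.hE p)
    (pdR d.hE p) R (T := fun μ ν => T x μ ν) hsymm D).symm.trans
    (Finset.sum_eq_zero fun ν _ => by rw [show divS n _ _ _ _ _ _ R (fun μ ν => T x μ ν) D ν = 0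
      from hdiv ν, mul_zero])
  have tr₀ := trace_tangential θ φ fun κ μ => D κ μ 0
  have trₙ := trace_tangential θ φ fun κ μ => ∑ ν, n ν * D κ μ ν
  have trT := trace_tangential θ φ fun κ μ => T x κ μ
  rw [contract_ginvS, tr₀, trT] at e0
  rw [contract_ginvS, trₙ, trT] at en
  have hb1 : ∑ ν, n ν * D 0 0 ν = ∑ μ, n μ * D 0 μ 0 :=
    Finset.sum_congr rfl fun μ _ => by rw [hDsymm]
  have hb2 : ∑ κ, n κ * ∑ μ, n μ * D κ μ 0 = ∑ μ, n μ * ∑ κ, n κ * D κ μ 0 := by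
    simp_rw [Finset.mul_sum]; rw [Finset.sum_comm]
    exact Finset.sum_congr rfl fun _ _ => Finset.sum_congr rfl fun _ _ => by ring
  have hb3 : ∑ κ, n κ * ∑ μ, n μ * ∑ ν, n ν * D κ μ ν =
      ∑ μ, n μ * ∑ ν, n ν * ∑ κ, n κ * D κ μ ν := by
    simp only [Fin.sum_univ_four]; ring
  rw [hb2] at e0
  rw [hb1, hb3] at en
  have hr : d.rE p ≠ 0 := (hd.rE_pos h0.le h1 hR).ne'
  exact balance_algebra (p := ∑ κ, eθ θ φ κ * ∑ μ, eθ θ φ μ * T x κ μ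
      + ∑ κ, eφ φ κ * ∑ μ, eφ φ μ * T x κ μ) hr (hd.rR_pos h0.le h1).ne' (hd.E_pos R).ne' hR.ne'
    (hd.rT_mul_pdR_rT hM hR.ne') (hd.sE_eq hR.ne') (hd.hE_eq p) (hd.pdt_sE hM hR.ne')
    (hd.pdR_sE hM hR.ne') (hd.pdt_hE h0.le h1) (hd.pdR_hE h0.le h1) e0 en

end IsStressEnergy
end TBData
end

noncomputable section
namespace TBData
variable {d : TBData}
namespace IsStressEnergy
variable {T : (Fin 4 → ℝ) → Matrix (Fin 4) (Fin 4) ℝ}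

theorem pdt_flA (hT : d.IsStressEnergy T) (hd : d.Admissible) {t R : ℝ} (hp : (t, R) ∈ d.Gs)
    (h0 : 0 < t) (hR : R ≠ 0) : pdt (d.flA T) (t, R) =
      (2 * d.rE (t, R) * d.rT (t, R) * d.rR (t, R) + d.rE (t, R) ^ 2 * pdR d.rT (t, R))
        * avA T (t, R) + d.rE (t, R) ^ 2 * d.rR (t, R) * pdt (avA T) (t, R)
      - ((2 * d.rE (t, R) * d.rT (t, R) * d.rT (t, R)
            + d.rE (t, R) ^ 2 * (-(d.m R / d.rE (t, R) ^ 2))) * avB T (t, R)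
        + d.rE (t, R) ^ 2 * d.rT (t, R) * pdt (avB T) (t, R)) := by
  have h1 := hd.lt_of_mem_Gs h0.le hp
  have hM := hd.mem_Mext h0.le h1
  obtain ⟨ha, hb, -⟩ := hT.contDiffAt_av hd hp h0
  have cr := hasDerivAt_pdt ((hd.contDiffAt_rE hM).differentiableAt (by simp))
  have crR := hasDerivAt_pdt ((hd.contDiffAt_rR hM).differentiableAt (by simp))
  have crT := hasDerivAt_pdt ((hd.contDiffAt_rT hM).differentiableAt (by simp))
  have ca := hasDerivAt_pdt (ha.differentiableAt one_ne_zero)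
  have cb := hasDerivAt_pdt (hb.differentiableAt one_ne_zero)
  have hf := hasDerivAt_pdt ((hT.contDiffAt_fl hd hp h0).1.differentiableAt one_ne_zero)
  rw [hd.pdt_rR hM] at crR
  rw [hd.pdt_rT hM hR] at crT
  have := hf.unique ((cr.pow 2).mul ((crR.mul ca).sub (crT.mul cb)))
  rw [this]
  have e : pdt d.rE (t, R) = d.rT (t, R) := rfl
  simp only [e, Pi.pow_apply]
  push_cast
  ring

theorem pdR_flB (hT : d.IsStressEnergy T) (hd : d.Admissible) {t R : ℝ} (hp : (t, R) ∈ d.Gs)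
    (h0 : 0 < t) : pdR (d.flB T) (t, R) =
      (2 * d.rE (t, R) * d.rR (t, R) * d.rR (t, R) / d.hE (t, R)
          + d.rE (t, R) ^ 2 * pdR d.rR (t, R) / d.hE (t, R)
          - d.rE (t, R) ^ 2 * d.rR (t, R) * pdR d.hE (t, R) / d.hE (t, R) ^ 2) * avB T (t, R)
        + d.rE (t, R) ^ 2 * d.rR (t, R) / d.hE (t, R) * pdR (avB T) (t, R)
      - ((2 * d.rE (t, R) * d.rR (t, R) * d.rT (t, R) / d.hE (t, R)
            + d.rE (t, R) ^ 2 * pdR d.rT (t, R) / d.hE (t, R)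
            - d.rE (t, R) ^ 2 * d.rT (t, R) * pdR d.hE (t, R) / d.hE (t, R) ^ 2) * avE T (t, R)
        + d.rE (t, R) ^ 2 * d.rT (t, R) / d.hE (t, R) * pdR (avE T) (t, R)) := by
  have h1 := hd.lt_of_mem_Gs h0.le hp
  have hM := hd.mem_Mext h0.le h1
  obtain ⟨-, hb, he⟩ := hT.contDiffAt_av hd hp h0
  have hh : d.hE (t, R) ≠ 0 := one_div_ne_zero (pow_ne_zero 2 (hd.gE_pos h0.le h1).ne')
  have cr := hasDerivAt_pdR ((hd.contDiffAt_rE hM).differentiableAt (by simp))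
  have crR := hasDerivAt_pdR ((hd.contDiffAt_rR hM).differentiableAt (by simp))
  have crT := hasDerivAt_pdR ((hd.contDiffAt_rT hM).differentiableAt (by simp))
  have ch := hasDerivAt_pdR ((hd.contDiffAt_hE h0.le h1).differentiableAt (by simp))
  have cb := hasDerivAt_pdR (hb.differentiableAt one_ne_zero)
  have ce := hasDerivAt_pdR (he.differentiableAt one_ne_zero)
  have hf := hasDerivAt_pdR ((hT.contDiffAt_fl hd hp h0).2.differentiableAt one_ne_zero)
  have := hf.unique (((cr.pow 2).div ch hh).mul ((crR.mul cb).sub (crT.mul ce)))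
  rw [this]
  have e : pdR d.rE (t, R) = d.rR (t, R) := rfl
  simp only [e, Pi.pow_apply, Pi.div_apply]
  push_cast
  field_simp
  ring

/-- The balance law for the Kodama current at positive radius. -/
theorem balance_of_pos (hT : d.IsStressEnergy T) (hd : d.Admissible) {t R : ℝ} (h0 : 0 < t)
    (hR : 0 < R) (hG : (t, R) ∈ d.G) : pdt (d.flA T) (t, R) = pdR (d.flB T) (t, R)
      + d.rE (t, R) * (4 * Real.pi * (d.ρ₀ R * R ^ 2)) / d.rR (t, R) * avB T (t, R) := by
  have hp : (t, R) ∈ d.Gs := hd.mem_Gs (by rwa [abs_of_pos hR])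
  have hTc : ∀ μ ν, Continuous fun z : ℝ × ℝ => T (sph t R z.1 z.2) μ ν := by
    intro μ ν
    have h3 : Continuous fun z : ℝ × ℝ => sph t R z.1 z.2 :=
      continuous_sph.comp (g := fun z : ((ℝ × ℝ) × ℝ) × ℝ => sph z.1.1.1 z.1.1.2 z.1.2 z.2)
        (f := fun z : ℝ × ℝ => (((t, R), z.1), z.2)) (by fun_prop)
    rw [continuous_iff_continuousAt]
    intro z
    have hx := hd.sph_mem_D hp z.1 z.2
    rw [max_eq_left h0.le] at hx
    exact ContinuousAt.comp (f := fun z : ℝ × ℝ => sph t R z.1 z.2)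
      (hT.contDiffAt_comp hd hx (by rw [sph_zero]; exact h0) μ ν).continuousAt h3.continuousAt
  have hDc := hT.continuous_pd hd hp h0
  have hs : Continuous fun z : ℝ × ℝ => Real.sin z.1 := by fun_prop
  have hn := continuous_frame
  -- Treating the integrands as continuous functions lets the linear map `sphL` account for all
  -- integrability conditions.
  let FA : C(ℝ × ℝ, ℝ) := ⟨fun z => Real.sin z.1 * T (sph t R z.1 z.2) 0 0, hs.mul (hTc 0 0)⟩
  let FB : C(ℝ × ℝ, ℝ) := ⟨fun z => Real.sin z.1 * ∑ σ, nvec z.1 z.2 σ * T (sph t R z.1 z.2) σ 0,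
    hs.mul (continuous_finsetSum _ fun σ _ => (hn σ).mul (hTc σ 0))⟩
  let FE : C(ℝ × ℝ, ℝ) := ⟨fun z => Real.sin z.1 * ∑ κ, nvec z.1 z.2 κ * ∑ μ, nvec z.1 z.2 μ *
    T (sph t R z.1 z.2) κ μ, hs.mul (continuous_finsetSum _ fun κ _ => (hn κ).mul
    (continuous_finsetSum _ fun μ _ => (hn μ).mul (hTc κ μ)))⟩
  let FAt : C(ℝ × ℝ, ℝ) := ⟨fun z => Real.sin z.1 * pd 0 (fun x => T x 0 0) (sph t R z.1 z.2),
    hs.mul (hDc 0 0 0)⟩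
  let FBt : C(ℝ × ℝ, ℝ) := ⟨fun z => Real.sin z.1 * ∑ μ, nvec z.1 z.2 μ *
    pd 0 (fun x => T x μ 0) (sph t R z.1 z.2),
    hs.mul (continuous_finsetSum _ fun μ _ => (hn μ).mul (hDc 0 μ 0))⟩
  let FBR : C(ℝ × ℝ, ℝ) := ⟨fun z => Real.sin z.1 * ∑ μ, nvec z.1 z.2 μ * ∑ κ, nvec z.1 z.2 κ *
    pd κ (fun x => T x μ 0) (sph t R z.1 z.2), hs.mul (continuous_finsetSum _ fun μ _ => (hn μ).mul
    (continuous_finsetSum _ fun κ _ => (hn κ).mul (hDc κ μ 0)))⟩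
  let FER : C(ℝ × ℝ, ℝ) := ⟨fun z => Real.sin z.1 * ∑ μ, nvec z.1 z.2 μ * ∑ ν, nvec z.1 z.2 ν *
    ∑ κ, nvec z.1 z.2 κ * pd κ (fun x => T x μ ν) (sph t R z.1 z.2),
    hs.mul (continuous_finsetSum _ fun μ _ => (hn μ).mul (continuous_finsetSum _ fun ν _ =>
    (hn ν).mul (continuous_finsetSum _ fun κ _ => (hn κ).mul (hDc κ μ ν))))⟩
  have eA : avA T (t, R) = sphL FA := by simp only [avA, tcomp, max_eq_left h0.le]; rfl
  have eB : avB T (t, R) = sphL FB := by simp only [avB, tcomp, max_eq_left h0.le]; rfl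
  have eE : avE T (t, R) = sphL FE := by simp only [avE, tcomp, max_eq_left h0.le]; rfl
  have eAt : pdt (avA T) (t, R) = sphL FAt := (hT.pdt_av hd hp h0).1
  have eBt : pdt (avB T) (t, R) = sphL FBt := (hT.pdt_av hd hp h0).2
  have eBR : pdR (avB T) (t, R) = sphL FBR := (hT.pdR_av hd hp h0).1
  have eER : pdR (avE T) (t, R) = sphL FER := (hT.pdR_av hd hp h0).2
  rw [hT.pdt_flA hd hp h0 hR.ne', hT.pdR_flB hd hp h0, eA, eB, eE, eAt, eBt, eBR, eER]
  have tang := hT.tangential_average hd hp h0 (d.rR (t, R)) (d.rT (t, R))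
  have hpt := hT.balance_pointwise hd h0 hR hG
  simp only at hpt
  set r := d.rE (t, R)
  set rT := d.rT (t, R)
  set rR := d.rR (t, R)
  set h := d.hE (t, R)
  set C₁ := 2 * r * rT * rR + r ^ 2 * pdR d.rT (t, R)
  set C₂ := 2 * r * rT * rT + r ^ 2 * (-(d.m R / r ^ 2))
  set C₃ := 2 * r * rR * rR / h + r ^ 2 * pdR d.rR (t, R) / h
    - r ^ 2 * rR * pdR d.hE (t, R) / h ^ 2
  set C₄ := 2 * r * rR * rT / h + r ^ 2 * pdR d.rT (t, R) / h
    - r ^ 2 * rT * pdR d.hE (t, R) / h ^ 2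
  set C₅ := r * (4 * Real.pi * (d.ρ₀ R * R ^ 2)) / rR
  -- Pointwise this combination is R times the integrand of `tangential_average`, so its average
  -- vanishes. Expanding by linearity gives the balance law.
  have key : sphL (C₁ • FA + (r ^ 2 * rR) • FAt - (C₂ • FB + (r ^ 2 * rT) • FBt)
      - (C₃ • FB + (r ^ 2 * rR / h) • FBR - (C₄ • FE + (r ^ 2 * rT / h) • FER) + C₅ • FB)) = 0 := by
    have e1 : sphI (fun θ φ => (C₁ • FA + (r ^ 2 * rR) • FAt - (C₂ • FB + (r ^ 2 * rT) • FBt)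
      - (C₃ • FB + (r ^ 2 * rR / h) • FBR - (C₄ • FE + (r ^ 2 * rT / h) • FER) + C₅ • FB)) (θ, φ))
      = R * 0 := by
      rw [← tang]
      unfold sphI
      rw [← intervalIntegral.integral_const_mul]
      refine intervalIntegral.integral_congr fun θ _ => ?_
      simp only
      rw [← intervalIntegral.integral_const_mul]
      refine intervalIntegral.integral_congr fun φ _ => ?_
      simp only [ContinuousMap.sub_apply, ContinuousMap.add_apply, ContinuousMap.smul_apply,
        smul_eq_mul, ContinuousMap.coe_mk, FA, FB, FE, FAt, FBt, FBR, FER]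
      have := hpt θ φ
      linear_combination Real.sin θ * this
    rw [mul_zero] at e1
    exact e1
  simp only [map_add, map_sub, map_smul, smul_eq_mul] at key
  linarith

end IsStressEnergy
end TBData
end

noncomputable section
namespace TBData
variable {d : TBData}

/-! ### Reflection at the centre -/

/-- In the extension to negative radii, -R denotes the antipodal point. Consequently the averages of
T(u,u) and T(n,n) are even in R and the average of T(u,n) is odd. -/
theorem sph_neg (t R θ φ : ℝ) : sph t (-R) θ φ = sph t R (Real.pi - θ) (φ + Real.pi) := by
  simp [sph, Real.sin_pi_sub, Real.cos_pi_sub, Real.cos_add_pi, Real.sin_add_pi]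

theorem nvec_antipodal (θ φ : ℝ) (μ : Fin 4) :
    nvec θ φ μ = -nvec (Real.pi - θ) (φ + Real.pi) μ := by
  fin_cases μ <;>
    simp [nvec, Real.sin_pi_sub, Real.cos_pi_sub, Real.cos_add_pi, Real.sin_add_pi]

theorem sphI_antipodal {H : ℝ → ℝ → ℝ} (hH : ∀ θ φ, H θ (φ + 2 * Real.pi) = H θ φ) :
    sphI (fun θ φ => H (Real.pi - θ) (φ + Real.pi)) = sphI H := by
  unfold sphI
  have h1 : ∀ θ, ∫ φ in (0 : ℝ)..2 * Real.pi, H θ (φ + Real.pi) =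
      ∫ φ in (0 : ℝ)..2 * Real.pi, H θ φ := by
    intro θ
    rw [intervalIntegral.integral_comp_add_right (fun φ => H θ φ)]
    have hp : Function.Periodic (fun φ => H θ φ) (2 * Real.pi) := hH θ
    have := hp.intervalIntegral_add_eq Real.pi 0
    rw [zero_add] at this ⊢
    rw [← this]
    congr 1
    ring
  simp_rw [h1]
  rw [intervalIntegral.integral_comp_sub_left
    (fun θ => ∫ φ in (0 : ℝ)..2 * Real.pi, H θ φ) Real.pi]
  simp

theorem sph_periodic (t R θ φ : ℝ) : sph t R θ (φ + 2 * Real.pi) = sph t R θ φ := by simp [sph]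

theorem nvec_periodic (θ φ : ℝ) : nvec θ (φ + 2 * Real.pi) = nvec θ φ := by simp [nvec]

theorem avA_neg (T : (Fin 4 → ℝ) → Matrix (Fin 4) (Fin 4) ℝ) (t R : ℝ) :
    avA T (t, -R) = avA T (t, R) := by
  refine Eq.trans ?_ (sphI_antipodal (H := fun θ φ => Real.sin θ * tcomp T (t, R) θ φ 0 0)
    fun θ φ => by simp only [tcomp, sph_periodic])
  unfold avA tcomp
  simp only [sph_neg, Real.sin_pi_sub]

theorem avB_neg (T : (Fin 4 → ℝ) → Matrix (Fin 4) (Fin 4) ℝ) (t R : ℝ) :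
    avB T (t, -R) = -avB T (t, R) := by
  have h := sphI_antipodal (H := fun θ φ => Real.sin θ *
    ∑ μ, nvec θ φ μ * tcomp T (t, R) θ φ μ 0)
    fun θ φ => by simp only [tcomp, sph_periodic, nvec_periodic]
  unfold avB
  rw [← h]
  unfold sphI
  simp_rw [← intervalIntegral.integral_neg]
  refine intervalIntegral.integral_congr fun θ _ => intervalIntegral.integral_congr fun φ _ => ?_
  simp only [tcomp, sph_neg, Real.sin_pi_sub, nvec_antipodal θ φ, neg_mul, Finset.sum_neg_distrib,
    mul_neg]

theorem avE_neg (T : (Fin 4 → ℝ) → Matrix (Fin 4) (Fin 4) ℝ) (t R : ℝ) :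
    avE T (t, -R) = avE T (t, R) := by
  have h := sphI_antipodal (H := fun θ φ => Real.sin θ *
    ∑ κ, nvec θ φ κ * ∑ μ, nvec θ φ μ * tcomp T (t, R) θ φ κ μ)
    fun θ φ => by simp only [tcomp, sph_periodic, nvec_periodic]
  unfold avE
  rw [← h]
  congr 1; ext θ φ
  simp only [tcomp, sph_neg, Real.sin_pi_sub, nvec_antipodal θ φ, neg_mul, Finset.sum_neg_distrib,
    mul_neg, neg_neg]

namespace Admissible

theorem rT_neg_R (hd : d.Admissible) {t R : ℝ} (hp : (t, R) ∈ d.Mext) :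
    d.rT (t, -R) = -d.rT (t, R) := by
  have h1 := hasDerivAt_pdt ((hd.contDiffAt_rE (hd.Mext_neg hp)).differentiableAt (by simp))
  have h2 := (hasDerivAt_pdt ((hd.contDiffAt_rE hp).differentiableAt (by simp))).neg
  have e : (fun s => d.rE (s, -R)) = -fun s => d.rE (s, R) := by
    ext s; simp [hd.rE_neg]
  rw [e] at h1
  exact h1.unique h2

theorem hE_neg (hd : d.Admissible) {t R : ℝ} (hp : (t, R) ∈ d.Mext) :
    d.hE (t, -R) = d.hE (t, R) := by simp only [hE, hd.gE_neg hp]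

theorem flA_neg (hd : d.Admissible) (T : (Fin 4 → ℝ) → Matrix (Fin 4) (Fin 4) ℝ) {t R : ℝ}
    (hp : (t, R) ∈ d.Mext) : d.flA T (t, -R) = d.flA T (t, R) := by
  simp only [flA, hd.rE_neg, hd.rR_neg hp, hd.rT_neg_R hp, avA_neg, avB_neg]; ring

theorem flB_neg (hd : d.Admissible) (T : (Fin 4 → ℝ) → Matrix (Fin 4) (Fin 4) ℝ) {t R : ℝ}
    (hp : (t, R) ∈ d.Mext) : d.flB T (t, -R) = -d.flB T (t, R) := by
  simp only [flB, hd.rE_neg, hd.rR_neg hp, hd.rT_neg_R hp, hd.hE_neg hp, avE_neg, avB_neg]; ring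

end Admissible

namespace IsStressEnergy
variable {T : (Fin 4 → ℝ) → Matrix (Fin 4) (Fin 4) ℝ}

/-- The balance law for the Kodama current. -/
theorem balance (hT : d.IsStressEnergy T) (hd : d.Admissible) {t R : ℝ} (h0 : 0 < t)
    (hR : R ≠ 0) (hG : (t, |R|) ∈ d.G) : pdt (d.flA T) (t, R) = pdR (d.flB T) (t, R)
      + d.rE (t, R) * (4 * Real.pi * (d.ρ₀ R * R ^ 2)) / d.rR (t, R) * avB T (t, R) := by
  rcases hR.lt_or_gt with h | h
  · have hp := hd.mem_Gs hG
    have hp' : (t, -R) ∈ d.Gs := hd.mem_Gs (by rwa [abs_neg])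
    have hM := hd.mem_Mext h0.le (hd.lt_of_mem_Gs h0.le hp)
    rw [abs_of_neg h] at hG
    have hb := hT.balance_of_pos hd h0 (neg_pos.2 h) hG
    obtain ⟨cA, cB⟩ := hT.contDiffAt_fl hd hp h0
    obtain ⟨cA', cB'⟩ := hT.contDiffAt_fl hd hp' h0
    have e1 : pdt (d.flA T) (t, -R) = pdt (d.flA T) (t, R) := by
      have h1 := hasDerivAt_pdt (cA'.differentiableAt one_ne_zero)
      have h2 := hasDerivAt_pdt (cA.differentiableAt one_ne_zero)
      have hc : Tendsto (fun s : ℝ => (s, R)) (𝓝 t) (𝓝 (t, R)) :=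
        (continuous_id.prodMk continuous_const).tendsto t
      have e : (fun s => d.flA T (s, -R)) =ᶠ[𝓝 t] fun s => d.flA T (s, R) := by
        filter_upwards [hc (hd.isOpen_Mext.mem_nhds hM)] with s hs
        exact hd.flA_neg T hs
      exact h1.unique (h2.congr_of_eventuallyEq e)
    have e2 : pdR (d.flB T) (t, -R) = pdR (d.flB T) (t, R) := by
      have h1 := hasDerivAt_pdR (cB'.differentiableAt one_ne_zero)
      have h2 := hasDerivAt_pdR (cB.differentiableAt one_ne_zero)
      have h3 := h1.scomp R (hasDerivAt_neg R)
      have hc : Tendsto (fun s : ℝ => (t, s)) (𝓝 R) (𝓝 (t, R)) :=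
        (continuous_const.prodMk continuous_id).tendsto R
      have e : (fun s => d.flB T (t, s)) ∘ Neg.neg =ᶠ[𝓝 R] fun s => -d.flB T (t, s) := by
        filter_upwards [hc (hd.isOpen_Mext.mem_nhds hM)] with s hs
        exact hd.flB_neg T hs
      have := h3.unique (h2.neg.congr_of_eventuallyEq e)
      simp at this
      exact this
    rw [e1, e2, hd.rE_neg, hd.rR_neg hM, avB_neg, hd.even_ρ₀] at hb
    rw [hb]; ring
  · rw [abs_of_pos h] at hG
    exact hT.balance_of_pos hd h0 h hG

end IsStressEnergy
end TBData
end

noncomputable section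

/-- The dominant energy condition tests timelike vectors, that is |v| < 1. Passing to v = ±1 yields
the inequalities for null vectors. -/
theorem nonneg_endpoints_of_affine {A B : ℝ} (h : ∀ v ∈ Ioo (-1 : ℝ) 1, 0 ≤ A + v * B) :
    0 ≤ A + B ∧ 0 ≤ A - B := by
  have hcl : IsClosed {v : ℝ | 0 ≤ A + v * B} := isClosed_le continuous_const (by fun_prop)
  have hsub : closure (Ioo (-1 : ℝ) 1) ⊆ {v : ℝ | 0 ≤ A + v * B} := closure_minimal h hcl
  rw [closure_Ioo (by norm_num)] at hsub
  have h1 : 0 ≤ A + 1 * B := hsub (show (1 : ℝ) ∈ Icc (-1 : ℝ) 1 by constructor <;> norm_num)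
  have h2 : 0 ≤ A + -1 * B := hsub (show (-1 : ℝ) ∈ Icc (-1 : ℝ) 1 by constructor <;> norm_num)
  constructor <;> linarith

namespace TBData
variable {d : TBData}

/-! ### Consequences of the dominant energy condition -/

theorem rdot_eq_sum (x X : Fin 4 → ℝ) : rdot x X = ∑ μ, radial x μ * X μ := by
  simp only [rdot, Fin.sum_univ_four]
  have : radial x 0 = 0 := by simp [radial]
  rw [this]; ring

namespace IsStressEnergy
variable {T : (Fin 4 → ℝ) → Matrix (Fin 4) (Fin 4) ℝ}

/-- The condition is tested on X = u + vw. The angular part of the current contributes nonnegatively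
to its norm and may be dropped, so causality of the current bounds its radial part by its time part.
-/
theorem current_bounds (hT : d.IsStressEnergy T) (hd : d.Admissible) {x : Fin 4 → ℝ}
    (hx : x ∈ d.D) (hr : 0 < rad x) {v : ℝ} (hv : v ∈ Ioo (-1 : ℝ) 1) :
    |d.gE (x 0, rad x) * ∑ σ, radial x σ * ∑ ν, T x σ ν *
      (u + (v * d.gE (x 0, rad x)) • radial x) ν| ≤
      ∑ ν, T x 0 ν * (u + (v * d.gE (x 0, rad x)) • radial x) ν := by
  obtain ⟨h0, h1⟩ := hx.1
  have hn := isUnitRadial_radial hr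
  set n := radial x with hndef
  set γ := d.gE (x 0, rad x) with hγ
  have hγ0 : 0 < γ := hd.gE_pos h0 h1
  set X := u + (v * γ) • n with hX
  have hy := hd.yE_pos h0 h1
  have hs : d.sE (x 0, rad x) ≠ 0 := pow_ne_zero 4 hy.ne'
  have hh : d.hE (x 0, rad x) ≠ 0 := one_div_ne_zero (pow_ne_zero 2 hγ0.ne')
  have hinv : (d.g x)⁻¹ = Matrix.of (ginvS n (d.sE (x 0, rad x)) (d.hE (x 0, rad x))) := by
    rw [hd.g_eq h0 h1, hn.metricS_inv hs hh]
  have hX0 : X 0 = 1 := by simp [hX, hn.zero, u_zero]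
  have hXi : ∀ i : Fin 4, i ≠ 0 → X i = v * γ * n i := fun i hi => by simp [hX, u, hi]
  have hnsq : n 1 * n 1 + n 2 * n 2 + n 3 * n 3 = 1 := by
    have := hn.sq
    rw [Fin.sum_univ_four, hn.zero] at this
    linarith
  have hrX : rdot x X = v * γ := by
    rw [rdot_eq_sum, ← hndef, Fin.sum_univ_four, hX0, hXi 1 (by decide), hXi 2 (by decide),
      hXi 3 (by decide), hn.zero]
    linear_combination v * γ * hnsq
  have hXt : ev (d.g x) X X < 0 := by
    rw [ev_g, hrX, hX0, hXi 1 (by decide), hXi 2 (by decide), hXi 3 (by decide),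
      hd.γ_eq h0 h1, ← hγ]
    have e : -(1 * 1) + d.y (x 0) (rad x) ^ 4 * (v * γ * n 1 * (v * γ * n 1)
        + v * γ * n 2 * (v * γ * n 2) + v * γ * n 3 * (v * γ * n 3))
        + (1 / γ ^ 2 - d.y (x 0) (rad x) ^ 4) * (v * γ * (v * γ)) = v ^ 2 - 1 := by
      have e2 : 1 / γ ^ 2 * (v * γ * (v * γ)) = v ^ 2 := by field_simp
      linear_combination d.y (x 0) (rad x) ^ 4 * (v * γ) ^ 2 * hnsq + e2
    rw [e]
    nlinarith [hv.1, hv.2]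
  obtain ⟨hJ1, hJ2⟩ := hT.dominant x hx X hXt (by rw [hX0]; norm_num)
  set Y : Fin 4 → ℝ := fun σ => ∑ ν, T x σ ν * X ν with hY
  set Yn := ∑ σ, n σ * Y σ with hYn
  have hJ : ∀ μ, d.current T x X μ = -(-u μ * Y 0 + (Y μ - u μ * Y 0 - n μ * Yn)
      / d.sE (x 0, rad x) + n μ / d.hE (x 0, rad x) * Yn) := by
    intro μ
    rw [← sum_ginvS]
    simp only [current, hinv, Matrix.of_apply, hY, Finset.mul_sum, mul_assoc]
  have hJ0 : d.current T x X 0 = Y 0 := by rw [hJ, hn.zero, u_zero]; ring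
  have hrJ : rdot x (d.current T x X) = -(γ ^ 2 * Yn) := by
    rw [rdot_eq_sum, ← hndef]
    have e : ∀ μ, n μ * d.current T x X μ = -(-(Y 0) * (n μ * u μ) + (n μ * Y μ - Y 0 * (n μ * u μ)
        - Yn * (n μ * n μ)) / d.sE (x 0, rad x) + Yn / d.hE (x 0, rad x) * (n μ * n μ)) := by
      intro μ; rw [hJ]; ring
    simp_rw [e]
    rw [Finset.sum_neg_distrib]
    simp_rw [Finset.sum_add_distrib, ← Finset.sum_div, Finset.sum_sub_distrib, ← Finset.mul_sum,
      hn.sum_n_u, hn.sq, ← hYn]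
    rw [hE, ← hγ]
    field_simp
    ring
  rw [hJ0] at hJ2
  rw [ev_g, hJ0, hrJ, hd.γ_eq h0 h1, ← hγ] at hJ1
  have hsq := rdot_sq_le x (d.current T x X)
  rw [hrJ, rad_sq] at hsq
  have hfin : (γ * Yn) ^ 2 ≤ Y 0 ^ 2 := by
    have h4 : 0 ≤ d.y (x 0) (rad x) ^ 4 := by positivity
    have h5 := mul_le_mul_of_nonneg_left hsq h4
    have e2 : 1 / γ ^ 2 * (-(γ ^ 2 * Yn) * -(γ ^ 2 * Yn)) = (γ * Yn) ^ 2 := by field_simp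
    nlinarith
  exact abs_le_of_sq_le_sq hfin hJ2

/-- The three expressions are T(k,k), T(l,l) and T(u,u) - T(w,w) = T(k,l). They arise from
`current_bounds` in the limits v → ±1. -/
theorem dec_pointwise (hT : d.IsStressEnergy T) (hd : d.Admissible) {x : Fin 4 → ℝ}
    (hx : x ∈ d.D) (hr : 0 < rad x) :
    let γ := d.gE (x 0, rad x)
    let b := ∑ σ, radial x σ * T x σ 0
    let e := ∑ κ, radial x κ * ∑ μ, radial x μ * T x κ μ
    0 ≤ T x 0 0 + 2 * γ * b + γ ^ 2 * e ∧ 0 ≤ T x 0 0 - 2 * γ * b + γ ^ 2 * e ∧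
      γ ^ 2 * e ≤ T x 0 0 := by
  intro γ b e
  have hsymm : ∀ μ ν, T x μ ν = T x ν μ := fun μ ν => (hT.symm x hx).apply ν μ
  have key : ∀ v ∈ Ioo (-1 : ℝ) 1, |γ * (b + v * γ * e)| ≤ T x 0 0 + v * γ * b := by
    intro v hv
    have h := hT.current_bounds hd hx hr hv
    have e1 : ∀ σ, ∑ ν, T x σ ν * (u + (v * d.gE (x 0, rad x)) • radial x) ν =
        T x σ 0 + v * γ * ∑ ν, radial x ν * T x σ ν := by
      intro σ
      have : ∀ ν, T x σ ν * (u + (v * d.gE (x 0, rad x)) • radial x) ν =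
          u ν * T x σ ν + v * γ * (radial x ν * T x σ ν) := fun ν => by
        simp only [Pi.add_apply, Pi.smul_apply, smul_eq_mul]; ring
      simp_rw [this, Finset.sum_add_distrib, ← Finset.mul_sum]
      rw [sum_u (fun ν => T x σ ν)]
    simp_rw [e1] at h
    have e2 : ∑ σ, radial x σ * (T x σ 0 + v * γ * ∑ ν, radial x ν * T x σ ν) = b + v * γ * e := by
      simp_rw [mul_add, Finset.sum_add_distrib]
      congr 1
      rw [Finset.mul_sum]
      exact Finset.sum_congr rfl fun _ _ => by ring
    have e3 : ∑ ν, radial x ν * T x 0 ν = b := Finset.sum_congr rfl fun _ _ => by rw [hsymm]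
    rw [e2, e3] at h
    exact h
  have k1 := nonneg_endpoints_of_affine (A := T x 0 0 + γ * b) (B := γ * b + γ ^ 2 * e)
    fun v hv => by have := (abs_le.1 (key v hv)).1; nlinarith
  have k2 := nonneg_endpoints_of_affine (A := T x 0 0 - γ * b) (B := γ * b - γ ^ 2 * e)
    fun v hv => by have := (abs_le.1 (key v hv)).2; nlinarith
  refine ⟨by linarith [k1.1], by linarith [k2.2], by linarith [k2.1]⟩

end IsStressEnergy
end TBData
end

/-! ### Coercivity of the Kodama energy in the untrapped region -/

noncomputable section
namespace TBData
variable {d : TBData}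

theorem radial_sph_of_neg {R : ℝ} (hR : R < 0) (t θ φ : ℝ) :
    radial (sph t R θ φ) = fun μ => -nvec θ φ μ := by
  have h := radial_sph (neg_pos.2 hR) t (Real.pi - θ) (φ + Real.pi)
  rw [← sph_neg, neg_neg] at h
  rw [h]
  ext μ
  rw [nvec_antipodal θ φ, neg_neg]

/-- The slices are untrapped, uniformly. -/
def Untrapped (d : TBData) (δ : ℝ) : Prop :=
  0 < δ ∧ ∀ t R, (t, R) ∈ d.G → 0 < R → 2 * d.m R ≤ (1 - δ) * d.rE (t, R)

/-- The product of W - |ṙ| and W + |ṙ| is 1 - 2m/r ≥ δ, and the second factor is at most 2. -/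
theorem Untrapped.sub_abs_rT {δ : ℝ} (h : d.Untrapped δ) (hd : d.Admissible) {t R : ℝ}
    (hG : (t, |R|) ∈ d.G) (hR : R ≠ 0) :
    δ / 2 ≤ Real.sqrt (1 + 2 * d.E R) - |d.rT (t, R)| := by
  have key : ∀ R, (t, R) ∈ d.G → 0 < R → δ / 2 ≤ Real.sqrt (1 + 2 * d.E R) - |d.rT (t, R)| := by
    intro R hG hR
    have h0 : 0 ≤ t := hG.1
    have h1 := hd.G_lt_tauS hG
    have hM := hd.mem_Mext h0 h1
    have hr := hd.rE_pos h0 h1 hR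
    have hT := hd.rT_sq hM hR.ne'
    simp only at hT
    have hm := h.2 t R hG hR
    set W := Real.sqrt (1 + 2 * d.E R) with hW
    have hW2 : W ^ 2 = 1 + 2 * d.E R := Real.sq_sqrt (hd.E_pos R).le
    have hW1 : W ≤ 1 := hd.sqrt_E_le_one R
    have hW0 : 0 < W := hd.sqrt_E_pos R
    have h2 : 2 * d.m R / d.rE (t, R) ≤ 1 - δ := by rw [div_le_iff₀ hr]; exact hm
    have h3 : δ ≤ W ^ 2 - |d.rT (t, R)| ^ 2 := by rw [sq_abs, hT, hW2]; linarith
    have hδ := h.1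
    have hT0 := abs_nonneg (d.rT (t, R))
    set q := |d.rT (t, R)|
    have hqW : q < W := by nlinarith
    nlinarith
  rcases hR.lt_or_gt with hn | hp
  · rw [abs_of_neg hn] at hG
    have := key (-R) hG (neg_pos.2 hn)
    have h0 : 0 ≤ t := hG.1
    have h1 := hd.G_lt_tauS hG
    rw [hd.tauS_neg] at h1
    rwa [hd.E_neg, hd.rT_neg_R (hd.mem_Mext h0 h1), abs_neg] at this
  · rw [abs_of_pos hp] at hG
    exact key R hG hp

namespace IsStressEnergy
variable {T : (Fin 4 → ℝ) → Matrix (Fin 4) (Fin 4) ℝ}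

theorem continuous_tcomp (hT : d.IsStressEnergy T) (hd : d.Admissible) {p : ℝ × ℝ} (hp : p ∈ d.Gs)
    (μ ν : Fin 4) : Continuous fun z : ℝ × ℝ => tcomp T p z.1 z.2 μ ν := by
  rw [continuous_iff_continuousAt]
  intro z
  have h := (hT.contDiffAt_zero_tcomp hd hp z.1 z.2 μ ν).continuousAt
  have hc : Continuous fun z : ℝ × ℝ => (((p, z.1), z.2) : ((ℝ × ℝ) × ℝ) × ℝ) := by fun_prop
  exact ContinuousAt.comp (f := fun z : ℝ × ℝ => (((p, z.1), z.2) : ((ℝ × ℝ) × ℝ) × ℝ)) h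
    hc.continuousAt

/-- Linear combinations of the averages are averages of linear combinations. -/
theorem av_comb (hT : d.IsStressEnergy T) (hd : d.Admissible) {p : ℝ × ℝ} (hp : p ∈ d.Gs)
    (c₁ c₂ c₃ : ℝ) : c₁ * avA T p + c₂ * avB T p + c₃ * avE T p =
      sphI fun θ φ => Real.sin θ * (c₁ * tcomp T p θ φ 0 0
        + c₂ * ∑ μ, nvec θ φ μ * tcomp T p θ φ μ 0
        + c₃ * ∑ κ, nvec θ φ κ * ∑ μ, nvec θ φ μ * tcomp T p θ φ κ μ) := by
  have hTc := hT.continuous_tcomp hd hp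
  have hs : Continuous fun z : ℝ × ℝ => Real.sin z.1 := by fun_prop
  have hn := continuous_frame
  let FA : C(ℝ × ℝ, ℝ) := ⟨fun z => Real.sin z.1 * tcomp T p z.1 z.2 0 0, hs.mul (hTc 0 0)⟩
  let FB : C(ℝ × ℝ, ℝ) := ⟨fun z => Real.sin z.1 * ∑ σ, nvec z.1 z.2 σ * tcomp T p z.1 z.2 σ 0,
    hs.mul (continuous_finsetSum _ fun σ _ => (hn σ).mul (hTc σ 0))⟩
  let FE : C(ℝ × ℝ, ℝ) := ⟨fun z => Real.sin z.1 * ∑ κ, nvec z.1 z.2 κ * ∑ μ, nvec z.1 z.2 μ *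
    tcomp T p z.1 z.2 κ μ, hs.mul (continuous_finsetSum _ fun κ _ => (hn κ).mul
    (continuous_finsetSum _ fun μ _ => (hn μ).mul (hTc κ μ)))⟩
  have e : c₁ * avA T p + c₂ * avB T p + c₃ * avE T p = sphL (c₁ • FA + c₂ • FB + c₃ • FE) := by
    simp only [map_add, map_smul, smul_eq_mul]; rfl
  rw [e]
  unfold sphL
  simp only [LinearMap.coe_mk, AddHom.coe_mk]
  congr 1; ext θ φ
  simp only [ContinuousMap.add_apply, ContinuousMap.smul_apply, smul_eq_mul, ContinuousMap.coe_mk,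
    FA, FB, FE]
  ring

/-- The dominant energy condition for the averages. -/
theorem av_dec (hT : d.IsStressEnergy T) (hd : d.Admissible) {t R : ℝ} (hG : (t, |R|) ∈ d.G)
    (hR : R ≠ 0) :
    0 ≤ avA T (t, R) + 2 * d.gE (t, R) * avB T (t, R) + d.gE (t, R) ^ 2 * avE T (t, R) ∧
    0 ≤ avA T (t, R) - 2 * d.gE (t, R) * avB T (t, R) + d.gE (t, R) ^ 2 * avE T (t, R) ∧
    d.gE (t, R) ^ 2 * avE T (t, R) ≤ avA T (t, R) := by
  have h0 : 0 ≤ t := hG.1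
  have hp := hd.mem_Gs hG
  have hM := hd.mem_Mext h0 (hd.lt_of_mem_Gs h0 hp)
  have hg : d.gE (t, |R|) = d.gE (t, R) := by
    rcases abs_choice R with h | h <;> rw [h]
    exact hd.gE_neg hM
  have pt : ∀ θ φ, let b := ∑ μ, nvec θ φ μ * tcomp T (t, R) θ φ μ 0
      let e := ∑ κ, nvec θ φ κ * ∑ μ, nvec θ φ μ * tcomp T (t, R) θ φ κ μ
      let a := tcomp T (t, R) θ φ 0 0
      0 ≤ a + 2 * d.gE (t, R) * b + d.gE (t, R) ^ 2 * e ∧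
      0 ≤ a - 2 * d.gE (t, R) * b + d.gE (t, R) ^ 2 * e ∧ d.gE (t, R) ^ 2 * e ≤ a := by
    intro θ φ
    have hx := hd.sph_mem_D hp θ φ
    simp only [max_eq_left h0] at hx
    have h := hT.dec_pointwise hd hx (by rw [rad_sph]; positivity)
    simp only [sph_zero, rad_sph, hg] at h
    simp only [tcomp, max_eq_left h0]
    rcases hR.lt_or_gt with hn | hp
    · simp only [radial_sph_of_neg hn, neg_mul, Finset.sum_neg_distrib, mul_neg, neg_neg] at h
      refine ⟨by linarith [h.2.1], by linarith [h.1], h.2.2⟩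
    · rw [radial_sph hp] at h
      exact h
  refine ⟨?_, ?_, ?_⟩
  · have e := hT.av_comb hd hp 1 (2 * d.gE (t, R)) (d.gE (t, R) ^ 2)
    rw [one_mul] at e
    rw [e]
    refine sphI_nonneg fun θ hθ φ => mul_nonneg (Real.sin_nonneg_of_mem_Icc hθ) ?_
    have := (pt θ φ).1
    linarith
  · have e := hT.av_comb hd hp 1 (-(2 * d.gE (t, R))) (d.gE (t, R) ^ 2)
    have e' : avA T (t, R) - 2 * d.gE (t, R) * avB T (t, R) + d.gE (t, R) ^ 2 * avE T (t, R) =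
      1 * avA T (t, R) + -(2 * d.gE (t, R)) * avB T (t, R) + d.gE (t, R) ^ 2 * avE T (t, R) := by
      ring
    rw [e', e]
    refine sphI_nonneg fun θ hθ φ => mul_nonneg (Real.sin_nonneg_of_mem_Icc hθ) ?_
    have := (pt θ φ).2.1
    linarith
  · have e := hT.av_comb hd hp 1 0 (-(d.gE (t, R) ^ 2))
    have e' : avA T (t, R) - d.gE (t, R) ^ 2 * avE T (t, R) =
      1 * avA T (t, R) + 0 * avB T (t, R) + -(d.gE (t, R) ^ 2) * avE T (t, R) := by ring
    rw [← sub_nonneg, e', e]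
    refine sphI_nonneg fun θ hθ φ => mul_nonneg (Real.sin_nonneg_of_mem_Icc hθ) ?_
    have := (pt θ φ).2.2
    linarith

/-- The energy density and the fluxes of the Kodama current control those of `u`. -/
theorem flux_bounds (hT : d.IsStressEnergy T) (hd : d.Admissible) {δ : ℝ} (hδ : d.Untrapped δ)
    {t R : ℝ} (hG : (t, |R|) ∈ d.G) :
    δ / 2 * (d.rE (t, R) ^ 2 * avA T (t, R) / d.gE (t, R)) ≤ d.flA T (t, R) ∧
    d.flA T (t, R) ≤ 2 * (d.rE (t, R) ^ 2 * avA T (t, R) / d.gE (t, R)) ∧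
    0 ≤ d.rE (t, R) ^ 2 * avA T (t, R) / d.gE (t, R) ∧
    δ / 2 * (d.rE (t, R) ^ 2 * (avA T (t, R) + d.gE (t, R) * avB T (t, R))) ≤
      d.gE (t, R) * d.flA T (t, R) + d.flB T (t, R) ∧
    δ / 2 * (d.rE (t, R) ^ 2 * (avA T (t, R) - d.gE (t, R) * avB T (t, R))) ≤
      d.gE (t, R) * d.flA T (t, R) - d.flB T (t, R) ∧
    0 ≤ d.rE (t, R) ^ 2 * (avA T (t, R) + d.gE (t, R) * avB T (t, R)) ∧
    0 ≤ d.rE (t, R) ^ 2 * (avA T (t, R) - d.gE (t, R) * avB T (t, R)) ∧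
    d.rE (t, R) * d.rE (t, R) * |avB T (t, R)| * d.rR (t, R) * δ / 2 ≤
      d.rR (t, R) * d.flA T (t, R) := by
  by_cases hR : R = 0
  · subst hR
    have : d.rE (t, 0) = 0 := by simp [rE]
    simp [flA, flB, this]
  have h0 : 0 ≤ t := hG.1
  have hp := hd.mem_Gs hG
  have h1 := hd.lt_of_mem_Gs h0 hp
  obtain ⟨c1, c2, c3⟩ := hT.av_dec hd hG hR
  have hW := hδ.sub_abs_rT hd hG hR
  have hδ0 := hδ.1
  have hγ := hd.gE_pos h0 h1
  have hrR := hd.rR_pos h0 h1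
  have hW1 := hd.sqrt_E_le_one R
  have hγdef : d.gE (t, R) = Real.sqrt (1 + 2 * d.E R) / d.rR (t, R) := rfl
  have hh : d.hE (t, R) = 1 / d.gE (t, R) ^ 2 := rfl
  simp only [flA, flB, hh]
  set γ := d.gE (t, R)
  set a := avA T (t, R)
  set b := avB T (t, R)
  set e := avE T (t, R)
  set W := Real.sqrt (1 + 2 * d.E R)
  set r := d.rE (t, R)
  set q := d.rT (t, R)
  have hW0 : 0 < W := hd.sqrt_E_pos R
  -- After this substitution the density is r²(Wa - ṙγb)/γ and the flux r²(Wγb - ṙγ²e), both linear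
  -- in the quantities controlled by the dominant energy condition.
  have hrRW : d.rR (t, R) = W / γ := by rw [eq_div_iff hγ.ne', hγdef]; field_simp
  rw [hrRW] at hrR ⊢
  have hb : |γ * b| ≤ a := by rw [abs_le]; constructor <;> linarith
  have hq := abs_nonneg q
  have ha : 0 ≤ a := (abs_nonneg _).trans hb
  have hqb : |q * (γ * b)| ≤ |q| * a := by
    rw [abs_mul]; exact mul_le_mul_of_nonneg_left hb hq
  have hqb' := abs_le.1 hqb
  have hr2 : 0 ≤ r ^ 2 := sq_nonneg r
  have eA : r ^ 2 * (W / γ * a - q * b) = r ^ 2 * (W * a - q * (γ * b)) / γ := by field_simp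
  have e3 : γ * (r ^ 2 * (W / γ * a - q * b)) = r ^ 2 * (W * a - q * (γ * b)) := by field_simp
  have eB : r ^ 2 / (1 / γ ^ 2) * (W / γ * b - q * e) = r ^ 2 * (W * (γ * b) - q * (γ ^ 2 * e)) := by
    field_simp
  have hq1 := neg_abs_le q
  have hq2 := le_abs_self q
  -- The outgoing flux of the Kodama current is (W - q)/2 times T(k,k) plus (W + q)/2 times T(k,l).
  -- The corresponding flux of u is half the sum of the same two terms. For incoming directions W -
  -- q and W + q exchange roles and T(l,l) replaces T(k,k).
  have l1 : δ / 4 ≤ (W - q) / 2 := by linarith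
  have l2 : δ / 4 ≤ (W + q) / 2 := by linarith
  rw [e3, eA, eB, mul_div_assoc', mul_div_assoc']
  have low : δ / 2 * a ≤ W * a - q * (γ * b) := by
    have := mul_le_mul_of_nonneg_right hW ha
    linarith
  refine ⟨?_, ?_, by positivity, ?_, ?_, ?_, ?_, ?_⟩
  · refine div_le_div_of_nonneg_right ?_ hγ.le
    calc δ / 2 * (r ^ 2 * a) = r ^ 2 * (δ / 2 * a) := by ring
      _ ≤ _ := mul_le_mul_of_nonneg_left low hr2
  · refine div_le_div_of_nonneg_right ?_ hγ.le
    calc r ^ 2 * (W * a - q * (γ * b)) ≤ r ^ 2 * (2 * a) := by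
          refine mul_le_mul_of_nonneg_left ?_ hr2
          have h5 : |q| ≤ 1 := by linarith
          have h6 := mul_le_mul_of_nonneg_right h5 ha
          have h7 := mul_le_mul_of_nonneg_right hW1 ha
          linarith
      _ = _ := by ring
  · have k1 := mul_le_mul_of_nonneg_right l1 c1
    have k2 := mul_le_mul_of_nonneg_right l2 (sub_nonneg.2 c3)
    calc δ / 2 * (r ^ 2 * (a + γ * b)) = r ^ 2 * (δ / 2 * (a + γ * b)) := by ring
      _ ≤ r ^ 2 * ((W * a - q * (γ * b)) + (W * (γ * b) - q * (γ ^ 2 * e))) := by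
          refine mul_le_mul_of_nonneg_left ?_ hr2; linarith
      _ = _ := by ring
  · have k1 := mul_le_mul_of_nonneg_right l2 c2
    have k2 := mul_le_mul_of_nonneg_right l1 (sub_nonneg.2 c3)
    calc δ / 2 * (r ^ 2 * (a - γ * b)) = r ^ 2 * (δ / 2 * (a - γ * b)) := by ring
      _ ≤ r ^ 2 * ((W * a - q * (γ * b)) - (W * (γ * b) - q * (γ ^ 2 * e))) := by
          refine mul_le_mul_of_nonneg_left ?_ hr2; linarith
      _ = _ := by ring
  · exact mul_nonneg hr2 (by linarith [(abs_le.1 hb).1])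
  · exact mul_nonneg hr2 (by linarith [(abs_le.1 hb).2])
  · have hb2 : |b| ≤ a / γ := by
      rw [le_div_iff₀ hγ]; rw [abs_mul, abs_of_pos hγ] at hb; linarith
    calc r * r * |b| * (W / γ) * δ / 2 = W / γ * (r ^ 2 * (δ / 2 * |b|)) := by ring
      _ ≤ W / γ * (r ^ 2 * (δ / 2 * (a / γ))) := by gcongr
      _ = W / γ * (r ^ 2 * (δ / 2 * a) / γ) := by ring
      _ ≤ W / γ * (r ^ 2 * (W * a - q * (γ * b)) / γ) := by gcongr

end IsStressEnergy
end TBData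
end

/-! ### The energy inequality between two light rays -/

noncomputable section

/-- Continuity of integrals with moving endpoints. -/
theorem continuousOn_integral_of_moving_endpoints {A : ℝ × ℝ → ℝ} {α β : ℝ → ℝ} {a b : ℝ}
    (hα : ContinuousOn α (Icc a b)) (hβ : ContinuousOn β (Icc a b))
    (hA : ∀ s ∈ Icc a b, ∀ R ∈ uIcc (α s) (β s), ContinuousAt A (s, R)) :
    ContinuousOn (fun s => ∫ R in α s..β s, A (s, R)) (Icc a b) := by
  have hα' := continuousOn_iff_continuous_domRestrict.1 hα
  have hβ' := continuousOn_iff_continuous_domRestrict.1 hβ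
  rw [continuousOn_iff_continuous_domRestrict]
  -- Continuity of A is known only between the end points. Clamping the rescaled variable to [0,1]
  -- makes the integrand continuous on the whole line without changing the integral.
  let cl : ℝ → ℝ := fun x => max 0 (min x 1)
  have hcl : Continuous cl := by fun_prop
  have hcl01 : ∀ x, 0 ≤ cl x ∧ cl x ≤ 1 := fun x =>
    ⟨le_max_left _ _, max_le zero_le_one (min_le_right _ _)⟩
  let H : Icc a b → ℝ → ℝ := fun s x => A ((s : ℝ), (β s - α s) * cl x + α s)
  have hH : Continuous (Function.uncurry H) := by
    rw [continuous_iff_continuousAt]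
    rintro ⟨s, x⟩
    have hc : Continuous fun z : Icc a b × ℝ =>
        ((z.1 : ℝ), (β z.1 - α z.1) * cl z.2 + α z.1) := by
      have h1 : Continuous fun z : Icc a b × ℝ => α z.1 := hα'.comp continuous_fst
      have h2 : Continuous fun z : Icc a b × ℝ => β z.1 := hβ'.comp continuous_fst
      exact (continuous_subtype_val.comp continuous_fst).prodMk
        (((h2.sub h1).mul (hcl.comp continuous_snd)).add h1)
    have hm : (β s - α s) * cl x + α s ∈ uIcc (α s) (β s) := by
      obtain ⟨h1, h2⟩ := hcl01 x
      rcases le_total (α s) (β s) with h | h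
      · rw [uIcc_of_le h]; constructor <;> nlinarith
      · rw [uIcc_of_ge h]; constructor <;> nlinarith
    exact ContinuousAt.comp (f := fun z : Icc a b × ℝ =>
        ((z.1 : ℝ), (β z.1 - α z.1) * cl z.2 + α z.1)) (hA s s.2 _ hm) hc.continuousAt
  have h := intervalIntegral.continuous_parametric_intervalIntegral_of_continuous'
    (μ := volume) hH 0 1
  refine ((hβ'.sub hα').mul h).congr fun s => ?_
  have e : ∫ x in (0 : ℝ)..1, H s x = ∫ x in (0 : ℝ)..1, A ((s : ℝ), (β s - α s) * x + α s) := by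
    refine intervalIntegral.integral_congr fun x hx => ?_
    rw [uIcc_of_le zero_le_one] at hx
    have : cl x = x := by simp only [cl]; rw [min_eq_left hx.2, max_eq_right hx.1]
    simp only [H, this]
  have e2 := intervalIntegral.mul_integral_comp_mul_add (a := 0) (b := 1)
    (f := fun R => A ((s : ℝ), R)) (β s - α s) (α s)
  simp only [mul_zero, zero_add, mul_one, sub_add_cancel] at e2
  simp only [domRestrict_apply, Pi.mul_apply, Pi.sub_apply, e, ← e2]

theorem ContDiffAt.continuousAt_pd {A : ℝ × ℝ → ℝ} {p : ℝ × ℝ} (h : ContDiffAt ℝ 1 A p) :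
    ContinuousAt (pdt A) p ∧ ContinuousAt (pdR A) p := by
  have := (h.fderiv_right (m := 0) (by norm_num)).continuousAt
  exact ⟨this.clm_apply continuousAt_const, this.clm_apply continuousAt_const⟩

namespace TBData
variable {d : TBData}

/-- The domain of dependence of a slice lies in the development. -/
theorem Admissible.mem_G_of_ray_le (hd : d.Admissible) {α : ℝ → ℝ} {τ : ℝ} (hα : d.IsRayOn α 0 τ)
    (h0 : 0 ≤ α τ) {s R : ℝ} (hs : s ∈ Icc 0 τ) (hR : α s ≤ R) : (s, |R|) ∈ d.G := by
  rcases le_or_gt 0 (α s) with h | h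
  · rw [abs_of_nonneg (h.trans hR)]
    exact hd.mem_G_of_lt (hd.mem_G_of_ray hα hs.1 hs.2) h hR
  · exact hd.mem_G_of_lt_tauS_zero hs.1 (hd.ray_lt_tauS hα h0 s hs 0 h.le)

/-- The flux of the Kodama current through an outgoing light ray. -/
def outflux (d : TBData) (T : (Fin 4 → ℝ) → Matrix (Fin 4) (Fin 4) ℝ) (p : ℝ × ℝ) : ℝ :=
  d.gE p * d.flA T p + d.flB T p

/-- `n` bounds the relative size of the source term of the Kodama energy off the finite set `S`. -/
structure SourceBound (d : TBData) (N n : ℝ → ℝ) (Nmax : ℝ) (S : Finset ℝ) : Prop where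
  cont : Continuous N
  le_max : ∀ t, 0 ≤ t → |N t| ≤ Nmax
  nonneg : ∀ t, 0 ≤ n t
  hasDerivAt : ∀ t, t ∉ S → HasDerivAt N (n t) t
  bound : ∀ t R, (t, R) ∈ d.G → 0 < R → t ∉ S →
    4 * Real.pi * (d.ρ₀ R * R ^ 2) / (d.rE (t, R) * d.rR (t, R)) ≤ n t

namespace IsStressEnergy
variable {T : (Fin 4 → ℝ) → Matrix (Fin 4) (Fin 4) ℝ}

theorem continuousAt_fl (hT : d.IsStressEnergy T) (hd : d.Admissible) {t R : ℝ}
    (hG : (t, |R|) ∈ d.G) : ContinuousAt (d.flA T) (t, R) ∧ ContinuousAt (d.flB T) (t, R) ∧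
      ContinuousAt (d.outflux T) (t, R) := by
  have h0 : 0 ≤ t := hG.1
  have hp := hd.mem_Gs hG
  have h1 := hd.lt_of_mem_Gs h0 hp
  have hM := hd.mem_Mext h0 h1
  obtain ⟨ha, hb, he⟩ := hT.continuousAt_av hd hp
  have cr := (hd.contDiffAt_rE hM).continuousAt
  have crR := (hd.contDiffAt_rR hM).continuousAt
  have crT := (hd.contDiffAt_rT hM).continuousAt
  have ch := (hd.contDiffAt_hE h0 h1).continuousAt
  have cg := (hd.contDiffAt_gE hM (hd.rR_pos h0 h1)).continuousAt
  have hh : d.hE (t, R) ≠ 0 := one_div_ne_zero (pow_ne_zero 2 (hd.gE_pos h0 h1).ne')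
  have cA : ContinuousAt (d.flA T) (t, R) := (cr.pow 2).mul ((crR.mul ha).sub (crT.mul hb))
  have cB : ContinuousAt (d.flB T) (t, R) :=
    ((cr.pow 2).div₀ ch hh).mul ((crR.mul hb).sub (crT.mul he))
  exact ⟨cA, cB, (cg.mul cA).add cB⟩

theorem flA_nonneg (hT : d.IsStressEnergy T) (hd : d.Admissible) {δ : ℝ} (hδ : d.Untrapped δ)
    {t R : ℝ} (hG : (t, |R|) ∈ d.G) : 0 ≤ d.flA T (t, R) := by
  have h := hT.flux_bounds hd hδ hG
  exact (mul_nonneg (half_pos hδ.1).le h.2.2.1).trans h.1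

theorem outflux_nonneg (hT : d.IsStressEnergy T) (hd : d.Admissible) {δ : ℝ} (hδ : d.Untrapped δ)
    {t R : ℝ} (hG : (t, |R|) ∈ d.G) : 0 ≤ d.outflux T (t, R) := by
  have h := hT.flux_bounds hd hδ hG
  exact (mul_nonneg (half_pos hδ.1).le h.2.2.2.2.2.1).trans h.2.2.2.1

/-- The source term of the balance law is controlled by the energy. -/
theorem pdt_flA_le (hT : d.IsStressEnergy T) (hd : d.Admissible) {δ Nmax : ℝ} {N n : ℝ → ℝ}
    {S : Finset ℝ} (hδ : d.Untrapped δ) (hN : d.SourceBound N n Nmax S) {t R : ℝ} (h0 : 0 < t)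
    (ht : t ∉ S) (hR : R ≠ 0) (hG : (t, |R|) ∈ d.G) :
    pdt (d.flA T) (t, R) ≤ pdR (d.flB T) (t, R) + 2 / δ * n t * d.flA T (t, R) := by
  rw [hT.balance hd h0 hR hG]
  have hδ0 := hδ.1
  have hp := hd.mem_Gs hG
  have h1 := hd.lt_of_mem_Gs h0.le hp
  have hM := hd.mem_Mext h0.le h1
  have hrR := hd.rR_pos h0.le h1
  have hsrc : |4 * Real.pi * (d.ρ₀ R * R ^ 2)| ≤ n t * (|d.rE (t, R)| * d.rR (t, R)) := by
    have hpos : ∀ R, 0 ≤ R → 0 ≤ d.ρ₀ R := fun R hR => by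
      rcases lt_or_ge R d.Rstar with h | h
      · exact (hd.density_pos R hR h).le
      · exact (hd.density_zero R h).ge
    have hb := hN.bound t |R| hG (abs_pos.2 hR) ht
    have hr : 0 < d.rE (t, |R|) := hd.rE_pos h0.le (by rwa [hd.tauS_abs]) (abs_pos.2 hR)
    have e1 : d.ρ₀ |R| = d.ρ₀ R := by
      rcases abs_choice R with h | h <;> rw [h]
      exact hd.even_ρ₀ R
    have e2 : d.rR (t, |R|) = d.rR (t, R) := by
      rcases abs_choice R with h | h <;> rw [h]
      exact hd.rR_neg hM
    have e3 : d.rE (t, |R|) = |d.rE (t, R)| := by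
      rw [← abs_of_pos hr]
      rcases abs_choice R with h | h <;> rw [h]
      rw [hd.rE_neg, abs_neg]
    rw [e3] at hr
    rw [e1, e2, e3, sq_abs, div_le_iff₀ (by positivity)] at hb
    rwa [abs_of_nonneg]
    have := hpos |R| (abs_nonneg R)
    rw [e1] at this
    positivity
  have hf := (hT.flux_bounds hd hδ hG).2.2.2.2.2.2.2
  have hf' : d.rE (t, R) * d.rE (t, R) * |avB T (t, R)| ≤ 2 / δ * d.flA T (t, R) := by
    rw [div_mul_eq_mul_div, le_div_iff₀ hδ0]
    refine le_of_mul_le_mul_left ?_ hrR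
    linarith
  have hn := hN.nonneg t
  refine add_le_add_right ((le_abs_self _).trans ?_) _
  rw [abs_mul, abs_div, abs_mul, abs_of_pos hrR]
  calc |d.rE (t, R)| * |4 * Real.pi * (d.ρ₀ R * R ^ 2)| / d.rR (t, R) * |avB T (t, R)|
      ≤ |d.rE (t, R)| * (n t * (|d.rE (t, R)| * d.rR (t, R))) / d.rR (t, R) * |avB T (t, R)| := by
        gcongr
    _ = n t * (|d.rE (t, R)| * |d.rE (t, R)| * |avB T (t, R)|) := by field_simp
    _ = n t * (d.rE (t, R) * d.rE (t, R) * |avB T (t, R)|) := by rw [abs_mul_abs_self]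
    _ ≤ n t * (2 / δ * d.flA T (t, R)) := by gcongr
    _ = _ := by ring

/-- The Kodama energy between the light rays `α` and `-k`. -/
theorem hasDerivAt_energy (hT : d.IsStressEnergy T) (hd : d.Admissible) {δ Nmax : ℝ}
    {N n : ℝ → ℝ} {S : Finset ℝ} (hδ : d.Untrapped δ) (hN : d.SourceBound N n Nmax S)
    {α k : ℝ → ℝ} {s : ℝ} (h0 : 0 < s) (hs : s ∉ S) (hα : HasDerivAt α (d.gE (s, α s)) s)
    (hk : HasDerivAt k (d.gE (s, k s)) s) (hle : α s ≤ -k s) (hksG : s < d.tauS (k s))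
    (hG : ∀ R, α s ≤ R → (s, |R|) ∈ d.G) :
    ∃ Φ', HasDerivAt (fun s => ∫ R in α s..-k s, d.flA T (s, R)) Φ' s ∧
      Φ' ≤ 2 / δ * n s * (∫ R in α s..-k s, d.flA T (s, R))
        - d.outflux T (s, α s) - d.outflux T (s, k s) := by
  have hcd : ∀ R, α s ≤ R → ContDiffAt ℝ 1 (d.flA T) (s, R) ∧ ContDiffAt ℝ 1 (d.flB T) (s, R) :=
    fun R hR => hT.contDiffAt_fl hd (hd.mem_Gs (hG R hR)) h0
  have hui : ∀ R ∈ uIcc (α s) (-k s), α s ≤ R := fun R hR => by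
    rw [uIcc_of_le hle] at hR; exact hR.1
  have hci : ∀ {F : ℝ × ℝ → ℝ}, (∀ R, α s ≤ R → ContinuousAt F (s, R)) →
      IntervalIntegrable (fun R => F (s, R)) volume (α s) (-k s) := fun {F} hF =>
    ContinuousOn.intervalIntegrable fun R hR =>
      (ContinuousAt.comp (f := fun R : ℝ => (s, R)) (hF R (hui R hR))
        (by fun_prop)).continuousWithinAt
  refine ⟨_, hasDerivAt_integral_of_moving_endpoints hα hk.fun_neg
    fun R hR => (hcd R (hui R hR)).1, ?_⟩
  have i1 := hci fun R hR => (hcd R hR).1.continuousAt_pd.1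
  have i2 := hci fun R hR => (hcd R hR).2.continuousAt_pd.2
  have i3 := (hci fun R hR => (hcd R hR).1.continuousAt).const_mul (2 / δ * n s)
  -- The balance law is not available at R = 0, where spherical coordinates degenerate. A single
  -- radius does not affect the integrals.
  have hm : ∫ R in α s..-k s, pdt (d.flA T) (s, R) ≤ ∫ R in α s..-k s,
      (pdR (d.flB T) (s, R) + 2 / δ * n s * d.flA T (s, R)) := by
    refine intervalIntegral.integral_mono_ae_restrict hle i1 (i2.add i3) ?_
    filter_upwards [ae_restrict_mem measurableSet_Icc,
      ae_restrict_of_ae ((countable_singleton (0 : ℝ)).ae_notMem volume)] with R hR hR0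
    exact hT.pdt_flA_le hd hδ hN h0 hs hR0 (hG R hR.1)
  rw [intervalIntegral.integral_add i2 i3, intervalIntegral.integral_const_mul,
    intervalIntegral.integral_eq_sub_of_hasDerivAt (f := fun R => d.flB T (s, R))
      (fun R hR => hasDerivAt_pdR ((hcd R (hui R hR)).2.differentiableAt (by norm_num))) i2] at hm
  -- At the right end -k the density is even and the flux odd. The boundary term there becomes minus
  -- the outgoing flux at k, of the same form as the term at α.
  have hM := hd.mem_Mext h0.le hksG
  simp only [outflux, hd.flA_neg T hM, hd.flB_neg T hM] at hm ⊢
  linarith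

end IsStressEnergy
end TBData
end

noncomputable section
namespace TBData
variable {d : TBData}

theorem GloballyNaked.exists_sourceBound (hn : d.GloballyNaked) (hd : d.Admissible) :
    ∃ N n Nmax S, d.SourceBound N n Nmax S := by
  obtain ⟨N, n, Nmax, τ₁, h1, h2, h3, h4, h5⟩ := hn.exists_source_bound hd
  refine ⟨N, n, Nmax, {d.tauS 0, τ₁}, h1, h2, h3, fun t ht => ?_, fun t R hG hR ht => ?_⟩ <;>
  · simp only [Finset.mem_insert, Finset.mem_singleton, not_or] at ht
    first | exact h4 t ht.1 ht.2 | exact h5 t R hG hR ht.1 ht.2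

namespace IsStressEnergy
variable {T : (Fin 4 → ℝ) → Matrix (Fin 4) (Fin 4) ℝ}

/-- The energy inequality for the region between the outgoing light ray `α`, the incoming light
ray `-k`, and the slices `0` and `τ`. -/
theorem energy_inequality (hT : d.IsStressEnergy T) (hd : d.Admissible) {δ Nmax : ℝ}
    {N n : ℝ → ℝ} {S : Finset ℝ} (hδ : d.Untrapped δ) (hN : d.SourceBound N n Nmax S)
    {α k : ℝ → ℝ} {τ : ℝ} (hτ : 0 ≤ τ) (hα : d.IsRayOn α 0 τ) (hk : d.IsRayOn k 0 τ)
    (h0 : 0 ≤ α τ) (hle : α τ ≤ -k τ) :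
    (∫ R in α τ..-k τ, d.flA T (τ, R))
        + ∫ s in (0 : ℝ)..τ, (d.outflux T (s, α s) + d.outflux T (s, k s)) ≤
      Real.exp (4 / δ * Nmax) * ∫ R in α 0..-k 0, d.flA T (0, R) := by
  have hδ0 := hδ.1
  have hαm := (hd.ray_strictMono hα).monotoneOn
  have hkm := (hd.ray_strictMono hk).monotoneOn
  have hτm : τ ∈ Icc 0 τ := right_mem_Icc.2 hτ
  have hα_le : ∀ s ∈ Icc 0 τ, α s ≤ α τ := fun s hs => hαm hs hτm hs.2
  have hk_le : ∀ s ∈ Icc 0 τ, -k τ ≤ -k s := fun s hs => neg_le_neg (hkm hs hτm hs.2)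
  have hαk : ∀ s ∈ Icc 0 τ, α s ≤ -k s := fun s hs =>
    (hα_le s hs).trans (hle.trans (hk_le s hs))
  have hG : ∀ s ∈ Icc 0 τ, ∀ R, α s ≤ R → (s, |R|) ∈ d.G := fun s hs R hR =>
    hd.mem_G_of_ray_le hα h0 hs hR
  have hGk : ∀ s ∈ Icc 0 τ, (s, |k s|) ∈ d.G := fun s hs => by
    rw [← abs_neg]; exact hG s hs _ (hαk s hs)
  set Φ : ℝ → ℝ := fun s => ∫ R in α s..-k s, d.flA T (s, R) with hΦ
  have hΦ0 : ∀ s ∈ Icc 0 τ, 0 ≤ Φ s := fun s hs =>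
    intervalIntegral.integral_nonneg (hαk s hs) fun R hR =>
      hT.flA_nonneg hd hδ (hG s hs R hR.1)
  have hΦc : ContinuousOn Φ (Icc 0 τ) :=
    continuousOn_integral_of_moving_endpoints hα.continuousOn hk.continuousOn.fun_neg
      fun s hs R hR => by
        rw [uIcc_of_le (hαk s hs)] at hR
        exact (hT.continuousAt_fl hd (hG s hs R hR.1)).1
  set J : ℝ → ℝ := fun s => d.outflux T (s, α s) + d.outflux T (s, k s) with hJ
  have hJ0 : ∀ s ∈ Icc 0 τ, 0 ≤ J s := fun s hs =>
    add_nonneg (hT.outflux_nonneg hd hδ (hG s hs _ le_rfl)) (hT.outflux_nonneg hd hδ (hGk s hs))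
  have hJc : ∀ s ∈ Icc 0 τ, ContinuousAt J s := fun s hs => by
    have c1 := (hT.continuousAt_fl hd (hG s hs _ le_rfl)).2.2
    have c2 := (hT.continuousAt_fl hd (hGk s hs)).2.2
    exact (ContinuousAt.comp (f := fun s => (s, α s)) c1
        (continuousAt_id.prodMk (hα s hs).2.2.continuousAt)).add
      (ContinuousAt.comp (f := fun s => (s, k s)) c2
        (continuousAt_id.prodMk (hk s hs).2.2.continuousAt))
  have hJc' : ContinuousOn J (Icc 0 τ) := fun s hs => (hJc s hs).continuousWithinAt
  have hJi : IntervalIntegrable J volume 0 τ := by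
    refine ContinuousOn.intervalIntegrable ?_
    rwa [uIcc_of_le hτ]
  set ε := Real.exp (-(2 / δ * Nmax)) with hε
  have hε0 : 0 < ε := Real.exp_pos _
  have hNM : ∀ s, 0 ≤ s → ε ≤ Real.exp (-(2 / δ * N s)) := fun s hs => by
    have := (abs_le.1 (hN.le_max s hs)).2
    exact Real.exp_le_exp.2 (by gcongr)
  -- The weight absorbs the source: the derivative of F is at most (ε - exp(-2N/δ)) J. This is
  -- nonpositive because ε is a lower bound for the weight and J ≥ 0.
  set F : ℝ → ℝ := fun s => Real.exp (-(2 / δ * N s)) * Φ s + ε * ∫ x in (0 : ℝ)..s, J x with hF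
  have hFc : ContinuousOn F (Icc 0 τ) := by
    have c1 : Continuous fun s => Real.exp (-(2 / δ * N s)) :=
      Real.continuous_exp.comp (continuous_const.mul hN.cont).neg
    have c2 : ContinuousOn (fun s => ∫ x in (0 : ℝ)..s, J x) (Icc 0 τ) := by
      have := intervalIntegral.continuousOn_primitive_interval' (μ := volume) hJi left_mem_uIcc
      rwa [uIcc_of_le hτ] at this
    exact (c1.continuousOn.mul hΦc).add (continuousOn_const.mul c2)
  have hFd : ∀ s ∈ Ioo 0 τ, s ∉ S → ∃ F', HasDerivAt F F' s ∧ F' ≤ 0 := by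
    intro s hs hsS
    have hs' := Ioo_subset_Icc_self hs
    obtain ⟨Φ', hΦ', hle'⟩ := hT.hasDerivAt_energy hd hδ hN hs.1 hsS (hα s hs').2.2 (hk s hs').2.2
      (hαk s hs') (hk s hs').2.1 (hG s hs')
    have d1 : HasDerivAt (fun s => Real.exp (-(2 / δ * N s))) _ s :=
      ((hN.hasDerivAt s hsS).const_mul (2 / δ)).fun_neg.exp
    have hJs : StronglyMeasurableAtFilter J (𝓝 s) volume :=
      hJc'.stronglyMeasurableAtFilter_nhdsWithin measurableSet_Icc s |>.filter_mono (by
        rw [nhdsWithin_eq_nhds.2 (Icc_mem_nhds hs.1 hs.2)])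
    have d2 : HasDerivAt (fun s => ∫ x in (0 : ℝ)..s, J x) (J s) s := by
      refine intervalIntegral.integral_hasDerivAt_right ?_ hJs (hJc s hs')
      exact hJi.mono_set (by
        rw [uIcc_of_le hτ, uIcc_of_le hs.1.le]; exact Icc_subset_Icc_right hs.2.le)
    refine ⟨_, (d1.mul hΦ').add (d2.const_mul ε), ?_⟩
    have e1 := hNM s hs.1.le
    have e2 : 0 < Real.exp (-(2 / δ * N s)) := Real.exp_pos _
    have k1 := mul_le_mul_of_nonneg_left hle' e2.le
    have k2 := mul_le_mul_of_nonneg_right e1 (hJ0 s hs')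
    simp only [hJ] at k2 ⊢
    nlinarith [k1, k2]
  choose! F' hF' using hFd
  have h := le_of_hasDerivAt_nonpos_off_finite S hτ hFc hF'
  have hz : (∫ x in (0 : ℝ)..0, J x) = 0 := intervalIntegral.integral_same
  simp only [hF, hz, mul_zero, add_zero] at h
  have b1 := mul_le_mul_of_nonneg_right (hNM τ hτ) (hΦ0 τ hτm)
  have b2 : Real.exp (-(2 / δ * N 0)) ≤ Real.exp (2 / δ * Nmax) := by
    have := (abs_le.1 (hN.le_max 0 le_rfl)).1
    refine Real.exp_le_exp.2 ?_
    rw [← mul_neg]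
    gcongr; linarith
  have b3 := mul_le_mul_of_nonneg_right b2 (hΦ0 0 (left_mem_Icc.2 hτ))
  have e : Real.exp (4 / δ * Nmax) = ε⁻¹ * Real.exp (2 / δ * Nmax) := by
    rw [hε, ← Real.exp_neg, ← Real.exp_add]; congr 1; ring
  -- One factor exp(2Nmax/δ) stems from the weight at time 0, the other from division by ε.
  rw [e, mul_assoc, ← div_eq_inv_mul, le_div_iff₀ hε0]
  linarith

end IsStressEnergy
end TBData
end

/-! ### Identification of the energies and fluxes with averaged quantities -/

noncomputable section

/-- An integral over an order connected set is the supremum of the integrals over the compact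
subintervals. -/
theorem Set.OrdConnected.setLIntegral_le {P : Set ℝ} (hP : P.OrdConnected) {h : ℝ → ℝ≥0∞}
    {C : ℝ≥0∞} (H : ∀ a ∈ P, ∀ b ∈ P, a ≤ b → ∫⁻ x in Icc a b, h x ≤ C) :
    ∫⁻ x in P, h x ≤ C := by
  -- Intervals with rational end points form a countable directed family. It exhausts the set except
  -- possibly for its least and greatest elements, which are null.
  let ι := {q : ℚ × ℚ // (q.1 : ℝ) ∈ P ∧ (q.2 : ℝ) ∈ P}
  let s : ι → Set ℝ := fun q => Icc (q.1.1 : ℝ) (q.1.2 : ℝ)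
  have hdir : Directed (· ⊆ ·) s := by
    rintro ⟨⟨a, b⟩, ha, hb⟩ ⟨⟨a', b'⟩, ha', hb'⟩
    refine ⟨⟨(min a a', max b b'), ?_, ?_⟩, ?_, ?_⟩
    · rcases min_choice a a' with h | h <;> simp only [h] <;> assumption
    · rcases max_choice b b' with h | h <;> simp only [h] <;> assumption
    · exact Icc_subset_Icc (by exact_mod_cast min_le_left _ _) (by exact_mod_cast le_max_left _ _)
    · exact Icc_subset_Icc (by exact_mod_cast min_le_right _ _) (by exact_mod_cast le_max_right _ _)
  have hcov : P ⊆ (⋃ q, s q) ∪ ({x | IsLeast P x} ∪ {x | IsGreatest P x}) := by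
    intro x hx
    by_contra hn
    simp only [mem_union, mem_ofPred_eq, not_or] at hn
    obtain ⟨h1, h2, h3⟩ := hn
    have h2' : ∃ y ∈ P, y < x := by
      by_contra hc
      push Not at hc
      exact h2 ⟨hx, hc⟩
    have h3' : ∃ y ∈ P, x < y := by
      by_contra hc
      push Not at hc
      exact h3 ⟨hx, hc⟩
    obtain ⟨y, hy, hyx⟩ := h2'
    obtain ⟨z, hz, hxz⟩ := h3'
    obtain ⟨p, hp1, hp2⟩ := exists_rat_btwn hyx
    obtain ⟨q, hq1, hq2⟩ := exists_rat_btwn hxz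
    exact h1 (mem_iUnion.2 ⟨⟨(p, q), hP.out hy hx ⟨hp1.le, hp2.le⟩, hP.out hx hz ⟨hq1.le, hq2.le⟩⟩,
      hp2.le, hq1.le⟩)
  have hnull : volume ({x | IsLeast P x} ∪ {x | IsGreatest P x}) = 0 :=
    measure_union_null (Set.Subsingleton.measure_zero (fun _ hx _ hy => hx.unique hy) _)
      (Set.Subsingleton.measure_zero (fun _ hx _ hy => hx.unique hy) _)
  calc ∫⁻ x in P, h x ≤ ∫⁻ x in (⋃ q, s q) ∪ ({x | IsLeast P x} ∪ {x | IsGreatest P x}), h x :=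
        lintegral_mono_set hcov
    _ ≤ (∫⁻ x in ⋃ q, s q, h x) + ∫⁻ x in {x | IsLeast P x} ∪ {x | IsGreatest P x}, h x :=
        lintegral_union_le _ _ _
    _ = ∫⁻ x in ⋃ q, s q, h x := by rw [setLIntegral_measure_zero _ _ hnull, add_zero]
    _ = ⨆ q, ∫⁻ x in s q, h x := setLIntegral_iUnion_of_directed _ hdir
    _ ≤ C := iSup_le fun ⟨⟨a, b⟩, ha, hb⟩ => by
        rcases le_or_gt (a : ℝ) b with hab | hab
        · exact H _ ha _ hb hab
        · simp only [s, Icc_eq_empty_of_lt hab, Measure.restrict_empty, lintegral_zero_measure,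
            zero_le]

theorem lintegral_eq_two_mul_of_even {f : ℝ → ℝ≥0∞} (hf : ∀ x, f (-x) = f x) :
    ∫⁻ x, f x = 2 * ∫⁻ x in Ioi 0, f x := by
  have h1 : ∫⁻ x in Iio 0, f x = ∫⁻ x in Ioi 0, f x := by
    have := (Measure.measurePreserving_neg (volume : Measure ℝ)).setLIntegral_comp_preimage_emb
      (Homeomorph.neg ℝ).measurableEmbedding f (Ioi 0)
    simpa [hf] using this
  rw [← lintegral_add_compl f (measurableSet_Ioi (a := (0 : ℝ))), compl_Ioi,
    setLIntegral_congr Iio_ae_eq_Iic.symm, h1, two_mul]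

theorem ofReal_intervalIntegral_eq_setLIntegral {f : ℝ → ℝ} {a b : ℝ} (hab : a ≤ b)
    (hc : ContinuousOn f (Icc a b)) (h0 : ∀ x ∈ Icc a b, 0 ≤ f x) :
    ENNReal.ofReal (∫ x in a..b, f x) = ∫⁻ x in Icc a b, ENNReal.ofReal (f x) := by
  rw [intervalIntegral.integral_of_le hab, ← integral_Icc_eq_integral_Ioc,
    ofReal_integral_eq_lintegral_ofReal (hc.integrableOn_compact isCompact_Icc)]
  filter_upwards [ae_restrict_mem measurableSet_Icc] with x hx using h0 x hx

namespace TBData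
variable {d : TBData}

theorem sphereInt_eq_ofReal_sphI {F : (Fin 4 → ℝ) → ℝ} {H : ℝ → ℝ → ℝ} {τ R : ℝ}
    (hF : ∀ θ φ, F (sph τ R θ φ) * Real.sin θ = H θ φ) (hc : Continuous fun z : ℝ × ℝ => H z.1 z.2)
    (h0 : ∀ θ ∈ Icc 0 Real.pi, ∀ φ, 0 ≤ H θ φ) :
    sphereInt F τ R = ENNReal.ofReal (sphI H) := by
  have hc2 : Continuous fun θ => ∫ φ in (0 : ℝ)..2 * Real.pi, H θ φ :=
    intervalIntegral.continuous_parametric_intervalIntegral_of_continuous' (μ := volume) hc _ _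
  have hp : (0 : ℝ) ≤ 2 * Real.pi := by positivity
  unfold sphereInt sphI
  rw [ofReal_intervalIntegral_eq_setLIntegral Real.pi_pos.le hc2.continuousOn fun θ hθ =>
    intervalIntegral.integral_nonneg hp fun φ _ => h0 θ hθ φ]
  refine setLIntegral_congr_fun measurableSet_Icc fun θ hθ => ?_
  simp only [hF]
  rw [ofReal_intervalIntegral_eq_setLIntegral hp (by fun_prop) fun φ _ => h0 θ hθ φ]

theorem ev_u (A : Matrix (Fin 4) (Fin 4) ℝ) (Y : Fin 4 → ℝ) : ev A u Y = ∑ ν, A 0 ν * Y ν := by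
  simp [ev, u, Pi.single_apply]

namespace IsStressEnergy
variable {T : (Fin 4 → ℝ) → Matrix (Fin 4) (Fin 4) ℝ}

theorem sphereInt_eq (hT : d.IsStressEnergy T) (hd : d.Admissible) {t R c₁ c₂ : ℝ}
    {F : (Fin 4 → ℝ) → ℝ} (hG : (t, |R|) ∈ d.G)
    (hF : ∀ θ φ, F (sph t R θ φ) = c₁ * T (sph t R θ φ) 0 0
      + c₂ * ∑ μ, nvec θ φ μ * T (sph t R θ φ) μ 0)
    (h0 : ∀ θ φ, 0 ≤ F (sph t R θ φ)) :
    sphereInt F t R = ENNReal.ofReal (c₁ * avA T (t, R) + c₂ * avB T (t, R)) := by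
  have hp := hd.mem_Gs hG
  have hTc := hT.continuous_tcomp hd hp
  have h := hT.av_comb hd hp c₁ c₂ 0
  simp only [zero_mul, add_zero, tcomp, max_eq_left (show 0 ≤ t from hG.1)] at h hTc
  rw [h]
  refine sphereInt_eq_ofReal_sphI (fun θ φ => ?_) ?_ fun θ hθ φ => ?_
  · rw [hF]; ring
  · have hn := continuous_frame
    have hs : Continuous fun z : ℝ × ℝ => Real.sin z.1 := by fun_prop
    exact hs.mul ((continuous_const.mul (hTc 0 0)).add (continuous_const.mul
      (continuous_finsetSum _ fun μ _ => (hn μ).mul (hTc μ 0))))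
  · rw [← hF]
    exact mul_nonneg (Real.sin_nonneg_of_mem_Icc hθ) (h0 θ φ)

theorem abs_flux_le (hT : d.IsStressEnergy T) (hd : d.Admissible) {t R : ℝ} (hR : 0 < R)
    (hG : (t, R) ∈ d.G) (θ φ : ℝ) :
    |d.gE (t, R) * ∑ μ, nvec θ φ μ * T (sph t R θ φ) μ 0| ≤ T (sph t R θ φ) 0 0 := by
  have hx := hd.sph_mem_D (hd.mem_Gs (by rwa [abs_of_pos hR])) θ φ
  simp only [max_eq_left (show 0 ≤ t from hG.1)] at hx
  have h := hT.dec_pointwise hd hx (by rw [rad_sph]; positivity)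
  simp only [sph_zero, rad_sph, abs_of_pos hR, radial_sph hR] at h
  rw [abs_le]; constructor <;> linarith [h.1, h.2.1, h.2.2]

theorem sphereInt_energy (hT : d.IsStressEnergy T) (hd : d.Admissible) {t R : ℝ} (hR : 0 ≤ R)
    (hG : (t, R) ∈ d.G) :
    sphereInt (fun x => d.r t R ^ 2 * ev (T x) u u / d.γ t R) t R =
      ENNReal.ofReal (d.rE (t, R) ^ 2 * avA T (t, R) / d.gE (t, R)) := by
  have h0 : 0 ≤ t := hG.1
  have h1 := hd.G_lt_tauS hG
  rw [hd.r_eq h0 h1, hd.γ_eq h0 h1]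
  rcases hR.eq_or_lt with rfl | hR
  · have : d.rE (t, 0) = 0 := by simp [rE]
    simp [this, sphereInt]
  have hγ := hd.gE_pos h0 h1
  have e : ∀ x, ev (T x) u u = T x 0 0 := fun x => by rw [ev_u]; simp [u, Pi.single_apply]
  rw [hT.sphereInt_eq hd (c₁ := d.rE (t, R) ^ 2 / d.gE (t, R)) (c₂ := 0)
    (by rwa [abs_of_pos hR]) (fun θ φ => by rw [e]; ring) fun θ φ => ?_]
  · congr 1; ring
  · rw [e]
    have := (abs_nonneg _).trans (hT.abs_flux_le hd hR hG θ φ)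
    positivity

/-- The factor |2D| is the Jacobian of the null coordinate along the ray and cancels the
denominator. For D ≤ 0 the integrand is nonpositive and truncated to 0, so the sign of V̇ or U̇ need
not be known. The values σ = 1 and σ = -1 correspond to k and l. -/
theorem sphereInt_flux_mul_le (hT : d.IsStressEnergy T) (hd : d.Admissible) {t R σ D : ℝ}
    (hσ : |σ| ≤ 1) (hR : 0 < R) (hG : (t, R) ∈ d.G) :
    ENNReal.ofReal |2 * D| *
      sphereInt (fun x => d.r t R ^ 2 * ev (T x) u (u + σ • d.w x) / D) t R ≤
      2 * ENNReal.ofReal (d.rE (t, R) ^ 2 * (avA T (t, R) + σ * d.gE (t, R) * avB T (t, R))) := by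
  have h0 : 0 ≤ t := hG.1
  have h1 := hd.G_lt_tauS hG
  rw [hd.r_eq h0 h1]
  have e : ∀ θ φ, ev (T (sph t R θ φ)) u (u + σ • d.w (sph t R θ φ)) = T (sph t R θ φ) 0 0
      + σ * d.gE (t, R) * ∑ μ, nvec θ φ μ * T (sph t R θ φ) μ 0 := by
    intro θ φ
    have hx := hd.sph_mem_D (hd.mem_Gs (by rwa [abs_of_pos hR])) θ φ
    simp only [max_eq_left h0] at hx
    have hs : ∀ μ, T (sph t R θ φ) 0 μ = T (sph t R θ φ) μ 0 := fun μ => (hT.symm _ hx).apply μ 0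
    simp only [ev_u, w, sph_zero, rad_sph, abs_of_pos hR, hd.γ_eq h0 h1, radial_sph hR,
      Pi.add_apply, Pi.smul_apply, smul_eq_mul, mul_add, Finset.sum_add_distrib, hs,
      Finset.mul_sum]
    congr 1
    · simp [u, Pi.single_apply]
    · exact Finset.sum_congr rfl fun μ _ => by ring
  have hpos : ∀ θ φ, 0 ≤ ev (T (sph t R θ φ)) u (u + σ • d.w (sph t R θ φ)) := by
    intro θ φ
    have h := hT.abs_flux_le hd hR hG θ φ
    rw [e, mul_assoc]
    set b := d.gE (t, R) * ∑ μ, nvec θ φ μ * T (sph t R θ φ) μ 0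
    have h2 : |σ * b| ≤ |b| := by
      rw [abs_mul]; exact mul_le_of_le_one_left (abs_nonneg b) hσ
    linarith [neg_abs_le (σ * b)]
  rcases le_or_gt D 0 with hD | hD
  · have : sphereInt (fun x => d.rE (t, R) ^ 2 * ev (T x) u (u + σ • d.w x) / D) t R = 0 := by
      unfold sphereInt
      rw [setLIntegral_congr_fun (g := fun _ => 0) measurableSet_Icc fun θ hθ => ?_]
      · simp
      · have hz : ∀ φ, ENNReal.ofReal (d.rE (t, R) ^ 2 * ev (T (sph t R θ φ)) u
            (u + σ • d.w (sph t R θ φ)) / D * Real.sin θ) = 0 := fun φ =>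
          ENNReal.ofReal_of_nonpos (mul_nonpos_of_nonpos_of_nonneg
            (div_nonpos_of_nonneg_of_nonpos (mul_nonneg (sq_nonneg _) (hpos θ φ)) hD)
            (Real.sin_nonneg_of_mem_Icc hθ))
        simp only [hz, lintegral_zero]
    rw [this, mul_zero]; exact zero_le
  · rw [hT.sphereInt_eq hd (c₁ := d.rE (t, R) ^ 2 / D)
      (c₂ := d.rE (t, R) ^ 2 / D * (σ * d.gE (t, R))) (by rwa [abs_of_pos hR])
      (fun θ φ => by rw [e]; ring)
      fun θ φ => div_nonneg (mul_nonneg (sq_nonneg _) (hpos θ φ)) hD.le,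
      abs_of_pos (by positivity), ← ENNReal.ofReal_mul (by positivity),
      show (2 : ℝ≥0∞) = ENNReal.ofReal 2 by simp, ← ENNReal.ofReal_mul (by positivity)]
    refine le_of_eq ?_
    congr 1
    field_simp

end IsStressEnergy
end TBData
end

/-! ### Bounds on slices and along light rays -/

noncomputable section
namespace TBData
variable {d : TBData}

theorem Admissible.mem_G_neg (hd : d.Admissible) {t R : ℝ} (h0 : 0 ≤ R) (hG : (t, R) ∈ d.G) :
    (t, -R) ∈ d.G :=
  hd.mem_G_of_nonpos hG.1 (neg_nonpos.2 h0) (by rw [hd.tauS_neg]; exact hd.G_lt_tauS hG)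

namespace IsStressEnergy
variable {T : (Fin 4 → ℝ) → Matrix (Fin 4) (Fin 4) ℝ}

theorem continuousAt_flA_slice (hT : d.IsStressEnergy T) (hd : d.Admissible) {t R : ℝ}
    (hG : (t, |R|) ∈ d.G) : ContinuousAt (fun R => d.flA T (t, R)) R :=
  ContinuousAt.comp (f := fun R : ℝ => (t, R)) (hT.continuousAt_fl hd hG).1 (by fun_prop)

/-- The constant 4 combines a factor 2 for the reflected half-line with the factor 2 in the upper
bound for the Kodama density. -/
theorem ofReal_initial_le (hT : d.IsStressEnergy T) (hd : d.Admissible) {δ : ℝ}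
    (hδ : d.Untrapped δ) {a b : ℝ} (hab : a ≤ b) :
    ENNReal.ofReal (∫ R in a..b, d.flA T (0, R)) ≤ 4 * d.sliceEnergy T 0 := by
  have hG : ∀ R, (0, R) ∈ d.G := fun R => hd.mem_G_of_lt_tauS_zero le_rfl (hd.tauS_pos 0)
  have hM : ∀ R, (0, R) ∈ d.Mext := fun R => hd.mem_Mext le_rfl (hd.tauS_pos R)
  rw [ofReal_intervalIntegral_eq_setLIntegral hab
    (fun R _ => (hT.continuousAt_flA_slice hd (hG _)).continuousWithinAt)
    fun R _ => hT.flA_nonneg hd hδ (hG _)]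
  calc ∫⁻ R in Icc a b, ENNReal.ofReal (d.flA T (0, R))
      ≤ ∫⁻ R, ENNReal.ofReal (d.flA T (0, R)) := setLIntegral_le_lintegral _ _
    _ = 2 * ∫⁻ R in Ioi 0, ENNReal.ofReal (d.flA T (0, R)) :=
        lintegral_eq_two_mul_of_even fun R => by rw [hd.flA_neg T (hM R)]
    _ ≤ 2 * ∫⁻ R in Ioi 0, 2 *
          sphereInt (fun x => d.r 0 R ^ 2 * ev (T x) u u / d.γ 0 R) 0 R := by
        refine mul_le_mul_right (setLIntegral_mono' measurableSet_Ioi fun R hR => ?_) _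
        have hR : 0 < R := hR
        rw [hT.sphereInt_energy hd hR.le (hG R), show (2 : ℝ≥0∞) = ENNReal.ofReal 2 by simp,
          ← ENNReal.ofReal_mul (by positivity)]
        exact ENNReal.ofReal_le_ofReal (hT.flux_bounds hd hδ (hG _)).2.1
    _ = 4 * ∫⁻ R in Ioi 0,
          sphereInt (fun x => d.r 0 R ^ 2 * ev (T x) u u / d.γ 0 R) 0 R := by
        rw [lintegral_const_mul' _ _ (by simp), ← mul_assoc]; norm_num
    _ ≤ _ := mul_le_mul_right (lintegral_mono_set fun R hR =>
        show (0, R) ∈ d.Drad from hd.mem_Drad_iff.2 ⟨le_of_lt hR, hG R⟩) _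

/-- Bound of the energy on the slices. -/
theorem sliceEnergy_le (hT : d.IsStressEnergy T) (hd : d.Admissible) {δ Nmax : ℝ}
    {N n : ℝ → ℝ} {S : Finset ℝ} (hδ : d.Untrapped δ) (hN : d.SourceBound N n Nmax S) (τ : ℝ) :
    d.sliceEnergy T τ ≤ ENNReal.ofReal (2 / δ) *
      (ENNReal.ofReal (Real.exp (4 / δ * Nmax)) * (4 * d.sliceEnergy T 0)) := by
  have hδ0 := hδ.1
  have hP : OrdConnected {R | (τ, R) ∈ d.Drad} := ⟨fun a ha b _ x hx => by
    have ha := hd.mem_Drad_iff.1 ha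
    exact hd.mem_Drad_iff.2 ⟨ha.1.trans hx.1, hd.mem_G_of_lt ha.2 ha.1 hx.1⟩⟩
  refine hP.setLIntegral_le fun a ha b hb hab => ?_
  obtain ⟨ha0, haG⟩ := hd.mem_Drad_iff.1 ha
  obtain ⟨hb0, hbG⟩ := hd.mem_Drad_iff.1 hb
  have hG : ∀ R ∈ Icc a b, (τ, R) ∈ d.G := fun R hR => hd.mem_G_of_lt haG ha0 hR.1
  have hG' : ∀ R ∈ Icc a b, (τ, |R|) ∈ d.G := fun R hR => by
    rw [abs_of_nonneg (ha0.trans hR.1)]; exact hG R hR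
  -- The region below the piece [a,b] of the slice is bounded by the outgoing ray through a and the
  -- incoming ray through b. The latter is the reflection of the outgoing ray k through -b.
  obtain ⟨hτ, α, hα, hαa⟩ := haG
  obtain ⟨-, k, hk, hkb⟩ := hd.mem_G_neg hb0 hbG
  simp only at hτ hα hαa hk hkb
  have h := hT.energy_inequality hd hδ hN hτ hα hk (by rwa [hαa]) (by rw [hαa, hkb, neg_neg]; exact hab)
  have hαm := (hd.ray_strictMono hα).monotoneOn (left_mem_Icc.2 hτ) (right_mem_Icc.2 hτ) hτ
  have hkm := (hd.ray_strictMono hk).monotoneOn (left_mem_Icc.2 hτ) (right_mem_Icc.2 hτ) hτ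
  have hJ : 0 ≤ ∫ s in (0 : ℝ)..τ, (d.outflux T (s, α s) + d.outflux T (s, k s)) := by
    refine intervalIntegral.integral_nonneg hτ fun s hs => ?_
    have hks := (hd.ray_strictMono hk).monotoneOn hs (right_mem_Icc.2 hτ) hs.2
    have hαs := (hd.ray_strictMono hα).monotoneOn hs (right_mem_Icc.2 hτ) hs.2
    refine add_nonneg (hT.outflux_nonneg hd hδ (hd.mem_G_of_ray_le hα (by rwa [hαa]) hs le_rfl))
      (hT.outflux_nonneg hd hδ ?_)
    rw [← abs_neg]
    exact hd.mem_G_of_ray_le hα (by rwa [hαa]) hs (by linarith)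
  rw [hαa, hkb, neg_neg] at h
  calc ∫⁻ R in Icc a b, sphereInt (fun x => d.r τ R ^ 2 * ev (T x) u u / d.γ τ R) τ R
      ≤ ∫⁻ R in Icc a b, ENNReal.ofReal (2 / δ) * ENNReal.ofReal (d.flA T (τ, R)) := by
        refine setLIntegral_mono' measurableSet_Icc fun R hR => ?_
        rw [hT.sphereInt_energy hd (ha0.trans hR.1) (hG R hR), ← ENNReal.ofReal_mul (by positivity)]
        refine ENNReal.ofReal_le_ofReal ?_
        have := (hT.flux_bounds hd hδ (hG' R hR)).1
        rw [div_mul_eq_mul_div, le_div_iff₀ hδ0]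
        linarith
    _ = ENNReal.ofReal (2 / δ) * ENNReal.ofReal (∫ R in a..b, d.flA T (τ, R)) := by
        rw [lintegral_const_mul' _ _ ENNReal.ofReal_ne_top,
          ofReal_intervalIntegral_eq_setLIntegral hab
            (fun R hR => (hT.continuousAt_flA_slice hd (hG' R hR)).continuousWithinAt)
            fun R hR => hT.flA_nonneg hd hδ (hG' R hR)]
    _ ≤ ENNReal.ofReal (2 / δ) * ENNReal.ofReal (Real.exp (4 / δ * Nmax) *
          ∫ R in α 0..-k 0, d.flA T (0, R)) := by
        gcongr; linarith
    _ ≤ _ := by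
        rw [ENNReal.ofReal_mul (Real.exp_pos _).le]
        gcongr
        exact hT.ofReal_initial_le hd hδ (by linarith)

/-- Bound of the flux through a light ray. -/
theorem lintegral_outflux_le (hT : d.IsStressEnergy T) (hd : d.Admissible) {δ Nmax : ℝ}
    {N n : ℝ → ℝ} {S : Finset ℝ} (hδ : d.Untrapped δ) (hN : d.SourceBound N n Nmax S) {τ : ℝ}
    {α : ℝ → ℝ} (hτ : 0 ≤ τ) (hα : d.IsRayOn α 0 τ) (hG : (τ, |α τ|) ∈ d.G) :
    ∫⁻ s in Icc 0 τ, ENNReal.ofReal (d.outflux T (s, α s)) ≤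
      ENNReal.ofReal (Real.exp (4 / δ * Nmax)) * (4 * d.sliceEnergy T 0) := by
  -- The two rays are made to meet at time τ. The final slice is then empty, and the inequality
  -- controls only the fluxes.
  have key : ∀ {α k : ℝ → ℝ}, d.IsRayOn α 0 τ → d.IsRayOn k 0 τ → 0 ≤ α τ → k τ = -α τ →
      ∫⁻ s in Icc 0 τ, ENNReal.ofReal (d.outflux T (s, α s) + d.outflux T (s, k s)) ≤
      ENNReal.ofReal (Real.exp (4 / δ * Nmax)) * (4 * d.sliceEnergy T 0) ∧
      ∀ s ∈ Icc 0 τ, 0 ≤ d.outflux T (s, α s) ∧ 0 ≤ d.outflux T (s, k s) := by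
    intro α k hα hk h0 hkα
    have h := hT.energy_inequality hd hδ hN hτ hα hk h0 (by rw [hkα, neg_neg])
    rw [hkα, neg_neg, intervalIntegral.integral_same, zero_add] at h
    have hG : ∀ s ∈ Icc 0 τ, (s, |α s|) ∈ d.G ∧ (s, |k s|) ∈ d.G := fun s hs => by
      have hks := (hd.ray_strictMono hk).monotoneOn hs (right_mem_Icc.2 hτ) hs.2
      have hαs := (hd.ray_strictMono hα).monotoneOn hs (right_mem_Icc.2 hτ) hs.2
      refine ⟨hd.mem_G_of_ray_le hα h0 hs le_rfl, ?_⟩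
      rw [← abs_neg]
      exact hd.mem_G_of_ray_le hα h0 hs (by linarith)
    have hpos : ∀ s ∈ Icc 0 τ, 0 ≤ d.outflux T (s, α s) ∧ 0 ≤ d.outflux T (s, k s) := fun s hs =>
      ⟨hT.outflux_nonneg hd hδ (hG s hs).1, hT.outflux_nonneg hd hδ (hG s hs).2⟩
    refine ⟨?_, hpos⟩
    rw [← ofReal_intervalIntegral_eq_setLIntegral hτ (fun s hs => ?_)
      fun s hs => add_nonneg (hpos s hs).1 (hpos s hs).2]
    · refine (ENNReal.ofReal_le_ofReal h).trans ?_
      rw [ENNReal.ofReal_mul (Real.exp_pos _).le]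
      gcongr
      refine hT.ofReal_initial_le hd hδ ?_
      have hks := (hd.ray_strictMono hk).monotoneOn (left_mem_Icc.2 hτ) (right_mem_Icc.2 hτ) hτ
      have hαs := (hd.ray_strictMono hα).monotoneOn (left_mem_Icc.2 hτ) (right_mem_Icc.2 hτ) hτ
      linarith
    · have c1 := (hT.continuousAt_fl hd (hG s hs).1).2.2
      have c2 := (hT.continuousAt_fl hd (hG s hs).2).2.2
      exact ((ContinuousAt.comp (f := fun s => (s, α s)) c1
          (continuousAt_id.prodMk (hα s hs).2.2.continuousAt)).add
        (ContinuousAt.comp (f := fun s => (s, k s)) c2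
          (continuousAt_id.prodMk (hk s hs).2.2.continuousAt))).continuousWithinAt
  rcases le_or_gt 0 (α τ) with h | h
  · rw [abs_of_nonneg h] at hG
    obtain ⟨-, k, hk, hkα⟩ := hd.mem_G_neg h hG
    obtain ⟨h1, h2⟩ := key hα hk h hkα
    refine (setLIntegral_mono' measurableSet_Icc fun s hs => ?_).trans h1
    exact ENNReal.ofReal_le_ofReal (le_add_of_nonneg_right (h2 s hs).2)
  -- A ray ending at negative radius is an incoming ray. It plays the part of k, and the outgoing
  -- ray through the reflected point that of α.
  · rw [abs_of_neg h] at hG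
    obtain ⟨-, k, hk, hkα⟩ := hG
    simp only at hk hkα
    obtain ⟨h1, h2⟩ := key hk hα (by linarith) (by rw [hkα, neg_neg])
    refine (setLIntegral_mono' measurableSet_Icc fun s hs => ?_).trans h1
    exact ENNReal.ofReal_le_ofReal (le_add_of_nonneg_left (h2 s hs).1)

end IsStressEnergy
end TBData
end

/-! ### Null coordinates as labels of light rays -/

noncomputable section
namespace TBData
variable {d : TBData}

/-- `X` is constant along the light rays that move outwards (`σ = 1`) or inwards (`σ = -1`), and
equals minus the starting point of the ray in the spacetime extended to negative `R`. -/
def ConstAlongRays (d : TBData) (σ : ℝ) (X : ℝ → ℝ → ℝ) : Prop :=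
  ∀ t R α, 0 ≤ R → (t, R) ∈ d.G → d.IsRayOn α 0 t → α t = σ * R → X t R = -α 0

theorem Admissible.Drad_mem_nhds (hd : d.Admissible) {t R : ℝ} (h0 : 0 < t) (hR : 0 < R)
    (hG : (t, R) ∈ d.G) : d.Drad ∈ 𝓝 (t, R) := by
  have h1 : ∀ᶠ z : ℝ × ℝ in 𝓝 (t, R), 0 < z.1 := continuous_fst.continuousAt.eventually_const_lt h0
  have h2 : ∀ᶠ z : ℝ × ℝ in 𝓝 (t, R), 0 < z.2 := continuous_snd.continuousAt.eventually_const_lt hR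
  filter_upwards [h1, h2, hd.G_open hG] with z hz1 hz2 hz
  exact hd.mem_Drad_iff.2 ⟨hz2.le, hz hz1.le⟩

theorem deriv_eq_pd {X : ℝ → ℝ → ℝ} {t R : ℝ} (h : DifferentiableAt ℝ (Function.uncurry X) (t, R)) :
    deriv (fun τ => X τ R) t = pdt (Function.uncurry X) (t, R) ∧
    deriv (fun s => X t s) R = pdR (Function.uncurry X) (t, R) :=
  ⟨(hasDerivAt_pdt (φ := Function.uncurry X) h).deriv,
    (hasDerivAt_pdR (φ := Function.uncurry X) h).deriv⟩

/-- The method of characteristics. As X is differentiable in a full neighbourhood only at positive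
time and radius, the end points are covered by continuity. -/
theorem Admissible.eq_of_transport (hd : d.Admissible) {X : ℝ → ℝ → ℝ} {β : ℝ → ℝ} {σ a b : ℝ}
    (hX : ContDiffOn ℝ ∞ (Function.uncurry X) d.Drad)
    (hE : ∀ τ R, (τ, R) ∈ d.Drad → 0 < τ → 0 < R →
      deriv (fun t => X t R) τ = -(σ * d.γ τ R) * deriv (fun s => X τ s) R)
    (h0 : 0 ≤ a) (hab : a ≤ b) (hD : ∀ s ∈ Icc a b, (s, β s) ∈ d.Drad)
    (hc : ContinuousOn β (Icc a b))
    (hβ : ∀ s ∈ Ioo a b, 0 < β s ∧ HasDerivAt β (σ * d.gE (s, β s)) s) :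
    X b (β b) = X a (β a) := by
  have hXc : ContinuousOn (fun s => X s (β s)) (Icc a b) :=
    hX.continuousOn.comp (f := fun s => (s, β s)) (continuousOn_id.prodMk hc) hD
  have hXd : ∀ s ∈ Ioo a b, HasDerivAt (fun s => X s (β s)) 0 s := by
    intro s hs
    obtain ⟨hp, hβ'⟩ := hβ s hs
    have hDs := hD s (Ioo_subset_Icc_self hs)
    have hG := (hd.mem_Drad_iff.1 hDs).2
    have hs0 := h0.trans_lt hs.1
    have hdiff : DifferentiableAt ℝ (Function.uncurry X) (s, β s) :=
      (hX.contDiffAt (hd.Drad_mem_nhds hs0 hp hG)).differentiableAt (by simp)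
    have h := hasDerivAt_comp_curve hdiff hβ'
    have e := hE s (β s) hDs hs0 hp
    rw [(deriv_eq_pd hdiff).1, (deriv_eq_pd hdiff).2, hd.γ_eq hs0.le (hd.G_lt_tauS hG)] at e
    refine h.congr_deriv ?_
    rw [e]; ring
  refine le_antisymm ?_ ?_
  · exact le_of_hasDerivAt_nonpos_off_finite (f := fun s => X s (β s)) ∅ hab hXc
      fun s hs _ => ⟨hXd s hs, le_rfl⟩
  · have := le_of_hasDerivAt_nonpos_off_finite (f := fun s => -X s (β s)) (f' := fun _ => 0) ∅ hab
      hXc.fun_neg fun s hs _ => ⟨by simpa using (hXd s hs).fun_neg, le_rfl⟩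
    exact neg_le_neg_iff.1 this

namespace IsNullCoordinates
variable {U V : ℝ → ℝ → ℝ}

/-- An incoming ray is the reflection -k of a ray with negative radius. It can meet the centre only
at its final time, so it is one characteristic back to the initial slice, where V = R. -/
theorem constAlongRays_V (h : d.IsNullCoordinates U V) (hd : d.Admissible) :
    d.ConstAlongRays (-1) V := by
  intro t R k hR hG hk hkR
  have ht : 0 ≤ t := hG.1
  have hmono := hd.ray_strictMono hk
  have hle : ∀ s ∈ Icc 0 t, k s ≤ k t := fun s hs => hmono.monotoneOn hs (right_mem_Icc.2 ht) hs.2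
  have hkt : -k t = R := by linarith
  obtain ⟨-, α, hα, hαR⟩ := hG
  simp only at hα hαR
  have hD : ∀ s ∈ Icc 0 t, (s, -k s) ∈ d.Drad := fun s hs => by
    have h1 : 0 ≤ -k s := by linarith [hle s hs]
    have h2 := (hd.ray_strictMono hα).monotoneOn hs (right_mem_Icc.2 ht) hs.2
    have := hd.mem_G_of_ray_le hα (by linarith) hs (R := -k s) (by linarith [hle s hs])
    rw [abs_of_nonneg h1] at this
    exact hd.mem_Drad_iff.2 ⟨h1, this⟩
  have e := hd.eq_of_transport (X := V) (β := fun s => -k s) (σ := -1) h.smooth_V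
    (fun τ R h1 h2 h3 => by rw [h.eq_V τ R h1 h2 h3]; ring) le_rfl ht hD hk.continuousOn.fun_neg
    fun s hs => by
      have hs' := Ioo_subset_Icc_self hs
      have := hmono hs' (right_mem_Icc.2 ht) hs.2
      obtain ⟨-, h1, h2⟩ := hk s hs'
      refine ⟨by linarith, ?_⟩
      rw [hd.gE_neg (hd.mem_Mext hs.1.le h1)]
      simpa using h2.fun_neg
  simp only [hkt] at e
  rw [e, h.init_V]
  have := hle 0 (left_mem_Icc.2 ht)
  linarith

/-- The outgoing characteristic is followed back to the initial slice or to the centre. In the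
second case U = V there, and V is carried along the incoming continuation of the same extended ray.
-/
theorem constAlongRays_U (h : d.IsNullCoordinates U V) (hd : d.Admissible) :
    d.ConstAlongRays 1 U := by
  intro t R α hR hG hα hαR
  rw [one_mul] at hαR
  have ht : 0 ≤ t := hG.1
  have hmono := hd.ray_strictMono hα
  have key : ∀ s₀ ∈ Icc 0 t, 0 ≤ α s₀ → U t R = U s₀ (α s₀) := by
    intro s₀ hs₀ h0
    have hge : ∀ s ∈ Icc s₀ t, α s₀ ≤ α s := fun s hs =>
      hmono.monotoneOn hs₀ ⟨hs₀.1.trans hs.1, hs.2⟩ hs.1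
    have e := hd.eq_of_transport (X := U) (β := α) (σ := 1) h.smooth_U
      (fun τ R h1 h2 h3 => by rw [h.eq_U τ R h1 h2 h3]; ring) hs₀.1 hs₀.2
      (fun s hs => hd.mem_Drad_iff.2 ⟨h0.trans (hge s hs),
        hd.mem_G_of_ray hα (hs₀.1.trans hs.1) hs.2⟩)
      (hα.continuousOn.mono (Icc_subset_Icc_left hs₀.1)) fun s hs => by
        have hs' : s ∈ Icc 0 t := ⟨hs₀.1.trans hs.1.le, hs.2.le⟩
        refine ⟨h0.trans_lt (hmono hs₀ hs' hs.1), ?_⟩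
        rw [one_mul]; exact (hα s hs').2.2
    rwa [hαR] at e
  rcases le_or_gt 0 (α 0) with h0 | h0
  · rw [key 0 (left_mem_Icc.2 ht) h0, h.init_U _ h0]
  · obtain ⟨s₀, hs₀, hz⟩ := intermediate_value_Icc ht hα.continuousOn
      (show (0 : ℝ) ∈ _ from ⟨h0.le, by rw [hαR]; exact hR⟩)
    have hlt := (hα s₀ hs₀).2.1
    rw [hz] at hlt
    rw [key s₀ hs₀ hz.ge, hz, h.centre s₀ hs₀.1 hlt]
    exact h.constAlongRays_V hd s₀ 0 α le_rfl (hd.mem_G_of_lt_tauS_zero hs₀.1 hlt)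
      (hα.mono le_rfl hs₀.2) (by rw [hz, mul_zero])

end IsNullCoordinates

theorem Admissible.exists_ray (hd : d.Admissible) {σ t R : ℝ} (hσ : σ = 1 ∨ σ = -1) (hR : 0 ≤ R)
    (hG : (t, R) ∈ d.G) : ∃ α, d.IsRayOn α 0 t ∧ α t = σ * R := by
  rcases hσ with rfl | rfl
  · obtain ⟨-, α, hα, e⟩ := hG
    exact ⟨α, hα, by rw [one_mul]; exact e⟩
  · obtain ⟨-, α, hα, e⟩ := hd.mem_G_neg hR hG
    exact ⟨α, hα, by rw [neg_one_mul]; exact e⟩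

/-- Points are determined by their null coordinates. -/
theorem Admissible.eq_of_nullCoordinates (hd : d.Admissible) {σ : ℝ} (hσ : σ = 1 ∨ σ = -1)
    {X Y : ℝ → ℝ → ℝ} (hX : d.ConstAlongRays σ X) (hY : d.ConstAlongRays (-σ) Y)
    {t₁ R₁ t₂ R₂ : ℝ} (h₁ : 0 ≤ R₁) (h₂ : 0 ≤ R₂) (hG₁ : (t₁, R₁) ∈ d.G) (hG₂ : (t₂, R₂) ∈ d.G)
    (eX : X t₁ R₁ = X t₂ R₂) (eY : Y t₁ R₁ = Y t₂ R₂) : t₁ = t₂ ∧ R₁ = R₂ := by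
  wlog hle : t₁ ≤ t₂ generalizing t₁ R₁ t₂ R₂
  · obtain ⟨e1, e2⟩ := this h₂ h₁ hG₂ hG₁ eX.symm eY.symm (le_of_not_ge hle)
    exact ⟨e1.symm, e2.symm⟩
  have ht₁ : 0 ≤ t₁ := hG₁.1
  have hσ' : -σ = 1 ∨ -σ = -1 := by rcases hσ with rfl | rfl <;> norm_num
  -- Along a ray σR increases strictly with time. If t₁ < t₂, the coordinate X would give σR₁ < σR₂
  -- and Y the opposite inequality.
  have key : ∀ {σ : ℝ} {X : ℝ → ℝ → ℝ}, σ = 1 ∨ σ = -1 → d.ConstAlongRays σ X →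
      X t₁ R₁ = X t₂ R₂ → (t₁ < t₂ → σ * R₁ < σ * R₂) ∧
        (t₁ = t₂ → σ * R₁ = σ * R₂) := by
    intro σ X hσ hX eX
    obtain ⟨α₁, hα₁, e₁⟩ := hd.exists_ray hσ h₁ hG₁
    obtain ⟨α₂, hα₂, e₂⟩ := hd.exists_ray hσ h₂ hG₂
    have e0 : α₁ 0 = α₂ 0 := by
      have := hX t₁ R₁ α₁ h₁ hG₁ hα₁ e₁
      have := hX t₂ R₂ α₂ h₂ hG₂ hα₂ e₂
      linarith
    have heq := hd.ray_unique hα₁ (hα₂.mono le_rfl hle) (left_mem_Icc.2 ht₁) e0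
      (right_mem_Icc.2 ht₁)
    have hm := hd.ray_strictMono hα₂
    have m1 : t₁ ∈ Icc 0 t₂ := ⟨ht₁, hle⟩
    have m2 : t₂ ∈ Icc 0 t₂ := right_mem_Icc.2 (ht₁.trans hle)
    rw [← e₁, ← e₂, heq]
    exact ⟨fun h => hm m1 m2 h, fun h => by rw [h]⟩
  obtain ⟨k2, k3⟩ := key hσ hX eX
  obtain ⟨l2, -⟩ := key hσ' hY eY
  have ht : t₁ = t₂ := by
    refine hle.eq_of_not_lt fun h => ?_
    have := k2 h
    have := l2 h
    linarith
  refine ⟨ht, ?_⟩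
  have := k3 ht
  rcases hσ with rfl | rfl <;> linarith

end TBData
end

/-! ### Fluxes through the null hypersurfaces -/

noncomputable section
namespace TBData
variable {d : TBData}

/-- The times at which the light ray `X = x₀` is in the interior of the development. -/
def rayTimes (d : TBData) (X : ℝ → ℝ → ℝ) (x₀ : ℝ) : Set ℝ :=
  {t | 0 < t ∧ ∃ R, 0 < R ∧ (t, R) ∈ d.G ∧ X t R = x₀}

theorem rayTimes_spec {σ x₀ : ℝ} (hσ : σ = 1 ∨ σ = -1) {X : ℝ → ℝ → ℝ} (hd : d.Admissible)
    (hX : d.ConstAlongRays σ X) : ∃ ψ : ℝ → ℝ, ∀ t ∈ d.rayTimes X x₀,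
      0 < ψ t ∧ (t, ψ t) ∈ d.G ∧ X t (ψ t) = x₀ ∧
      ∀ α, d.IsRayOn α 0 t → α 0 = -x₀ → α t = σ * ψ t := by
  have h : ∀ t, t ∈ d.rayTimes X x₀ → ∃ R, 0 < R ∧ (t, R) ∈ d.G ∧ X t R = x₀ := fun t ht => ht.2
  choose! ψ hψ using h
  refine ⟨ψ, fun t ht => ?_⟩
  obtain ⟨h1, h2, h3⟩ := hψ t ht
  refine ⟨h1, h2, h3, fun α hα hα0 => ?_⟩
  obtain ⟨α', hα', e⟩ := hd.exists_ray hσ h1.le h2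
  have e0 := hX t (ψ t) α' h1.le h2 hα' e
  rw [← e]
  exact hd.ray_unique hα hα' (left_mem_Icc.2 ht.1.le) (by linarith) (right_mem_Icc.2 ht.1.le)

theorem mem_rayTimes {σ x₀ t : ℝ} (hσ : σ = 1 ∨ σ = -1) {X : ℝ → ℝ → ℝ}
    (hX : d.ConstAlongRays σ X) {α : ℝ → ℝ} (ht : 0 < t) (hα : d.IsRayOn α 0 t) (h0 : α 0 = -x₀)
    (hp : 0 < σ * α t) (hG : (t, σ * α t) ∈ d.G) : t ∈ d.rayTimes X x₀ := by
  refine ⟨ht, σ * α t, hp, hG, ?_⟩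
  rw [hX t _ α hp.le hG hα (by rcases hσ with rfl | rfl <;> ring), h0, neg_neg]

/-- An outgoing ray with positive radius keeps it later. An incoming ray with positive radius had it
earlier, and lies outside the past outgoing ray of its final point, hence in the development. -/
theorem ordConnected_rayTimes {σ x₀ : ℝ} (hσ : σ = 1 ∨ σ = -1) {X : ℝ → ℝ → ℝ} (hd : d.Admissible)
    (hX : d.ConstAlongRays σ X) : (d.rayTimes X x₀).OrdConnected := by
  obtain ⟨ψ, hψ⟩ := rayTimes_spec (x₀ := x₀) hσ hd hX
  refine ⟨fun a ha b hb t ht => ?_⟩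
  obtain ⟨ha1, ha2, ha3, ha4⟩ := hψ a ha
  obtain ⟨hb1, hb2, hb3, hb4⟩ := hψ b hb
  have ht0 : 0 < t := ha.1.trans_le ht.1
  obtain ⟨α, hα, e⟩ := hd.exists_ray hσ hb1.le hb2
  have e0 := hX b (ψ b) α hb1.le hb2 hα e
  have e0' : α 0 = -x₀ := by linarith
  have ea := ha4 α (hα.mono le_rfl (ht.1.trans ht.2)) e0'
  have hm := (hd.ray_strictMono hα).monotoneOn
  have hta : t ∈ Icc 0 b := ⟨ht0.le, ht.2⟩
  have m1 := hm ⟨ha.1.le, ht.1.trans ht.2⟩ hta ht.1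
  have m2 := hm hta (right_mem_Icc.2 hb.1.le) ht.2
  obtain ⟨-, ρ, hρ, hρb⟩ := hb2
  simp only at hρ hρb
  have hρt := (hd.ray_strictMono hρ).monotoneOn hta (right_mem_Icc.2 hb.1.le) ht.2
  rcases hσ with rfl | rfl
  · refine mem_rayTimes (Or.inl rfl) hX ht0 (hα.mono le_rfl ht.2) e0' (by linarith) ?_
    rw [one_mul]
    exact hd.mem_G_of_ray hα ht0.le ht.2
  · refine mem_rayTimes (Or.inr rfl) hX ht0 (hα.mono le_rfl ht.2) e0' (by linarith) ?_
    have := hd.mem_G_of_ray_le hρ (by linarith) hta (R := -1 * α t) (by linarith)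
    rwa [abs_of_nonneg (by linarith)] at this

/-- Near T the function ψ coincides with σβ, where β is the extension of the ray across T given by
`exists_extension`. -/
theorem hasDerivAt_of_rayTimes {σ x₀ : ℝ} (hσ : σ = 1 ∨ σ = -1) {X : ℝ → ℝ → ℝ}
    (hd : d.Admissible) (hX : d.ConstAlongRays σ X) {ψ : ℝ → ℝ}
    (hψ : ∀ t ∈ d.rayTimes X x₀, 0 < ψ t ∧ (t, ψ t) ∈ d.G ∧ X t (ψ t) = x₀ ∧
      ∀ α, d.IsRayOn α 0 t → α 0 = -x₀ → α t = σ * ψ t) {T : ℝ} (hT : T ∈ d.rayTimes X x₀) :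
    HasDerivAt ψ (σ * d.gE (T, ψ T)) T := by
  have hσ2 : σ * σ = 1 := by rcases hσ with rfl | rfl <;> norm_num
  obtain ⟨h1, h2, h3, -⟩ := hψ T hT
  have hT0 := hT.1
  obtain ⟨α, hα, e⟩ := hd.exists_ray hσ h1.le h2
  have e0 := hX T (ψ T) α h1.le h2 hα e
  obtain ⟨β, ε, hε, heq, hext⟩ := hd.exists_extension hT0.le hα
  have hβT : β T = σ * ψ T := by rw [heq (right_mem_Icc.2 hT0.le), e]
  have hβ0 : β 0 = -x₀ := by rw [heq (left_mem_Icc.2 hT0.le)]; linarith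
  have hβd := (hext 0 le_rfl (by linarith) T (by linarith) T (right_mem_Icc.2 hT0.le)).2
  have hσβ : σ * β T = ψ T := by rw [hβT, ← mul_assoc, hσ2, one_mul]
  have hd1 : HasDerivAt (fun t => σ * β t) (σ * d.gE (T, β T)) T := hβd.2.const_mul σ
  have hc : ContinuousAt (fun t => (t, σ * β t)) T := continuousAt_id.prodMk hd1.continuousAt
  have hg : d.gE (T, β T) = d.gE (T, ψ T) := by
    have hM := hd.mem_Mext hT0.le (hd.G_lt_tauS h2)
    rw [hβT]
    rcases hσ with rfl | rfl
    · rw [one_mul]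
    · rw [neg_one_mul, hd.gE_neg hM]
  rw [← hg]
  refine hd1.congr_of_eventuallyEq ?_
  have ev1 : ∀ᶠ t in 𝓝 T, 0 < σ * β t :=
    hd1.continuousAt.eventually_const_lt (by simpa only [hσβ] using h1)
  have ev2 : ∀ᶠ t in 𝓝 T, 0 ≤ t → (t, σ * β t) ∈ d.G :=
    hc.eventually (p := fun z => 0 ≤ z.1 → z ∈ d.G) (by simpa only [hσβ] using hd.G_open h2)
  filter_upwards [ev1, ev2, lt_mem_nhds hT0, gt_mem_nhds (show T < T + ε by linarith)]
    with t t1 t2 t3 t4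
  have hβt := hext 0 le_rfl (by linarith) t t4
  have := (hψ t (mem_rayTimes hσ hX t3 hβt hβ0 t1 (t2 t3.le))).2.2.2 β hβt hβ0
  rw [this, ← mul_assoc, hσ2, one_mul]

namespace IsStressEnergy
variable {T : (Fin 4 → ℝ) → Matrix (Fin 4) (Fin 4) ℝ}

/-- Bound of the flux through the null surface `X = x₀`. -/
theorem flux_le (hT : d.IsStressEnergy T) (hd : d.Admissible) {δ Nmax : ℝ}
    {N n : ℝ → ℝ} {S : Finset ℝ} (hδ : d.Untrapped δ) (hN : d.SourceBound N n Nmax S)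
    {σ : ℝ} (hσ : σ = 1 ∨ σ = -1) {X Y : ℝ → ℝ → ℝ} (hX : d.ConstAlongRays σ X)
    (hY : d.ConstAlongRays (-σ) Y) (hYd : ContDiffOn ℝ ∞ (Function.uncurry Y) d.Drad)
    (hYe : ∀ τ R, (τ, R) ∈ d.Drad → 0 < τ → 0 < R →
      deriv (fun t => Y t R) τ = σ * d.γ τ R * deriv (fun s => Y τ s) R) (x₀ : ℝ) :
    (∫⁻ v, ⨆ p ∈ {p : ℝ × ℝ | p ∈ d.Drad ∧ X p.1 p.2 = x₀ ∧ Y p.1 p.2 = v},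
      sphereInt (fun x => d.r p.1 p.2 ^ 2 * ev (T x) u (u + σ • d.w x) /
        deriv (fun t => Y t p.2) p.1) p.1 p.2) ≤
    2 * (ENNReal.ofReal (2 / δ) *
      (ENNReal.ofReal (Real.exp (4 / δ * Nmax)) * (4 * d.sliceEnergy T 0))) := by
  have hδ0 := hδ.1
  set P := d.rayTimes X x₀ with hPdef
  obtain ⟨ψ, hψ⟩ := rayTimes_spec (x₀ := x₀) hσ hd hX
  have hP : P.OrdConnected := ordConnected_rayTimes hσ hd hX
  set Q : ℝ × ℝ → ℝ≥0∞ := fun p => sphereInt (fun x => d.r p.1 p.2 ^ 2 *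
    ev (T x) u (u + σ • d.w x) / deriv (fun t => Y t p.2) p.1) p.1 p.2 with hQ
  set f : ℝ → ℝ≥0∞ := fun v => ⨆ p ∈ {p : ℝ × ℝ | p ∈ d.Drad ∧ X p.1 p.2 = x₀ ∧ Y p.1 p.2 = v},
    Q p with hf
  set v : ℝ → ℝ := fun t => Y t (ψ t) with hv
  have hmem : ∀ {t R}, 0 < t → 0 < R → (t, R) ∈ d.G → X t R = x₀ → t ∈ P ∧ R = ψ t := by
    intro t R ht hR hG hx
    have htP : t ∈ P := ⟨ht, R, hR, hG, hx⟩
    obtain ⟨α, hα, e⟩ := hd.exists_ray hσ hR.le hG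
    have e0 := hX t R α hR.le hG hα e
    have := (hψ t htP).2.2.2 α hα (by linarith)
    refine ⟨htP, ?_⟩
    rw [e] at this
    rcases hσ with rfl | rfl <;> linarith
  -- Along the ray the derivative of Y is Ẏ + σγY', and the transport equation makes the two
  -- summands equal. Hence dv = 2Ẏ dt.
  have hvd : ∀ t ∈ P, HasDerivAt v (2 * deriv (fun s => Y s (ψ t)) t) t := by
    intro t ht
    obtain ⟨h1, h2, -, -⟩ := hψ t ht
    have hD := hd.Drad_mem_nhds ht.1 h1 h2
    have hdiff : DifferentiableAt ℝ (Function.uncurry Y) (t, ψ t) :=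
      (hYd.contDiffAt hD).differentiableAt (by simp)
    have e := hYe t (ψ t) (mem_of_mem_nhds hD) ht.1 h1
    refine (hasDerivAt_comp_curve hdiff (hasDerivAt_of_rayTimes hσ hd hX hψ ht)).congr_deriv ?_
    rw [hd.γ_eq ht.1.le (hd.G_lt_tauS h2), (deriv_eq_pd hdiff).2] at e
    rw [← e, (deriv_eq_pd hdiff).1, two_mul]
  have hinj : InjOn v P := fun t ht s hs hts => by
    obtain ⟨h1, h2, h3, -⟩ := hψ t ht
    obtain ⟨h1', h2', h3', -⟩ := hψ s hs
    exact (hd.eq_of_nullCoordinates hσ hX hY h1.le h1'.le h2 h2' (h3.trans h3'.symm) hts).1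
  have hfv : ∀ t ∈ P, f (v t) ≤ Q (t, ψ t) := by
    intro t ht
    obtain ⟨h1, h2, h3, -⟩ := hψ t ht
    refine iSup₂_le fun ⟨s, R⟩ ⟨hD, hx, hy⟩ => ?_
    obtain ⟨hR, hG⟩ := hd.mem_Drad_iff.1 hD
    obtain ⟨rfl, rfl⟩ := hd.eq_of_nullCoordinates hσ hX hY hR h1.le hG h2 (hx.trans h3.symm) hy
    exact le_rfl
  -- Besides the parametrised points, the null surface may contain centre points, where r = 0, and
  -- points of the initial slice. The latter satisfy Y = -X, so they concern only the value -x₀, a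
  -- null set.
  have hf0 : ∀ w, w ≠ -x₀ → f w ≤ (v '' P).indicator f w := by
    intro w hw
    by_cases hwP : w ∈ v '' P
    · rw [indicator_of_mem hwP]
    · rw [indicator_of_notMem hwP]
      refine iSup₂_le fun ⟨s, R⟩ ⟨hD, hx, hy⟩ => ?_
      obtain ⟨hR, hG⟩ := hd.mem_Drad_iff.1 hD
      simp only at hx hy
      have hs : 0 ≤ s := hG.1
      rcases hR.eq_or_lt with rfl | hR
      · simp [hQ, sphereInt, r]
      rcases hs.eq_or_lt with rfl | hs
      · obtain ⟨α, hα, e⟩ := hd.exists_ray hσ hR.le hG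
        obtain ⟨k, hk, e'⟩ := hd.exists_ray (σ := -σ)
          (by rcases hσ with rfl | rfl <;> norm_num) hR.le hG
        have a1 := hX 0 R α hR.le hG hα e
        have a2 := hY 0 R k hR.le hG hk e'
        exact absurd (by linarith) hw
      · obtain ⟨hsP, rfl⟩ := hmem hs hR hG hx
        exact absurd ⟨s, hsP, hy⟩ hwP
  calc ∫⁻ w, f w ≤ ∫⁻ w, (v '' P).indicator f w := by
        refine lintegral_mono_ae ?_
        filter_upwards [(countable_singleton (-x₀)).ae_notMem volume] with w hw using hf0 w hw
    _ ≤ ∫⁻ w in v '' P, f w := lintegral_indicator_le _ _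
    _ = ∫⁻ t in P, ENNReal.ofReal |2 * deriv (fun s => Y s (ψ t)) t| * f (v t) :=
        lintegral_image_eq_lintegral_abs_deriv_mul hP.measurableSet
          (fun t ht => (hvd t ht).hasDerivWithinAt) hinj f
    _ ≤ ∫⁻ t in P, 2 * ENNReal.ofReal (d.rE (t, ψ t) ^ 2 *
          (avA T (t, ψ t) + σ * d.gE (t, ψ t) * avB T (t, ψ t))) := by
        refine setLIntegral_mono' hP.measurableSet fun t ht => ?_
        obtain ⟨h1, h2, -, -⟩ := hψ t ht
        exact (mul_le_mul_right (hfv t ht) _).trans (hT.sphereInt_flux_mul_le hd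
          (by rcases hσ with rfl | rfl <;> norm_num) h1 h2)
    _ ≤ _ := by
        refine hP.setLIntegral_le fun a ha b hb hab => ?_
        obtain ⟨h1, h2, -, -⟩ := hψ b hb
        obtain ⟨α, hα, e⟩ := hd.exists_ray hσ h1.le h2
        have e0 : α 0 = -x₀ := by
          have := hX b (ψ b) α h1.le h2 hα e
          linarith [(hψ b hb).2.2.1]
        have hb' : (b, |α b|) ∈ d.G := by
          rw [e, abs_mul, abs_of_pos h1]
          rcases hσ with rfl | rfl <;> simpa using h2
        have hout := hT.lintegral_outflux_le hd hδ hN hb.1.le hα hb'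
        rw [lintegral_const_mul' _ _ (by simp)]
        gcongr
        refine le_trans ?_ (mul_le_mul_right hout (ENNReal.ofReal (2 / δ)))
        rw [← lintegral_const_mul' _ _ ENNReal.ofReal_ne_top]
        refine le_trans (setLIntegral_mono' measurableSet_Icc fun t ht => ?_)
          (lintegral_mono_set (Icc_subset_Icc_left ha.1.le))
        have htP : t ∈ P := hP.out ha hb ht
        obtain ⟨t1, t2, -, t4⟩ := hψ t htP
        have et := t4 α (hα.mono le_rfl ht.2) e0
        have hM := hd.mem_Mext htP.1.le (hd.G_lt_tauS t2)
        have hG' : (t, |σ * ψ t|) ∈ d.G := by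
          rw [abs_mul, abs_of_pos t1]
          rcases hσ with rfl | rfl <;> simpa using t2
        have hb4 := (hT.flux_bounds hd hδ hG').2.2.2.1
        -- For σ = -1 the integrand is evaluated at the reflected radius, where by parity it takes
        -- the form bounded by `outflux`.
        have epar : d.rE (t, ψ t) ^ 2 * (avA T (t, ψ t) + σ * d.gE (t, ψ t) * avB T (t, ψ t)) =
            d.rE (t, σ * ψ t) ^ 2 * (avA T (t, σ * ψ t)
              + d.gE (t, σ * ψ t) * avB T (t, σ * ψ t)) := by
          rcases hσ with rfl | rfl
          · simp only [one_mul]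
          · simp only [neg_one_mul, hd.rE_neg, avA_neg, avB_neg, hd.gE_neg hM]; ring
        rw [et, epar, ← ENNReal.ofReal_mul (by positivity)]
        refine ENNReal.ofReal_le_ofReal ?_
        rw [outflux, div_mul_eq_mul_div, le_div_iff₀ hδ0]
        linarith

/-- All energies and fluxes are bounded by the initial energy. -/
theorem uniformBound (hT : d.IsStressEnergy T) (hd : d.Admissible) {δ Nmax : ℝ}
    {N n : ℝ → ℝ} {S : Finset ℝ} (hδ : d.Untrapped δ) (hN : d.SourceBound N n Nmax S) :
    d.UniformBound T
      (ENNReal.ofReal (16 / δ * Real.exp (4 / δ * Nmax)) * d.sliceEnergy T 0) := by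
  have hδ0 := hδ.1
  -- The constant 16/δ is a product of 2 from dv = 2Ẏ dt, 2/δ from coercivity and 4 from the initial
  -- energy.
  have e : 2 * (ENNReal.ofReal (2 / δ) * (ENNReal.ofReal (Real.exp (4 / δ * Nmax)) *
      (4 * d.sliceEnergy T 0))) =
      ENNReal.ofReal (16 / δ * Real.exp (4 / δ * Nmax)) * d.sliceEnergy T 0 := by
    rw [show 16 / δ * Real.exp (4 / δ * Nmax) = 8 * (2 / δ) * Real.exp (4 / δ * Nmax) by ring,
      ENNReal.ofReal_mul (by positivity), ENNReal.ofReal_mul (by positivity),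
      show ENNReal.ofReal 8 = 2 * 4 by
        rw [show (8 : ℝ) = ((8 : ℕ) : ℝ) by norm_num, ENNReal.ofReal_natCast]; norm_num]
    ring
  rw [← e]
  refine ⟨fun τ _ => (hT.sliceEnergy_le hd hδ hN τ).trans
    (le_mul_of_one_le_left zero_le one_le_two), fun U V h => ⟨fun U₀ => ?_, fun V₀ => ?_⟩⟩
  · have := hT.flux_le hd hδ hN (Or.inl rfl) (h.constAlongRays_U hd) (h.constAlongRays_V hd)
      h.smooth_V (fun τ R h1 h2 h3 => by rw [one_mul]; exact h.eq_V τ R h1 h2 h3) U₀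
    simpa only [fluxU, k, one_smul] using this
  · have := hT.flux_le hd hδ hN (Or.inr rfl) (h.constAlongRays_V hd)
      (by rw [neg_neg]; exact h.constAlongRays_U hd) h.smooth_U
      (fun τ R h1 h2 h3 => by rw [neg_one_mul]; exact h.eq_U τ R h1 h2 h3) V₀
    have hset : ∀ s, {p : ℝ × ℝ | p ∈ d.Drad ∧ U p.1 p.2 = s ∧ V p.1 p.2 = V₀} =
        {p : ℝ × ℝ | p ∈ d.Drad ∧ V p.1 p.2 = V₀ ∧ U p.1 p.2 = s} := fun s => by
      ext p; simp only [mem_ofPred_eq, and_comm (a := U p.1 p.2 = s)]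
    simpa only [fluxV, l, neg_one_smul, ← sub_eq_add_neg, hset] using this

end IsStressEnergy
end TBData
end

theorem theorem1 (d : TBData) (hd : d.Admissible) (hn : d.GloballyNaked) :
    ∃ κ : ℝ, 0 < κ ∧
      ∀ T : (Fin 4 → ℝ) → Matrix (Fin 4) (Fin 4) ℝ, d.IsStressEnergy T →
        d.UniformBound T (ENNReal.ofReal κ * d.sliceEnergy T 0) ∧
        (d.sliceEnergy T 0 ≠ ⊤ → ∃ C : ℝ, 0 < C ∧ d.UniformBound T (ENNReal.ofReal C)) := by
  obtain ⟨δ, hδ0, hδ⟩ := hn.exists_untrapped hd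
  obtain ⟨N, n, Nmax, S, hN⟩ := hn.exists_sourceBound hd
  have hU : d.Untrapped δ := ⟨hδ0, hδ⟩
  refine ⟨16 / δ * Real.exp (4 / δ * Nmax), by positivity, fun T hT => ?_⟩
  have h := hT.uniformBound hd hU hN
  refine ⟨h, fun hE => ?_⟩
  set κ := 16 / δ * Real.exp (4 / δ * Nmax) with hκ
  have hκ0 : 0 < κ := by positivity
  -- The summand 1 keeps the constant positive when the initial energy vanishes.
  have hle : ENNReal.ofReal κ * d.sliceEnergy T 0 ≤
      ENNReal.ofReal (κ * (d.sliceEnergy T 0).toReal + 1) := by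
    rw [← ENNReal.ofReal_toReal (ENNReal.mul_ne_top ENNReal.ofReal_ne_top hE), ENNReal.toReal_mul,
      ENNReal.toReal_ofReal hκ0.le]
    exact ENNReal.ofReal_le_ofReal (by linarith)
  exact ⟨κ * (d.sliceEnergy T 0).toReal + 1, by positivity, fun τ hτ => (h.1 τ hτ).trans hle,
    fun U V hUV => ⟨fun U₀ => ((h.2 U V hUV).1 U₀).trans hle,
      fun V₀ => ((h.2 U V hUV).2 V₀).trans hle⟩⟩
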